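/- Consider, for $(x,t)\in I\times J$ with open intervals $I,J\subseteq\mathbb R$, the equation $$ i\psi_t+f\psi_{xx}+g|\psi|^2\psi+h\psi+k\psi_x+i\,l\,\psi_{xxx}+i\,m\,(|\psi|^2\psi)_x+i\,n\,\psi(|\psi|^2)_x=0, $$ where $f=f_1+if_2$, $g=g_1+ig_2$, $h=h_1+ih_2$, $k=k_1+ik_2$ are complex-valued analytic functions of $(x,t)$ and $l,m,n$ are real analytic functions of $t$, none of them identically zero on $J$. Let $T$ be the set of $t\in J$ with $l(t)m(t)n(t)\neq0$. Write the equation with its complex conjugate as a system for $u=\psi$ and $v=\bar\psi$, regarded as independent functions, and substitute $u=\sum_{j\ge0}u_j(x,t)\Phi(x,t)^{\alpha+j}$, $v=\sum_{j\ge0}v_j(x,t)\Phi(x,t)^{\beta+j}$ with analytic complex-valued coefficients, $u_0,v_0$ nowhere zero. The coefficients of $\Phi^{2\alpha+\beta-1+j}$ in the first equation and of $\Phi^{\alpha+2\beta-1+j}$ in the second are the equations of level $j$. The equation *passes the Painlevé test* on $I\times T$ if there are negative integers $\alpha,\beta$ and five levels $j\ge 0$ (counted with multiplicity) such that, for every open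 $U\subseteq I\times T$ and every analytic complex-valued $\Phi$ on $U$ that is non-characteristic ($l\,\Phi_x^3\ne0$) and has a zero in $U$, the following holds for every $j\ge 0$: whatever solution of the levels below $j$ has been chosen, the equations of level $j$ are solvable and leave exactly as many of $u_j,v_j$ arbitrary as the multiplicity of $j$ among the five levels (so that, with $\Phi$, there are six arbitrary functions). For $\alpha=\beta=-1$ let $Q(r)$ be the matrix multiplying $(u_r,v_r)$ in the equations of level $r$; its entries are polynomials in $r$. The *resonances* are the roots of $\det Q(r)=0$, with multiplicity; they are considered at every $t\in T$, for all nonzero complex values of $\Phi_x,u_0,v_0$ with $(3m+2n)u_0v_0=-6l\Phi_x^2$. Then: 1. If the equation passes the Painlevé test on $I\times T$, then $n=-m$ on $J$ or $n=-\tfrac12m$ on $J$. 2. At each $t\in T$ the resonances consist of $-1$, $0$ (each once) and four positive integers (with multiplicity) if and only if $n(t)=-m(t)$ or $n(t)=-\tfrac12m(t)$. They are $-1,0,1,3,4,5$ if $n(t)=-m(t)$, and $-1,0,2,3,4,4$ if $n(t)=-\tfrac12m(t)$. 3. If $n=-m$ on $J$, then the equation passes the Painlevé test on $I\times T$ if and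 only if there are real functions $\gamma_1,\gamma_2,\beta_1,\beta_2$ of $t$ such that on $I\times T$ $$ f_1=\frac{3l}{m}g_1,\qquad f_2=0,\qquad g_2=0,\qquad k_1=\frac{3l}{m}g_{1,x},\qquad k_2=-\frac{3l}{m^2}g_1^2+x\gamma_1+\gamma_2, $$ $$ h_1=\int_{x_0}^x\Big(\frac{g_{1,t}}{m}-\frac{\dot m\,g_1}{m^2}\Big)dx+(x\gamma_1+\gamma_2)\frac{g_1}{m}-\frac{l}{m^3}g_1^3+\frac lm g_{1,xx}+x\beta_1+\beta_2, $$ $$ h_2=\frac{\dot m}{2m}-\frac{\dot l}{2l}-\frac{3l}{m^2}g_1g_{1,x}+\gamma_1, $$ where $x_0\in I$ is any fixed base point. 4. If $n=-\tfrac12m$ on $J$, then the equation passes the Painlevé test on $I\times T$ if and only if the conditions of 3 hold with $\beta_1=0$, for some real functions $\gamma_1,\gamma_2,\beta_2$ of $t$. -/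

import Mathlib

open scoped Polynomial

/-- Data of the equation
`i ψ_t + f ψ_xx + g |ψ|² ψ + h ψ + k ψ_x + i l ψ_xxx + i m (|ψ|² ψ)_x + i n ψ (|ψ|²)_x = 0`.
Points of the plane are pairs `(x, t)`; the functions `f, g, h, k` of `(x, t)` are complex valued and
`l, m, n` are real functions of `t`. -/
structure NLSCoeffs where
  f : ℝ × ℝ → ℂ
  g : ℝ × ℝ → ℂ
  h : ℝ × ℝ → ℂ
  k : ℝ × ℝ → ℂ
  l : ℝ → ℝ
  m : ℝ → ℝ
  n : ℝ → ℝ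

namespace NLSCoeffs

/-- Partial derivative with respect to `x`. -/
noncomputable def dx {E : Type*} [NormedAddCommGroup E] [NormedSpace ℝ E]
    (F : ℝ × ℝ → E) (p : ℝ × ℝ) : E := fderiv ℝ F p (1, 0)

/-- Partial derivative with respect to `t`. -/
noncomputable def dt {E : Type*} [NormedAddCommGroup E] [NormedSpace ℝ E]
    (F : ℝ × ℝ → E) (p : ℝ × ℝ) : E := fderiv ℝ F p (0, 1)

theorem dx_zero : dx (0 : ℝ × ℝ → ℂ) = 0 := by
  funext p; simp [dx]

theorem dt_zero : dt (0 : ℝ × ℝ → ℂ) = 0 := by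
  funext p; simp [dt]

/-- Formal Laurent series `∑ a_k Φ^k` in the singularity function `Φ`, whose coefficients `a_k` are
functions of `(x, t)`. -/
abbrev Series : Type := LaurentSeries (ℝ × ℝ → ℂ)

/-- `x`-derivative of a formal series in `Φ`:
`(∑ a_k Φ^k)_x = ∑ (a_k)_x Φ^k + Φ_x ∑ k a_k Φ^(k-1)`. -/
noncomputable def Dx (Φ : ℝ × ℝ → ℂ) (a : Series) : Series :=
  HahnSeries.map a (⟨dx, dx_zero⟩ : ZeroHom (ℝ × ℝ → ℂ) (ℝ × ℝ → ℂ)) +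
    HahnSeries.C (dx Φ) * LaurentSeries.derivative (ℝ × ℝ → ℂ) a

/-- `t`-derivative of a formal series in `Φ`:
`(∑ a_k Φ^k)_t = ∑ (a_k)_t Φ^k + Φ_t ∑ k a_k Φ^(k-1)`. -/
noncomputable def Dt (Φ : ℝ × ℝ → ℂ) (a : Series) : Series :=
  HahnSeries.map a (⟨dt, dt_zero⟩ : ZeroHom (ℝ × ℝ → ℂ) (ℝ × ℝ → ℂ)) +
    HahnSeries.C (dt Φ) * LaurentSeries.derivative (ℝ × ℝ → ℂ) a

/-- The expansion `∑_{j ≥ 0} u_j Φ^(α+j)`. -/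
noncomputable def expansion (α : ℤ) (u : ℕ → ℝ × ℝ → ℂ) : Series :=
  HahnSeries.single α 1 * HahnSeries.ofPowerSeries ℤ (ℝ × ℝ → ℂ) (PowerSeries.mk u)

/-- The formal series obtained by substituting formal series `u`, `v` into the left-hand side of
`i u_t + f u_xx + g u² v + h u + k u_x + i l u_xxx + i m (u² v)_x + i n u (u v)_x = 0`. -/
noncomputable def lhs (c : NLSCoeffs) (Φ : ℝ × ℝ → ℂ) (u v : Series) : Series :=
  HahnSeries.C (fun _ => Complex.I) * Dt Φ u
    + HahnSeries.C c.f * Dx Φ (Dx Φ u)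
    + HahnSeries.C c.g * (u ^ 2 * v)
    + HahnSeries.C c.h * u
    + HahnSeries.C c.k * Dx Φ u
    + HahnSeries.C (fun p => Complex.I * (c.l p.2 : ℂ)) * Dx Φ (Dx Φ (Dx Φ u))
    + HahnSeries.C (fun p => Complex.I * (c.m p.2 : ℂ)) * Dx Φ (u ^ 2 * v)
    + HahnSeries.C (fun p => Complex.I * (c.n p.2 : ℂ)) * (u * Dx Φ (u * v))

/-- The same for the complex conjugate equation, in which `v` stands for the conjugate of `u` but is
treated as an independent unknown:
`-i v_t + f̄ v_xx + ḡ v² u + h̄ v + k̄ v_x - i l v_xxx - i m (v² u)_x - i n v (u v)_x = 0`. -/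
noncomputable def lhsConj (c : NLSCoeffs) (Φ : ℝ × ℝ → ℂ) (u v : Series) : Series :=
  HahnSeries.C (fun _ => -Complex.I) * Dt Φ v
    + HahnSeries.C (fun p => (starRingEnd ℂ) (c.f p)) * Dx Φ (Dx Φ v)
    + HahnSeries.C (fun p => (starRingEnd ℂ) (c.g p)) * (v ^ 2 * u)
    + HahnSeries.C (fun p => (starRingEnd ℂ) (c.h p)) * v
    + HahnSeries.C (fun p => (starRingEnd ℂ) (c.k p)) * Dx Φ v
    + HahnSeries.C (fun p => -Complex.I * (c.l p.2 : ℂ)) * Dx Φ (Dx Φ (Dx Φ v))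
    + HahnSeries.C (fun p => -Complex.I * (c.m p.2 : ℂ)) * Dx Φ (v ^ 2 * u)
    + HahnSeries.C (fun p => -Complex.I * (c.n p.2 : ℂ)) * (v * Dx Φ (u * v))

/-- The level `j` equations of the expansion `u = ∑ u_j Φ^(α+j)`, `v = ∑ v_j Φ^(β+j)` hold on `U`.
For negative integers `α`, `β` the lowest powers of `Φ` that can occur in the two equations are
`2α+β-1` and `α+2β-1`; level `j` consists of the coefficients `j` steps above them, and it involves
`u_i`, `v_i` only for `i ≤ j`. -/
def SolvesLevel (c : NLSCoeffs) (U : Set (ℝ × ℝ)) (Φ : ℝ × ℝ → ℂ) (α β : ℤ)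
    (u v : ℕ → ℝ × ℝ → ℂ) (j : ℕ) : Prop :=
  ∀ p ∈ U,
    (c.lhs Φ (expansion α u) (expansion β v)).coeff (2 * α + β - 1 + j) p = 0 ∧
    (c.lhsConj Φ (expansion α u) (expansion β v)).coeff (α + 2 * β - 1 + j) p = 0

/-- Admissible coefficient at level `j`: analytic on `U`, and nowhere zero if `j = 0`. -/
def Admissible (U : Set (ℝ × ℝ)) (j : ℕ) (a : ℝ × ℝ → ℂ) : Prop :=
  AnalyticOnNhd ℝ a U ∧ (j = 0 → ∀ p ∈ U, a p ≠ 0)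

/-- `HasArbitrary U A S N`: among the pairs `(a, b)` of functions on `U` with `A a` and `A b`, the
relation `S a b` leaves exactly `N` of the two functions arbitrary: for `N = 0` it determines both;
for `N = 1` one of them is arbitrary and determines the other; for `N = 2` both are arbitrary. -/
def HasArbitrary (U : Set (ℝ × ℝ)) (A : (ℝ × ℝ → ℂ) → Prop)
    (S : (ℝ × ℝ → ℂ) → (ℝ × ℝ → ℂ) → Prop) : ℕ → Prop
  | 0 => ∃ a b, A a ∧ A b ∧ S a b ∧
      ∀ a' b', A a' → A b' → S a' b' → Set.EqOn a' a U ∧ Set.EqOn b' b U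
  | 1 => (∀ a, A a → ∃ b, A b ∧ S a b ∧ ∀ b', A b' → S a b' → Set.EqOn b' b U) ∨
      (∀ b, A b → ∃ a, A a ∧ S a b ∧ ∀ a', A a' → S a' b → Set.EqOn a' a U)
  | 2 => ∀ a b, A a → A b → S a b
  | _ => False

/-- `Φ` is an analytic function on the open set `U` whose zero set is a singularity manifold in `U`
that is non-characteristic: the principal symbol `l Φ_x³` does not vanish on `U`. -/
structure SingularManifold (c : NLSCoeffs) (U : Set (ℝ × ℝ)) (Φ : ℝ × ℝ → ℂ) : Prop where
  isOpen : IsOpen U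
  analytic : AnalyticOnNhd ℝ Φ U
  noncharacteristic : ∀ p ∈ U, (c.l p.2 : ℂ) * dx Φ p ^ 3 ≠ 0
  zero : ∃ p ∈ U, Φ p = 0

/-- The equation passes the Painlevé test on `Ω`. There are negative integers `α`, `β` (leading
orders) and a multiset `res` of five levels (the resonances other than `-1`) such that, for every
non-characteristic `Φ` on every open `U ⊆ Ω`, the coefficients of the expansions
`u = ∑ u_j Φ^(α+j)`, `v = ∑ v_j Φ^(β+j)` can be found level by level: whatever solution of the
levels below `j` has been chosen, the equations of level `j` can be solved, and they leave
arbitrary as many of `u_j`, `v_j` as the multiplicity of `j` in `res`. Together with the arbitrary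
function `Φ` this gives six arbitrary functions, the number required by the Cauchy-Kovalevskaya
theorem for two equations of third order. -/
def PassesPainleveTest (c : NLSCoeffs) (Ω : Set (ℝ × ℝ)) : Prop :=
  ∃ α β : ℤ, α < 0 ∧ β < 0 ∧ ∃ res : Multiset ℕ, res.card + 1 = 6 ∧
    ∀ U ⊆ Ω, ∀ Φ : ℝ × ℝ → ℂ, c.SingularManifold U Φ →
      ∀ (j : ℕ) (u v : ℕ → ℝ × ℝ → ℂ),
        (∀ i < j, Admissible U i (u i) ∧ Admissible U i (v i) ∧ c.SolvesLevel U Φ α β u v i) →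
        HasArbitrary U (Admissible U j)
          (fun a b => c.SolvesLevel U Φ α β (Function.update u j a) (Function.update v j b) j)
          (res.count j)

/-- The matrix `Q(r)` that multiplies `(u_r, v_r)` in the equations of level `r` for `α = β = -1`,
as a matrix of polynomials in `r = X`. Here `l, m, n` are the values of the coefficients at a given
time, and `κ, a, b` are the values of `Φ_x, u_0, v_0` at a point. The entries are the coefficients
of `A Φ^(r-4)` and `B Φ^(r-4)` in the part linear in `A, B` of the dominant terms
`i (l u_xxx + (2m+n) u v u_x + (m+n) u² v_x)` and `-i (l v_xxx + (2m+n) u v v_x + (m+n) v² u_x)`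
at `u = a Φ⁻¹ + A Φ^(r-1)`, `v = b Φ⁻¹ + B Φ^(r-1)`. -/
noncomputable def resonanceMatrix (l m n : ℝ) (κ a b : ℂ) : Matrix (Fin 2) (Fin 2) ℂ[X] :=
  let d : ℂ[X] :=
    Polynomial.C (l * κ ^ 3) * ((Polynomial.X - 1) * (Polynomial.X - 2) * (Polynomial.X - 3))
      + Polynomial.C (κ * a * b) *
        (Polynomial.C (2 * m + n : ℂ) * (Polynomial.X - 2) - 2 * Polynomial.C (m + n : ℂ))
  let e : ℂ[X] :=
    Polynomial.C (m + n : ℂ) * (Polynomial.X - 1) - Polynomial.C (2 * m + n : ℂ)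
  !![Polynomial.C Complex.I * d, Polynomial.C (Complex.I * κ * a ^ 2) * e;
     Polynomial.C (-Complex.I * κ * b ^ 2) * e, Polynomial.C (-Complex.I) * d]

/-- The resonances, with multiplicity: the roots `r` of `det Q(r) = 0`. -/
noncomputable def resonances (l m n : ℝ) (κ a b : ℂ) : Multiset ℂ :=
  (resonanceMatrix l m n κ a b).det.roots

/-- The times in `J` at which none of `l, m, n` vanishes. -/
def regularTimes (c : NLSCoeffs) (J : Set ℝ) : Set ℝ :=
  {t | t ∈ J ∧ c.l t ≠ 0 ∧ c.m t ≠ 0 ∧ c.n t ≠ 0}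

/-- The explicit conditions on `f, g, h, k` on `I × T`, with functions `γ₁, γ₂, β₁, β₂` of time. The
indefinite integral with respect to `x` is taken from the base point `x₀`. -/
structure CompatibilityConditions (c : NLSCoeffs) (I T : Set ℝ) (x₀ : ℝ)
    (γ₁ γ₂ β₁ β₂ : ℝ → ℝ) : Prop where
  f_re : ∀ x ∈ I, ∀ t ∈ T, (c.f (x, t)).re = 3 * c.l t / c.m t * (c.g (x, t)).re
  f_im : ∀ x ∈ I, ∀ t ∈ T, (c.f (x, t)).im = 0
  g_im : ∀ x ∈ I, ∀ t ∈ T, (c.g (x, t)).im = 0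
  k_re : ∀ x ∈ I, ∀ t ∈ T,
    (c.k (x, t)).re = 3 * c.l t / c.m t * dx (fun p => (c.g p).re) (x, t)
  k_im : ∀ x ∈ I, ∀ t ∈ T,
    (c.k (x, t)).im =
      -(3 * c.l t / c.m t ^ 2) * (c.g (x, t)).re ^ 2 + x * γ₁ t + γ₂ t
  h_re : ∀ x ∈ I, ∀ t ∈ T,
    (c.h (x, t)).re =
      (∫ s in x₀..x, (dt (fun p => (c.g p).re) (s, t) / c.m t
          - deriv c.m t * (c.g (s, t)).re / c.m t ^ 2))
        + (x * γ₁ t + γ₂ t) * ((c.g (x, t)).re / c.m t)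
        - c.l t / c.m t ^ 3 * (c.g (x, t)).re ^ 3
        + c.l t / c.m t * dx (dx (fun p => (c.g p).re)) (x, t)
        + x * β₁ t + β₂ t
  h_im : ∀ x ∈ I, ∀ t ∈ T,
    (c.h (x, t)).im =
      deriv c.m t / (2 * c.m t) - deriv c.l t / (2 * c.l t)
        - 3 * c.l t / c.m t ^ 2 * (c.g (x, t)).re * dx (fun p => (c.g p).re) (x, t)
        + γ₁ t

end NLSCoeffs

/-! With the factors Φ^α, Φ^β removed, the unknowns are power series over the ring of analytic
functions on `U`, with a derivation that sends `X` to κ = Φ_x. For j ≥ 1 level j is a 2×2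
affine-linear system for (u_j, v_j) whose matrix involves only the leading coefficients
(`levelEqns_iff`). So the test is a matter of determinants and, at resonances, of compatibility.

Leading orders and resonances. If α + β < -2, dispersion is missing from the leading balance; then α
= β and 3m + 2n = 0, and (u₀, v₀) is a kernel vector at every level, which gives infinitely many
resonances (`Tests.eq_zero`). Hence α = β = -1. The determinant is then a difference of squares and
splits into two cubics, with roots -1, 3, 4 and 0, r, 6 - r (`resonances_eq`, `levelDet_eq`). Five
nonnegative integer levels are available only if {r, 6 - r} is {1, 5} or {2, 4}, that is, n = -m or
n = -m/2 at the given time (`Tests.card_le`). Since analytic functions on an interval have no zero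
divisors, the same alternative holds on all of J.

Normal form. For a general Φ the higher levels are unmanageable, so the equations are transformed
first (`exists_normalForm`). Taylor expansion in x at the front replaces Φ by the x-distance s from
the front: d/dx becomes d/ds, and known coefficients become their Taylor series. A gauge u = e y, v
= σ e⁻¹ z with e_s = i a e and a = g₁/m makes the leading coefficients 1. The first nonvanishing
coefficient of a series is only multiplied by a unit in the process (`coeff_of_expand`), so levels
can be read off from the normalized equations. There, levels 1 to 5 are short polynomials, and after
evaluation at a homomorphism to ℂ the whole question is rational algebra.

Sufficiency. In normal form the conditions say that F = G = 0, that both equations have the same K,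
affine in x, that the zeroth-order coefficients H, B satisfy H + B = 2 K_x, and that H - B is affine
in s (for n = -m) or constant in s (for n = -m/2). Under these the two equations of each resonant
level are dependent or vacuous (`hirota_compat`, `sasaSatsuma_compat`); elsewhere the determinant is
a unit.

Necessity. Straight fronts x - x₀ - s(t - t₁) with s = 0 and s = 1 are enough. Comparing solutions
that differ by 1 in a free coefficient extracts from the constraint of the next resonance the factor
of that coefficient; comparing the two speeds gives G = 0; levels 4 and 5 give the rest
(`compatible_of_tests_hirota`, `compatible_of_tests_sasaSatsuma`).

Finally, real and imaginary parts are separated (`Parts.compatible_iff`), and integration in x turns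
the differential conditions into the explicit formulas with functions of time. -/

open scoped PowerSeries

/-! ### The differential ring of analytic functions on an open set -/

namespace NLSCoeffs

open TopologicalSpace

/-- The algebra of complex-valued real-analytic functions on an open set of the plane. -/
def analyticRing (U : Opens (ℝ × ℝ)) : Subalgebra ℂ (U → ℂ) where
  carrier := {φ | ∃ F : ℝ × ℝ → ℂ, AnalyticOnNhd ℝ F U ∧ ∀ p : U, φ p = F p}
  mul_mem' := by
    rintro a b ⟨F, hF, hFa⟩ ⟨G, hG, hGb⟩
    exact ⟨F * G, hF.mul hG, fun p => by simp [hFa, hGb]⟩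
  add_mem' := by
    rintro a b ⟨F, hF, hFa⟩ ⟨G, hG, hGb⟩
    exact ⟨F + G, hF.add hG, fun p => by simp [hFa, hGb]⟩
  algebraMap_mem' := fun r => ⟨fun _ => r, analyticOnNhd_const, fun p => rfl⟩

namespace analyticRing

variable {U : Opens (ℝ × ℝ)}

/-- The restriction of an analytic function. -/
def restr (F : ℝ × ℝ → ℂ) (hF : AnalyticOnNhd ℝ F U) : analyticRing U :=
  ⟨fun p => F p, F, hF, fun _ => rfl⟩

@[simp] theorem restr_apply (F : ℝ × ℝ → ℂ) (hF : AnalyticOnNhd ℝ F U) (p : U) :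
    (restr F hF).1 p = F p := rfl

/-- An analytic function on the plane with a given restriction. -/
noncomputable def extend (φ : analyticRing U) : ℝ × ℝ → ℂ := φ.2.choose

theorem extend_analytic (φ : analyticRing U) : AnalyticOnNhd ℝ (extend φ) U := φ.2.choose_spec.1

theorem extend_apply (φ : analyticRing U) (p : U) : extend φ p = φ.1 p :=
  (φ.2.choose_spec.2 p).symm

@[ext] theorem ext' {φ ψ : analyticRing U} (h : ∀ p : U, φ.1 p = ψ.1 p) : φ = ψ :=
  Subtype.ext (funext h)

@[simp] theorem val_add (φ ψ : analyticRing U) (p : U) : (φ + ψ).1 p = φ.1 p + ψ.1 p := rfl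
@[simp] theorem val_mul (φ ψ : analyticRing U) (p : U) : (φ * ψ).1 p = φ.1 p * ψ.1 p := rfl
@[simp] theorem val_smul (z : ℂ) (φ : analyticRing U) (p : U) : (z • φ).1 p = z * φ.1 p := rfl

/-- Openness of `U` makes derivatives on `U` independent of the values off `U`. This is why
`dirDeriv` may be defined through the arbitrary choice made in `extend`. -/
theorem fderiv_eq_of_eqOn {F G : ℝ × ℝ → ℂ} (h : Set.EqOn F G U) {p : ℝ × ℝ} (hp : p ∈ U) :
    fderiv ℝ F p = fderiv ℝ G p :=
  Filter.EventuallyEq.fderiv_eq (h.eventuallyEq_of_mem (U.isOpen.mem_nhds hp))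

theorem analyticOnNhd_fderiv_apply {F : ℝ × ℝ → ℂ} (hF : AnalyticOnNhd ℝ F U) (v : ℝ × ℝ) :
    AnalyticOnNhd ℝ (fun p => fderiv ℝ F p v) U := fun p hp =>
  ((ContinuousLinearMap.apply ℝ ℂ v).analyticAt _).comp (hF.fderiv p hp)

theorem extend_restr_eqOn (F : ℝ × ℝ → ℂ) (hF : AnalyticOnNhd ℝ F U) :
    Set.EqOn (extend (restr F hF)) F U := fun p hp => extend_apply (restr F hF) ⟨p, hp⟩

/-- The derivative in the direction `v`. -/
noncomputable def dirDeriv (v : ℝ × ℝ) : Derivation ℂ (analyticRing U) (analyticRing U) :=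
  Derivation.mk'
    { toFun := fun φ => restr (fun p => fderiv ℝ (extend φ) p v)
        (analyticOnNhd_fderiv_apply (extend_analytic φ) v)
      map_add' := fun φ ψ => by
        ext p
        have h : Set.EqOn (extend (φ + ψ)) (extend φ + extend ψ) U := fun q hq => by
          have h1 := extend_apply (φ + ψ) ⟨q, hq⟩
          have h2 := extend_apply φ ⟨q, hq⟩
          have h3 := extend_apply ψ ⟨q, hq⟩
          simp_all
        simp only [restr_apply, val_add]
        rw [fderiv_eq_of_eqOn h p.2, fderiv_add ((extend_analytic φ) p p.2).differentiableAt
          ((extend_analytic ψ) p p.2).differentiableAt]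
        rfl
      map_smul' := fun z φ => by
        ext p
        have h : Set.EqOn (extend (z • φ)) (fun q => z * extend φ q) U := fun q hq => by
          have h1 := extend_apply (z • φ) ⟨q, hq⟩
          have h2 := extend_apply φ ⟨q, hq⟩
          simp_all
        simp only [restr_apply, val_smul, RingHom.id_apply]
        rw [fderiv_eq_of_eqOn h p.2,
          fderiv_const_mul ((extend_analytic φ) p p.2).differentiableAt]
        rfl }
    (fun φ ψ => by
      ext p
      have h : Set.EqOn (extend (φ * ψ)) (fun q => extend φ q * extend ψ q) U := fun q hq => by
        have h1 := extend_apply (φ * ψ) ⟨q, hq⟩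
        have h2 := extend_apply φ ⟨q, hq⟩
        have h3 := extend_apply ψ ⟨q, hq⟩
        simp_all
      simp only [LinearMap.coe_mk, AddHom.coe_mk, restr_apply, val_add, smul_eq_mul, val_mul]
      rw [fderiv_eq_of_eqOn h p.2, fderiv_fun_mul ((extend_analytic φ) p p.2).differentiableAt
          ((extend_analytic ψ) p p.2).differentiableAt]
      simp [extend_apply])

theorem dirDeriv_restr (v : ℝ × ℝ) (F : ℝ × ℝ → ℂ) (hF : AnalyticOnNhd ℝ F U) :
    dirDeriv v (restr F hF) =
      restr (fun p => fderiv ℝ F p v) (analyticOnNhd_fderiv_apply hF v) := by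
  ext p
  change fderiv ℝ (extend (restr F hF)) p v = fderiv ℝ F p v
  rw [fderiv_eq_of_eqOn (extend_restr_eqOn F hF) p.2]

theorem dirDeriv_apply (v : ℝ × ℝ) (F : ℝ × ℝ → ℂ) (φ : analyticRing U)
    (h : ∀ p : U, φ.1 p = F p) (p : U) : (dirDeriv v φ).1 p = fderiv ℝ F p v := by
  change fderiv ℝ (extend φ) p v = fderiv ℝ F p v
  rw [fderiv_eq_of_eqOn (fun q hq => (extend_apply φ ⟨q, hq⟩).trans (h ⟨q, hq⟩)) p.2]

theorem restr_extend (φ : analyticRing U) : restr (extend φ) (extend_analytic φ) = φ := by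
  ext p
  exact extend_apply φ p

/-- Symmetry of second derivatives. Besides commuting the two derivations, it provides Φ_tx = Φ_xt
for a front. -/
theorem dirDeriv_comm (v w : ℝ × ℝ) (φ : analyticRing U) :
    dirDeriv v (dirDeriv w φ) = dirDeriv w (dirDeriv v φ) := by
  rw [← restr_extend φ]
  ext p
  have hF := extend_analytic φ
  have key : ∀ a b : ℝ × ℝ, (dirDeriv a (dirDeriv b (restr (extend φ) hF))).1 p
      = fderiv ℝ (fderiv ℝ (extend φ)) p a b := by
    intro a b
    rw [dirDeriv_restr, dirDeriv_restr, restr_apply]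
    have hd : HasFDerivAt (fun q => fderiv ℝ (extend φ) q b)
        ((ContinuousLinearMap.apply ℝ ℂ b).comp (fderiv ℝ (fderiv ℝ (extend φ)) p)) p :=
      (ContinuousLinearMap.apply ℝ ℂ b).hasFDerivAt.comp (p : ℝ × ℝ)
        (hF.fderiv p p.2).differentiableAt.hasFDerivAt
    rw [hd.fderiv]
    rfl
  rw [key, key]
  exact (((hF p p.2).contDiffAt (n := ⊤)).isSymmSndFDerivAt (by simp)) v w

/-- A nowhere vanishing analytic function is a unit. -/
theorem isUnit_of_ne_zero (φ : analyticRing U) (h : ∀ p, φ.1 p ≠ 0) : IsUnit φ := by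
  have hi : AnalyticOnNhd ℝ (extend φ)⁻¹ U := fun p hp =>
    (extend_analytic φ p hp).inv (by have := h ⟨p, hp⟩; rwa [← extend_apply] at this)
  refine IsUnit.of_mul_eq_one (restr _ hi) ?_
  ext p
  have := h p
  simp [extend_apply, this]

theorem isUnit_iff (φ : analyticRing U) : IsUnit φ ↔ ∀ p, φ.1 p ≠ 0 := by
  refine ⟨fun h p hp => ?_, isUnit_of_ne_zero φ⟩
  obtain ⟨b, hb⟩ := h.exists_right_inv
  have := congrArg (fun ψ : analyticRing U => ψ.1 p) hb
  simp [hp] at this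

end analyticRing

end NLSCoeffs

/-! ### Laurent series in Φ as shifted power series over the analytic ring -/

namespace NLSCoeffs

/-- The operator `w ↦ x^(1-a) D(x^a w)`. -/
def shiftD {A : Type*} [CommRing A] [Algebra ℂ A] (D : Derivation ℂ A A) (x : A) (a : ℤ) (w : A) :
    A :=
  x * D w + a * (D x * w)

/-- Coefficients `ct, f, g, h, k, cl, cm, cn` of an equation
`ct u_t + f u_xx + g u² v + h u + k u_x + cl u_xxx + cm (u² v)_x + cn u (u v)_x = 0`. -/
@[ext] structure EqnCoeffs (A : Type*) where
  ct : A
  f : A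
  g : A
  h : A
  k : A
  cl : A
  cm : A
  cn : A

/-- The image of the coefficients under a map. -/
def EqnCoeffs.map {A B : Type*} (φ : A → B) (q : EqnCoeffs A) : EqnCoeffs B :=
  ⟨φ q.ct, φ q.f, φ q.g, φ q.h, φ q.k, φ q.cl, φ q.cm, φ q.cn⟩

/-- The left-hand side of the equation at `u = x^α U`, `v = x^β V`, divided by `x^(2α+β-1)`, where
`d = -α-β-2`. -/
def eqnSeries {A : Type*} [CommRing A] [Algebra ℂ A] (D T : Derivation ℂ A A) (x : A) (α β : ℤ)
    (d : ℕ) (q : EqnCoeffs A) (U V : A) : A :=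
  q.ct * (x ^ (d + 2) * shiftD T x α U)
    + q.f * (x ^ (d + 1) * shiftD D x (α - 1) (shiftD D x α U))
    + q.g * (x * (U ^ 2 * V))
    + q.h * (x ^ (d + 3) * U)
    + q.k * (x ^ (d + 2) * shiftD D x α U)
    + q.cl * (x ^ d * shiftD D x (α - 2) (shiftD D x (α - 1) (shiftD D x α U)))
    + q.cm * shiftD D x (2 * α + β) (U ^ 2 * V)
    + q.cn * (U * shiftD D x (α + β) (U * V))

section PowerSeriesDerivations

variable {R : Type*} [CommRing R] [Algebra ℂ R]

/-- The coefficientwise extension of a derivation to power series. -/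
noncomputable def mapD (d : Derivation ℂ R R) : Derivation ℂ R⟦X⟧ R⟦X⟧ :=
  Derivation.mk'
    { toFun := fun W => PowerSeries.mk fun n => d (PowerSeries.coeff n W)
      map_add' := fun a b => by ext n; simp
      map_smul' := fun z a => by ext n; simp }
    (fun a b => by
      ext n
      simp only [LinearMap.coe_mk, AddHom.coe_mk, PowerSeries.coeff_mk, PowerSeries.coeff_mul,
        map_sum, Derivation.leibniz, smul_eq_mul, map_add, Finset.sum_add_distrib]
      congr 1
      exact Finset.sum_equiv (Equiv.prodComm ℕ ℕ) (by simp [add_comm]) (by simp))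

@[simp] theorem coeff_mapD (d : Derivation ℂ R R) (n : ℕ) (W : R⟦X⟧) :
    PowerSeries.coeff n (mapD d W) = d (PowerSeries.coeff n W) := by
  change PowerSeries.coeff n (PowerSeries.mk fun n => d (PowerSeries.coeff n W)) = _
  simp

/-- The derivation of `R⟦X⟧` that extends `d` and sends `X` to `κ`. -/
noncomputable def totalD (d : Derivation ℂ R R) (κ : R) : Derivation ℂ R⟦X⟧ R⟦X⟧ :=
  mapD d + PowerSeries.C κ • (PowerSeries.derivative R).restrictScalars ℂ

theorem totalD_apply (d : Derivation ℂ R R) (κ : R) (W : R⟦X⟧) :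
    totalD d κ W = mapD d W + PowerSeries.C κ * PowerSeries.derivative R W := rfl

theorem coeff_totalD (d : Derivation ℂ R R) (κ : R) (n : ℕ) (W : R⟦X⟧) :
    PowerSeries.coeff n (totalD d κ W) =
      d (PowerSeries.coeff n W) + κ * (n + 1) * PowerSeries.coeff (n + 1) W := by
  rw [totalD_apply, map_add, coeff_mapD, PowerSeries.coeff_C_mul, PowerSeries.coeff_derivative]
  ring

@[simp] theorem totalD_X (d : Derivation ℂ R R) (κ : R) :
    totalD d κ PowerSeries.X = PowerSeries.C κ := by
  have h : mapD d PowerSeries.X = 0 := by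
    ext n
    rw [coeff_mapD, PowerSeries.coeff_X]
    split_ifs <;> simp
  rw [totalD_apply, h]
  simp

@[simp] theorem totalD_C (d : Derivation ℂ R R) (κ a : R) :
    totalD d κ (PowerSeries.C a) = PowerSeries.C (d a) := by
  ext n
  rw [coeff_totalD, PowerSeries.coeff_C, PowerSeries.coeff_C, PowerSeries.coeff_C]
  split_ifs <;> simp_all

theorem coeff_shiftD_zero (d : Derivation ℂ R R) (κ : R) (a : ℤ) (W : R⟦X⟧) :
    PowerSeries.coeff 0 (shiftD (totalD d κ) PowerSeries.X a W) =
      κ * a * PowerSeries.coeff 0 W := by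
  simp [shiftD]
  ring

theorem intCast_eq_C {R : Type*} [CommRing R] (a : ℤ) : (a : R⟦X⟧) = PowerSeries.C (a : R) :=
    (map_intCast _ a).symm

/-- The factor `a + (n + 1)` is the exponent of the differentiated power of Φ; the factor `x` in
`shiftD` makes up for the drop of that exponent by one and keeps everything inside power series. -/
theorem coeff_shiftD_succ (d : Derivation ℂ R R) (κ : R) (a : ℤ) (n : ℕ) (W : R⟦X⟧) :
    PowerSeries.coeff (n + 1) (shiftD (totalD d κ) PowerSeries.X a W) =
      d (PowerSeries.coeff n W) + κ * (a + (n + 1)) * PowerSeries.coeff (n + 1) W := by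
  rw [shiftD, map_add, PowerSeries.coeff_succ_X_mul, coeff_totalD, totalD_X, intCast_eq_C,
    PowerSeries.coeff_C_mul, PowerSeries.coeff_C_mul]
  ring

end PowerSeriesDerivations

section Representation

open TopologicalSpace

variable {U : Opens (ℝ × ℝ)}

/-- `Represents N α a W`: the formal series `a` is `Φ^α` times a power series in `Φ` whose
coefficients up to the `N`-th restrict to those of `W`. -/
def Represents (N : ℕ) (α : ℤ) (a : Series) (W : (analyticRing U)⟦X⟧) : Prop :=
  ∃ W' : (ℝ × ℝ → ℂ)⟦X⟧, a = HahnSeries.single α 1 * HahnSeries.ofPowerSeries ℤ _ W' ∧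
    ∀ n ≤ N, ∀ p : U, PowerSeries.coeff n W' p = (PowerSeries.coeff n W).1 p

theorem val_sum {ι : Type*} (s : Finset ι) (F : ι → analyticRing U) (p : U) :
    (∑ i ∈ s, F i).1 p = ∑ i ∈ s, (F i).1 p := by
  simp [Finset.sum_apply]

namespace Represents

variable {N : ℕ} {α β : ℤ} {a b : Series} {W V : (analyticRing U)⟦X⟧}

theorem add (ha : Represents N α a W) (hb : Represents N α b V) :
    Represents N α (a + b) (W + V) := by
  obtain ⟨W', rfl, hW⟩ := ha
  obtain ⟨V', rfl, hV⟩ := hb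
  refine ⟨W' + V', by rw [map_add, mul_add], fun n hn p => ?_⟩
  simp [hW n hn p, hV n hn p]

/-- The `n`-th coefficient of a product uses only coefficients of index at most `n`, so agreement up
to order `N` suffices. The truncation is essential: nothing is known about the coefficients beyond
the current level, not even analyticity. -/
theorem mul (ha : Represents N α a W) (hb : Represents N β b V) :
    Represents N (α + β) (a * b) (W * V) := by
  obtain ⟨W', rfl, hW⟩ := ha
  obtain ⟨V', rfl, hV⟩ := hb
  refine ⟨W' * V', ?_, fun n hn p => ?_⟩
  · rw [map_mul, mul_mul_mul_comm, HahnSeries.single_mul_single, one_mul]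
  · rw [PowerSeries.coeff_mul, PowerSeries.coeff_mul, val_sum, Finset.sum_apply]
    refine Finset.sum_congr rfl fun ij hij => ?_
    have := Finset.HasAntidiagonal.mem_antidiagonal.1 hij
    rw [Pi.mul_apply, hW _ (by omega), hV _ (by omega)]
    rfl

theorem pow_two (ha : Represents N α a W) : Represents N (2 * α) (a ^ 2) (W ^ 2) := by
  rw [sq, sq, two_mul]
  exact ha.mul ha

theorem const (F : ℝ × ℝ → ℂ) (φ : analyticRing U) (h : ∀ p : U, F p = φ.1 p) :
    Represents N 0 (HahnSeries.C F) (PowerSeries.C φ) := by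
  refine ⟨PowerSeries.C F, ?_, fun n _ p => ?_⟩
  · rw [HahnSeries.ofPowerSeries_C]
    exact (one_mul _).symm
  · rw [PowerSeries.coeff_C, PowerSeries.coeff_C]
    split_ifs
    · exact h p
    · rfl

theorem const_mul (F : ℝ × ℝ → ℂ) (φ : analyticRing U) (h : ∀ p : U, F p = φ.1 p)
    (ha : Represents N α a W) : Represents N α (HahnSeries.C F * a) (PowerSeries.C φ * W) := by
  have := (const (N := N) F φ h).mul ha
  rwa [zero_add] at this

/-- Φ^α W = Φ^(α-d) (X^d W). This brings terms of different orders to the common exponent 2α + β -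
1. -/
theorem shift (ha : Represents N α a W) (d : ℕ) :
    Represents N (α - d) a (PowerSeries.X ^ d * W) := by
  obtain ⟨W', rfl, hW⟩ := ha
  refine ⟨PowerSeries.X ^ d * W', ?_, fun n hn p => ?_⟩
  · rw [map_mul, HahnSeries.ofPowerSeries_X_pow, ← mul_assoc, HahnSeries.single_mul_single, one_mul]
    congr 2
    simp
  · rw [PowerSeries.coeff_X_pow_mul', PowerSeries.coeff_X_pow_mul']
    split_ifs
    · exact hW _ (by omega) p
    · rfl

theorem coeff_eq (ha : Represents N α a W) (n : ℕ) (hn : n ≤ N) (p : U) :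
    a.coeff (α + n) p = (PowerSeries.coeff n W).1 p := by
  obtain ⟨W', rfl, hW⟩ := ha
  rw [add_comm, HahnSeries.coeff_single_mul_add, one_mul, LaurentSeries.coeff_coe_powerSeries, hW n
      hn]

/-- The rule (Φ^α W)' = Φ^(α-1) (X W' + α κ W), proved once for both variables. -/
theorem deriv_aux {δ : ZeroHom (ℝ × ℝ → ℂ) (ℝ × ℝ → ℂ)} {v : ℝ × ℝ}
    (hδ : ∀ F p, δ F p = fderiv ℝ F p v) (K : ℝ × ℝ → ℂ) (κ : analyticRing U)
    (hκ : ∀ p : U, K p = κ.1 p) (ha : Represents N α a W) :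
    Represents N (α - 1)
      (HahnSeries.map a δ + HahnSeries.C K * LaurentSeries.derivative (ℝ × ℝ → ℂ) a)
      (shiftD (totalD (analyticRing.dirDeriv v) κ) PowerSeries.X α W) := by
  obtain ⟨W', rfl, hW⟩ := ha
  refine ⟨PowerSeries.mk fun n => (if n = 0 then 0 else δ (PowerSeries.coeff (n - 1) W'))
      + K * (α + n) * PowerSeries.coeff n W', ?_, fun n hn p => ?_⟩
  · ext1
    funext n
    rw [HahnSeries.coeff_add, HahnSeries.map_coeff, HahnSeries.C_mul_eq_smul, HahnSeries.coeff_smul,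
      LaurentSeries.derivative_apply, LaurentSeries.hasseDeriv_coeff, HahnSeries.coeff_single_mul,
      HahnSeries.coeff_single_mul, HahnSeries.coeff_single_mul]
    simp only [one_mul, Nat.cast_one, Ring.choose_one_right]
    -- Below the new leading exponent everything vanishes; at it only the derivative of Φ^α
    -- contributes; above it there is also the derivative of a coefficient.
    rcases lt_trichotomy (n - (α - 1)) 0 with h | h | h
    · have e1 : ∀ (Z : (ℝ × ℝ → ℂ)⟦X⟧) (m : ℤ), m < 0 →
          (HahnSeries.ofPowerSeries ℤ (ℝ × ℝ → ℂ) Z).coeff m = 0 := by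
        intro Z m hm
        rw [HahnSeries.ofPowerSeries_apply]
        apply HahnSeries.embDomain_of_notMem_range
        rintro ⟨k, hk⟩
        simp at hk
        omega
      rw [e1 _ _ h, e1 _ _ (by omega), e1 _ _ (by omega)]
      simp
    · have e1 : ∀ (Z : (ℝ × ℝ → ℂ)⟦X⟧) (m : ℤ), m < 0 →
          (HahnSeries.ofPowerSeries ℤ (ℝ × ℝ → ℂ) Z).coeff m = 0 := by
        intro Z m hm
        rw [HahnSeries.ofPowerSeries_apply]
        apply HahnSeries.embDomain_of_notMem_range
        rintro ⟨k, hk⟩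
        simp at hk
        omega
      rw [e1 _ (n - α) (by omega), show n - (α - 1) = ((0 : ℕ) : ℤ) by simpa using h,
        show n + 1 - α = ((0 : ℕ) : ℤ) by push_cast; omega, LaurentSeries.coeff_coe_powerSeries,
        LaurentSeries.coeff_coe_powerSeries, PowerSeries.coeff_mk, show n + 1 = α by omega]
      simp [mul_assoc]
    · obtain ⟨k, hk⟩ : ∃ k : ℕ, n - α = k := ⟨(n - α).toNat, by omega⟩
      rw [hk, show n - (α - 1) = ((k + 1 : ℕ) : ℤ) by push_cast; omega,
        show n + 1 - α = ((k + 1 : ℕ) : ℤ) by push_cast; omega, LaurentSeries.coeff_coe_powerSeries,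
        LaurentSeries.coeff_coe_powerSeries, LaurentSeries.coeff_coe_powerSeries,
        PowerSeries.coeff_mk, show n + 1 = α + (k + 1 : ℕ) by push_cast; omega]
      simp [mul_assoc]
  · rcases n with _ | n
    · rw [coeff_shiftD_zero, PowerSeries.coeff_mk]
      have := hW 0 hn p
      simp only [PowerSeries.coeff_zero_eq_constantCoeff] at this
      simp [hκ p, this]
    · rw [coeff_shiftD_succ, PowerSeries.coeff_mk]
      have h1 := analyticRing.dirDeriv_apply v (PowerSeries.coeff n W') (PowerSeries.coeff n W)
        (fun p => (hW n (by omega) p).symm) p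
      simp [hκ p, hW (n + 1) hn p, h1, hδ]

theorem Dx {Φ : ℝ × ℝ → ℂ} {κ : analyticRing U} (hκ : ∀ p : U, dx Φ p = κ.1 p)
    (ha : Represents N α a W) : Represents N (α - 1) (Dx Φ a)
      (shiftD (totalD (analyticRing.dirDeriv (1, 0)) κ) PowerSeries.X α W) :=
  deriv_aux (fun _ _ => rfl) _ κ hκ ha

theorem Dt {Φ : ℝ × ℝ → ℂ} {τ : analyticRing U} (hτ : ∀ p : U, dt Φ p = τ.1 p)
    (ha : Represents N α a W) : Represents N (α - 1) (Dt Φ a)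
      (shiftD (totalD (analyticRing.dirDeriv (0, 1)) τ) PowerSeries.X α W) :=
  deriv_aux (fun _ _ => rfl) _ τ hτ ha

theorem expansion (u : ℕ → ℝ × ℝ → ℂ) (W : (analyticRing U)⟦X⟧)
    (h : ∀ n ≤ N, ∀ p : U, u n p = (PowerSeries.coeff n W).1 p) :
    Represents N α (expansion α u) W :=
  ⟨PowerSeries.mk u, rfl, fun n hn p => by rw [PowerSeries.coeff_mk, h n hn p]⟩

theorem cast {γ : ℤ} (ha : Represents N α a W) (h : α = γ) : Represents N γ a W := h ▸ ha

/-- The general equation in terms of power series. -/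
theorem eqn {Φ : ℝ × ℝ → ℂ} {κ τ : analyticRing U} (hκ : ∀ p : U, dx Φ p = κ.1 p)
    (hτ : ∀ p : U, dt Φ p = τ.1 p) (d : ℕ) (hd : (d : ℤ) = -α - β - 2)
    (q' : EqnCoeffs (ℝ × ℝ → ℂ)) (q : EqnCoeffs (analyticRing U))
    (hct : ∀ p : U, q'.ct p = q.ct.1 p) (hf : ∀ p : U, q'.f p = q.f.1 p)
    (hg : ∀ p : U, q'.g p = q.g.1 p) (hh : ∀ p : U, q'.h p = q.h.1 p)
    (hk : ∀ p : U, q'.k p = q.k.1 p) (hcl : ∀ p : U, q'.cl p = q.cl.1 p)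
    (hcm : ∀ p : U, q'.cm p = q.cm.1 p) (hcn : ∀ p : U, q'.cn p = q.cn.1 p)
    (ha : Represents N α a W) (hb : Represents N β b V) :
    Represents N (2 * α + β - 1)
      (HahnSeries.C q'.ct * NLSCoeffs.Dt Φ a
        + HahnSeries.C q'.f * NLSCoeffs.Dx Φ (NLSCoeffs.Dx Φ a)
        + HahnSeries.C q'.g * (a ^ 2 * b)
        + HahnSeries.C q'.h * a
        + HahnSeries.C q'.k * NLSCoeffs.Dx Φ a
        + HahnSeries.C q'.cl * NLSCoeffs.Dx Φ (NLSCoeffs.Dx Φ (NLSCoeffs.Dx Φ a))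
        + HahnSeries.C q'.cm * NLSCoeffs.Dx Φ (a ^ 2 * b)
        + HahnSeries.C q'.cn * (a * NLSCoeffs.Dx Φ (a * b)))
      (eqnSeries (totalD (analyticRing.dirDeriv (1, 0)) κ)
        (totalD (analyticRing.dirDeriv (0, 1)) τ) PowerSeries.X α β d (q.map PowerSeries.C)
        W V) := by
  have h1 := ha.Dx hκ
  have h2 := h1.Dx hκ
  have h3 := (h2.Dx hκ).cast (show α - 1 - 1 - 1 = α - 3 by ring)
  have hc := ha.pow_two.mul hb
  have e2 : α - 1 - 1 = α - 2 := by ring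
  rw [e2] at h2 h3
  have t1 := ((((ha.Dt hτ).shift (d + 2)).cast
    (show _ = 2 * α + β - 1 by push_cast; omega)).const_mul _ _ hct)
  have t2 := (((h2.shift (d + 1)).cast
    (show _ = 2 * α + β - 1 by push_cast; omega)).const_mul _ _ hf)
  have t3 := (((hc.shift 1).cast (show _ = 2 * α + β - 1 by push_cast; omega)).const_mul _ _ hg)
  have t4 := (((ha.shift (d + 3)).cast
    (show _ = 2 * α + β - 1 by push_cast; omega)).const_mul _ _ hh)
  have t5 := (((h1.shift (d + 2)).cast
    (show _ = 2 * α + β - 1 by push_cast; omega)).const_mul _ _ hk)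
  have t6 := (((h3.shift d).cast (show _ = 2 * α + β - 1 by omega)).const_mul _ _ hcl)
  have t7 := (hc.Dx hκ).const_mul _ _ hcm
  have t8 := (((ha.mul ((ha.mul hb).Dx hκ)).cast
    (show _ = 2 * α + β - 1 by ring)).const_mul _ _ hcn)
  have := ((((((t1.add t2).add t3).add t4).add t5).add t6).add t7).add t8
  rw [pow_one] at this
  exact this

end Represents

end Representation

end NLSCoeffs

/-! ### Taylor homomorphism, change of expansion variable, gauge -/

namespace NLSCoeffs

section Taylor

variable {A R : Type*} [CommRing A] [Algebra ℂ A] [CommRing R] [Algebra ℂ R]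

/-- The coefficients `ε(D^k w)/k!` of the Taylor series. -/
noncomputable def taylorFun (D : Derivation ℂ A A) (ε : A →+* R) (w : A) : R⟦X⟧ :=
  PowerSeries.mk fun k => algebraMap ℂ R ((k.factorial : ℂ)⁻¹) * ε (D^[k] w)

theorem algebraMap_inv_factorial_succ (k : ℕ) :
    algebraMap ℂ R (((k + 1).factorial : ℂ)⁻¹) * (k + 1) =
      algebraMap ℂ R ((k.factorial : ℂ)⁻¹) := by
  have h : ((k : R) + 1) = algebraMap ℂ R ((k : ℂ) + 1) := by simp
  rw [h, ← map_mul]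
  congr 1
  have : (k.factorial : ℂ) ≠ 0 := by exact_mod_cast k.factorial_ne_zero
  have h2 : (k : ℂ) + 1 ≠ 0 := by exact_mod_cast k.succ_ne_zero
  rw [Nat.factorial_succ]
  push_cast
  field_simp

theorem coeff_succ_taylorFun (D : Derivation ℂ A A) (ε : A →+* R) (w : A) (k : ℕ) :
    (k + 1) * PowerSeries.coeff (k + 1) (taylorFun D ε w) =
      PowerSeries.coeff k (taylorFun D ε (D w)) := by
  simp only [taylorFun, PowerSeries.coeff_mk, Function.iterate_succ_apply]
  rw [← algebraMap_inv_factorial_succ (R := R) k]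
  ring

/-- Positive integers are units in a ℂ-algebra; `R` need not be a domain. -/
theorem natCast_succ_mul_cancel {a b : R} (k : ℕ) (h : (k + 1) * a = (k + 1) * b) : a = b := by
  have h2 : (k : ℂ) + 1 ≠ 0 := by exact_mod_cast k.succ_ne_zero
  have hu : algebraMap ℂ R ((k + 1 : ℂ)⁻¹) * ((k : R) + 1) = 1 := by
    have h : ((k : R) + 1) = algebraMap ℂ R ((k : ℂ) + 1) := by simp
    rw [h, ← map_mul, inv_mul_cancel₀ h2, map_one]
  calc a = algebraMap ℂ R ((k + 1 : ℂ)⁻¹) * ((k + 1) * a) := by rw [← mul_assoc, hu, one_mul]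
    _ = b := by rw [h, ← mul_assoc, hu, one_mul]

theorem coeff_zero_taylorFun (D : Derivation ℂ A A) (ε : A →+* R) (w : A) :
    PowerSeries.coeff 0 (taylorFun D ε w) = ε w := by
  rw [taylorFun, PowerSeries.coeff_mk]
  simp

theorem taylorFun_add (D : Derivation ℂ A A) (ε : A →+* R) (w v : A) :
    taylorFun D ε (w + v) = taylorFun D ε w + taylorFun D ε v := by
  ext k
  simp [taylorFun, iterate_map_add, mul_add]

/-- Both series have the same derivative by the Leibniz rule, so induction on the order works after
cancelling `k + 1`. The factors are quantified after `k` because the step applies the claim to their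
derivatives. -/
theorem coeff_taylorFun_mul (D : Derivation ℂ A A) (ε : A →+* R) (k : ℕ) : ∀ w v : A,
    PowerSeries.coeff k (taylorFun D ε (w * v)) =
      PowerSeries.coeff k (taylorFun D ε w * taylorFun D ε v) := by
  have key : ∀ w : A, PowerSeries.derivative R (taylorFun D ε w) = taylorFun D ε (D w) := by
    intro w
    ext n
    rw [PowerSeries.coeff_derivative, ← coeff_succ_taylorFun, mul_comm]
  induction k with
  | zero =>
    intro w v
    rw [coeff_zero_taylorFun, PowerSeries.coeff_mul]
    simp [taylorFun]
  | succ k ih =>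
    intro w v
    apply natCast_succ_mul_cancel k
    have h := PowerSeries.coeff_derivative (taylorFun D ε w * taylorFun D ε v) k
    rw [coeff_succ_taylorFun, mul_comm ((k : R) + 1), ← h, Derivation.leibniz, Derivation.leibniz,
      taylorFun_add, key, key]
    simp only [smul_eq_mul, map_add, ih]

/-- The Taylor homomorphism `w ↦ ∑ ε(D^k w)/k! s^k`. -/
noncomputable def taylor (D : Derivation ℂ A A) (ε : A →+* R) : A →+* R⟦X⟧ where
  toFun := taylorFun D ε
  map_one' := by
    ext k
    rcases k with _ | k
    · simp [coeff_zero_taylorFun]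
    · rw [taylorFun, PowerSeries.coeff_mk, Function.iterate_succ_apply, D.map_one_eq_zero,
        iterate_map_zero]
      simp [PowerSeries.coeff_one]
  map_zero' := by
    ext k
    rw [taylorFun, PowerSeries.coeff_mk, iterate_map_zero]
    simp
  map_add' := taylorFun_add D ε
  map_mul' := fun w v => by
    ext k
    exact coeff_taylorFun_mul D ε k w v

theorem constantCoeff_taylor (D : Derivation ℂ A A) (ε : A →+* R) (w : A) :
    PowerSeries.constantCoeff (taylor D ε w) = ε w := by
  rw [← PowerSeries.coeff_zero_eq_constantCoeff_apply]
  exact coeff_zero_taylorFun D ε w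

/-- The map is ε ∘ exp(s D), on which `D` acts as d/ds. -/
theorem taylor_D (D : Derivation ℂ A A) (ε : A →+* R) (w : A) :
    taylor D ε (D w) = totalD 0 1 (taylor D ε w) := by
  ext k
  rw [coeff_totalD]
  have := coeff_succ_taylorFun D ε w k
  change PowerSeries.coeff k (taylorFun D ε (D w)) =
    (0 : Derivation ℂ R R) _ + 1 * (k + 1) * PowerSeries.coeff (k + 1) (taylorFun D ε w)
  simpa using this.symm

/-- `T` commutes with `D`, hence with the formation of Taylor coefficients, and `h` describes it at
order zero. For fronts this is the chain rule with a moving origin: s has time derivative `θ`. -/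
theorem taylor_T (D T : Derivation ℂ A A) (hDT : ∀ w, D (T w) = T (D w)) (ε : A →+* R)
    (δ : Derivation ℂ R R) (θ : R) (h : ∀ w, ε (T w) = δ (ε w) + θ * ε (D w)) (w : A) :
    taylor D ε (T w) = totalD δ θ (taylor D ε w) := by
  have hit : ∀ (k : ℕ) (w : A), D^[k] (T w) = T (D^[k] w) := by
    intro k
    induction k with
    | zero => intro w; rfl
    | succ k ih => intro w; rw [Function.iterate_succ_apply, hDT, ih, Function.iterate_succ_apply]
  ext k
  rw [coeff_totalD]
  change PowerSeries.coeff k (taylorFun D ε (T w)) = δ (PowerSeries.coeff k (taylorFun D ε w)) +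
    θ * (k + 1) * PowerSeries.coeff (k + 1) (taylorFun D ε w)
  rw [mul_assoc, coeff_succ_taylorFun]
  simp only [taylorFun, PowerSeries.coeff_mk, hit, h, Derivation.leibniz, Derivation.map_algebraMap,
    smul_eq_mul]
  rw [← Function.iterate_succ_apply, Function.iterate_succ_apply' D k w, 
    ← Function.iterate_succ_apply' D k w, Function.iterate_succ_apply]
  ring

theorem taylor_eq_C (D : Derivation ℂ A A) (ε : A →+* R) (w : A) (h : D w = 0) :
    taylor D ε w = PowerSeries.C (ε w) := by
  ext k
  change PowerSeries.coeff k (taylorFun D ε w) = _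
  rcases k with _ | k
  · rw [coeff_zero_taylorFun]; simp
  · rw [taylorFun, PowerSeries.coeff_mk, Function.iterate_succ_apply, h, iterate_map_zero,
      PowerSeries.coeff_C]
    simp

end Taylor

section Transformations

variable {A B : Type*} [CommRing A] [Algebra ℂ A] [CommRing B] [Algebra ℂ B]

/-- The image of x^(-a) W is y^(-a) w, the powers of `η` cancelling; the `a + 1` factors of `η` come
from clearing the denominator x^(a+1). Restricting to exponents -a keeps inverses of `η` out of the
formula. -/
theorem map_shiftD (φ : A →+* B) (D : Derivation ℂ A A) (D' : Derivation ℂ B B)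
    (hD : ∀ w, φ (D w) = D' (φ w)) (x : A) (y η : B) (hx : φ x = y * η) (a : ℕ) (W : A) (w : B)
    (hw : φ W = η ^ a * w) :
    φ (shiftD D x (-(a : ℤ)) W) = η ^ (a + 1) * shiftD D' y (-(a : ℤ)) w := by
  simp only [shiftD, map_add, map_mul, hD, hw, hx, Derivation.leibniz, Derivation.leibniz_pow,
    smul_eq_mul, nsmul_eq_mul, map_intCast]
  rcases a with _ | a
  · simp; ring
  · simp only [Nat.add_sub_cancel]
    push_cast
    ring

/-- Change of the expansion variable. -/
theorem map_eqnSeries (φ : A →+* B) (D T : Derivation ℂ A A) (D' T' : Derivation ℂ B B)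
    (hD : ∀ w, φ (D w) = D' (φ w)) (hT : ∀ w, φ (T w) = T' (φ w)) (x : A) (y η : B)
    (hx : φ x = y * η) (q : EqnCoeffs A) (U V : A) (u v : B) (hU : φ U = η * u)
    (hV : φ V = η * v) :
    φ (eqnSeries D T x (-1) (-1) 0 q U V) =
      η ^ 4 * eqnSeries D' T' y (-1) (-1) 0 (q.map φ) u v := by
  have hU1 : φ U = η ^ 1 * u := by rw [hU, pow_one]
  have hT1 := map_shiftD φ T T' hT x y η hx 1 U u hU1
  have h1 := map_shiftD φ D D' hD x y η hx 1 U u hU1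
  have h2 := map_shiftD φ D D' hD x y η hx 2 _ _ h1
  have h3 := map_shiftD φ D D' hD x y η hx 3 _ _ h2
  have hc := map_shiftD φ D D' hD x y η hx 3 (U ^ 2 * V) (u ^ 2 * v) (by simp [hU, hV]; ring)
  have hn := map_shiftD φ D D' hD x y η hx 2 (U * V) (u * v) (by simp [hU, hV]; ring)
  norm_num at hT1 h1 h2 h3 hc hn
  norm_num [eqnSeries, EqnCoeffs.map]
  rw [hT1, h1, h2, h3, hc, hn, hU, hV, hx]
  ring

/-- The coefficients after the change of unknowns `u = e y`, `v = e⁻¹ σ z`, where `D e = c e` and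
`T e = b e`. -/
def EqnCoeffs.gauge (D : Derivation ℂ A A) (c b σ : A) (q : EqnCoeffs A) : EqnCoeffs A where
  ct := q.ct
  f := q.f + 3 * c * q.cl
  g := σ * (q.g + c * q.cm)
  h := q.h + c * q.k + (D c + c ^ 2) * q.f + (D (D c) + 3 * c * D c + c ^ 3) * q.cl + q.ct * b
  k := q.k + 2 * c * q.f + 3 * (D c + c ^ 2) * q.cl
  cl := q.cl
  cm := σ * q.cm
  cn := σ * q.cn

/-- Multiplication of all coefficients by a factor. -/
def EqnCoeffs.scale (a : A) (q : EqnCoeffs A) : EqnCoeffs A := q.map (a * ·)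

theorem eqnSeries_scale (D T : Derivation ℂ A A) (x : A) (α β : ℤ) (d : ℕ) (a : A)
    (q : EqnCoeffs A) (U V : A) :
    eqnSeries D T x α β d (q.scale a) U V = a * eqnSeries D T x α β d q U V := by
  simp only [eqnSeries, EqnCoeffs.scale, EqnCoeffs.map]
  ring

/-- A factor `e` comes out of every term: u² v = e σ y² z and u v = σ y z because e e' = σ, and
derivatives of `e` are multiples of `e`. What they leave behind is collected in `EqnCoeffs.gauge`.
-/
theorem eqnSeries_gauge (D T : Derivation ℂ A A) (x : A) (hDx : D (D x) = 0) (q : EqnCoeffs A)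
    (e e' c b σ y z : A) (he : e * e' = σ) (hDe : D e = c * e) (hTe : T e = b * e) 
    (hσ : D σ = 0) :
    eqnSeries D T x (-1) (-1) 0 q (e * y) (e' * z) =
      e * eqnSeries D T x (-1) (-1) 0 (q.gauge D c b σ) y z := by
  have hc : (e * y) ^ 2 * (e' * z) = e * (σ * (y ^ 2 * z)) := by rw [← he]; ring
  have hn : e * y * (e' * z) = σ * (y * z) := by rw [← he]; ring
  have hS : ∀ (a : ℤ) (w : A), shiftD D x a (e * w) = e * (shiftD D x a w + x * c * w) := by
    intro a w
    simp only [shiftD, Derivation.leibniz, hDe, smul_eq_mul]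
    ring
  have hST : shiftD T x (-1) (e * y) = e * (shiftD T x (-1) y + x * b * y) := by
    simp only [shiftD, Derivation.leibniz, hTe, smul_eq_mul]
    ring
  have hSσ : ∀ (a : ℤ) (w : A), shiftD D x a (σ * w) = σ * shiftD D x a w := by
    intro a w
    simp only [shiftD, Derivation.leibniz, hσ, smul_eq_mul]
    ring
  simp only [eqnSeries, hc, hn, hS, hST, hSσ, EqnCoeffs.gauge]
  simp only [shiftD, Derivation.leibniz, map_add, hDx, smul_eq_mul, Derivation.map_intCast,
    mul_zero]
  push_cast
  ring

end Transformations

end NLSCoeffs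

/-! ### Levels 1 to 5 of the normalized equation -/

namespace NLSCoeffs

section NormalForm

variable {R : Type*} [CommRing R] [Algebra ℂ R]

/-- The coefficients of the normalized equation
`u_t + F u_xx + G u² v + H u + K u_x + u_xxx + μ (u² v)_x + ν u (u v)_x = 0`. -/
noncomputable def normalCoeffs (μ ν : R) (F G H K : R⟦X⟧) : EqnCoeffs R⟦X⟧ :=
  ⟨1, F, G, H, K, 1, PowerSeries.C μ, PowerSeries.C ν⟩

/-- The left-hand side of the normalized equation at `u = y / X`, `v = z / X`. -/
noncomputable def normalSeries (D : Derivation ℂ R R) (μ ν : R) (F G H K y z : R⟦X⟧) : R⟦X⟧ :=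
  eqnSeries (totalD 0 1) (totalD D 0) PowerSeries.X (-1) (-1) 0 (normalCoeffs μ ν F G H K) y z

theorem coeff_shiftD (d : Derivation ℂ R R) (κ : R) (a : ℤ) (n : ℕ) (W : R⟦X⟧) :
    PowerSeries.coeff n (shiftD (totalD d κ) PowerSeries.X a W) =
      (if n = 0 then 0 else d (PowerSeries.coeff (n - 1) W))
        + κ * (a + n) * PowerSeries.coeff n W := by
  rcases n with _ | n
  · rw [coeff_shiftD_zero]; simp
  · rw [coeff_shiftD_succ]; simp

/-- `w` is the sequence of the values of the coefficients of `W` under `φ`. -/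
def Evaluates (φ : R →+* ℂ) (W : R⟦X⟧) (w : ℕ → ℂ) : Prop := ∀ n, φ (PowerSeries.coeff n W) = w n

/-- This and the next four formulas are convolution expansions with leading coefficients 1. Passing
to ℂ through `φ` makes the later eliminations polynomial algebra with rational coefficients; only
the time derivative of a coefficient, present from level 4 on, is not a function of the values. -/
theorem map_coeff_normalSeries_one (φ : R →+* ℂ) (D : Derivation ℂ R R) {μ' ν' : R} {μ ν : ℂ}
    (hμ : φ μ' = μ) (hν : φ ν' = ν) {Fs Gs Hs Ks Ys Zs : R⟦X⟧} {F G Y Z : ℕ → ℂ}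
    (hF : Evaluates φ Fs F) (hG : Evaluates φ Gs G)
    (hY : Evaluates φ Ys Y) (hZ : Evaluates φ Zs Z) (hY0 : PowerSeries.coeff 0 Ys = 1)
    (hZ0 : PowerSeries.coeff 0 Zs = 1) :
    φ (PowerSeries.coeff 1 (normalSeries D μ' ν' Fs Gs Hs Ks Ys Zs)) =
    2*F 0 + G 0 - 4*Y 1*μ - 3*Y 1*ν - 2*Z 1*μ - Z 1*ν := by
  have h2 : φ 2 = 2 := map_ofNat φ 2
  have h3 : φ 3 = 3 := map_ofNat φ 3
  simp [h2, h3, normalSeries, normalCoeffs, eqnSeries, coeff_shiftD, pow_two, PowerSeries.coeff_X,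
    PowerSeries.coeff_mul, Finset.Nat.antidiagonal_succ, hY0, hZ0, hμ, hν, hF _, hG _,
    hY _, hZ _, -PowerSeries.coeff_zero_eq_constantCoeff]
  ring

theorem map_coeff_normalSeries_two (φ : R →+* ℂ) (D : Derivation ℂ R R) {μ' ν' : R} {μ ν : ℂ}
    (hμ : φ μ' = μ) (hν : φ ν' = ν) {Fs Gs Hs Ks Ys Zs : R⟦X⟧} {F G K Y Z : ℕ → ℂ}
    (hF : Evaluates φ Fs F) (hG : Evaluates φ Gs G) (hK : Evaluates φ Ks K)
    (hY : Evaluates φ Ys Y) (hZ : Evaluates φ Zs Z) (hY0 : PowerSeries.coeff 0 Ys = 1)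
    (hZ0 : PowerSeries.coeff 0 Zs = 1) :
    φ (PowerSeries.coeff 2 (normalSeries D μ' ν' Fs Gs Hs Ks Ys Zs)) =
    2*F 1 + G 1 - K 0 + 2*G 0*Y 1 + G 0*Z 1 - 2*Y 2*μ - 2*Y 2*ν - Z 2*μ - 2*Y 1*Z 1*μ - Y
    1*Z 1*ν - Y 1^2*μ - Y 1^2*ν := by
  have h2 : φ 2 = 2 := map_ofNat φ 2
  have h3 : φ 3 = 3 := map_ofNat φ 3
  simp [h2, h3, normalSeries, normalCoeffs, eqnSeries, coeff_shiftD, pow_two, PowerSeries.coeff_X,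
    PowerSeries.coeff_mul, Finset.Nat.antidiagonal_succ, hY0, hZ0, hμ, hν, hF _, hG _, hK _,
    hY _, hZ _, -PowerSeries.coeff_zero_eq_constantCoeff]
  ring

/-- The term with `μ` is absent: at this level u² v has exponent -3 + 3 = 0, and its derivative
drops out. -/
theorem map_coeff_normalSeries_three (φ : R →+* ℂ) (D : Derivation ℂ R R) {μ' ν' : R} {ν : ℂ}
    (hν : φ ν' = ν) {Fs Gs Hs Ks Ys Zs : R⟦X⟧} {F G H K Y Z : ℕ → ℂ}
    (hF : Evaluates φ Fs F) (hG : Evaluates φ Gs G) (hH : Evaluates φ Hs H) (hK : Evaluates φ Ks K)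
    (hY : Evaluates φ Ys Y) (hZ : Evaluates φ Zs Z) (hY0 : PowerSeries.coeff 0 Ys = 1)
    (hZ0 : PowerSeries.coeff 0 Zs = 1) :
    φ (PowerSeries.coeff 3 (normalSeries D μ' ν' Fs Gs Hs Ks Ys Zs)) =
    2*F 2 + G 2 + H 0 - K 1 + 2*G 0*Y 2 + G 0*Z 2 + 2*G 1*Y 1 + G 1*Z 1 - Y 3*ν + Z 3*ν +
    2*G 0*Y 1*Z 1 + G 0*Y 1^2 - Y 1*Y 2*ν + Y 1*Z 2*ν := by
  have h2 : φ 2 = 2 := map_ofNat φ 2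
  have h3 : φ 3 = 3 := map_ofNat φ 3
  simp [h2, h3, normalSeries, normalCoeffs, eqnSeries, coeff_shiftD, pow_two, PowerSeries.coeff_X,
    PowerSeries.coeff_mul, Finset.Nat.antidiagonal_succ, hY0, hZ0, hν, hF _, hG _, hH _, hK _,
    hY _, hZ _, -PowerSeries.coeff_zero_eq_constantCoeff]
  ring

theorem map_coeff_normalSeries_four (φ : R →+* ℂ) (D : Derivation ℂ R R) {μ' ν' : R} {μ ν : ℂ}
    (hμ : φ μ' = μ) (hν : φ ν' = ν) {Fs Gs Hs Ks Ys Zs : R⟦X⟧} {F G H K Y Z : ℕ → ℂ}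
    (hF : Evaluates φ Fs F) (hG : Evaluates φ Gs G) (hH : Evaluates φ Hs H) (hK : Evaluates φ Ks K)
    (hY : Evaluates φ Ys Y) (hZ : Evaluates φ Zs Z) (hY0 : PowerSeries.coeff 0 Ys = 1)
    (hZ0 : PowerSeries.coeff 0 Zs = 1) :
    φ (PowerSeries.coeff 4 (normalSeries D μ' ν' Fs Gs Hs Ks Ys Zs)) =
    φ (D (PowerSeries.coeff 1 Ys)) + 2*F 3 + G 3 + H 1 - K 2 + 6*Y 4 + 2*F 0*Y 3 + 2*G 0*Y 3 + G 0*Z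
        3 + 2*G 1*Y 2
    + G 1*Z 2 + 2*G 2*Y 1 + G 2*Z 1 + H 0*Y 1 + K 0*Y 2 + 2*Y 4*μ + Z 4*μ + 2*Z 4*ν + 2*G
    0*Y 1*Y 2 + 2*G 0*Y 1*Z 2 + 2*G 0*Y 2*Z 1 + 2*G 1*Y 1*Z 1 + G 1*Y 1^2 + 2*Y 1*Y 3*μ +
    2*Y 1*Z 3*μ + 3*Y 1*Z 3*ν + 2*Y 2*Z 2*μ + 2*Y 2*Z 2*ν + Y 2^2*μ + 2*Y 3*Z 1*μ + Y 3*Z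
    1*ν + G 0*Y 1^2*Z 1 + 2*Y 1*Y 2*Z 1*μ + Y 1*Y 2*Z 1*ν + Y 1^2*Z 2*μ + Y 1^2*Z 2*ν := by
  have h2 : φ 2 = 2 := map_ofNat φ 2
  have h3 : φ 3 = 3 := map_ofNat φ 3
  have h4 : φ 4 = 4 := map_ofNat φ 4
  simp [h2, h3, h4, normalSeries, normalCoeffs, eqnSeries, coeff_shiftD, pow_two,
      PowerSeries.coeff_X,
    PowerSeries.coeff_mul, Finset.Nat.antidiagonal_succ, hY0, hZ0, hμ, hν, hF _, hG _, hH _, hK _,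
    hY _, hZ _, -PowerSeries.coeff_zero_eq_constantCoeff]
  ring

/-- `F` and `G` are zero here because this level is used only after they have been shown to vanish.
-/
theorem map_coeff_normalSeries_five (φ : R →+* ℂ) (D : Derivation ℂ R R) {μ' ν' : R} {μ ν : ℂ}
    (hμ : φ μ' = μ) (hν : φ ν' = ν) {Hs Ks Ys Zs : R⟦X⟧} {H K Y Z : ℕ → ℂ}
    (hH : Evaluates φ Hs H) (hK : Evaluates φ Ks K) (hY : Evaluates φ Ys Y) (hZ : Evaluates φ Zs Z)
    (hY0 : PowerSeries.coeff 0 Ys = 1) (hZ0 : PowerSeries.coeff 0 Zs = 1) :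
    φ (PowerSeries.coeff 5 (normalSeries D μ' ν' 0 0 Hs Ks Ys Zs)) =
    φ (D (PowerSeries.coeff 2 Ys)) + H 2 - K 3 + 24*Y 5 + H 0*Y 2 + H 1*Y 1 + 2*K 0*Y 3 + K 1*Y 2 +
        4*Y 5*μ + Y
    5*ν + 2*Z 5*μ + 3*Z 5*ν + 4*Y 1*Y 4*μ + Y 1*Y 4*ν + 4*Y 1*Z 4*μ + 5*Y 1*Z 4*ν + 4*Y 2*Y
    3*μ + Y 2*Y 3*ν + 4*Y 2*Z 3*μ + 4*Y 2*Z 3*ν + 4*Y 3*Z 2*μ + 3*Y 3*Z 2*ν + 4*Y 4*Z 1*μ +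
    2*Y 4*Z 1*ν + 4*Y 1*Y 2*Z 2*μ + 3*Y 1*Y 2*Z 2*ν + 4*Y 1*Y 3*Z 1*μ + 2*Y 1*Y 3*Z 1*ν +
    2*Y 1^2*Z 3*μ + 2*Y 1^2*Z 3*ν + 2*Y 2^2*Z 1*μ + Y 2^2*Z 1*ν := by
  have h2 : φ 2 = 2 := map_ofNat φ 2
  have h3 : φ 3 = 3 := map_ofNat φ 3
  have h4 : φ 4 = 4 := map_ofNat φ 4
  have h5 : φ 5 = 5 := map_ofNat φ 5
  simp [h2, h3, h4, h5, normalSeries, normalCoeffs, eqnSeries, coeff_shiftD, pow_two,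
      PowerSeries.coeff_X,
    PowerSeries.coeff_mul, Finset.Nat.antidiagonal_succ, hY0, hZ0, hμ, hν, hH _, hK _,
    hY _, hZ _, -PowerSeries.coeff_zero_eq_constantCoeff]
  ring

end NormalForm

end NLSCoeffs

/-! ### Polynomial identities behind compatibility and necessity -/

namespace NLSCoeffs

section LevelAlgebra

/-- For μ = -6, ν = 6 the new unknowns enter the two equations with opposite signs, so their sum is
the constraint. With Y1 + Z1 = 0 and Y2 = Z2 it reduces to `hH`. -/
theorem hirota_compat_three {B0 H0 K0 K1 Y1 Y2 Y3 Z1 Z2 Z3 : ℂ}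
    (e1 : 6 * Y1 + 6 * Z1 = 0)
    (e2 : -K0 + 6 * Z2 + 6 * Y1 * Z1 = 0)
    (e2b : -K0 + 6 * Y2 + 6 * Y1 * Z1 = 0)
    (hH : H0 + B0 = 2 * K1) :
    H0 - K1 - 6 * Y3 + 6 * Z3 - 6 * Y1 * Y2 + 6 * Y1 * Z2 + (B0 - K1 + 6 * Y3 - 6 * Z3 + 6 * Y2 *
      Z1 - 6 * Z1 * Z2) = 0 := by
  have hZ1 : Z1 = -Y1 := by linear_combination (1 / 6) * e1
  subst hZ1
  have hZ2 : Z2 = K0 / 6 + Y1 ^ 2 := by linear_combination (1 / 6) * e2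
  have hY2 : Y2 = K0 / 6 + Y1 ^ 2 := by linear_combination (1 / 6) * e2b
  subst hZ2 hY2
  linear_combination hH

/-- The sum is again free of the new unknowns. After elimination of `Z3` by `e3` it is a combination
of `hH`, `hH1` and the cancellation of time derivatives `hD`. -/
theorem hirota_compat_four {B0 B1 DY1 DZ1 H0 H1 K0 K1 Y1 Y2 Y3 Y4 Z1 Z2 Z3 Z4 : ℂ}
    (e1 : 6 * Y1 + 6 * Z1 = 0)
    (e2 : -K0 + 6 * Z2 + 6 * Y1 * Z1 = 0)
    (e2b : -K0 + 6 * Y2 + 6 * Y1 * Z1 = 0)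
    (e3 : H0 - K1 - 6 * Y3 + 6 * Z3 - 6 * Y1 * Y2 + 6 * Y1 * Z2 = 0)
    (hD : DZ1 = -DY1)
    (hH : H0 + B0 = 2 * K1)
    (hH1 : H1 + B1 = 0) :
    DY1 + H1 - 6 * Y4 + 6 * Z4 + H0 * Y1 + K0 * Y2 - 12 * Y1 * Y3 + 6 * Y1 * Z3 - 6 * Y2 ^ 2 - 6
      * Y3 * Z1 - 6 * Y1 * Y2 * Z1 + (B1 + DZ1 + 6 * Y4 - 6 * Z4 + B0 * Z1 + K0 * Z2 - 6 * Y1 *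
      Z3 + 6 * Y3 * Z1 - 12 * Z1 * Z3 - 6 * Z2 ^ 2 - 6 * Y1 * Z1 * Z2) = 0 := by
  have hZ1 : Z1 = -Y1 := by linear_combination (1 / 6) * e1
  subst hZ1
  have hZ2 : Z2 = K0 / 6 + Y1 ^ 2 := by linear_combination (1 / 6) * e2
  have hY2 : Y2 = K0 / 6 + Y1 ^ 2 := by linear_combination (1 / 6) * e2b
  subst hZ2 hY2
  have hZ3 : Z3 = Y3 + (K1 - H0) / 6 := by linear_combination (1 / 6) * e3
  subst hZ3
  linear_combination (-Y1) * hH + hH1 + hD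

/-- Here the new unknowns enter both equations as 6 Y5 + 6 Z5, so the difference is the constraint;
`hH2` is its only new ingredient. -/
theorem hirota_compat_five {B0 B1 B2 DY1 DY2 DZ2 H0 H1 H2 K0 K1 Y1 Y2 Y3 Y4 Y5 Z1 Z2 Z3 Z4 Z5 : ℂ}
    (e1 : 6 * Y1 + 6 * Z1 = 0)
    (e2 : -K0 + 6 * Z2 + 6 * Y1 * Z1 = 0)
    (e2b : -K0 + 6 * Y2 + 6 * Y1 * Z1 = 0)
    (e3 : H0 - K1 - 6 * Y3 + 6 * Z3 - 6 * Y1 * Y2 + 6 * Y1 * Z2 = 0)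
    (e4 : DY1 + H1 - 6 * Y4 + 6 * Z4 + H0 * Y1 + K0 * Y2 - 12 * Y1 * Y3 + 6 * Y1 * Z3 - 6 * Y2 ^
      2 - 6 * Y3 * Z1 - 6 * Y1 * Y2 * Z1 = 0)
    (hD : DZ2 = DY2)
    (hH : H0 + B0 = 2 * K1)
    (hH1 : H1 + B1 = 0)
    (hH2 : H2 = B2) :
    DY2 + H2 + 6 * Y5 + 6 * Z5 + H0 * Y2 + H1 * Y1 + 2 * K0 * Y3 + K1 * Y2 - 18 * Y1 * Y4 + 6 *
      Y1 * Z4 - 18 * Y2 * Y3 - 6 * Y3 * Z2 - 12 * Y4 * Z1 - 6 * Y1 * Y2 * Z2 - 12 * Y1 * Y3 * Z1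
      - 6 * Y2 ^ 2 * Z1 - (B2 + DZ2 + 6 * Y5 + 6 * Z5 + B0 * Z2 + B1 * Z1 + 2 * K0 * Z3 + K1 * Z2
      - 12 * Y1 * Z4 - 6 * Y2 * Z3 + 6 * Y4 * Z1 - 18 * Z1 * Z4 - 18 * Z2 * Z3 - 12 * Y1 * Z1 *
      Z3 - 6 * Y1 * Z2 ^ 2 - 6 * Y2 * Z1 * Z2) = 0 := by
  have hZ1 : Z1 = -Y1 := by linear_combination (1 / 6) * e1
  subst hZ1
  have hZ2 : Z2 = K0 / 6 + Y1 ^ 2 := by linear_combination (1 / 6) * e2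
  have hY2 : Y2 = K0 / 6 + Y1 ^ 2 := by linear_combination (1 / 6) * e2b
  subst hZ2 hY2
  have hZ3 : Z3 = Y3 + (K1 - H0) / 6 := by linear_combination (1 / 6) * e3
  subst hZ3
  have hZ4 : Z4 = -DY1 / 6 - H1 / 6 + Y4 - K1 * Y1 / 6 := by linear_combination (1 / 6) * e4
  subst hZ4
  linear_combination hH2 - hD - (K0 / 6 + Y1 ^ 2) * hH + Y1 * hH1

/-- For μ = -3, ν = 3/2 level 1 is nonsingular and gives Y1 = Z1 = 0; at level 2 both equations then
coincide. -/
theorem sasaSatsuma_compat_two {K0 Y1 Y2 Z1 Z2 : ℂ}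
    (e1 : 15/2 * Y1 + 9/2 * Z1 = 0)
    (e1b : 9/2 * Y1 + 15/2 * Z1 = 0) :
    -K0 + 3 * Y2 + 3 * Z2 + 9/2 * Y1 * Z1 + 3/2 * Y1 ^ 2 - (-K0 + 3 * Y2 + 3 * Z2 + 9/2 * Y1 * Z1
      + 3/2 * Z1 ^ 2) = 0 := by
  have hY1 : Y1 = 0 := by linear_combination (5 / 24) * e1 - (1 / 8) * e1b
  have hZ1 : Z1 = 0 := by linear_combination (5 / 24) * e1b - (1 / 8) * e1
  subst hY1 hZ1
  ring

theorem sasaSatsuma_compat_three {B0 H0 K0 K1 Y1 Y2 Y3 Z1 Z2 Z3 : ℂ}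
    (e1 : 15/2 * Y1 + 9/2 * Z1 = 0)
    (e1b : 9/2 * Y1 + 15/2 * Z1 = 0)
    (e2 : -K0 + 3 * Y2 + 3 * Z2 + 9/2 * Y1 * Z1 + 3/2 * Y1 ^ 2 = 0)
    (hH : H0 + B0 = 2 * K1) :
    H0 - K1 - 3/2 * Y3 + 3/2 * Z3 - 3/2 * Y1 * Y2 + 3/2 * Y1 * Z2 + (B0 - K1 + 3/2 * Y3 - 3/2 *
      Z3 + 3/2 * Y2 * Z1 - 3/2 * Z1 * Z2) = 0 := by
  have hY1 : Y1 = 0 := by linear_combination (5 / 24) * e1 - (1 / 8) * e1b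
  have hZ1 : Z1 = 0 := by linear_combination (5 / 24) * e1b - (1 / 8) * e1
  subst hY1 hZ1
  linear_combination hH

/-- The unknowns Y4, Z4 do not occur: 4 is a double resonance, and each equation is a constraint by
itself. -/
theorem sasaSatsuma_compat_four {DY1 H0 H1 K0 K1 Y1 Y2 Y3 Z1 Z2 Z3 : ℂ}
    (e1 : 15/2 * Y1 + 9/2 * Z1 = 0)
    (e1b : 9/2 * Y1 + 15/2 * Z1 = 0)
    (e2 : -K0 + 3 * Y2 + 3 * Z2 + 9/2 * Y1 * Z1 + 3/2 * Y1 ^ 2 = 0)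
    (e3 : H0 - K1 - 3/2 * Y3 + 3/2 * Z3 - 3/2 * Y1 * Y2 + 3/2 * Y1 * Z2 = 0)
    (hDY : DY1 = 0)
    (hH1 : H1 = 0) :
    DY1 + H1 + H0 * Y1 + K0 * Y2 - 6 * Y1 * Y3 - 3/2 * Y1 * Z3 - 3 * Y2 * Z2 - 3 * Y2 ^ 2 - 9/2 *
      Y3 * Z1 - 9/2 * Y1 * Y2 * Z1 - 3/2 * Y1 ^ 2 * Z2 = 0 := by
  have hY1 : Y1 = 0 := by linear_combination (5 / 24) * e1 - (1 / 8) * e1b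
  have hZ1 : Z1 = 0 := by linear_combination (5 / 24) * e1b - (1 / 8) * e1
  subst hY1 hZ1
  have hZ2 : Z2 = K0 / 3 - Y2 := by linear_combination (1 / 3) * e2
  subst hZ2
  have hZ3 : Z3 = Y3 + 2 / 3 * (K1 - H0) := by linear_combination (2 / 3) * e3
  subst hZ3
  linear_combination hDY + hH1

theorem sasaSatsuma_compat_four_conj {B0 B1 DZ1 H0 K0 K1 Y1 Y2 Y3 Z1 Z2 Z3 : ℂ}
    (e1 : 15/2 * Y1 + 9/2 * Z1 = 0)
    (e1b : 9/2 * Y1 + 15/2 * Z1 = 0)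
    (e2 : -K0 + 3 * Y2 + 3 * Z2 + 9/2 * Y1 * Z1 + 3/2 * Y1 ^ 2 = 0)
    (e3 : H0 - K1 - 3/2 * Y3 + 3/2 * Z3 - 3/2 * Y1 * Y2 + 3/2 * Y1 * Z2 = 0)
    (hDZ : DZ1 = 0)
    (hB1 : B1 = 0) :
    B1 + DZ1 + B0 * Z1 + K0 * Z2 - 9/2 * Y1 * Z3 - 3 * Y2 * Z2 - 3/2 * Y3 * Z1 - 6 * Z1 * Z3 - 3
      * Z2 ^ 2 - 9/2 * Y1 * Z1 * Z2 - 3/2 * Y2 * Z1 ^ 2 = 0 := by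
  have hY1 : Y1 = 0 := by linear_combination (5 / 24) * e1 - (1 / 8) * e1b
  have hZ1 : Z1 = 0 := by linear_combination (5 / 24) * e1b - (1 / 8) * e1
  subst hY1 hZ1
  have hZ2 : Z2 = K0 / 3 - Y2 := by linear_combination (1 / 3) * e2
  subst hZ2
  have hZ3 : Z3 = Y3 + 2 / 3 * (K1 - H0) := by linear_combination (2 / 3) * e3
  subst hZ3
  linear_combination hDZ + hB1

theorem hirota_dispersion_one {F0 G0 J0 Y1 Z1 : ℂ}
    (e1 : 2 * F0 + G0 + 6 * Y1 + 6 * Z1 = 0)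
    (e1b : G0 + 2 * J0 + 6 * Y1 + 6 * Z1 = 0) :
    F0 = J0 := by
  linear_combination (1 / 2) * e1 - (1 / 2) * e1b

/-- The sum of the level 3 equations, with `Z1`, `Y2`, `Z2` eliminated. It is affine in the free
coefficient `Y1`, with slope 12 (L0 - K0), so varying `Y1` gives K0 = L0. After that the front speed
survives only through G0 K0, so varying the speed gives G0 = 0. -/
theorem hirota_constraint_three {B0 F0 F1 F2 G0 G1 G2 H0 K0 K1 L0 L1 Y1 Y2 Y3 Z1 Z2 Z3 : ℂ}
    (e1 : 2 * F0 + G0 + 6 * Y1 + 6 * Z1 = 0)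
    (e2 : 2 * F1 + G1 - K0 + 6 * Z2 + 2 * G0 * Y1 + G0 * Z1 + 6 * Y1 * Z1 = 0)
    (e2b : 2 * F1 + G1 - L0 + 6 * Y2 + G0 * Y1 + 2 * G0 * Z1 + 6 * Y1 * Z1 = 0)
    (e3 : 2 * F2 + G2 + H0 - K1 - 6 * Y3 + 6 * Z3 + 2 * G0 * Y2 + G0 * Z2 + 2 * G1 * Y1 + G1 * Z1
      - 6 * Y1 * Y2 + 6 * Y1 * Z2 + 2 * G0 * Y1 * Z1 + G0 * Y1 ^ 2 = 0)
    (e3b : B0 + 2 * F2 + G2 - L1 + 6 * Y3 - 6 * Z3 + G0 * Y2 + 2 * G0 * Z2 + G1 * Y1 + 2 * G1 *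
      Z1 + 6 * Y2 * Z1 - 6 * Z1 * Z2 + 2 * G0 * Y1 * Z1 + G0 * Z1 ^ 2 = 0) :
    -6 * B0 + -24 * F2 + -12 * G2 + -6 * H0 + 6 * K1 + 6 * L1 + 6 * F0 * G1 + -2 * F0 * K0 + 2 *
      F0 * L0 + 12 * F1 * G0 + 9 * G0 * G1 + -4 * G0 * K0 + -2 * G0 * L0 + -12 * K0 * Y1 + 12 *
      L0 * Y1 + -3 * F0 * G0 ^ 2 + -3/2 * G0 ^ 3 = 0 := by
  have hZ1 : Z1 = -F0 / 3 - G0 / 6 - Y1 := by linear_combination (1 / 6) * e1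
  subst hZ1
  have hZ2 : Z2 = -F1 / 3 - G1 / 6 + K0 / 6 + F0 * G0 / 18 + F0 * Y1 / 3
      + G0 ^ 2 / 36 + Y1 ^ 2 := by
    linear_combination (1 / 6) * e2
  have hY2 : Y2 = -F1 / 3 - G1 / 6 + L0 / 6 + F0 * G0 / 9 + F0 * Y1 / 3 + G0 * Y1 / 3
      + G0 ^ 2 / 18 + Y1 ^ 2 := by
    linear_combination (1 / 6) * e2b
  subst hZ2 hY2
  linear_combination (-6) * e3 - 6 * e3b

/-- Raising the free coefficient `Y3` by 1 raises `Z3` by 1 and changes the sum of the level 4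
equations by 8 F0. -/
theorem hirota_dispersion_four {B0 B1 DY1 DZ1 F0 F2 F3 H0 H1 K0 K1 K2 Y1 Y2 Y3 Y3' Y4 Y4' Z1 Z2
      Z3 Z3' Z4 Z4' : ℂ}
    (e1 : 2 * F0 + 6 * Y1 + 6 * Z1 = 0)
    (e3 : 2 * F2 + H0 - K1 - 6 * Y3 + 6 * Z3 - 6 * Y1 * Y2 + 6 * Y1 * Z2 = 0)
    (e3' : 2 * F2 + H0 - K1 - 6 * Y3' + 6 * Z3' - 6 * Y1 * Y2 + 6 * Y1 * Z2 = 0)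
    (e4 : DY1 + 2 * F3 + H1 - K2 - 6 * Y4 + 6 * Z4 + 2 * F0 * Y3 + H0 * Y1 + K0 * Y2 - 12 * Y1 *
      Y3 + 6 * Y1 * Z3 - 6 * Y2 ^ 2 - 6 * Y3 * Z1 - 6 * Y1 * Y2 * Z1 = 0)
    (e4b : B1 + DZ1 + 2 * F3 - K2 + 6 * Y4 - 6 * Z4 + B0 * Z1 + 2 * F0 * Z3 + K0 * Z2 - 6 * Y1 *
      Z3 + 6 * Y3 * Z1 - 12 * Z1 * Z3 - 6 * Z2 ^ 2 - 6 * Y1 * Z1 * Z2 = 0)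
    (e4' : DY1 + 2 * F3 + H1 - K2 - 6 * Y4' + 6 * Z4' + 2 * F0 * Y3' + H0 * Y1 + K0 * Y2 - 12 *
      Y1 * Y3' + 6 * Y1 * Z3' - 6 * Y2 ^ 2 - 6 * Y3' * Z1 - 6 * Y1 * Y2 * Z1 = 0)
    (e4b' : B1 + DZ1 + 2 * F3 - K2 + 6 * Y4' - 6 * Z4' + B0 * Z1 + 2 * F0 * Z3' + K0 * Z2 - 6 *
      Y1 * Z3' + 6 * Y3' * Z1 - 12 * Z1 * Z3' - 6 * Z2 ^ 2 - 6 * Y1 * Z1 * Z2 = 0)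
    (hY : Y3' = Y3 + 1) :
    F0 = 0 := by
  have hZ1 : Z1 = -F0 / 3 - Y1 := by linear_combination (1 / 6) * e1
  subst hZ1 hY
  have hZ3 : Z3' = Z3 + 1 := by linear_combination (1 / 6) * e3' - (1 / 6) * e3
  subst hZ3
  linear_combination (1 / 8) * (e4' + e4b' - e4 - e4b)

/-- The sum from `hirota_compat_four`, now known to vanish, contains H1 + B1 - 2 K2. By `hH1` this
is 2 K2, and everything else cancels. -/
theorem hirota_constraint_four {B0 B1 DY1 DZ1 H0 H1 K0 K1 K2 Y1 Y2 Y3 Y4 Z1 Z2 Z3 Z4 : ℂ}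
    (e1 : 6 * Y1 + 6 * Z1 = 0)
    (e2 : -K0 + 6 * Z2 + 6 * Y1 * Z1 = 0)
    (e2b : -K0 + 6 * Y2 + 6 * Y1 * Z1 = 0)
    (e3 : H0 - K1 - 6 * Y3 + 6 * Z3 - 6 * Y1 * Y2 + 6 * Y1 * Z2 = 0)
    (e4 : DY1 + H1 - K2 - 6 * Y4 + 6 * Z4 + H0 * Y1 + K0 * Y2 - 12 * Y1 * Y3 + 6 * Y1 * Z3 - 6 *
      Y2 ^ 2 - 6 * Y3 * Z1 - 6 * Y1 * Y2 * Z1 = 0)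
    (e4b : B1 + DZ1 - K2 + 6 * Y4 - 6 * Z4 + B0 * Z1 + K0 * Z2 - 6 * Y1 * Z3 + 6 * Y3 * Z1 - 12 *
      Z1 * Z3 - 6 * Z2 ^ 2 - 6 * Y1 * Z1 * Z2 = 0)
    (hD : DZ1 = -DY1)
    (hH : H0 + B0 = 2 * K1)
    (hH1 : H1 + B1 = 4 * K2) :
    K2 = 0 := by
  have hZ1 : Z1 = -Y1 := by linear_combination (1 / 6) * e1
  subst hZ1
  have hZ2 : Z2 = K0 / 6 + Y1 ^ 2 := by linear_combination (1 / 6) * e2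
  have hY2 : Y2 = K0 / 6 + Y1 ^ 2 := by linear_combination (1 / 6) * e2b
  subst hZ2 hY2
  have hZ3 : Z3 = Y3 + (K1 - H0) / 6 := by linear_combination (1 / 6) * e3
  subst hZ3
  linear_combination (1 / 2) * (e4 + e4b - (-Y1) * hH - hH1 - hD)

theorem hirota_constraint_five {B0 B1 B2 DY1 DY2 DZ2 H0 H1 H2 K0 K1 Y1 Y2 Y3 Y4 Y5 Z1 Z2 Z3 Z4 Z5
      : ℂ}
    (e1 : 6 * Y1 + 6 * Z1 = 0)
    (e2 : -K0 + 6 * Z2 + 6 * Y1 * Z1 = 0)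
    (e2b : -K0 + 6 * Y2 + 6 * Y1 * Z1 = 0)
    (e3 : H0 - K1 - 6 * Y3 + 6 * Z3 - 6 * Y1 * Y2 + 6 * Y1 * Z2 = 0)
    (e4 : DY1 + H1 - 6 * Y4 + 6 * Z4 + H0 * Y1 + K0 * Y2 - 12 * Y1 * Y3 + 6 * Y1 * Z3 - 6 * Y2 ^
      2 - 6 * Y3 * Z1 - 6 * Y1 * Y2 * Z1 = 0)
    (e5 : DY2 + H2 + 6 * Y5 + 6 * Z5 + H0 * Y2 + H1 * Y1 + 2 * K0 * Y3 + K1 * Y2 - 18 * Y1 * Y4 +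
      6 * Y1 * Z4 - 18 * Y2 * Y3 - 6 * Y3 * Z2 - 12 * Y4 * Z1 - 6 * Y1 * Y2 * Z2 - 12 * Y1 * Y3 *
      Z1 - 6 * Y2 ^ 2 * Z1 = 0)
    (e5b : B2 + DZ2 + 6 * Y5 + 6 * Z5 + B0 * Z2 + B1 * Z1 + 2 * K0 * Z3 + K1 * Z2 - 12 * Y1 * Z4
      - 6 * Y2 * Z3 + 6 * Y4 * Z1 - 18 * Z1 * Z4 - 18 * Z2 * Z3 - 12 * Y1 * Z1 * Z3 - 6 * Y1 * Z2
      ^ 2 - 6 * Y2 * Z1 * Z2 = 0)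
    (hD : DZ2 = DY2)
    (hH : H0 + B0 = 2 * K1)
    (hH1 : H1 + B1 = 0) :
    H2 = B2 := by
  have hZ1 : Z1 = -Y1 := by linear_combination (1 / 6) * e1
  subst hZ1
  have hZ2 : Z2 = K0 / 6 + Y1 ^ 2 := by linear_combination (1 / 6) * e2
  have hY2 : Y2 = K0 / 6 + Y1 ^ 2 := by linear_combination (1 / 6) * e2b
  subst hZ2 hY2
  have hZ3 : Z3 = Y3 + (K1 - H0) / 6 := by linear_combination (1 / 6) * e3
  subst hZ3
  have hZ4 : Z4 = -DY1 / 6 - H1 / 6 + Y4 - K1 * Y1 / 6 := by linear_combination (1 / 6) * e4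
  subst hZ4
  linear_combination e5 - e5b + hD + (K0 / 6 + Y1 ^ 2) * hH - Y1 * hH1

/-- Level 1 determines `Y1`, `Z1`, and the difference of the level 2 equations is free of `Y2`,
`Z2`. For equal F and J it says K0 = L0. -/
theorem sasaSatsuma_constraint_two {F0 F1 G0 G1 J0 J1 K0 L0 Y1 Y2 Z1 Z2 : ℂ}
    (e1 : 2 * F0 + G0 + 15/2 * Y1 + 9/2 * Z1 = 0)
    (e1b : G0 + 2 * J0 + 9/2 * Y1 + 15/2 * Z1 = 0)
    (e2 : 2 * F1 + G1 - K0 + 3 * Y2 + 3 * Z2 + 2 * G0 * Y1 + G0 * Z1 + 9/2 * Y1 * Z1 + 3/2 * Y1 ^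
      2 = 0)
    (e2b : G1 + 2 * J1 - L0 + 3 * Y2 + 3 * Z2 + G0 * Y1 + 2 * G0 * Z1 + 9/2 * Y1 * Z1 + 3/2 * Z1
      ^ 2 = 0) :
    6 * F1 + -6 * J1 + -3 * K0 + 3 * L0 + -3/2 * F0 * G0 + 1/2 * F0 ^ 2 + 3/2 * G0 * J0 + -1/2 *
      J0 ^ 2 = 0 := by
  have hY1 : Y1 = -5 / 12 * F0 - G0 / 12 + J0 / 4 := by
    linear_combination (5 / 24) * e1 - (1 / 8) * e1b
  have hZ1 : Z1 = F0 / 4 - G0 / 12 - 5 / 12 * J0 := by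
    linear_combination (5 / 24) * e1b - (1 / 8) * e1
  subst hY1 hZ1
  linear_combination 3 * e2 - 3 * e2b

/-- Raising the free coefficient `Y2` by 1 lowers `Z2` by 1, and the sum of the level 3 equations
changes by 2 (F0 - J0). -/
theorem sasaSatsuma_dispersion_three {B0 F0 F1 F2 G0 G1 G2 H0 J0 J2 K0 K1 L1 Y1 Y2 Y2' Y3 Y3' Z1
      Z2 Z2' Z3 Z3' : ℂ}
    (e1 : 2 * F0 + G0 + 15/2 * Y1 + 9/2 * Z1 = 0)
    (e1b : G0 + 2 * J0 + 9/2 * Y1 + 15/2 * Z1 = 0)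
    (e2 : 2 * F1 + G1 - K0 + 3 * Y2 + 3 * Z2 + 2 * G0 * Y1 + G0 * Z1 + 9/2 * Y1 * Z1 + 3/2 * Y1 ^
      2 = 0)
    (e2' : 2 * F1 + G1 - K0 + 3 * Y2' + 3 * Z2' + 2 * G0 * Y1 + G0 * Z1 + 9/2 * Y1 * Z1 + 3/2 *
      Y1 ^ 2 = 0)
    (e3 : 2 * F2 + G2 + H0 - K1 - 3/2 * Y3 + 3/2 * Z3 + 2 * G0 * Y2 + G0 * Z2 + 2 * G1 * Y1 + G1
      * Z1 - 3/2 * Y1 * Y2 + 3/2 * Y1 * Z2 + 2 * G0 * Y1 * Z1 + G0 * Y1 ^ 2 = 0)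
    (e3b : B0 + G2 + 2 * J2 - L1 + 3/2 * Y3 - 3/2 * Z3 + G0 * Y2 + 2 * G0 * Z2 + G1 * Y1 + 2 * G1
      * Z1 + 3/2 * Y2 * Z1 - 3/2 * Z1 * Z2 + 2 * G0 * Y1 * Z1 + G0 * Z1 ^ 2 = 0)
    (e3' : 2 * F2 + G2 + H0 - K1 - 3/2 * Y3' + 3/2 * Z3' + 2 * G0 * Y2' + G0 * Z2' + 2 * G1 * Y1
      + G1 * Z1 - 3/2 * Y1 * Y2' + 3/2 * Y1 * Z2' + 2 * G0 * Y1 * Z1 + G0 * Y1 ^ 2 = 0)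
    (e3b' : B0 + G2 + 2 * J2 - L1 + 3/2 * Y3' - 3/2 * Z3' + G0 * Y2' + 2 * G0 * Z2' + G1 * Y1 + 2
      * G1 * Z1 + 3/2 * Y2' * Z1 - 3/2 * Z1 * Z2' + 2 * G0 * Y1 * Z1 + G0 * Z1 ^ 2 = 0)
    (hY : Y2' = Y2 + 1) :
    F0 = J0 := by
  have hY1 : Y1 = -5 / 12 * F0 - G0 / 12 + J0 / 4 := by
    linear_combination (5 / 24) * e1 - (1 / 8) * e1b
  have hZ1 : Z1 = F0 / 4 - G0 / 12 - 5 / 12 * J0 := by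
    linear_combination (5 / 24) * e1b - (1 / 8) * e1
  subst hY1 hZ1
  subst hY
  have hZ2 : Z2' = Z2 - 1 := by linear_combination (1 / 3) * e2' - (1 / 3) * e2
  subst hZ2
  linear_combination (1 / 2) * (e3' + e3b' - e3 - e3b)

/-- Since Y1 = Z1, the sum of the level 3 equations depends on `Y2` and `Z2` only through Y2 + Z2,
which level 2 fixes. The result therefore contains no free coefficient. -/
theorem sasaSatsuma_constraint_three {B0 F0 F1 F2 G0 G1 G2 H0 K0 K1 Y1 Y2 Y3 Z1 Z2 Z3 : ℂ}
    (e1 : 2 * F0 + G0 + 15/2 * Y1 + 9/2 * Z1 = 0)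
    (e1b : 2 * F0 + G0 + 9/2 * Y1 + 15/2 * Z1 = 0)
    (e2 : 2 * F1 + G1 - K0 + 3 * Y2 + 3 * Z2 + 2 * G0 * Y1 + G0 * Z1 + 9/2 * Y1 * Z1 + 3/2 * Y1 ^
      2 = 0)
    (e3 : 2 * F2 + G2 + H0 - K1 - 3/2 * Y3 + 3/2 * Z3 + 2 * G0 * Y2 + G0 * Z2 + 2 * G1 * Y1 + G1
      * Z1 - 3/2 * Y1 * Y2 + 3/2 * Y1 * Z2 + 2 * G0 * Y1 * Z1 + G0 * Y1 ^ 2 = 0)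
    (e3b : B0 + 2 * F2 + G2 - K1 + 3/2 * Y3 - 3/2 * Z3 + G0 * Y2 + 2 * G0 * Z2 + G1 * Y1 + 2 * G1
      * Z1 + 3/2 * Y2 * Z1 - 3/2 * Z1 * Z2 + 2 * G0 * Y1 * Z1 + G0 * Z1 ^ 2 = 0) :
    -3/2 * B0 + -6 * F2 + -3 * G2 + -3/2 * H0 + 3/2 * K1 + 3/2 * K1 + 3/2 * F0 * G1 + 3 * F1 * G0
      + 9/4 * G0 * G1 + -3/2 * G0 * K0 + -3/4 * F0 * G0 ^ 2 + -3/8 * G0 ^ 3 = 0 := by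
  have hY1 : Y1 = -F0 / 6 - G0 / 12 := by
    linear_combination (5 / 24) * e1 - (1 / 8) * e1b
  have hZ1 : Z1 = -F0 / 6 - G0 / 12 := by
    linear_combination (5 / 24) * e1b - (1 / 8) * e1
  subst hY1 hZ1
  have hZ2 : Z2 = -2 / 3 * F1 - G1 / 3 + K0 / 3 - Y2 + F0 * G0 / 9 - F0 ^ 2 / 18
      + 5 / 72 * G0 ^ 2 := by
    linear_combination (1 / 3) * e2
  subst hZ2
  linear_combination (-3 / 2) * e3 - (3 / 2) * e3b

/-- At the double resonance one equation suffices: raising `Y3`, and with it `Z3`, by 1 changes it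
by 4 F0. -/
theorem sasaSatsuma_dispersion_four {DY1 F0 F2 F3 H0 H1 K0 K1 K2 Y1 Y2 Y3 Y3' Z1 Z2 Z3 Z3' : ℂ}
    (e1 : 2 * F0 + 15/2 * Y1 + 9/2 * Z1 = 0)
    (e1b : 2 * F0 + 9/2 * Y1 + 15/2 * Z1 = 0)
    (e3 : 2 * F2 + H0 - K1 - 3/2 * Y3 + 3/2 * Z3 - 3/2 * Y1 * Y2 + 3/2 * Y1 * Z2 = 0)
    (e3' : 2 * F2 + H0 - K1 - 3/2 * Y3' + 3/2 * Z3' - 3/2 * Y1 * Y2 + 3/2 * Y1 * Z2 = 0)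
    (e4 : DY1 + 2 * F3 + H1 - K2 + 2 * F0 * Y3 + H0 * Y1 + K0 * Y2 - 6 * Y1 * Y3 - 3/2 * Y1 * Z3
      - 3 * Y2 * Z2 - 3 * Y2 ^ 2 - 9/2 * Y3 * Z1 - 9/2 * Y1 * Y2 * Z1 - 3/2 * Y1 ^ 2 * Z2 = 0)
    (e4' : DY1 + 2 * F3 + H1 - K2 + 2 * F0 * Y3' + H0 * Y1 + K0 * Y2 - 6 * Y1 * Y3' - 3/2 * Y1 *
      Z3' - 3 * Y2 * Z2 - 3 * Y2 ^ 2 - 9/2 * Y3' * Z1 - 9/2 * Y1 * Y2 * Z1 - 3/2 * Y1 ^ 2 * Z2 =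
      0)
    (hY : Y3' = Y3 + 1) :
    F0 = 0 := by
  have hY1 : Y1 = -F0 / 6 := by linear_combination (5 / 24) * e1 - (1 / 8) * e1b
  have hZ1 : Z1 = -F0 / 6 := by linear_combination (5 / 24) * e1b - (1 / 8) * e1
  subst hY1 hZ1 hY
  have hZ3 : Z3' = Z3 + 1 := by linear_combination (2 / 3) * e3' - (2 / 3) * e3
  subst hZ3
  linear_combination (1 / 4) * (e4' - e4)

/-- To be combined with B1 = K2 from the conjugate equation: together with H1 + B1 = 4 K2 they force
K2 = 0 and H1 = B1. -/
theorem sasaSatsuma_constraint_four {DY1 H0 H1 K0 K1 K2 Y1 Y2 Y3 Z1 Z2 Z3 : ℂ}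
    (e1 : 15/2 * Y1 + 9/2 * Z1 = 0)
    (e1b : 9/2 * Y1 + 15/2 * Z1 = 0)
    (e2 : -K0 + 3 * Y2 + 3 * Z2 + 9/2 * Y1 * Z1 + 3/2 * Y1 ^ 2 = 0)
    (e3 : H0 - K1 - 3/2 * Y3 + 3/2 * Z3 - 3/2 * Y1 * Y2 + 3/2 * Y1 * Z2 = 0)
    (e4 : DY1 + H1 - K2 + H0 * Y1 + K0 * Y2 - 6 * Y1 * Y3 - 3/2 * Y1 * Z3 - 3 * Y2 * Z2 - 3 * Y2
      ^ 2 - 9/2 * Y3 * Z1 - 9/2 * Y1 * Y2 * Z1 - 3/2 * Y1 ^ 2 * Z2 = 0)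
    (hDY : DY1 = 0) :
    H1 = K2 := by
  have hY1 : Y1 = 0 := by linear_combination (5 / 24) * e1 - (1 / 8) * e1b
  have hZ1 : Z1 = 0 := by linear_combination (5 / 24) * e1b - (1 / 8) * e1
  subst hY1 hZ1
  have hZ2 : Z2 = K0 / 3 - Y2 := by linear_combination (1 / 3) * e2
  subst hZ2
  have hZ3 : Z3 = Y3 + 2 / 3 * (K1 - H0) := by linear_combination (2 / 3) * e3
  subst hZ3
  linear_combination e4 - hDY

theorem sasaSatsuma_constraint_four_conj {B0 B1 DZ1 H0 K0 K1 K2 Y1 Y2 Y3 Z1 Z2 Z3 : ℂ}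
    (e1 : 15/2 * Y1 + 9/2 * Z1 = 0)
    (e1b : 9/2 * Y1 + 15/2 * Z1 = 0)
    (e2 : -K0 + 3 * Y2 + 3 * Z2 + 9/2 * Y1 * Z1 + 3/2 * Y1 ^ 2 = 0)
    (e3 : H0 - K1 - 3/2 * Y3 + 3/2 * Z3 - 3/2 * Y1 * Y2 + 3/2 * Y1 * Z2 = 0)
    (e4 : B1 + DZ1 - K2 + B0 * Z1 + K0 * Z2 - 9/2 * Y1 * Z3 - 3 * Y2 * Z2 - 3/2 * Y3 * Z1 - 6 *
      Z1 * Z3 - 3 * Z2 ^ 2 - 9/2 * Y1 * Z1 * Z2 - 3/2 * Y2 * Z1 ^ 2 = 0)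
    (hDZ : DZ1 = 0) :
    B1 = K2 := by
  have hY1 : Y1 = 0 := by linear_combination (5 / 24) * e1 - (1 / 8) * e1b
  have hZ1 : Z1 = 0 := by linear_combination (5 / 24) * e1b - (1 / 8) * e1
  subst hY1 hZ1
  have hZ2 : Z2 = K0 / 3 - Y2 := by linear_combination (1 / 3) * e2
  subst hZ2
  have hZ3 : Z3 = Y3 + 2 / 3 * (K1 - H0) := by linear_combination (2 / 3) * e3
  subst hZ3
  linear_combination e4 - hDZ

end LevelAlgebra

end NLSCoeffs

/-! ### The equation over a differential ring and its expansion at the front -/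

namespace NLSCoeffs

section FormalExponential

variable {R : Type*} [CommRing R] [Algebra ℂ R]

/-- The coefficients of the solution of `e' = c e` with initial value `r`. -/
noncomputable def expCoeff (c : R⟦X⟧) (r : R) : ℕ → R
  | 0 => r
  | n + 1 => algebraMap ℂ R ((n + 1 : ℂ)⁻¹) *
      ∑ i : Fin (n + 1), PowerSeries.coeff (n - i) c * expCoeff c r i

/-- Comparing coefficients gives a recursion whose only division is by `n + 1`. -/
theorem exists_formal_exp (c : R⟦X⟧) (r : R) :
    ∃ e : R⟦X⟧, totalD 0 1 e = c * e ∧ PowerSeries.constantCoeff e = r := by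
  refine ⟨PowerSeries.mk (expCoeff c r), ?_, ?_⟩
  · ext n
    rw [coeff_totalD, PowerSeries.coeff_mk, PowerSeries.coeff_mk, mul_comm c, PowerSeries.coeff_mul,
      Finset.Nat.sum_antidiagonal_eq_sum_range_succ
        (fun i j => PowerSeries.coeff i (PowerSeries.mk (expCoeff c r)) * PowerSeries.coeff j c),
      expCoeff]
    have h : ((n : R) + 1) = algebraMap ℂ R ((n : ℂ) + 1) := by simp
    have h2 : (n : ℂ) + 1 ≠ 0 := by exact_mod_cast n.succ_ne_zero
    rw [h, ← mul_assoc, one_mul, ← map_mul, mul_inv_cancel₀ h2, map_one, one_mul,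
      Finset.sum_range]
    simp [mul_comm]
  · rw [← PowerSeries.coeff_zero_eq_constantCoeff_apply, PowerSeries.coeff_mk, expCoeff]

end FormalExponential

/-- The data of the equation in a differential ring: `f, g, h, k, l, m, n` are the coefficients of
the equation and `fb, gb, hb, kb` those of the conjugate equation. -/
structure EquationData (R : Type*) [CommRing R] [Algebra ℂ R] where
  dx : Derivation ℂ R R
  dt : Derivation ℂ R R
  comm : ∀ w, dx (dt w) = dt (dx w)
  i : ℂ
  i_sq : i * i = -1
  f : R
  g : R
  h : R
  k : R
  fb : R
  gb : R
  hb : R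
  kb : R
  l : R
  linv : R
  m : R
  n : R
  l_linv : l * linv = 1
  dx_l : dx l = 0
  dx_m : dx m = 0
  dx_n : dx n = 0

namespace EquationData

variable {R : Type*} [CommRing R] [Algebra ℂ R] (E : EquationData R)

/-- The data of the conjugate equation. -/
def conj : EquationData R where
  dx := E.dx
  dt := E.dt
  comm := E.comm
  i := -E.i
  i_sq := by rw [neg_mul_neg, E.i_sq]
  f := E.fb
  g := E.gb
  h := E.hb
  k := E.kb
  fb := E.f
  gb := E.g
  hb := E.h
  kb := E.k
  l := E.l
  linv := E.linv
  m := E.m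
  n := E.n
  l_linv := E.l_linv
  dx_l := E.dx_l
  dx_m := E.dx_m
  dx_n := E.dx_n

/-- The imaginary unit in `R`. -/
def I : R := algebraMap ℂ R E.i

theorem I_sq : E.I * E.I = -1 := by rw [I, ← map_mul, E.i_sq]; simp

/-- The coefficients of the equation. -/
def coeffs : EqnCoeffs R :=
  ⟨E.I, E.f, E.g, E.h, E.k, E.I * E.l, E.I * E.m, E.I * E.n⟩

/-- The left-hand side of the equation at `Φ^α U`, `Φ^β V`, where `Φ_x = κ` and `Φ_t = τ`. -/
noncomputable def series (κ τ : R) (α β : ℤ) (d : ℕ) (U V : R⟦X⟧) : R⟦X⟧ :=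
  eqnSeries (totalD E.dx κ) (totalD E.dt τ) PowerSeries.X α β d (E.coeffs.map PowerSeries.C) U V

/-- The coefficient of `u_xx` in the normalized equation. -/
def normF (a : R) : R := -E.I * E.linv * E.f + 3 * E.I * a

/-- The coefficient of `u² v` in the normalized equation. -/
def normG (a σ : R) : R := σ * E.linv * E.I * (a * E.m - E.g)

/-- The coefficient of `u_x` in the normalized equation. -/
def normK (a : R) : R :=
  -E.I * E.linv * E.k + 2 * a * E.linv * E.f + 3 * E.I * E.dx a - 3 * a ^ 2

/-- The coefficient of `u` in the normalized equation, up to a term that depends on the gauge. -/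
def normH (a : R) : R :=
  -E.I * E.linv * E.h + a * E.linv * E.k - E.I * E.linv * (E.I * E.dx a - a ^ 2) * E.f
    + E.I * E.dx (E.dx a) - 3 * a * E.dx a - E.I * a ^ 3

/-- Taylor expansion along `x` at the singularity manifold. -/
noncomputable def expand (κ : R) : R⟦X⟧ →+* R⟦X⟧ := taylor (totalD E.dx κ) PowerSeries.constantCoeff

/-- Taylor expansion along `x` of a coefficient. -/
noncomputable def expandC (κ : R) : R →+* R⟦X⟧ := (E.expand κ).comp PowerSeries.C

theorem expand_D (κ : R) (W : R⟦X⟧) :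
    E.expand κ (totalD E.dx κ W) = totalD 0 1 (E.expand κ W) := taylor_D _ _ _

theorem expandC_dx (κ w : R) : E.expandC κ (E.dx w) = totalD 0 1 (E.expandC κ w) := by
  rw [expandC, RingHom.comp_apply, RingHom.comp_apply, ← expand_D, totalD_C]

theorem expandC_eq_C (κ w : R) (h : E.dx w = 0) : E.expandC κ w = PowerSeries.C w := by
  rw [expandC, RingHom.comp_apply, expand, taylor_eq_C _ _ _ (by rw [totalD_C, h, map_zero])]
  simp

theorem constantCoeff_expand (κ : R) (W : R⟦X⟧) :
    PowerSeries.constantCoeff (E.expand κ W) = PowerSeries.constantCoeff W :=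
  constantCoeff_taylor _ _ _

theorem coeff_zero_expandC (κ w : R) : PowerSeries.coeff 0 (E.expandC κ w) = w := by
  rw [PowerSeries.coeff_zero_eq_constantCoeff_apply, expandC, RingHom.comp_apply,
    constantCoeff_expand]
  simp

theorem coeff_succ_expandC (κ w : R) (j : ℕ) :
    (j + 1) * PowerSeries.coeff (j + 1) (E.expandC κ w) =
      PowerSeries.coeff j (E.expandC κ (E.dx w)) := by
  rw [expandC_dx, coeff_totalD]
  simp

/-- The time derivation along the singularity manifold. -/
def slide (θ : R) : Derivation ℂ R R := E.dt - θ • E.dx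

theorem expand_T (κ τ θ : R) (hθ : θ * κ = τ) (hτ : E.dx τ = E.dt κ) (W : R⟦X⟧) :
    E.expand κ (totalD E.dt τ W) = totalD (E.slide θ) θ (E.expand κ W) := by
  refine taylor_T _ _ (fun w => ?_) _ _ _ (fun w => ?_) _
  · ext j
    simp only [coeff_totalD, map_add, Derivation.leibniz, E.comm, hτ, smul_eq_mul,
      Derivation.map_natCast, Derivation.map_one_eq_zero, mul_zero, add_zero]
    ring
  · simp only [← PowerSeries.coeff_zero_eq_constantCoeff_apply, coeff_totalD, slide,
      Derivation.sub_apply, Derivation.smul_apply, smul_eq_mul, ← hθ]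
    push_cast
    ring

theorem expandC_dt (κ τ θ : R) (hθ : θ * κ = τ) (hτ : E.dx τ = E.dt κ) (w : R) :
    E.expandC κ (E.dt w) = totalD (E.slide θ) θ (E.expandC κ w) := by
  rw [expandC, RingHom.comp_apply, RingHom.comp_apply, ← E.expand_T κ τ θ hθ hτ, totalD_C]

/-- On the front Φ vanishes and its x-derivative is `κ`, so Φ = κ s + …. -/
theorem exists_expand_X (κ : R) :
    ∃ η : R⟦X⟧, E.expand κ PowerSeries.X = PowerSeries.X * η ∧ PowerSeries.constantCoeff η = κ := by
  have h0 : PowerSeries.constantCoeff (E.expand κ PowerSeries.X) = 0 := by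
    rw [constantCoeff_expand]; simp
  obtain ⟨η, hη⟩ := PowerSeries.X_dvd_iff.2 h0
  refine ⟨η, hη, ?_⟩
  have h := congrArg PowerSeries.constantCoeff (E.expand_D κ PowerSeries.X)
  rw [totalD_X, constantCoeff_expand, hη, Derivation.leibniz, totalD_X] at h
  simpa using h.symm

theorem totalD_comm (δ : Derivation ℂ R R) (θ : R) (W : R⟦X⟧) :
    totalD (0 : Derivation ℂ R R) 1 (totalD δ θ W) = totalD δ θ (totalD 0 1 W) := by
  ext j
  simp only [coeff_totalD, map_add, Derivation.leibniz, smul_eq_mul, Derivation.map_natCast,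
    Derivation.map_one_eq_zero, mul_zero, add_zero, Derivation.zero_apply]
  push_cast
  simp
  ring

/-- The moving origin adds `lam θ` times an s-derivative to the time derivative. Absorbed into `K`,
it makes the front speed visible as a constant in the coefficient of `u_x`. -/
theorem eqnSeries_eq_normalSeries (δ : Derivation ℂ R R) (θ lam μ ν : R) (F G H K y z : R⟦X⟧) :
    eqnSeries (totalD 0 1) (totalD δ θ) PowerSeries.X (-1) (-1) 0
      ⟨PowerSeries.C lam, F, G, H, K, 1, PowerSeries.C μ, PowerSeries.C ν⟩ y z =
    normalSeries (lam • δ) μ ν F G H (K + PowerSeries.C (lam * θ)) y z := by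
  have h : PowerSeries.C lam * shiftD (totalD δ θ) PowerSeries.X (-1) y =
      shiftD (totalD (lam • δ) 0) PowerSeries.X (-1) y +
        PowerSeries.C (lam * θ) * shiftD (totalD 0 1) PowerSeries.X (-1) y := by
    ext j
    simp only [coeff_shiftD, PowerSeries.coeff_C_mul, map_add]
    split_ifs
    · simp; ring
    · simp; ring
  simp only [normalSeries, normalCoeffs, eqnSeries]
  linear_combination PowerSeries.X ^ (0 + 2) * h

end EquationData

end NLSCoeffs

/-! ### Reduction to the normalized equations -/

namespace NLSCoeffs

namespace EquationData

variable {R : Type*} [CommRing R] [Algebra ℂ R] (E : EquationData R)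

theorem dx_I : E.dx E.I = 0 := E.dx.map_algebraMap _

theorem dt_I : E.dt E.I = 0 := E.dt.map_algebraMap _

theorem conj_I : E.conj.I = -E.I := by simp [I, conj]

/-- Pulling out `i l` normalizes the dispersion to 1. The identities use only i² = -1, the inverse
of `l`, and that `l`, `m`, `n`, `σ` do not depend on x. -/
theorem gauge_coeffs (κ a σ : R) (hσ : E.dx σ = 0) (b : R⟦X⟧) :
    ((E.coeffs.map PowerSeries.C).map (E.expand κ)).gauge (totalD 0 1) (E.expandC κ (E.I * a)) b
        (PowerSeries.C σ) =
      EqnCoeffs.scale (PowerSeries.C (E.I * E.l))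
        ⟨PowerSeries.C E.linv, E.expandC κ (E.normF a), E.expandC κ (E.normG a σ),
          E.expandC κ (E.normH a) + PowerSeries.C E.linv * b, E.expandC κ (E.normK a), 1,
          PowerSeries.C (σ * E.m * E.linv), PowerSeries.C (σ * E.n * E.linv)⟩ := by
  have hI : E.dx (E.I * E.l) = 0 := by simp [E.dx_I, E.dx_l]
  have hm : E.dx (E.I * E.m) = 0 := by simp [E.dx_I, E.dx_m]
  have hn : E.dx (E.I * E.n) = 0 := by simp [E.dx_I, E.dx_n]
  have hII : E.dx E.I = 0 := E.dx_I
  have e1 : ∀ w, E.expand κ (PowerSeries.C w) = E.expandC κ w := fun w => rfl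
  have hs := E.I_sq
  have hl := E.l_linv
  have hda : E.dx (E.I * a) = E.I * E.dx a := by simp [E.dx_I]
  have hdda : E.dx (E.I * E.dx a) = E.I * E.dx (E.dx a) := by simp [E.dx_I]
  have hCl : PowerSeries.C (E.I * E.l) = E.expandC κ (E.I * E.l) := (E.expandC_eq_C κ _ hI).symm
  have hCσ : PowerSeries.C σ = E.expandC κ σ := (E.expandC_eq_C κ _ hσ).symm
  have h3 : (3 : R⟦X⟧) = E.expandC κ 3 := (map_ofNat (E.expandC κ) 3).symm
  have h2 : (2 : R⟦X⟧) = E.expandC κ 2 := (map_ofNat (E.expandC κ) 2).symm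
  apply EqnCoeffs.ext <;>
    simp only [EqnCoeffs.gauge, EqnCoeffs.map, EqnCoeffs.scale, coeffs, e1, ← E.expandC_dx, hda,
      hdda, mul_one]
  · rw [E.expandC_eq_C κ _ hII, ← map_mul]
    congr 1
    linear_combination (-E.I) * hl
  · simp only [hCl, h3, ← map_mul, ← map_add]
    congr 1
    simp only [normF]
    linear_combination (E.f * E.l * E.linv) * hs - E.f * hl
  · simp only [hCl, hCσ, ← map_mul, ← map_add]
    congr 1
    simp only [normG]
    linear_combination (-σ * (a * E.m - E.g) * E.l * E.linv) * hs + σ * (a * E.m - E.g) * hl + (σ *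
        a * E.m) * hs
  · rw [mul_add, ← mul_assoc, ← map_mul PowerSeries.C,
      show E.I * E.l * E.linv = E.I by rw [mul_assoc, hl, mul_one], E.expandC_eq_C κ _ hII]
    congr 1
    simp only [hCl, h3, ← map_mul, ← map_add, ← map_pow]
    congr 1
    simp only [normH]
    linear_combination (E.l * E.linv * E.h + a ^ 2 * E.f + E.l * E.linv * (E.I * E.dx a - a ^ 2) *
        E.f
      + 3 * a * E.dx a * E.I * E.l + a ^ 3 * E.I ^ 2 * E.l) * hs
      - (E.h + E.I * a * E.k + (E.I * E.dx a - a ^ 2) * E.f) * hl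
  · simp only [hCl, h3, h2, ← map_mul, ← map_add, ← map_pow]
    congr 1
    simp only [normK]
    linear_combination (E.l * E.linv * E.k + 3 * a ^ 2 * E.I * E.l) * hs - (E.k + 2 * E.I * a * E.f)
        * hl
  · rw [hCl]
  · rw [E.expandC_eq_C κ _ hm, ← map_mul, ← map_mul]
    congr 1
    linear_combination (-σ * E.I * E.m) * hl
  · rw [E.expandC_eq_C κ _ hn, ← map_mul, ← map_mul]
    congr 1
    linear_combination (-σ * E.I * E.n) * hl

/-- The equation in the normalized unknowns. -/
theorem expand_series (κ τ θ a σ : R) (hθ : θ * κ = τ) (hτ : E.dx τ = E.dt κ)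
    (hσ : E.dx σ = 0) (η e e' b y z U V : R⟦X⟧) (hη : E.expand κ PowerSeries.X = PowerSeries.X * η)
    (he : e * e' = PowerSeries.C σ) (hDe : totalD 0 1 e = E.expandC κ (E.I * a) * e)
    (hTe : totalD (E.slide θ) θ e = b * e) (hU : E.expand κ U = η * (e * y))
    (hV : E.expand κ V = η * (e' * z)) :
    E.expand κ (E.series κ τ (-1) (-1) 0 U V) =
      η ^ 4 * e * PowerSeries.C (E.I * E.l) *
        normalSeries (E.linv • E.slide θ) (σ * E.m * E.linv) (σ * E.n * E.linv)
          (E.expandC κ (E.normF a)) (E.expandC κ (E.normG a σ))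
          (E.expandC κ (E.normH a) + PowerSeries.C E.linv * b)
          (E.expandC κ (E.normK a) + PowerSeries.C (E.linv * θ)) y z := by
  rw [series, map_eqnSeries (E.expand κ) (totalD E.dx κ) (totalD E.dt τ) (totalD 0 1)
    (totalD (E.slide θ) θ) (E.expand_D κ) (E.expand_T κ τ θ hθ hτ) _ _ _ hη _ _ _ _ _ hU hV,
    eqnSeries_gauge _ _ _ (by simp) _ e e' (E.expandC κ (E.I * a)) b (PowerSeries.C σ) y z he hDe
        hTe
      (by rw [totalD_C]; simp), E.gauge_coeffs κ a σ hσ b, eqnSeries_scale,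
    eqnSeries_eq_normalSeries]
  ring

/-- The reduction of both equations to normalized ones by a change of the expansion variable and
of the unknowns. -/
theorem exists_normalForm (κ κi τ a σ σi u₀ ui v₀ vi : R) (hκ : κ * κi = 1) (hτ : E.dx τ = E.dt κ)
    (hσ : E.dx σ = 0) (hσi : σ * σi = 1) (hu : u₀ * ui = 1) (hv : v₀ * vi = 1)
    (huv : u₀ * v₀ = σ * κ ^ 2) :
    ∃ b ρ₁ ρ₂ ω₁ ω₂ : R⟦X⟧,
      (∀ j : ℕ, (j + 1) * PowerSeries.coeff (j + 1) b =
        PowerSeries.coeff j (E.expandC κ (E.I * E.dt a))) ∧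
      PowerSeries.constantCoeff ρ₁ = ui ∧ PowerSeries.constantCoeff ρ₂ = vi ∧
      PowerSeries.constantCoeff ω₁ = κ ^ 3 * u₀ * (E.I * E.l) ∧
      PowerSeries.constantCoeff ω₂ = -(κ ^ 3 * v₀ * (E.I * E.l)) ∧
      ∀ U V : R⟦X⟧,
        E.expand κ (E.series κ τ (-1) (-1) 0 U V) = ω₁ *
          normalSeries (E.linv • E.slide (τ * κi)) (σ * E.m * E.linv) (σ * E.n * E.linv)
            (E.expandC κ (E.normF a)) (E.expandC κ (E.normG a σ))
            (E.expandC κ (E.normH a) + PowerSeries.C E.linv * b)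
            (E.expandC κ (E.normK a) + PowerSeries.C (E.linv * (τ * κi)))
            (ρ₁ * E.expand κ U) (ρ₂ * E.expand κ V) ∧
        E.expand κ (E.conj.series κ τ (-1) (-1) 0 V U) = ω₂ *
          normalSeries (E.linv • E.slide (τ * κi)) (σ * E.m * E.linv) (σ * E.n * E.linv)
            (E.expandC κ (E.conj.normF a)) (E.expandC κ (E.conj.normG a σ))
            (E.expandC κ (E.conj.normH a) +
              PowerSeries.C E.linv * (PowerSeries.C (E.dt σ * σi) - b))
            (E.expandC κ (E.conj.normK a) + PowerSeries.C (E.linv * (τ * κi)))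
            (ρ₂ * E.expand κ V) (ρ₁ * E.expand κ U) := by
  set θ := τ * κi with hθdef
  have hθ : θ * κ = τ := by rw [hθdef, mul_assoc, mul_comm κi, hκ, mul_one]
  obtain ⟨η, hη, hη0⟩ := E.exists_expand_X κ
  -- Since u₀/Φ = (u₀/κ)/s + …, the initial value u₀/κ makes the leading coefficient of `y` equal to
  -- 1.
  obtain ⟨e, hDe, he0⟩ := exists_formal_exp (E.expandC κ (E.I * a)) (u₀ * κi)
  have unit_inv : ∀ (w : R⟦X⟧) (r s : R), PowerSeries.constantCoeff w = r → r * s = 1 →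
      ∃ w' : R⟦X⟧, w * w' = 1 ∧ PowerSeries.constantCoeff w' = s := by
    intro w r s hw hrs
    obtain ⟨w', hw'⟩ := (PowerSeries.isUnit_iff_constantCoeff.2
      (by rw [hw]; exact IsUnit.of_mul_eq_one s hrs) : IsUnit w).exists_right_inv
    refine ⟨w', hw', ?_⟩
    have h := congrArg PowerSeries.constantCoeff hw'
    rw [map_mul, hw, map_one] at h
    linear_combination (-PowerSeries.constantCoeff w') * hrs + s * h
  obtain ⟨ηi, hηi, hηi0⟩ := unit_inv η κ κi hη0 hκ
  obtain ⟨ei, hei, hei0⟩ := unit_inv e (u₀ * κi) (ui * κ) he0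
    (by linear_combination (κ * κi) * hu + hκ)
  have hDei : totalD 0 1 ei = -E.expandC κ (E.I * a) * ei := by
    have h := congrArg (totalD (0 : Derivation ℂ R R) 1) hei
    rw [Derivation.leibniz, Derivation.map_one_eq_zero, hDe] at h
    simp only [smul_eq_mul] at h
    linear_combination ei * h - (totalD 0 1 ei + E.expandC κ (E.I * a) * ei) * hei
  obtain ⟨b, hb⟩ : ∃ b, b = ei * totalD (E.slide θ) θ e := ⟨_, rfl⟩
  have hTe : totalD (E.slide θ) θ e = b * e := by
    linear_combination (-totalD (E.slide θ) θ e) * hei - e * hb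
  have hTei : totalD (E.slide θ) θ ei = -b * ei := by
    have h := congrArg (totalD (E.slide θ) θ) hei
    rw [Derivation.leibniz, Derivation.map_one_eq_zero, hTe] at h
    simp only [smul_eq_mul] at h
    linear_combination ei * h - (totalD (E.slide θ) θ ei + b * ei) * hei
  -- Commuting d/ds and the time derivation on `e` gives b_s = i a_t. So `b` is known up to its
  -- constant term, which remains dependent on the gauge.
  have hDb : totalD 0 1 b = E.expandC κ (E.I * E.dt a) := by
    have h1 := totalD_comm (E.slide θ) θ e
    rw [hTe, hDe, Derivation.leibniz, Derivation.leibniz, hTe, hDe,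
      ← E.expandC_dt κ τ θ hθ hτ] at h1
    have h2 : E.dt (E.I * a) = E.I * E.dt a := by simp [E.dt_I]
    rw [h2] at h1
    simp only [smul_eq_mul] at h1
    linear_combination ei * h1 - (totalD 0 1 b - E.expandC κ (E.I * E.dt a)) * hei
  have hTσ : totalD (E.slide θ) θ (PowerSeries.C σ) =
      PowerSeries.C (E.dt σ * σi) * PowerSeries.C σ := by
    rw [totalD_C, ← map_mul, slide, Derivation.sub_apply, Derivation.smul_apply, hσ, smul_zero,
      sub_zero]
    congr 1
    linear_combination (-E.dt σ) * hσi
  have hDσ : totalD (0 : Derivation ℂ R R) 1 (PowerSeries.C σ) = 0 := by rw [totalD_C]; simp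
  have hσC : PowerSeries.C σ * PowerSeries.C σi = 1 := by rw [← map_mul, hσi, map_one]
  refine ⟨b, ei * ηi, e * PowerSeries.C σi * ηi, η ^ 4 * e * PowerSeries.C (E.I * E.l),
    η ^ 4 * (ei * PowerSeries.C σ) * PowerSeries.C (E.conj.I * E.l), ?_, ?_, ?_, ?_, ?_, ?_⟩
  · intro j
    rw [← hDb, coeff_totalD]
    simp
  · rw [map_mul, hei0, hηi0]
    linear_combination ui * hκ
  · simp only [map_mul, he0, hηi0, PowerSeries.constantCoeff_C]
    have h1 : u₀ * κi ^ 2 * σi = vi := by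
      linear_combination (-u₀ * κi ^ 2 * σi) * hv + vi * κi ^ 2 * σi * huv
        + vi * κi ^ 2 * κ ^ 2 * hσi + vi * (κ * κi + 1) * hκ
    linear_combination h1
  · simp only [map_mul, map_pow, he0, hη0, PowerSeries.constantCoeff_C]
    linear_combination (κ ^ 3 * u₀ * E.I * E.l) * hκ
  · simp only [map_mul, map_pow, hei0, hη0, PowerSeries.constantCoeff_C, conj_I]
    linear_combination (κ ^ 3 * ui * E.I * E.l) * huv - (κ ^ 3 * v₀ * E.I * E.l) * hu
  · intro U V
    have hU : E.expand κ U = η * (e * (ei * ηi * E.expand κ U)) := by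
      linear_combination (-E.expand κ U) * hηi - (η * ηi * E.expand κ U) * hei
    have hV : E.expand κ V =
        η * (ei * PowerSeries.C σ * (e * PowerSeries.C σi * ηi * E.expand κ V)) := by
      linear_combination (-E.expand κ V) * hηi - (η * ηi * E.expand κ V) * hei
        - (η * ηi * E.expand κ V * (e * ei)) * hσC
    refine ⟨E.expand_series κ τ θ a σ hθ hτ hσ η e (ei * PowerSeries.C σ) b _ _ U V hη
      (by linear_combination PowerSeries.C σ * hei) hDe hTe hU hV, ?_⟩
    have hc : E.conj.expandC κ (E.conj.I * a) = -E.expandC κ (E.I * a) := by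
      rw [conj_I, neg_mul, map_neg]; rfl
    -- The conjugate equation has -i in place of i, so its gauge factor is σ e⁻¹, with logarithmic
    -- derivatives -i a in s and σ_t/σ - b in time.
    have key := E.conj.expand_series κ τ θ a σ hθ hτ hσ η (ei * PowerSeries.C σ) e
      (PowerSeries.C (E.dt σ * σi) - b) _ _ V U hη (by linear_combination PowerSeries.C σ * hei)
      (by
        rw [Derivation.leibniz, hDσ, hDei, hc]
        simp only [smul_eq_mul]
        ring)
      (by
        change totalD (E.slide θ) θ _ = _
        rw [Derivation.leibniz, hTσ, hTei]
        simp only [smul_eq_mul]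
        ring) hV hU
    exact key

end EquationData

end NLSCoeffs

/-! ### Dependence of a level on its newest coefficients -/

namespace NLSCoeffs

section Perturbation

variable {R : Type*} [CommRing R]

/-- `Perturbs j W W' δ`: the power series `W'` has the same coefficients as `W` below the `j`-th,
and its `j`-th coefficient is larger by `δ`. -/
def Perturbs (j : ℕ) (W W' : R⟦X⟧) (δ : R) : Prop :=
  ∃ S : R⟦X⟧, W' = W + PowerSeries.X ^ j * S ∧ PowerSeries.constantCoeff S = δ

namespace Perturbs

variable {j : ℕ} {W W' V V' : R⟦X⟧} {δ ε : R}

theorem coeff_lt (h : Perturbs j W W' δ) {i : ℕ} (hi : i < j) :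
    PowerSeries.coeff i W' = PowerSeries.coeff i W := by
  obtain ⟨S, rfl, -⟩ := h
  rw [map_add, PowerSeries.coeff_X_pow_mul', if_neg (by omega), add_zero]

theorem coeff_self (h : Perturbs j W W' δ) :
    PowerSeries.coeff j W' = PowerSeries.coeff j W + δ := by
  obtain ⟨S, rfl, rfl⟩ := h
  rw [map_add, PowerSeries.coeff_X_pow_mul', if_pos le_rfl, Nat.sub_self,
    PowerSeries.coeff_zero_eq_constantCoeff_apply]

theorem of_coeff (h : ∀ i < j, PowerSeries.coeff i W' = PowerSeries.coeff i W)
    (h' : PowerSeries.coeff j W' = PowerSeries.coeff j W + δ) : Perturbs j W W' δ := by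
  obtain ⟨S, hS⟩ := PowerSeries.X_pow_dvd_iff.2
    (fun i hi => by rw [map_sub, h i hi, sub_self] : ∀ i < j, PowerSeries.coeff i (W' - W) = 0)
  refine ⟨S, by rw [← hS]; ring, ?_⟩
  have h2 := congrArg (PowerSeries.coeff j) hS
  rw [map_sub, h', PowerSeries.coeff_X_pow_mul', if_pos le_rfl, Nat.sub_self,
    PowerSeries.coeff_zero_eq_constantCoeff_apply] at h2
  rw [← h2]
  ring

theorem monomial (W : R⟦X⟧) (j : ℕ) (δ : R) :
    Perturbs j W (W + PowerSeries.X ^ j * PowerSeries.C δ) δ := ⟨_, rfl, by simp⟩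

theorem add (h : Perturbs j W W' δ) (h' : Perturbs j V V' ε) :
    Perturbs j (W + V) (W' + V') (δ + ε) := by
  obtain ⟨S, rfl, rfl⟩ := h
  obtain ⟨T, rfl, rfl⟩ := h'
  exact ⟨S + T, by ring, by simp⟩

/-- The product of the two increments has order 2j, which is invisible at order j because j ≠ 0. -/
theorem mul (hj : j ≠ 0) (h : Perturbs j W W' δ) (h' : Perturbs j V V' ε) :
    Perturbs j (W * V) (W' * V')
      (δ * PowerSeries.constantCoeff V + PowerSeries.constantCoeff W * ε) := by
  obtain ⟨S, rfl, rfl⟩ := h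
  obtain ⟨T, rfl, rfl⟩ := h'
  exact ⟨S * V + W * T + PowerSeries.X ^ j * S * T, by ring, by simp [hj]⟩

theorem const_mul (a : R) (h : Perturbs j W W' δ) :
    Perturbs j (PowerSeries.C a * W) (PowerSeries.C a * W') (a * δ) := by
  obtain ⟨S, rfl, rfl⟩ := h
  exact ⟨PowerSeries.C a * S, by ring, by simp⟩

theorem X_pow_mul {d : ℕ} (hd : d ≠ 0) (h : Perturbs j W W' δ) :
    Perturbs j (PowerSeries.X ^ d * W) (PowerSeries.X ^ d * W') 0 := by
  obtain ⟨S, rfl, rfl⟩ := h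
  exact ⟨PowerSeries.X ^ d * S, by ring, by simp [hd]⟩

theorem shiftD [Algebra ℂ R] (d : Derivation ℂ R R) (κ : R) (a : ℤ) (h : Perturbs j W W' δ) :
    Perturbs j (shiftD (totalD d κ) PowerSeries.X a W) (NLSCoeffs.shiftD (totalD d κ) PowerSeries.X
        a W')
      (κ * (a + j) * δ) := by
  refine of_coeff (fun i hi => ?_) ?_
  · rw [coeff_shiftD, coeff_shiftD, h.coeff_lt hi]
    split_ifs
    · rfl
    · rw [h.coeff_lt (by omega)]
  · rw [coeff_shiftD, coeff_shiftD, h.coeff_self]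
    split_ifs
    · ring
    · rw [h.coeff_lt (by omega)]
      ring

end Perturbs

end Perturbation

namespace EquationData

variable {R : Type*} [CommRing R] [Algebra ℂ R] (E : EquationData R)

/-- The coefficient of the `j`-th coefficient of `U` in the `j`-th level of the equation. -/
def levelDiag (κ : R) (α β : ℤ) (d j : ℕ) (u v : R) : R :=
  E.I * (E.l * (if d = 0 then κ ^ 3 * ((α + j) * (α - 1 + j) * (α - 2 + j)) else 0)
    + κ * u * v * (2 * E.m * (2 * α + β + j) + E.n * (2 * (α + β) + j)))

/-- The coefficient of the `j`-th coefficient of `V` in the `j`-th level of the equation. -/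
def levelOff (κ : R) (α β : ℤ) (j : ℕ) (u : R) : R :=
  E.I * (κ * u ^ 2 * (E.m * (2 * α + β + j) + E.n * (α + β + j)))

/-- Every term with a positive power of `X` in front ignores the increment. What remains is the two
differentiated cubic terms and, exactly when `d = 0`, the dispersion. -/
theorem perturbs_series (κ τ : R) (α β : ℤ) (d j : ℕ) (hj : j ≠ 0) {U U' V V' : R⟦X⟧} {A B : R}
    (hU : Perturbs j U U' A) (hV : Perturbs j V V' B) :
    Perturbs j (E.series κ τ α β d U V) (E.series κ τ α β d U' V')
      (E.levelDiag κ α β d j (PowerSeries.constantCoeff U) (PowerSeries.constantCoeff V) * A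
        + E.levelOff κ α β j (PowerSeries.constantCoeff U) * B) := by
  have h1 := hU.shiftD E.dx κ α
  have h2 := h1.shiftD E.dx κ (α - 1)
  have h3 := h2.shiftD E.dx κ (α - 2)
  have hc := (hU.mul hj hU).mul hj hV
  rw [← pow_two, ← pow_two] at hc
  have t3 := (hc.X_pow_mul one_ne_zero).const_mul E.g
  rw [pow_one] at t3
  have t6 : Perturbs j
      (PowerSeries.C (E.I * E.l) * (PowerSeries.X ^ d * NLSCoeffs.shiftD (totalD E.dx κ)
        PowerSeries.X (α - 2) (NLSCoeffs.shiftD (totalD E.dx κ) PowerSeries.X (α - 1)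
          (NLSCoeffs.shiftD (totalD E.dx κ) PowerSeries.X α U))))
      (PowerSeries.C (E.I * E.l) * (PowerSeries.X ^ d * NLSCoeffs.shiftD (totalD E.dx κ)
        PowerSeries.X (α - 2) (NLSCoeffs.shiftD (totalD E.dx κ) PowerSeries.X (α - 1)
          (NLSCoeffs.shiftD (totalD E.dx κ) PowerSeries.X α U'))))
      (if d = 0 then E.I * E.l * (κ * (((α - 2 : ℤ) : R) + j) * (κ * (((α - 1 : ℤ) : R) + j) *
        (κ * ((α : R) + j) * A))) else 0) := by
    by_cases hd : d = 0
    · subst hd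
      rw [if_pos rfl]
      simpa using h3.const_mul (E.I * E.l)
    · rw [if_neg hd]
      simpa using (h3.X_pow_mul hd).const_mul (E.I * E.l)
  have := (((((((((hU.shiftD E.dt τ α).X_pow_mul (d := d + 2) (by omega)).const_mul E.I).add
    ((h2.X_pow_mul (d := d + 1) (by omega)).const_mul E.f)).add t3).add
    ((hU.X_pow_mul (d := d + 3) (by omega)).const_mul E.h)).add
    ((h1.X_pow_mul (d := d + 2) (by omega)).const_mul E.k)).add t6).add
    ((hc.shiftD E.dx κ (2 * α + β)).const_mul (E.I * E.m))).add
    ((hU.mul hj ((hU.mul hj hV).shiftD E.dx κ (α + β))).const_mul (E.I * E.n))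
  convert this using 1
  · rfl
  · rfl
  have hz : PowerSeries.constantCoeff (NLSCoeffs.shiftD (totalD E.dx κ) PowerSeries.X (α + β) (U *
      V)) =
      κ * (α + β) * (PowerSeries.constantCoeff U * PowerSeries.constantCoeff V) := by
    have := coeff_shiftD_zero E.dx κ (α + β) (U * V)
    simp only [PowerSeries.coeff_zero_eq_constantCoeff, map_mul] at this
    rw [this]
    push_cast
    ring
  rw [hz]
  simp only [levelDiag, levelOff, map_pow]
  split_ifs <;> (push_cast; ring)

theorem coeff_zero_series (κ τ : R) (α β : ℤ) (d : ℕ) (U V : R⟦X⟧) :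
    PowerSeries.coeff 0 (E.series κ τ α β d U V) =
      E.I * PowerSeries.coeff 0 U *
        (E.l * (if d = 0 then κ ^ 3 * (α * (α - 1) * (α - 2)) else 0)
          + κ * PowerSeries.coeff 0 U * PowerSeries.coeff 0 V *
            (E.m * (2 * α + β) + E.n * (α + β))) := by
  rcases d with _ | d <;>
  simp [series, eqnSeries, coeffs, EqnCoeffs.map, coeff_shiftD,
    -PowerSeries.coeff_zero_eq_constantCoeff, PowerSeries.coeff_mul, pow_succ]
    <;> ring

end EquationData

end NLSCoeffs

/-! ### The normalization as a package of properties -/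

namespace NLSCoeffs

namespace EquationData

variable {R : Type*} [CommRing R] [Algebra ℂ R] (E : EquationData R)

/-- The sum of the coefficients of `u` and `v` in the two normalized equations. -/
def sumH (a σ σi : R) : R := E.normH a + E.conj.normH a + E.linv * (E.dt σ * σi)

/-- The `x`-derivative of the difference of the coefficients of `u` and `v` in the two normalized
equations. -/
def diffH (a : R) : R := E.dx (E.normH a - E.conj.normH a) + 2 * (E.linv * (E.I * E.dt a))

theorem dx_linv : E.dx E.linv = 0 := by
  have h := congrArg E.dx E.l_linv
  rw [Derivation.leibniz, Derivation.map_one_eq_zero, E.dx_l] at h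
  simp only [smul_eq_mul, mul_zero, add_zero] at h
  linear_combination E.linv * h - E.dx E.linv * E.l_linv

/-- A reduction of the two equations with leading orders `-1` and leading coefficients `u₀`, `v₀` to
normalized equations. -/
structure Normalization (κ τ θ a σ σi u₀ ui v₀ vi : R) where
  H : R⟦X⟧
  B : R⟦X⟧
  Y : R⟦X⟧ → R⟦X⟧
  Z : R⟦X⟧ → R⟦X⟧
  sum_eq : H + B = E.expandC κ (E.sumH a σ σi)
  diff_one : PowerSeries.coeff 1 H - PowerSeries.coeff 1 B = E.diffH a
  isUnit_κ : IsUnit κ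
  u₀_mul_ui : u₀ * ui = 1
  v₀_mul_vi : v₀ * vi = 1
  diff_two : 2 * (PowerSeries.coeff 2 H - PowerSeries.coeff 2 B) = E.dx (E.diffH a)
  constantCoeff_Y : ∀ U, PowerSeries.constantCoeff U = u₀ → PowerSeries.constantCoeff (Y U) = 1
  constantCoeff_Z : ∀ V, PowerSeries.constantCoeff V = v₀ → PowerSeries.constantCoeff (Z V) = 1
  perturbs_Y : ∀ (j : ℕ) (U U' : R⟦X⟧) (A : R), Perturbs j U U' A →
    Perturbs j (Y U) (Y U') (ui * κ ^ j * A)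
  perturbs_Z : ∀ (j : ℕ) (V V' : R⟦X⟧) (A : R), Perturbs j V V' A →
    Perturbs j (Z V) (Z V') (vi * κ ^ j * A)
  level : ∀ (j : ℕ) (U V : R⟦X⟧),
    (∀ i < j, PowerSeries.coeff i (E.series κ τ (-1) (-1) 0 U V) = 0) →
      κ ^ j * PowerSeries.coeff j (E.series κ τ (-1) (-1) 0 U V) = κ ^ 3 * u₀ * (E.I * E.l) *
        PowerSeries.coeff j (normalSeries (E.linv • E.slide θ) (σ * E.m * E.linv)
          (σ * E.n * E.linv) (E.expandC κ (E.normF a)) (E.expandC κ (E.normG a σ)) H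
          (E.expandC κ (E.normK a) + PowerSeries.C (E.linv * θ)) (Y U) (Z V))
  level_conj : ∀ (j : ℕ) (U V : R⟦X⟧),
    (∀ i < j, PowerSeries.coeff i (E.conj.series κ τ (-1) (-1) 0 V U) = 0) →
      κ ^ j * PowerSeries.coeff j (E.conj.series κ τ (-1) (-1) 0 V U) =
        -(κ ^ 3 * v₀ * (E.I * E.l)) *
        PowerSeries.coeff j (normalSeries (E.linv • E.slide θ) (σ * E.m * E.linv)
          (σ * E.n * E.linv) (E.expandC κ (E.conj.normF a)) (E.expandC κ (E.conj.normG a σ)) B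
          (E.expandC κ (E.conj.normK a) + PowerSeries.C (E.linv * θ)) (Z V) (Y U))

/-- If `P` starts at order `j`, then X^j S becomes (X η)^j times the expansion of `S`, and η has
constant term `κ`. So the first nonvanishing coefficient is only multiplied by units, which is what
lets level equations be transferred one at a time. -/
theorem coeff_of_expand (κ : R) {P ω N : R⟦X⟧} {w wi : R} (hw : w * wi = 1)
    (hω : PowerSeries.constantCoeff ω = w) (h : E.expand κ P = ω * N) (j : ℕ)
    (hP : ∀ i < j, PowerSeries.coeff i P = 0) :
    κ ^ j * PowerSeries.coeff j P = w * PowerSeries.coeff j N := by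
  obtain ⟨S, rfl⟩ := PowerSeries.X_pow_dvd_iff.2 hP
  obtain ⟨η, hη, hη0⟩ := E.exists_expand_X κ
  obtain ⟨ω', hω'⟩ := (PowerSeries.isUnit_iff_constantCoeff.2
    (by rw [hω]; exact IsUnit.of_mul_eq_one wi hw) : IsUnit ω).exists_right_inv
  rw [map_mul, map_pow, hη] at h
  have hN : N = PowerSeries.X ^ j * (ω' * (η ^ j * E.expand κ S)) := by
    linear_combination (-N) * hω' - ω' * h
  have h1 : w * PowerSeries.constantCoeff ω' = 1 := by rw [← hω, ← map_mul, hω', map_one]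
  rw [hN, PowerSeries.coeff_X_pow_mul', PowerSeries.coeff_X_pow_mul', if_pos le_rfl, if_pos le_rfl,
    Nat.sub_self, PowerSeries.coeff_zero_eq_constantCoeff_apply,
    PowerSeries.coeff_zero_eq_constantCoeff_apply, map_mul, map_mul, map_pow, hη0,
    E.constantCoeff_expand]
  linear_combination (-(κ ^ j * PowerSeries.constantCoeff S)) * h1

/-- The gauge series `b` cancels in H + B up to σ_t/σ, and in the positive coefficients of H - B it
enters only through b_s = i a_t. Hence the recorded sums and differences involve the original
coefficients alone. -/
theorem exists_normalization (κ κi τ a σ σi u₀ ui v₀ vi : R) (hκ : κ * κi = 1)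
    (hτ : E.dx τ = E.dt κ) (hσ : E.dx σ = 0) (hσi : σ * σi = 1) (hu : u₀ * ui = 1)
    (hv : v₀ * vi = 1) (huv : u₀ * v₀ = σ * κ ^ 2) :
    Nonempty (E.Normalization κ τ (τ * κi) a σ σi u₀ ui v₀ vi) := by
  obtain ⟨b, ρ₁, ρ₂, ω₁, ω₂, hb, hρ₁, hρ₂, hω₁, hω₂, h⟩ :=
    E.exists_normalForm κ κi τ a σ σi u₀ ui v₀ vi hκ hτ hσ hσi hu hv huv
  have hli := E.dx_linv
  have hσi' : E.dx σi = 0 := by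
    have h := congrArg E.dx hσi
    rw [Derivation.leibniz, Derivation.map_one_eq_zero, hσ] at h
    simp only [smul_eq_mul, mul_zero, add_zero] at h
    linear_combination σi * h - E.dx σi * hσi
  have hδ : E.dx (E.dt σ * σi) = 0 := by
    rw [Derivation.leibniz, E.comm, hσ, hσi']; simp
  have hδ' : E.dx (E.linv * (E.dt σ * σi)) = 0 := by
    rw [Derivation.leibniz, hδ, hli]; simp
  have b0 := hb 0
  have b1 := hb 1
  rw [E.coeff_zero_expandC] at b0
  have hd := E.coeff_succ_expandC κ (E.I * E.dt a) 0
  have hI := E.dx_I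
  rw [E.coeff_zero_expandC] at hd
  simp only [Nat.cast_zero, zero_add, one_mul, Nat.cast_one] at b0 b1 hd
  rw [hd] at b1
  have p1 := E.coeff_succ_expandC κ (E.normH a) 0
  have q1 := E.coeff_succ_expandC κ (E.conj.normH a) 0
  have p2 := E.coeff_succ_expandC κ (E.normH a) 1
  have q2 := E.coeff_succ_expandC κ (E.conj.normH a) 1
  have p3 := E.coeff_succ_expandC κ (E.dx (E.normH a)) 0
  have q3 := E.coeff_succ_expandC κ (E.dx (E.conj.normH a)) 0
  rw [E.coeff_zero_expandC] at p1 q1 p3 q3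
  simp only [Nat.cast_zero, zero_add, one_mul, Nat.cast_one] at p1 q1 p2 q2 p3 q3
  rw [p3] at p2
  rw [q3] at q2
  have hI3 : E.I * E.I * E.I * E.I = 1 := by linear_combination (E.I * E.I - 1) * E.I_sq
  have hκ3 : κ ^ 3 * κi ^ 3 = 1 := by rw [← mul_pow, hκ, one_pow]
  have hw1 : κ ^ 3 * u₀ * (E.I * E.l) * (-(κi ^ 3 * ui * (E.I * E.linv))) = 1 := by
    linear_combination (-(κ ^ 3 * κi ^ 3 * (u₀ * ui) * (E.l * E.linv))) * E.I_sq
      + u₀ * ui * E.l * E.linv * hκ3 + E.l * E.linv * hu + E.l_linv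
  have hw2 : -(κ ^ 3 * v₀ * (E.I * E.l)) * (κi ^ 3 * vi * (E.I * E.linv)) = 1 := by
    linear_combination (-(κ ^ 3 * κi ^ 3 * (v₀ * vi) * (E.l * E.linv))) * E.I_sq
      + v₀ * vi * E.l * E.linv * hκ3 + E.l * E.linv * hv + E.l_linv
  -- The increment X^j S turns into X^j η^j times the expansion of `S`; the constant terms of η and
  -- `ρ` supply the factor.
  have hper : ∀ (ρ : R⟦X⟧) (r : R), PowerSeries.constantCoeff ρ = r →
      ∀ (j : ℕ) (U U' : R⟦X⟧) (A : R), Perturbs j U U' A →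
        Perturbs j (ρ * E.expand κ U) (ρ * E.expand κ U') (r * κ ^ j * A) := by
    rintro ρ r rfl j U U' A ⟨S, rfl, rfl⟩
    obtain ⟨η, hη, hη0⟩ := E.exists_expand_X κ
    refine ⟨ρ * η ^ j * E.expand κ S, ?_, ?_⟩
    · rw [map_add, map_mul, map_pow, hη]
      ring
    · rw [map_mul, map_mul, map_pow, hη0, E.constantCoeff_expand]
  refine ⟨⟨_, _, fun U => ρ₁ * E.expand κ U, fun V => ρ₂ * E.expand κ V, ?_, ?_,
    IsUnit.of_mul_eq_one κi hκ, hu, hv, ?_, fun U hU => ?_, fun V hV => ?_, hper _ _ hρ₁, hper _ _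
        hρ₂,
    fun j U V => E.coeff_of_expand κ hw1 hω₁ (h U V).1 j,
    fun j U V => E.coeff_of_expand κ hw2 hω₂ (h U V).2 j⟩⟩
  · rw [sumH, map_add, map_add, E.expandC_eq_C κ _ hδ', map_mul PowerSeries.C E.linv]
    ring
  · simp only [map_add, map_sub, PowerSeries.coeff_C_mul, PowerSeries.coeff_C, one_ne_zero,
      if_false,
      p1, q1, b0, diffH]
    ring
  · simp only [map_add, map_sub, PowerSeries.coeff_C_mul, PowerSeries.coeff_C,
      OfNat.ofNat_ne_zero, if_false, diffH]
    have e2 : (1 : ℕ) + 1 = 2 := rfl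
    have hd2 : E.dx 2 = 0 := by simpa using E.dx.map_natCast 2
    rw [e2] at p2 q2 b1
    simp only [Derivation.leibniz, smul_eq_mul, hli, hI, hd2] at b1 ⊢
    linear_combination p2 - q2 + 2 * E.linv * b1
  · rw [map_mul, E.constantCoeff_expand, hρ₁, hU, mul_comm, hu]
  · rw [map_mul, E.constantCoeff_expand, hρ₂, hV, mul_comm, hv]

end EquationData

end NLSCoeffs

/-! ### Compatible coefficients and partial solutions -/

namespace NLSCoeffs

namespace EquationData

variable {R : Type*} [CommRing R] [Algebra ℂ R] {E : EquationData R}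

theorem coeff_expandC_of_dx_eq_zero (κ : R) {w : R} (h : E.dx w = 0) (n : ℕ) :
    PowerSeries.coeff (n + 1) (E.expandC κ w) = 0 := by
  rw [E.expandC_eq_C κ w h, PowerSeries.coeff_C, if_neg n.succ_ne_zero]

theorem coeff_one_expandC (κ w : R) : PowerSeries.coeff 1 (E.expandC κ w) = E.dx w := by
  simpa [E.coeff_zero_expandC, -PowerSeries.coeff_zero_eq_constantCoeff]
    using E.coeff_succ_expandC κ w 0

theorem two_mul_coeff_two_expandC (κ w : R) :
    2 * PowerSeries.coeff 2 (E.expandC κ w) = E.dx (E.dx w) := by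
  have h := E.coeff_succ_expandC κ w 1
  rw [coeff_one_expandC] at h
  rw [← h]
  norm_num

theorem coeff_expandC_of_dx_dx_eq_zero (κ : R) {w : R} (h : E.dx (E.dx w) = 0) (n : ℕ) :
    PowerSeries.coeff (n + 2) (E.expandC κ w) = 0 := by
  refine natCast_succ_mul_cancel (n + 1) ?_
  rw [E.coeff_succ_expandC κ w (n + 1), coeff_expandC_of_dx_eq_zero κ h, mul_zero]

/-- The conditions on the normalized equations that are common to both integrable cases. -/
structure Compatible (E : EquationData R) (a σ σi : R) : Prop where
  normF : E.normF a = 0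
  normF_conj : E.conj.normF a = 0
  normG : E.normG a σ = 0
  normG_conj : E.conj.normG a σ = 0
  normK_conj : E.conj.normK a = E.normK a
  dx_dx_normK : E.dx (E.dx (E.normK a)) = 0
  sumH : E.sumH a σ σi = 2 * E.dx (E.normK a)

namespace Normalization

variable {κ τ θ a σ σi u₀ ui v₀ vi : R} (N : E.Normalization κ τ θ a σ σi u₀ ui v₀ vi)

/-- The left-hand side of the first normalized equation. -/
noncomputable def normal (U V : R⟦X⟧) : R⟦X⟧ :=
  normalSeries (E.linv • E.slide θ) (σ * E.m * E.linv) (σ * E.n * E.linv)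
    (E.expandC κ (E.normF a)) (E.expandC κ (E.normG a σ)) N.H
    (E.expandC κ (E.normK a) + PowerSeries.C (E.linv * θ)) (N.Y U) (N.Z V)

/-- The left-hand side of the second normalized equation. -/
noncomputable def normalConj (U V : R⟦X⟧) : R⟦X⟧ :=
  normalSeries (E.linv • E.slide θ) (σ * E.m * E.linv) (σ * E.n * E.linv)
    (E.expandC κ (E.conj.normF a)) (E.expandC κ (E.conj.normG a σ)) N.B
    (E.expandC κ (E.conj.normK a) + PowerSeries.C (E.linv * θ)) (N.Z V) (N.Y U)

/-- The leading coefficients are `u₀`, `v₀`, and the equations of the levels below `j` hold. -/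
structure SolvedBelow (_ : E.Normalization κ τ θ a σ σi u₀ ui v₀ vi) (j : ℕ) (U V : R⟦X⟧) :
    Prop where
  coeff_zero_U : PowerSeries.coeff 0 U = u₀
  coeff_zero_V : PowerSeries.coeff 0 V = v₀
  eqn : ∀ i < j, PowerSeries.coeff i (E.series κ τ (-1) (-1) 0 U V) = 0
  eqn_conj : ∀ i < j, PowerSeries.coeff i (E.conj.series κ τ (-1) (-1) 0 V U) = 0

theorem isUnit_leading (N : E.Normalization κ τ θ a σ σi u₀ ui v₀ vi) {w wi : R} (hw : w * wi = 1) :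
    IsUnit (κ ^ 3 * w * (E.I * E.l)) := by
  have h1 : IsUnit E.I := IsUnit.of_mul_eq_one (-E.I) (by linear_combination -E.I_sq)
  exact ((N.isUnit_κ.pow 3).mul (IsUnit.of_mul_eq_one wi hw)).mul
    (h1.mul (IsUnit.of_mul_eq_one _ E.l_linv))

namespace SolvedBelow

variable {N} {i j : ℕ} {U V : R⟦X⟧} (h : N.SolvedBelow j U V)

include h

theorem mono (hij : i ≤ j) : N.SolvedBelow i U V :=
  ⟨h.1, h.2, fun k hk => h.3 k (by omega), fun k hk => h.4 k (by omega)⟩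

theorem coeff_zero_Y : PowerSeries.coeff 0 (N.Y U) = 1 := by
  have := h.1
  rw [PowerSeries.coeff_zero_eq_constantCoeff_apply] at this ⊢
  exact N.constantCoeff_Y U this

theorem coeff_zero_Z : PowerSeries.coeff 0 (N.Z V) = 1 := by
  have := h.2
  rw [PowerSeries.coeff_zero_eq_constantCoeff_apply] at this ⊢
  exact N.constantCoeff_Z V this

theorem normal_eq (hi : i < j) : PowerSeries.coeff i (N.normal U V) = 0 := by
  have := N.level i U V fun k hk => h.3 k (by omega)
  rw [h.3 i hi, mul_zero] at this
  exact ((N.isUnit_leading N.u₀_mul_ui).mul_right_eq_zero).1 this.symm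

theorem normalConj_eq (hi : i < j) : PowerSeries.coeff i (N.normalConj U V) = 0 := by
  have := N.level_conj i U V fun k hk => h.4 k (by omega)
  rw [h.4 i hi, mul_zero] at this
  exact ((N.isUnit_leading N.v₀_mul_vi).neg.mul_right_eq_zero).1 this.symm

/-- The prefactors of the two normalized equations are κ³ u₀ i l and -κ³ v₀ i l. The opposite sign
turns the difference of the normalized equations into a sum of the original ones, and vice versa in
`compat_sub`. -/
theorem compat_add
    (h' : PowerSeries.coeff j (N.normal U V) - PowerSeries.coeff j (N.normalConj U V) = 0) :
    v₀ * PowerSeries.coeff j (E.series κ τ (-1) (-1) 0 U V)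
      + u₀ * PowerSeries.coeff j (E.conj.series κ τ (-1) (-1) 0 V U) = 0 := by
  refine ((N.isUnit_κ.pow j).mul_right_eq_zero).1 ?_
  have h1 := N.level j U V h.3
  have h2 := N.level_conj j U V h.4
  rw [normal, normalConj] at h'
  linear_combination v₀ * h1 + u₀ * h2 + (κ ^ 3 * u₀ * v₀ * (E.I * E.l)) * h'

theorem compat_sub
    (h' : PowerSeries.coeff j (N.normal U V) + PowerSeries.coeff j (N.normalConj U V) = 0) :
    v₀ * PowerSeries.coeff j (E.series κ τ (-1) (-1) 0 U V)
      - u₀ * PowerSeries.coeff j (E.conj.series κ τ (-1) (-1) 0 V U) = 0 := by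
  refine ((N.isUnit_κ.pow j).mul_right_eq_zero).1 ?_
  have h1 := N.level j U V h.3
  have h2 := N.level_conj j U V h.4
  rw [normal, normalConj] at h'
  linear_combination v₀ * h1 - u₀ * h2 + (κ ^ 3 * u₀ * v₀ * (E.I * E.l)) * h'

theorem compat_eq_zero (h' : PowerSeries.coeff j (N.normal U V) = 0) :
    PowerSeries.coeff j (E.series κ τ (-1) (-1) 0 U V) = 0 := by
  refine ((N.isUnit_κ.pow j).mul_right_eq_zero).1 ?_
  rw [N.level j U V h.3]
  rw [normal] at h'
  rw [h', mul_zero]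

theorem compat_conj_eq_zero (h' : PowerSeries.coeff j (N.normalConj U V) = 0) :
    PowerSeries.coeff j (E.conj.series κ τ (-1) (-1) 0 V U) = 0 := by
  refine ((N.isUnit_κ.pow j).mul_right_eq_zero).1 ?_
  rw [N.level_conj j U V h.4]
  rw [normalConj] at h'
  rw [h', mul_zero]

end SolvedBelow

end Normalization

end EquationData

end NLSCoeffs

/-! ### Levels of the compatible normalized equations -/

namespace NLSCoeffs

namespace EquationData

variable {R : Type*} [CommRing R] [Algebra ℂ R] {E : EquationData R}

namespace Normalization

variable {κ τ θ a σ σi u₀ ui v₀ vi : R} {N : E.Normalization κ τ θ a σ σi u₀ ui v₀ vi}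

/-- The values at a point of the lower coefficients of the compatible normalized equations. -/
structure Values (N : E.Normalization κ τ θ a σ σi u₀ ui v₀ vi) (φ : R →+* ℂ)
    (H B K : ℕ → ℂ) : Prop where
  evalH : Evaluates φ N.H H
  evalB : Evaluates φ N.B B
  evalK : Evaluates φ (E.expandC κ (E.normK a) + PowerSeries.C (E.linv * θ)) K
  sum_zero : H 0 + B 0 = 2 * K 1
  sum_succ : ∀ n, H (n + 1) + B (n + 1) = 0
  K_zero : ∀ n, K (n + 2) = 0
  diff_one : H 1 - B 1 = φ (E.diffH a)
  diff_two : 2 * (H 2 - B 2) = φ (E.dx (E.diffH a))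

/-- H + B is twice the expansion of the x-derivative of `normK`, which is constant in x; the front
speed only shifts the zeroth coefficient of K. -/
theorem values (N : E.Normalization κ τ θ a σ σi u₀ ui v₀ vi) (hC : E.Compatible a σ σi)
    (φ : R →+* ℂ) : N.Values φ (fun n => φ (PowerSeries.coeff n N.H))
      (fun n => φ (PowerSeries.coeff n N.B))
      (fun n => φ (PowerSeries.coeff n
        (E.expandC κ (E.normK a) + PowerSeries.C (E.linv * θ)))) := by
  have hs : ∀ n, PowerSeries.coeff n N.H + PowerSeries.coeff n N.B =
      2 * PowerSeries.coeff n (E.expandC κ (E.dx (E.normK a))) := by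
    intro n
    rw [← map_add, N.sum_eq, hC.sumH, two_mul, two_mul, map_add, map_add]
  refine ⟨fun _ => rfl, fun _ => rfl, fun _ => rfl, ?_, fun n => ?_, fun n => ?_, ?_, ?_⟩
  · rw [← map_add, hs 0, E.coeff_zero_expandC, map_add, coeff_one_expandC, PowerSeries.coeff_C,
      if_neg one_ne_zero, add_zero, map_mul, map_ofNat]
  · rw [← map_add, hs, coeff_expandC_of_dx_eq_zero κ hC.dx_dx_normK, mul_zero, map_zero]
  · rw [map_add, coeff_expandC_of_dx_dx_eq_zero κ hC.dx_dx_normK, PowerSeries.coeff_C,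
      if_neg (by omega), add_zero, map_zero]
  · rw [← N.diff_one, map_sub]
  · rw [← N.diff_two, map_mul, map_sub, map_ofNat]

theorem map_coeff_normal_one (hC : E.Compatible a σ σi) {φ : R →+* ℂ}
    {Y Z : ℕ → ℂ} {μ ν : ℂ} (hμ : φ (σ * E.m * E.linv) = μ) (hν : φ (σ * E.n * E.linv) = ν)
    {U V : R⟦X⟧} (hY : Evaluates φ (N.Y U) Y) (hZ : Evaluates φ (N.Z V) Z)
    (h : N.SolvedBelow 0 U V) :
    φ (PowerSeries.coeff 1 (N.normal U V)) =
      -4*Y 1*μ - 3*Y 1*ν - 2*Z 1*μ - Z 1*ν := by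
  rw [normal, hC.normF, hC.normG, map_zero,
    map_coeff_normalSeries_one φ _ hμ hν (fun _ => by simp : Evaluates φ 0 0) (fun _ =>
        by simp : Evaluates φ 0 0) hY hZ h.coeff_zero_Y h.coeff_zero_Z]
  simp only [Pi.zero_apply]
  ring

theorem map_coeff_normal_two (hC : E.Compatible a σ σi) {φ : R →+* ℂ}
    {H B K Y Z : ℕ → ℂ} {μ ν : ℂ} (hμ : φ (σ * E.m * E.linv) = μ) (hν : φ (σ * E.n * E.linv) = ν)
    (hv : N.Values φ H B K)
    {U V : R⟦X⟧} (hY : Evaluates φ (N.Y U) Y) (hZ : Evaluates φ (N.Z V) Z)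
    (h : N.SolvedBelow 0 U V) :
    φ (PowerSeries.coeff 2 (N.normal U V)) =
      -K 0 - 2*Y 2*μ - 2*Y 2*ν - Z 2*μ - 2*Y 1*Z 1*μ - Y 1*Z 1*ν - Y 1^2*μ - Y 1^2*ν := by
  rw [normal, hC.normF, hC.normG, map_zero,
    map_coeff_normalSeries_two φ _ hμ hν (fun _ => by simp : Evaluates φ 0 0) (fun _ =>
        by simp : Evaluates φ 0 0) hv.evalK hY hZ h.coeff_zero_Y h.coeff_zero_Z]
  simp only [Pi.zero_apply]
  ring

theorem map_coeff_normal_three (hC : E.Compatible a σ σi) {φ : R →+* ℂ}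
    {H B K Y Z : ℕ → ℂ} {ν : ℂ} (hν : φ (σ * E.n * E.linv) = ν)
    (hv : N.Values φ H B K)
    {U V : R⟦X⟧} (hY : Evaluates φ (N.Y U) Y) (hZ : Evaluates φ (N.Z V) Z)
    (h : N.SolvedBelow 0 U V) :
    φ (PowerSeries.coeff 3 (N.normal U V)) =
      H 0 - K 1 - Y 3*ν + Z 3*ν - Y 1*Y 2*ν + Y 1*Z 2*ν := by
  rw [normal, hC.normF, hC.normG, map_zero,
    map_coeff_normalSeries_three φ _ hν (fun _ => by simp : Evaluates φ 0 0) (fun _ =>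
        by simp : Evaluates φ 0 0) (hv.evalH) hv.evalK hY hZ h.coeff_zero_Y h.coeff_zero_Z]
  simp only [Pi.zero_apply]
  ring

theorem map_coeff_normal_four (hC : E.Compatible a σ σi) {φ : R →+* ℂ}
    {H B K Y Z : ℕ → ℂ} {μ ν : ℂ} (hμ : φ (σ * E.m * E.linv) = μ) (hν : φ (σ * E.n * E.linv) = ν)
    (hv : N.Values φ H B K)
    {U V : R⟦X⟧} (hY : Evaluates φ (N.Y U) Y) (hZ : Evaluates φ (N.Z V) Z)
    (h : N.SolvedBelow 0 U V) :
    φ (PowerSeries.coeff 4 (N.normal U V)) =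
      φ ((E.linv • E.slide θ) (PowerSeries.coeff 1 (N.Y U))) + H 1 - K 2 + 6*Y 4 + H 0*Y 1 + K 0*Y 2
          + 2*Y
        4*μ + Z 4*μ + 2*Z 4*ν + 2*Y 1*Y 3*μ + 2*Y 1*Z 3*μ + 3*Y 1*Z 3*ν + 2*Y 2*Z 2*μ +
        2*Y 2*Z 2*ν + Y 2^2*μ + 2*Y 3*Z 1*μ + Y 3*Z 1*ν + 2*Y 1*Y 2*Z 1*μ + Y 1*Y 2*Z 1*ν
        + Y 1^2*Z 2*μ + Y 1^2*Z 2*ν := by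
  rw [normal, hC.normF, hC.normG, map_zero,
    map_coeff_normalSeries_four φ _ hμ hν (fun _ => by simp : Evaluates φ 0 0) (fun _ =>
        by simp : Evaluates φ 0 0) (hv.evalH) hv.evalK hY hZ h.coeff_zero_Y h.coeff_zero_Z]
  simp only [Pi.zero_apply]
  ring

theorem map_coeff_normal_five (hC : E.Compatible a σ σi) {φ : R →+* ℂ}
    {H B K Y Z : ℕ → ℂ} {μ ν : ℂ} (hμ : φ (σ * E.m * E.linv) = μ) (hν : φ (σ * E.n * E.linv) = ν)
    (hv : N.Values φ H B K)
    {U V : R⟦X⟧} (hY : Evaluates φ (N.Y U) Y) (hZ : Evaluates φ (N.Z V) Z)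
    (h : N.SolvedBelow 0 U V) :
    φ (PowerSeries.coeff 5 (N.normal U V)) =
      φ ((E.linv • E.slide θ) (PowerSeries.coeff 2 (N.Y U))) + H 2 - K 3 + 24*Y 5 + H 0*Y 2 + H 1*Y
          1 + 2*K
        0*Y 3 + K 1*Y 2 + 4*Y 5*μ + Y 5*ν + 2*Z 5*μ + 3*Z 5*ν + 4*Y 1*Y 4*μ + Y 1*Y 4*ν +
        4*Y 1*Z 4*μ + 5*Y 1*Z 4*ν + 4*Y 2*Y 3*μ + Y 2*Y 3*ν + 4*Y 2*Z 3*μ + 4*Y 2*Z 3*ν +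
        4*Y 3*Z 2*μ + 3*Y 3*Z 2*ν + 4*Y 4*Z 1*μ + 2*Y 4*Z 1*ν + 4*Y 1*Y 2*Z 2*μ + 3*Y 1*Y
        2*Z 2*ν + 4*Y 1*Y 3*Z 1*μ + 2*Y 1*Y 3*Z 1*ν + 2*Y 1^2*Z 3*μ + 2*Y 1^2*Z 3*ν + 2*Y
        2^2*Z 1*μ + Y 2^2*Z 1*ν := by
  rw [normal, hC.normF, hC.normG, map_zero,
    map_coeff_normalSeries_five φ _ hμ hν (hv.evalH) hv.evalK hY hZ h.coeff_zero_Y h.coeff_zero_Z]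

theorem map_coeff_normalConj_one (hC : E.Compatible a σ σi) {φ : R →+* ℂ}
    {Y Z : ℕ → ℂ} {μ ν : ℂ} (hμ : φ (σ * E.m * E.linv) = μ) (hν : φ (σ * E.n * E.linv) = ν)
    {U V : R⟦X⟧} (hY : Evaluates φ (N.Y U) Y) (hZ : Evaluates φ (N.Z V) Z)
    (h : N.SolvedBelow 0 U V) :
    φ (PowerSeries.coeff 1 (N.normalConj U V)) =
      -4*Z 1*μ - 3*Z 1*ν - 2*Y 1*μ - Y 1*ν := by
  rw [normalConj, hC.normF_conj, hC.normG_conj, map_zero,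
    map_coeff_normalSeries_one φ _ hμ hν (fun _ => by simp : Evaluates φ 0 0) (fun _ =>
        by simp : Evaluates φ 0 0) hZ hY h.coeff_zero_Z h.coeff_zero_Y]
  simp only [Pi.zero_apply]
  ring

theorem map_coeff_normalConj_two (hC : E.Compatible a σ σi) {φ : R →+* ℂ}
    {H B K Y Z : ℕ → ℂ} {μ ν : ℂ} (hμ : φ (σ * E.m * E.linv) = μ) (hν : φ (σ * E.n * E.linv) = ν)
    (hv : N.Values φ H B K)
    {U V : R⟦X⟧} (hY : Evaluates φ (N.Y U) Y) (hZ : Evaluates φ (N.Z V) Z)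
    (h : N.SolvedBelow 0 U V) :
    φ (PowerSeries.coeff 2 (N.normalConj U V)) =
      -K 0 - 2*Z 2*μ - 2*Z 2*ν - Y 2*μ - 2*Z 1*Y 1*μ - Z 1*Y 1*ν - Z 1^2*μ - Z 1^2*ν := by
  rw [normalConj, hC.normF_conj, hC.normG_conj, hC.normK_conj, map_zero,
    map_coeff_normalSeries_two φ _ hμ hν (fun _ => by simp : Evaluates φ 0 0) (fun _ =>
        by simp : Evaluates φ 0 0) hv.evalK hZ hY h.coeff_zero_Z h.coeff_zero_Y]
  simp only [Pi.zero_apply]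
  ring

theorem map_coeff_normalConj_three (hC : E.Compatible a σ σi) {φ : R →+* ℂ}
    {H B K Y Z : ℕ → ℂ} {ν : ℂ} (hν : φ (σ * E.n * E.linv) = ν)
    (hv : N.Values φ H B K)
    {U V : R⟦X⟧} (hY : Evaluates φ (N.Y U) Y) (hZ : Evaluates φ (N.Z V) Z)
    (h : N.SolvedBelow 0 U V) :
    φ (PowerSeries.coeff 3 (N.normalConj U V)) =
      B 0 - K 1 - Z 3*ν + Y 3*ν - Z 1*Z 2*ν + Z 1*Y 2*ν := by
  rw [normalConj, hC.normF_conj, hC.normG_conj, hC.normK_conj, map_zero,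
    map_coeff_normalSeries_three φ _ hν (fun _ => by simp : Evaluates φ 0 0) (fun _ =>
        by simp : Evaluates φ 0 0) (hv.evalB) hv.evalK hZ hY h.coeff_zero_Z h.coeff_zero_Y]
  simp only [Pi.zero_apply]
  ring

theorem map_coeff_normalConj_four (hC : E.Compatible a σ σi) {φ : R →+* ℂ}
    {H B K Y Z : ℕ → ℂ} {μ ν : ℂ} (hμ : φ (σ * E.m * E.linv) = μ) (hν : φ (σ * E.n * E.linv) = ν)
    (hv : N.Values φ H B K)
    {U V : R⟦X⟧} (hY : Evaluates φ (N.Y U) Y) (hZ : Evaluates φ (N.Z V) Z)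
    (h : N.SolvedBelow 0 U V) :
    φ (PowerSeries.coeff 4 (N.normalConj U V)) =
      φ ((E.linv • E.slide θ) (PowerSeries.coeff 1 (N.Z V))) + B 1 - K 2 + 6*Z 4 + B 0*Z 1 + K 0*Z 2
          + 2*Z
        4*μ + Y 4*μ + 2*Y 4*ν + 2*Z 1*Z 3*μ + 2*Z 1*Y 3*μ + 3*Z 1*Y 3*ν + 2*Z 2*Y 2*μ +
        2*Z 2*Y 2*ν + Z 2^2*μ + 2*Z 3*Y 1*μ + Z 3*Y 1*ν + 2*Z 1*Z 2*Y 1*μ + Z 1*Z 2*Y 1*ν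
        + Z 1^2*Y 2*μ + Z 1^2*Y 2*ν := by
  rw [normalConj, hC.normF_conj, hC.normG_conj, hC.normK_conj, map_zero,
    map_coeff_normalSeries_four φ _ hμ hν (fun _ => by simp : Evaluates φ 0 0) (fun _ =>
        by simp : Evaluates φ 0 0) (hv.evalB) hv.evalK hZ hY h.coeff_zero_Z h.coeff_zero_Y]
  simp only [Pi.zero_apply]
  ring

theorem map_coeff_normalConj_five (hC : E.Compatible a σ σi) {φ : R →+* ℂ}
    {H B K Y Z : ℕ → ℂ} {μ ν : ℂ} (hμ : φ (σ * E.m * E.linv) = μ) (hν : φ (σ * E.n * E.linv) = ν)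
    (hv : N.Values φ H B K)
    {U V : R⟦X⟧} (hY : Evaluates φ (N.Y U) Y) (hZ : Evaluates φ (N.Z V) Z)
    (h : N.SolvedBelow 0 U V) :
    φ (PowerSeries.coeff 5 (N.normalConj U V)) =
      φ ((E.linv • E.slide θ) (PowerSeries.coeff 2 (N.Z V))) + B 2 - K 3 + 24*Z 5 + B 0*Z 2 + B 1*Z
          1 + 2*K
        0*Z 3 + K 1*Z 2 + 4*Z 5*μ + Z 5*ν + 2*Y 5*μ + 3*Y 5*ν + 4*Z 1*Z 4*μ + Z 1*Z 4*ν +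
        4*Z 1*Y 4*μ + 5*Z 1*Y 4*ν + 4*Z 2*Z 3*μ + Z 2*Z 3*ν + 4*Z 2*Y 3*μ + 4*Z 2*Y 3*ν +
        4*Z 3*Y 2*μ + 3*Z 3*Y 2*ν + 4*Z 4*Y 1*μ + 2*Z 4*Y 1*ν + 4*Z 1*Z 2*Y 2*μ + 3*Z 1*Z
        2*Y 2*ν + 4*Z 1*Z 3*Y 1*μ + 2*Z 1*Z 3*Y 1*ν + 2*Z 1^2*Y 3*μ + 2*Z 1^2*Y 3*ν + 2*Z
        2^2*Y 1*μ + Z 2^2*Y 1*ν := by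
  rw [normalConj, hC.normF_conj, hC.normG_conj, hC.normK_conj, map_zero,
    map_coeff_normalSeries_five φ _ hμ hν (hv.evalB) hv.evalK hZ hY h.coeff_zero_Z h.coeff_zero_Y]

end Normalization

end EquationData

end NLSCoeffs

/-! ### Compatibility at the resonances -/

namespace NLSCoeffs

namespace EquationData

variable {R : Type*} [CommRing R] [Algebra ℂ R] {E : EquationData R}

namespace Normalization

variable {κ τ θ a σ σi u₀ ui v₀ vi : R} {N : E.Normalization κ τ θ a σ σi u₀ ui v₀ vi}

theorem map_derivation_eq (φ : R →+* ℂ) (D : Derivation ℂ R R) {w w' : R} (h : w = w') :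
    φ (D w) = φ (D w') := by rw [h]

/-- The compatibility of the levels of the equation in the case `n = -m`. -/
theorem hirota_compat (hsep : ∀ w : R, (∀ φ : R →+* ℂ, φ w = 0) → w = 0)
    (hC : E.Compatible a σ σi) (hd : E.dx (E.diffH a) = 0) (hμ : σ * E.m * E.linv = -6)
    (hν : σ * E.n * E.linv = 6) (U V : R⟦X⟧) :
    (N.SolvedBelow 1 U V →
      PowerSeries.coeff 1 (N.normal U V) - PowerSeries.coeff 1 (N.normalConj U V) = 0) ∧
    (N.SolvedBelow 3 U V →
      PowerSeries.coeff 3 (N.normal U V) + PowerSeries.coeff 3 (N.normalConj U V) = 0) ∧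
    (N.SolvedBelow 4 U V →
      PowerSeries.coeff 4 (N.normal U V) + PowerSeries.coeff 4 (N.normalConj U V) = 0) ∧
    (N.SolvedBelow 5 U V →
      PowerSeries.coeff 5 (N.normal U V) - PowerSeries.coeff 5 (N.normalConj U V) = 0) := by
  have hμ' : ∀ φ : R →+* ℂ, φ (σ * E.m * E.linv) = -6 := fun φ => by
    rw [hμ, map_neg, map_ofNat]
  have hν' : ∀ φ : R →+* ℂ, φ (σ * E.n * E.linv) = 6 := fun φ => by rw [hν, map_ofNat]
  have e1 : ∀ (φ : R →+* ℂ) {Y Z : ℕ → ℂ} (hY : Evaluates φ (N.Y U) Y)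
      (hZ : Evaluates φ (N.Z V) Z) {j : ℕ} (h : N.SolvedBelow j U V) (hj : 1 < j),
      6 * Y 1 + 6 * Z 1 = 0 :=
    fun φ Y Z hY hZ j h hj => by
      have := map_coeff_normal_one hC (hμ' φ) (hν' φ) hY hZ (h.mono (Nat.zero_le _))
      rw [h.normal_eq hj, map_zero] at this
      linear_combination -this
  have e2 : ∀ (φ : R →+* ℂ) {j : ℕ} (h : N.SolvedBelow j U V) (hj : 2 < j),
      φ (PowerSeries.coeff 2 (N.normal U V)) = 0 ∧
      φ (PowerSeries.coeff 2 (N.normalConj U V)) = 0 := fun φ j h hj => by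
    rw [h.normal_eq hj, h.normalConj_eq hj, map_zero]
    exact ⟨rfl, rfl⟩
  refine ⟨fun h => hsep _ fun φ => ?_, fun h => hsep _ fun φ => ?_, fun h => hsep _ fun φ => ?_,
    fun h => hsep _ fun φ => ?_⟩
  · have h0 := h.mono (Nat.zero_le _)
    obtain ⟨Y, hY⟩ : ∃ Y, Evaluates φ (N.Y U) Y := ⟨_, fun _ => rfl⟩
    obtain ⟨Z, hZ⟩ : ∃ Z, Evaluates φ (N.Z V) Z := ⟨_, fun _ => rfl⟩
    rw [map_sub, map_coeff_normal_one hC (hμ' φ) (hν' φ) hY hZ h0,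
      map_coeff_normalConj_one hC (hμ' φ) (hν' φ) hY hZ h0]
    ring
  · have h0 := h.mono (Nat.zero_le _)
    obtain ⟨H, B, K, hv⟩ : ∃ H B K, N.Values φ H B K := ⟨_, _, _, N.values hC φ⟩
    obtain ⟨Y, hY⟩ : ∃ Y, Evaluates φ (N.Y U) Y := ⟨_, fun _ => rfl⟩
    obtain ⟨Z, hZ⟩ : ∃ Z, Evaluates φ (N.Z V) Z := ⟨_, fun _ => rfl⟩
    obtain ⟨p2, q2⟩ := e2 φ h (by omega)
    rw [map_coeff_normal_two hC (hμ' φ) (hν' φ) hv hY hZ h0] at p2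
    rw [map_coeff_normalConj_two hC (hμ' φ) (hν' φ) hv hY hZ h0] at q2
    rw [map_add, map_coeff_normal_three hC (hν' φ) hv hY hZ h0,
      map_coeff_normalConj_three hC (hν' φ) hv hY hZ h0]
    have := @hirota_compat_three (B 0) (H 0) (K 0) (K 1) (Y 1) (Y 2) (Y 3) (Z 1) (Z 2) (Z 3) (e1
      φ hY hZ h (by omega)) (by linear_combination p2)
      (by linear_combination q2) hv.sum_zero
    linear_combination this
  · have h0 := h.mono (Nat.zero_le _)
    obtain ⟨H, B, K, hv⟩ : ∃ H B K, N.Values φ H B K := ⟨_, _, _, N.values hC φ⟩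
    obtain ⟨Y, hY⟩ : ∃ Y, Evaluates φ (N.Y U) Y := ⟨_, fun _ => rfl⟩
    obtain ⟨Z, hZ⟩ : ∃ Z, Evaluates φ (N.Z V) Z := ⟨_, fun _ => rfl⟩
    obtain ⟨p2, q2⟩ := e2 φ h (by omega)
    have p3 : φ (PowerSeries.coeff 3 (N.normal U V)) = 0 := by
      rw [h.normal_eq (by omega), map_zero]
    rw [map_coeff_normal_two hC (hμ' φ) (hν' φ) hv hY hZ h0] at p2
    rw [map_coeff_normalConj_two hC (hμ' φ) (hν' φ) hv hY hZ h0] at q2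
    rw [map_coeff_normal_three hC (hν' φ) hv hY hZ h0] at p3
    rw [map_add, map_coeff_normal_four hC (hμ' φ) (hν' φ) hv hY hZ h0,
      map_coeff_normalConj_four hC (hμ' φ) (hν' φ) hv hY hZ h0]
    -- The relation z₁ = -y₁ is needed in the ring and not merely at `φ`, because it is
    -- differentiated along the front.
    have hYZ : PowerSeries.coeff 1 (N.Z V) = -PowerSeries.coeff 1 (N.Y U) :=
      eq_neg_of_add_eq_zero_right (hsep _ fun φ => by
        rw [map_add]; linear_combination (1 / 6) * e1 φ (fun _ => rfl) (fun _ => rfl) h (by omega))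
    have := @hirota_compat_four (B 0) (B 1) _ _ (H 0) (H 1) (K 0) (K 1) (Y 1) (Y 2) (Y 3) (Y 4)
      (Z 1) (Z 2) (Z 3) (Z 4) (e1 φ hY hZ h (by omega)) (by linear_combination p2)
      (by linear_combination q2) (by linear_combination p3)
      ((map_derivation_eq φ (E.linv • E.slide θ) hYZ).trans (by rw [map_neg, map_neg]))
      hv.sum_zero (hv.sum_succ 0)
    linear_combination this - 2 * hv.K_zero 0
  · have h0 := h.mono (Nat.zero_le _)
    obtain ⟨H, B, K, hv⟩ : ∃ H B K, N.Values φ H B K := ⟨_, _, _, N.values hC φ⟩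
    obtain ⟨Y, hY⟩ : ∃ Y, Evaluates φ (N.Y U) Y := ⟨_, fun _ => rfl⟩
    obtain ⟨Z, hZ⟩ : ∃ Z, Evaluates φ (N.Z V) Z := ⟨_, fun _ => rfl⟩
    obtain ⟨p2, q2⟩ := e2 φ h (by omega)
    have p3 : φ (PowerSeries.coeff 3 (N.normal U V)) = 0 := by
      rw [h.normal_eq (by omega), map_zero]
    have p4 : φ (PowerSeries.coeff 4 (N.normal U V)) = 0 := by
      rw [h.normal_eq (by omega), map_zero]
    rw [map_coeff_normal_two hC (hμ' φ) (hν' φ) hv hY hZ h0] at p2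
    rw [map_coeff_normalConj_two hC (hμ' φ) (hν' φ) hv hY hZ h0] at q2
    rw [map_coeff_normal_three hC (hν' φ) hv hY hZ h0] at p3
    rw [map_coeff_normal_four hC (hμ' φ) (hν' φ) hv hY hZ h0] at p4
    rw [map_sub, map_coeff_normal_five hC (hμ' φ) (hν' φ) hv hY hZ h0,
      map_coeff_normalConj_five hC (hμ' φ) (hν' φ) hv hY hZ h0]
    -- Likewise z₂ = y₂ is differentiated in time at level 5, so it is proved at every homomorphism
    -- `ψ`.
    have hYZ : PowerSeries.coeff 2 (N.Z V) = PowerSeries.coeff 2 (N.Y U) := by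
      refine sub_eq_zero.1 (hsep _ fun ψ => ?_)
      obtain ⟨p2, q2⟩ := e2 ψ h (by omega)
      rw [map_coeff_normal_two hC (hμ' ψ) (hν' ψ) (N.values hC ψ) (fun _ => rfl)
        (fun _ => rfl) h0] at p2
      rw [map_coeff_normalConj_two hC (hμ' ψ) (hν' ψ) (N.values hC ψ) (fun _ => rfl)
        (fun _ => rfl) h0] at q2
      rw [map_sub]
      linear_combination (1 / 6) * p2 - (1 / 6) * q2
    have hd2 := hv.diff_two
    rw [hd, map_zero] at hd2
    have := @hirota_compat_five (B 0) (B 1) (B 2)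
      (φ ((E.linv • E.slide θ) (PowerSeries.coeff 1 (N.Y U)))) _ _ (H 0) (H 1) (H 2) (K 0) (K 1) (Y
          1) (Y 2) (Y 3) (Y 4) (Y 5) (Z 1) (Z 2) (Z 3) (Z 4) (Z 5) (e1 φ hY hZ h (by omega))
              (by linear_combination p2)
      (by linear_combination q2) (by linear_combination p3)
      (by linear_combination p4 + hv.K_zero 0) (map_derivation_eq φ (E.linv • E.slide θ) hYZ)
      hv.sum_zero (hv.sum_succ 0) (by linear_combination (1 / 2) * hd2)
    linear_combination this

/-- The compatibility of the levels of the equation in the case `n = -m / 2`. -/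
theorem sasaSatsuma_compat (hsep : ∀ w : R, (∀ φ : R →+* ℂ, φ w = 0) → w = 0)
    (hC : E.Compatible a σ σi) (hd : E.diffH a = 0) (hμ : σ * E.m * E.linv = -3)
    (hν : 2 * (σ * E.n * E.linv) = 3) (U V : R⟦X⟧) :
    (N.SolvedBelow 2 U V →
      PowerSeries.coeff 2 (N.normal U V) - PowerSeries.coeff 2 (N.normalConj U V) = 0) ∧
    (N.SolvedBelow 3 U V →
      PowerSeries.coeff 3 (N.normal U V) + PowerSeries.coeff 3 (N.normalConj U V) = 0) ∧
    (N.SolvedBelow 4 U V →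
      PowerSeries.coeff 4 (N.normal U V) = 0 ∧ PowerSeries.coeff 4 (N.normalConj U V) = 0) := by
  have hμ' : ∀ φ : R →+* ℂ, φ (σ * E.m * E.linv) = -3 := fun φ => by
    rw [hμ, map_neg, map_ofNat]
  have hν' : ∀ φ : R →+* ℂ, φ (σ * E.n * E.linv) = 3 / 2 := fun φ => by
    have := congrArg φ hν
    rw [map_mul, map_ofNat, map_ofNat] at this
    linear_combination (1 / 2) * this
  have e1 : ∀ (φ : R →+* ℂ) {Y Z : ℕ → ℂ} (hY : Evaluates φ (N.Y U) Y)
      (hZ : Evaluates φ (N.Z V) Z) {j : ℕ} (h : N.SolvedBelow j U V) (hj : 1 < j),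
      15 / 2 * Y 1 + 9 / 2 * Z 1 = 0 ∧ 9 / 2 * Y 1 + 15 / 2 * Z 1 = 0 :=
    fun φ Y Z hY hZ j h hj => by
      have p := map_coeff_normal_one hC (hμ' φ) (hν' φ) hY hZ (h.mono (Nat.zero_le _))
      have q := map_coeff_normalConj_one hC (hμ' φ) (hν' φ) hY hZ (h.mono (Nat.zero_le _))
      rw [h.normal_eq hj, map_zero] at p
      rw [h.normalConj_eq hj, map_zero] at q
      exact ⟨by linear_combination -p, by linear_combination -q⟩
  have e2 : ∀ (φ : R →+* ℂ) {j : ℕ} (h : N.SolvedBelow j U V) (hj : 2 < j),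
      φ (PowerSeries.coeff 2 (N.normal U V)) = 0 := fun φ j h hj => by
    rw [h.normal_eq hj, map_zero]
  refine ⟨fun h => hsep _ fun φ => ?_, fun h => hsep _ fun φ => ?_, fun h => ?_⟩
  · have h0 := h.mono (Nat.zero_le _)
    obtain ⟨H, B, K, hv⟩ : ∃ H B K, N.Values φ H B K := ⟨_, _, _, N.values hC φ⟩
    obtain ⟨Y, hY⟩ : ∃ Y, Evaluates φ (N.Y U) Y := ⟨_, fun _ => rfl⟩
    obtain ⟨Z, hZ⟩ : ∃ Z, Evaluates φ (N.Z V) Z := ⟨_, fun _ => rfl⟩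
    rw [map_sub, map_coeff_normal_two hC (hμ' φ) (hν' φ) hv hY hZ h0,
      map_coeff_normalConj_two hC (hμ' φ) (hν' φ) hv hY hZ h0]
    linear_combination @sasaSatsuma_compat_two (K 0) (Y 1) (Y 2) (Z 1) (Z 2)
      (e1 φ hY hZ h (by omega)).1 (e1 φ hY hZ h (by omega)).2
  · have h0 := h.mono (Nat.zero_le _)
    obtain ⟨H, B, K, hv⟩ : ∃ H B K, N.Values φ H B K := ⟨_, _, _, N.values hC φ⟩
    obtain ⟨Y, hY⟩ : ∃ Y, Evaluates φ (N.Y U) Y := ⟨_, fun _ => rfl⟩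
    obtain ⟨Z, hZ⟩ : ∃ Z, Evaluates φ (N.Z V) Z := ⟨_, fun _ => rfl⟩
    have p2 := e2 φ h (by omega)
    rw [map_coeff_normal_two hC (hμ' φ) (hν' φ) hv hY hZ h0] at p2
    rw [map_add, map_coeff_normal_three hC (hν' φ) hv hY hZ h0,
      map_coeff_normalConj_three hC (hν' φ) hv hY hZ h0]
    have := @sasaSatsuma_compat_three (B 0) (H 0) (K 0) (K 1) (Y 1) (Y 2) (Y 3) (Z 1) (Z 2) (Z 3)
      (e1 φ hY hZ h (by omega)).1 (e1 φ hY hZ h (by omega)).2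
      (by linear_combination p2) hv.sum_zero
    linear_combination this
  · have h0 := h.mono (Nat.zero_le _)
    have hY1 : PowerSeries.coeff 1 (N.Y U) = 0 := hsep _ fun φ => by
      obtain ⟨p, q⟩ := e1 φ (fun _ => rfl) (fun _ => rfl) h (by omega)
      linear_combination (5 / 24) * p - (1 / 8) * q
    have hZ1 : PowerSeries.coeff 1 (N.Z V) = 0 := hsep _ fun φ => by
      obtain ⟨p, q⟩ := e1 φ (fun _ => rfl) (fun _ => rfl) h (by omega)
      linear_combination (5 / 24) * q - (1 / 8) * p
    refine ⟨hsep _ fun φ => ?_, hsep _ fun φ => ?_⟩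
    all_goals
      obtain ⟨H, B, K, hv⟩ : ∃ H B K, N.Values φ H B K := ⟨_, _, _, N.values hC φ⟩
      obtain ⟨Y, hY⟩ : ∃ Y, Evaluates φ (N.Y U) Y := ⟨_, fun _ => rfl⟩
      obtain ⟨Z, hZ⟩ : ∃ Z, Evaluates φ (N.Z V) Z := ⟨_, fun _ => rfl⟩
      have p2 := e2 φ h (by omega)
      have p3 : φ (PowerSeries.coeff 3 (N.normal U V)) = 0 := by
        rw [h.normal_eq (by omega), map_zero]
      have hd1 := hv.diff_one
      have hs1 := hv.sum_succ 0
      rw [hd, map_zero] at hd1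
      rw [map_coeff_normal_two hC (hμ' φ) (hν' φ) hv hY hZ h0] at p2
      rw [map_coeff_normal_three hC (hν' φ) hv hY hZ h0] at p3
    · rw [map_coeff_normal_four hC (hμ' φ) (hν' φ) hv hY hZ h0]
      have := @sasaSatsuma_compat_four _ (H 0) (H 1) (K 0) (K 1) (Y 1) (Y 2) (Y 3) (Z 1) (Z 2)
        (Z 3) (e1 φ hY hZ h (by omega)).1 (e1 φ hY hZ h (by omega)).2
        (by linear_combination p2) (by linear_combination p3)
        ((map_derivation_eq φ (E.linv • E.slide θ) hY1).trans (by rw [map_zero, map_zero]))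
        (by linear_combination (1 / 2) * hd1 + (1 / 2) * hs1)
      linear_combination this - hv.K_zero 0
    · rw [map_coeff_normalConj_four hC (hμ' φ) (hν' φ) hv hY hZ h0]
      have := @sasaSatsuma_compat_four_conj (B 0) (B 1) _ (H 0) (K 0) (K 1) (Y 1) (Y 2) (Y 3) (Z
        1) (Z 2) (Z 3)
        (e1 φ hY hZ h (by omega)).1 (e1 φ hY hZ h (by omega)).2
        (by linear_combination p2) (by linear_combination p3)
        ((map_derivation_eq φ (E.linv • E.slide θ) hZ1).trans (by rw [map_zero, map_zero]))
        (by linear_combination (1 / 2) * hs1 - (1 / 2) * hd1)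
      linear_combination this - hv.K_zero 0

end Normalization

end EquationData

end NLSCoeffs

/-! ### Analytic coefficients as data over the analytic ring -/

namespace NLSCoeffs

open TopologicalSpace

/-- The coefficients of the equation are analytic on `U`, and `l` has no zeros there. -/
structure RegularOn (c : NLSCoeffs) (U : Opens (ℝ × ℝ)) : Prop where
  f : AnalyticOnNhd ℝ c.f U
  g : AnalyticOnNhd ℝ c.g U
  h : AnalyticOnNhd ℝ c.h U
  k : AnalyticOnNhd ℝ c.k U
  l : AnalyticOnNhd ℝ (fun p : ℝ × ℝ => (c.l p.2 : ℂ)) U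
  m : AnalyticOnNhd ℝ (fun p : ℝ × ℝ => (c.m p.2 : ℂ)) U
  n : AnalyticOnNhd ℝ (fun p : ℝ × ℝ => (c.n p.2 : ℂ)) U
  l_ne_zero : ∀ p ∈ U, (c.l p.2 : ℂ) ≠ 0

theorem analyticOnNhd_conj {U : Set (ℝ × ℝ)} {F : ℝ × ℝ → ℂ} (hF : AnalyticOnNhd ℝ F U) :
    AnalyticOnNhd ℝ (fun p => (starRingEnd ℂ) (F p)) U := fun p hp =>
  (Complex.conjCLE.toContinuousLinearMap.analyticAt (F p)).comp (hF p hp)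

theorem analyticOnNhd_comp_snd {U : Set (ℝ × ℝ)} {F : ℝ → ℝ} {J : Set ℝ}
    (hF : AnalyticOnNhd ℝ F J) (hU : ∀ p ∈ U, p.2 ∈ J) :
    AnalyticOnNhd ℝ (fun p : ℝ × ℝ => (F p.2 : ℂ)) U := fun p hp =>
  have h : AnalyticAt ℝ (F ∘ Prod.snd) p :=
    (hF p.2 (hU p hp)).comp ((ContinuousLinearMap.snd ℝ ℝ ℝ).analyticAt p)
  AnalyticAt.comp (f := F ∘ Prod.snd) (Complex.ofRealCLM.analyticAt _) h

theorem differentiableAt_of_comp_snd {E : Type*} [NormedAddCommGroup E] [NormedSpace ℝ E] {F : ℝ →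
    E}
    {p : ℝ × ℝ} (h : DifferentiableAt ℝ (fun q : ℝ × ℝ => F q.2) p) : DifferentiableAt ℝ F p.2 := by
  have h3 : DifferentiableAt ℝ (fun s : ℝ => (p.1, s)) p.2 := by fun_prop
  exact DifferentiableAt.comp (f := fun s : ℝ => (p.1, s)) p.2 h h3

theorem fderiv_comp_snd {E : Type*} [NormedAddCommGroup E] [NormedSpace ℝ E] (F : ℝ → E) (p : ℝ × ℝ)
    (hF : DifferentiableAt ℝ F p.2) (v : ℝ × ℝ) :
    fderiv ℝ (fun q : ℝ × ℝ => F q.2) p v = v.2 • deriv F p.2 := by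
  have h : HasFDerivAt (fun q : ℝ × ℝ => F q.2)
      ((fderiv ℝ F p.2).comp (ContinuousLinearMap.snd ℝ ℝ ℝ)) p :=
    hF.hasFDerivAt.comp p (ContinuousLinearMap.snd ℝ ℝ ℝ).hasFDerivAt
  rw [h.fderiv, ContinuousLinearMap.comp_apply]
  change fderiv ℝ F p.2 v.2 = _
  rw [← fderiv_apply_one_eq_deriv, ← map_smul, smul_eq_mul, mul_one]

/-- No regularity is assumed, since `fderiv` is zero by convention where differentiability fails.
This allows the functions of time in the compatibility conditions to be arbitrary. -/
theorem fderiv_comp_snd_fst {E : Type*} [NormedAddCommGroup E] [NormedSpace ℝ E] (F : ℝ → E)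
    (p : ℝ × ℝ) : fderiv ℝ (fun q : ℝ × ℝ => F q.2) p (1, 0) = 0 := by
  by_cases h : DifferentiableAt ℝ (fun q : ℝ × ℝ => F q.2) p
  · simp [fderiv_comp_snd F p (differentiableAt_of_comp_snd h)]
  · simp [fderiv_zero_of_not_differentiableAt h]

theorem EquationData.conj_series {R : Type*} [CommRing R] [Algebra ℂ R] (E : EquationData R) (κ τ :
    R)
    (α β : ℤ) (d : ℕ) (U V : R⟦X⟧) : E.conj.series κ τ α β d U V =
      eqnSeries (totalD E.dx κ) (totalD E.dt τ) PowerSeries.X α β d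
        (E.conj.coeffs.map PowerSeries.C) U V := rfl

namespace RegularOn

variable {c : NLSCoeffs} {U : Opens (ℝ × ℝ)} (hc : c.RegularOn U)

/-- The data of the equation in the ring of analytic functions on `U`. -/
noncomputable def data : EquationData (analyticRing U) where
  dx := analyticRing.dirDeriv (1, 0)
  dt := analyticRing.dirDeriv (0, 1)
  comm := analyticRing.dirDeriv_comm _ _
  i := Complex.I
  i_sq := Complex.I_mul_I
  f := analyticRing.restr _ hc.f
  g := analyticRing.restr _ hc.g
  h := analyticRing.restr _ hc.h
  k := analyticRing.restr _ hc.k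
  fb := analyticRing.restr _ (analyticOnNhd_conj hc.f)
  gb := analyticRing.restr _ (analyticOnNhd_conj hc.g)
  hb := analyticRing.restr _ (analyticOnNhd_conj hc.h)
  kb := analyticRing.restr _ (analyticOnNhd_conj hc.k)
  l := analyticRing.restr _ hc.l
  linv := analyticRing.restr (fun p : ℝ × ℝ => (c.l p.2 : ℂ))⁻¹ (fun p hp => (hc.l p hp).inv
      (hc.l_ne_zero p hp))
  m := analyticRing.restr _ hc.m
  n := analyticRing.restr _ hc.n
  l_linv := by
    ext p
    exact mul_inv_cancel₀ (hc.l_ne_zero p p.2)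
  dx_l := by
    ext p
    rw [analyticRing.dirDeriv_restr]
    exact fderiv_comp_snd_fst (fun s => (c.l s : ℂ)) p
  dx_m := by
    ext p
    rw [analyticRing.dirDeriv_restr]
    exact fderiv_comp_snd_fst (fun s => (c.m s : ℂ)) p
  dx_n := by
    ext p
    rw [analyticRing.dirDeriv_restr]
    exact fderiv_comp_snd_fst (fun s => (c.n s : ℂ)) p

theorem data_dx : hc.data.dx = analyticRing.dirDeriv (1, 0) := rfl

theorem data_dt : hc.data.dt = analyticRing.dirDeriv (0, 1) := rfl

theorem data_I (p : U) : Complex.I = hc.data.coeffs.ct.1 p := rfl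

theorem data_l (p : U) : Complex.I * (c.l p.1.2 : ℂ) = hc.data.coeffs.cl.1 p := rfl

theorem data_m (p : U) : Complex.I * (c.m p.1.2 : ℂ) = hc.data.coeffs.cm.1 p := rfl

theorem data_n (p : U) : Complex.I * (c.n p.1.2 : ℂ) = hc.data.coeffs.cn.1 p := rfl

theorem conj_data_I (p : U) : -Complex.I = hc.data.conj.coeffs.ct.1 p := rfl

theorem conj_data_l (p : U) : -Complex.I * (c.l p.1.2 : ℂ) = hc.data.conj.coeffs.cl.1 p := rfl

theorem conj_data_m (p : U) : -Complex.I * (c.m p.1.2 : ℂ) = hc.data.conj.coeffs.cm.1 p := rfl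

theorem conj_data_n (p : U) : -Complex.I * (c.n p.1.2 : ℂ) = hc.data.conj.coeffs.cn.1 p := rfl

open Classical in
/-- The power series with given analytic coefficients. -/
noncomputable def _root_.NLSCoeffs.powerSeriesOf (U : Opens (ℝ × ℝ)) (u : ℕ → ℝ × ℝ → ℂ) :
    (analyticRing U)⟦X⟧ :=
  PowerSeries.mk fun n => if h : AnalyticOnNhd ℝ (u n) U then analyticRing.restr (u n) h else 0

theorem _root_.NLSCoeffs.coeff_powerSeriesOf (u : ℕ → ℝ × ℝ → ℂ) (n : ℕ)
    (h : AnalyticOnNhd ℝ (u n) U) :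
    PowerSeries.coeff n (powerSeriesOf U u) = analyticRing.restr (u n) h := by
  rw [powerSeriesOf, PowerSeries.coeff_mk, dif_pos h]

variable {Φ : ℝ × ℝ → ℂ} {κ τ : analyticRing U}

/-- The equations of a level in terms of power series. -/
theorem solvesLevel_iff (hκ : ∀ p : U, dx Φ p = κ.1 p) (hτ : ∀ p : U, dt Φ p = τ.1 p) {α β : ℤ}
    {d : ℕ} (hd : (d : ℤ) = -α - β - 2) {u v : ℕ → ℝ × ℝ → ℂ} {W V : (analyticRing U)⟦X⟧} (j : ℕ)
    (hu : ∀ i ≤ j, ∀ p : U, u i p = (PowerSeries.coeff i W).1 p)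
    (hv : ∀ i ≤ j, ∀ p : U, v i p = (PowerSeries.coeff i V).1 p) :
    c.SolvesLevel U Φ α β u v j ↔ PowerSeries.coeff j (hc.data.series κ τ α β d W V) = 0 ∧
      PowerSeries.coeff j (hc.data.conj.series κ τ β α d V W) = 0 := by
  have ha : Represents j α (expansion α u) W := Represents.expansion u W hu
  have hb : Represents j β (expansion β v) V := Represents.expansion v V hv
  have h1 := Represents.eqn hκ hτ d hd
    ⟨fun _ => Complex.I, c.f, c.g, c.h, c.k, fun p => Complex.I * (c.l p.2 : ℂ),
      fun p => Complex.I * (c.m p.2 : ℂ), fun p => Complex.I * (c.n p.2 : ℂ)⟩ hc.data.coeffs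
    hc.data_I (fun _ => rfl) (fun _ => rfl) (fun _ => rfl) (fun _ => rfl) hc.data_l
    hc.data_m hc.data_n ha hb
  have h2 := Represents.eqn hκ hτ d (by rw [hd]; ring)
    ⟨fun _ => -Complex.I, fun p => (starRingEnd ℂ) (c.f p), fun p => (starRingEnd ℂ) (c.g p),
      fun p => (starRingEnd ℂ) (c.h p), fun p => (starRingEnd ℂ) (c.k p),
      fun p => -Complex.I * (c.l p.2 : ℂ),
      fun p => -Complex.I * (c.m p.2 : ℂ), fun p => -Complex.I * (c.n p.2 : ℂ)⟩
    hc.data.conj.coeffs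
    hc.conj_data_I (fun _ => rfl) (fun _ => rfl) (fun _ => rfl) (fun _ => rfl) hc.conj_data_l
    hc.conj_data_m hc.conj_data_n hb ha
  dsimp only at h1 h2
  rw [← lhs] at h1
  -- Exchanging the roles of the unknowns produces the product v u, while `lhsConj` is written with
  -- u v.
  rw [mul_comm (expansion β v) (expansion α u), ← lhsConj] at h2
  have e1 := h1.coeff_eq j le_rfl
  have e2 := h2.coeff_eq j le_rfl
  rw [show 2 * β + α - 1 + (j : ℤ) = α + 2 * β - 1 + j by ring] at e2
  rw [EquationData.conj_series, EquationData.series, hc.data_dx, hc.data_dt]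
  constructor
  · intro h
    exact ⟨analyticRing.ext' fun p => by rw [← e1]; exact (h p p.2).1,
      analyticRing.ext' fun p => by rw [← e2]; exact (h p p.2).2⟩
  · rintro ⟨h, h'⟩ p hp
    rw [e1 ⟨p, hp⟩, e2 ⟨p, hp⟩, h, h']
    exact ⟨rfl, rfl⟩

end RegularOn

end NLSCoeffs

/-! ### Arbitrary functions, fronts and level systems -/

namespace NLSCoeffs

open TopologicalSpace

section HasArbitrary

variable {U : Opens (ℝ × ℝ)} {S : (ℝ × ℝ → ℂ) → (ℝ × ℝ → ℂ) → Prop} {j N : ℕ}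
  {T : analyticRing U → analyticRing U → Prop}

theorem admissible_iff (hj : j ≠ 0) (a : ℝ × ℝ → ℂ) :
    Admissible U j a ↔ AnalyticOnNhd ℝ a U := by simp [Admissible, hj]

theorem admissible_extend (hj : j ≠ 0) (A : analyticRing U) :
    Admissible U j (analyticRing.extend A) :=
  (admissible_iff hj _).2 (analyticRing.extend_analytic A)

/-- `T` expresses the relation `S` between functions in terms of elements of `analyticRing U`. -/
def Describes (U : Opens (ℝ × ℝ)) (T : analyticRing U → analyticRing U → Prop)
    (S : (ℝ × ℝ → ℂ) → (ℝ × ℝ → ℂ) → Prop) : Prop :=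
  ∀ a b (ha : AnalyticOnNhd ℝ a U) (hb : AnalyticOnNhd ℝ b U),
    S a b ↔ T (analyticRing.restr a ha) (analyticRing.restr b hb)

theorem Describes.extend_iff (h : Describes U T S) (A B : analyticRing U) :
    S (analyticRing.extend A) (analyticRing.extend B) ↔ T A B := by
  rw [h _ _ (analyticRing.extend_analytic A) (analyticRing.extend_analytic B),
    analyticRing.restr_extend, analyticRing.restr_extend]

theorem eqOn_of_restr_eq {a b : ℝ × ℝ → ℂ} {ha : AnalyticOnNhd ℝ a U} {B : analyticRing U}
    (h : analyticRing.restr a ha = B) (hb : ∀ p : U, b p = B.1 p) : Set.EqOn a b U := fun p hp => by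
  rw [hb ⟨p, hp⟩, ← h, analyticRing.restr_apply]

theorem hasArbitrary_zero (hj : j ≠ 0) (h : Describes U T S)
    (hT : ∃ A B, T A B ∧ ∀ A' B', T A' B' → A' = A ∧ B' = B) :
    HasArbitrary U (Admissible U j) S 0 := by
  obtain ⟨A, B, hAB, huniq⟩ := hT
  refine ⟨analyticRing.extend A, analyticRing.extend B, admissible_extend hj A,
    admissible_extend hj B, (h.extend_iff A B).2 hAB, fun a' b' ha hb hab => ?_⟩
  have := huniq _ _ ((h a' b' ha.1 hb.1).1 hab)
  exact ⟨eqOn_of_restr_eq this.1 (analyticRing.extend_apply A),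
    eqOn_of_restr_eq this.2 (analyticRing.extend_apply B)⟩

theorem isUnit_restr_iff {a : ℝ × ℝ → ℂ} (ha : AnalyticOnNhd ℝ a U) :
    IsUnit (analyticRing.restr a ha) ↔ ∀ p ∈ U, a p ≠ 0 := by
  rw [analyticRing.isUnit_iff]
  exact ⟨fun h p hp => h ⟨p, hp⟩, fun h p => h p p.2⟩

theorem hasArbitrary_one (h : Describes U T S)
    (hT : ∀ A, (j = 0 → IsUnit A) → ∃ B, (j = 0 → IsUnit B) ∧ T A B ∧ ∀ B', T A B' → B' = B) :
    HasArbitrary U (Admissible U j) S 1 := by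
  refine Or.inl fun a ha => ?_
  obtain ⟨B, hBu, hB, huniq⟩ := hT (analyticRing.restr a ha.1)
    (fun hj => (isUnit_restr_iff ha.1).2 (ha.2 hj))
  refine ⟨analyticRing.extend B, ⟨analyticRing.extend_analytic B, fun hj p hp => ?_⟩, ?_,
    fun b' hb hab => ?_⟩
  · have := (analyticRing.isUnit_iff B).1 (hBu hj) ⟨p, hp⟩
    rwa [← analyticRing.extend_apply] at this
  · rw [h a _ ha.1 (analyticRing.extend_analytic B), analyticRing.restr_extend]
    exact hB
  · exact eqOn_of_restr_eq (huniq _ ((h a b' ha.1 hb.1).1 hab)) (analyticRing.extend_apply B)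

theorem hasArbitrary_two (h : Describes U T S) (hT : ∀ A B, T A B) :
    HasArbitrary U (Admissible U j) S 2 := fun a b ha hb => (h a b ha.1 hb.1).2 (hT _ _)

theorem HasArbitrary.le_two {A : (ℝ × ℝ → ℂ) → Prop} (h : HasArbitrary U A S N) : N ≤ 2 := by
  match N, h with
  | 0, _ => omega
  | 1, _ => omega
  | 2, _ => omega

theorem HasArbitrary.exists_solution {U : Set (ℝ × ℝ)} {A : (ℝ × ℝ → ℂ) → Prop} (hA : ∃ a, A a)
    (h : HasArbitrary U A S N) : ∃ a b, A a ∧ A b ∧ S a b := by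
  obtain ⟨a₀, ha₀⟩ := hA
  match N, h with
  | 0, ⟨a, b, ha, hb, hab, _⟩ => exact ⟨a, b, ha, hb, hab⟩
  | 1, Or.inl h =>
    obtain ⟨b, hb, hab, _⟩ := h a₀ ha₀
    exact ⟨a₀, b, ha₀, hb, hab⟩
  | 1, Or.inr h =>
    obtain ⟨a, ha, hab, _⟩ := h a₀ ha₀
    exact ⟨a, a₀, ha, ha₀, hab⟩
  | 2, h => exact ⟨a₀, a₀, ha₀, ha₀, h a₀ a₀ ha₀ ha₀⟩

theorem Describes.exists_solution (h : Describes U T S) (hj : j ≠ 0)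
    (hS : HasArbitrary U (Admissible U j) S N) : ∃ A B, T A B := by
  obtain ⟨a, b, ha, hb, hab⟩ := hS.exists_solution ⟨_, admissible_extend hj 0⟩
  exact ⟨_, _, (h a b ha.1 hb.1).1 hab⟩

/-- The first component is enough: it excludes kernel vectors whose first entry is nonzero. -/
theorem Describes.unique (h : Describes U T S) (hj : j ≠ 0)
    (hS : HasArbitrary U (Admissible U j) S 0) {A B A' B' : analyticRing U} (hT : T A B)
    (hT' : T A' B') : A' = A := by
  obtain ⟨a, b, -, -, -, huniq⟩ := hS
  have h1 := (huniq _ _ (admissible_extend hj A) (admissible_extend hj B)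
    ((h.extend_iff A B).2 hT)).1
  have h2 := (huniq _ _ (admissible_extend hj A') (admissible_extend hj B')
    ((h.extend_iff A' B').2 hT')).1
  ext p
  rw [← analyticRing.extend_apply, ← analyticRing.extend_apply, h1 p.2, h2 p.2]

/-- The free function is given the values 0 and 1. A difference of exactly 1 is more useful than
being nonzero, as the ring may have zero divisors. -/
theorem Describes.exists_variation (h : Describes U T S) (hj : j ≠ 0) (hN : N ≠ 0)
    (hS : HasArbitrary U (Admissible U j) S N) :
    ∃ A B A' B', T A B ∧ T A' B' ∧ (A' = A + 1 ∨ B' = B + 1) := by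
  have ad : ∀ w : analyticRing U, Admissible U j (analyticRing.extend w) := admissible_extend hj
  match N, hS with
  | 1, Or.inl hS =>
    obtain ⟨b, hb, hab, _⟩ := hS _ (ad 0)
    obtain ⟨b', hb', hab', _⟩ := hS _ (ad 1)
    refine ⟨0, analyticRing.restr b hb.1, 1, analyticRing.restr b' hb'.1, ?_, ?_, Or.inl (zero_add
        1).symm⟩
    · have := (h _ b (ad 0).1 hb.1).1 hab
      rwa [analyticRing.restr_extend] at this
    · have := (h _ b' (ad 1).1 hb'.1).1 hab'
      rwa [analyticRing.restr_extend] at this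
  | 1, Or.inr hS =>
    obtain ⟨a, ha, hab, _⟩ := hS _ (ad 0)
    obtain ⟨a', ha', hab', _⟩ := hS _ (ad 1)
    refine ⟨analyticRing.restr a ha.1, 0, analyticRing.restr a' ha'.1, 1, ?_, ?_, Or.inr (zero_add
        1).symm⟩
    · have := (h a _ ha.1 (ad 0).1).1 hab
      rwa [analyticRing.restr_extend] at this
    · have := (h a' _ ha'.1 (ad 1).1).1 hab'
      rwa [analyticRing.restr_extend] at this
  | 2, hS => exact ⟨0, 0, 1, 0, (h.extend_iff 0 0).1 (hS _ _ (ad 0) (ad 0)),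
      (h.extend_iff 1 0).1 (hS _ _ (ad 1) (ad 0)), Or.inl (zero_add 1).symm⟩

theorem Describes.forall_of_two (h : Describes U T S) (hj : j ≠ 0)
    (hS : HasArbitrary U (Admissible U j) S 2) (A B : analyticRing U) : T A B :=
  (h.extend_iff A B).1 (hS _ _ (admissible_extend hj A) (admissible_extend hj B))

end HasArbitrary

/-- The power series with the `j`-th coefficient replaced. -/
noncomputable def setCoeff {R : Type*} [CommRing R] (W : R⟦X⟧) (j : ℕ) (A : R) : R⟦X⟧ :=
  W + PowerSeries.X ^ j * PowerSeries.C (A - PowerSeries.coeff j W)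

theorem perturbs_setCoeff {R : Type*} [CommRing R] (W : R⟦X⟧) (j : ℕ) (A : R) :
    Perturbs j W (setCoeff W j A) (A - PowerSeries.coeff j W) := Perturbs.monomial _ _ _

theorem coeff_setCoeff_self {R : Type*} [CommRing R] (W : R⟦X⟧) (j : ℕ) (A : R) :
    PowerSeries.coeff j (setCoeff W j A) = A := by
  rw [(perturbs_setCoeff W j A).coeff_self]
  ring

/-- A singularity manifold on an open set where the coefficients of the equation are regular. -/
structure Front (c : NLSCoeffs) (U : Opens (ℝ × ℝ)) (Φ : ℝ × ℝ → ℂ) where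
  regular : c.RegularOn U
  κ : analyticRing U
  τ : analyticRing U
  dx_eq : ∀ p : U, dx Φ p = κ.1 p
  dt_eq : ∀ p : U, dt Φ p = τ.1 p
  isUnit_κ : IsUnit κ
  dx_τ : regular.data.dx τ = regular.data.dt κ

theorem SingularManifold.exists_front {c : NLSCoeffs} {U : Opens (ℝ × ℝ)} {Φ : ℝ × ℝ → ℂ}
    (hc : c.RegularOn U) (h : c.SingularManifold U Φ) : Nonempty (Front c U Φ) := by
  refine ⟨⟨hc, analyticRing.dirDeriv (1, 0) (analyticRing.restr Φ h.analytic),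
    analyticRing.dirDeriv (0, 1) (analyticRing.restr Φ h.analytic), fun p => ?_, fun p => ?_, ?_,
    analyticRing.dirDeriv_comm _ _ _⟩⟩
  · rw [analyticRing.dirDeriv_restr]; rfl
  · rw [analyticRing.dirDeriv_restr]; rfl
  · rw [analyticRing.isUnit_iff]
    intro p hp
    rw [analyticRing.dirDeriv_restr] at hp
    have h2 : dx Φ p = 0 := hp
    exact h.noncharacteristic p p.2 (by rw [h2]; simp)

namespace Front

variable {c : NLSCoeffs} {U : Opens (ℝ × ℝ)} {Φ : ℝ × ℝ → ℂ} (X : Front c U Φ)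

/-- The data of the equation. -/
noncomputable abbrev E : EquationData (analyticRing U) := X.regular.data

variable {α β : ℤ} {d j : ℕ} {u v : ℕ → ℝ × ℝ → ℂ} {W V : (analyticRing U)⟦X⟧}

/-- The equations of level `j` for given coefficients below the `j`-th. -/
def LevelEqns (α β : ℤ) (d j : ℕ) (W V : (analyticRing U)⟦X⟧) (A B : analyticRing U) : Prop :=
  PowerSeries.coeff j (X.E.series X.κ X.τ α β d (setCoeff W j A) (setCoeff V j B)) = 0 ∧
  PowerSeries.coeff j (X.E.conj.series X.κ X.τ β α d (setCoeff V j B) (setCoeff W j A)) = 0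

/-- Beyond level 0 the equations are affine-linear in the new coefficients, and the matrix depends
on the earlier choices only through the leading coefficients. -/
theorem levelEqns_iff (hj : j ≠ 0) (A B : analyticRing U) : X.LevelEqns α β d j W V A B ↔
    PowerSeries.coeff j (X.E.series X.κ X.τ α β d W V)
      + (X.E.levelDiag X.κ α β d j (PowerSeries.coeff 0 W) (PowerSeries.coeff 0 V)
        * (A - PowerSeries.coeff j W)
      + X.E.levelOff X.κ α β j (PowerSeries.coeff 0 W) * (B - PowerSeries.coeff j V)) = 0 ∧
    PowerSeries.coeff j (X.E.conj.series X.κ X.τ β α d V W)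
      + (X.E.conj.levelDiag X.κ β α d j (PowerSeries.coeff 0 V) (PowerSeries.coeff 0 W)
        * (B - PowerSeries.coeff j V)
      + X.E.conj.levelOff X.κ β α j (PowerSeries.coeff 0 V) * (A - PowerSeries.coeff j W)) = 0 := by
  have hW := perturbs_setCoeff W j A
  have hV := perturbs_setCoeff V j B
  rw [LevelEqns, (X.E.perturbs_series X.κ X.τ α β d j hj hW hV).coeff_self,
    (X.E.conj.perturbs_series X.κ X.τ β α d j hj hV hW).coeff_self]
  simp only [PowerSeries.coeff_zero_eq_constantCoeff]

theorem describes (hd : (d : ℤ) = -α - β - 2)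
    (hu : ∀ i < j, ∀ p : U, u i p = (PowerSeries.coeff i W).1 p)
    (hv : ∀ i < j, ∀ p : U, v i p = (PowerSeries.coeff i V).1 p) :
    Describes U (X.LevelEqns α β d j W V)
      (fun a b => c.SolvesLevel U Φ α β (Function.update u j a) (Function.update v j b) j) := by
  have key : ∀ (u : ℕ → ℝ × ℝ → ℂ) (W : (analyticRing U)⟦X⟧) (a : ℝ × ℝ → ℂ)
      (ha : AnalyticOnNhd ℝ a U), (∀ i < j, ∀ p : U, u i p = (PowerSeries.coeff i W).1 p) →
      ∀ i ≤ j, ∀ p : U, Function.update u j a i p =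
        (PowerSeries.coeff i (setCoeff W j (analyticRing.restr a ha))).1 p := by
    intro u W a ha hu i hi p
    have hW := perturbs_setCoeff W j (analyticRing.restr a ha)
    rcases hi.lt_or_eq with hi | rfl
    · rw [Function.update_of_ne (by omega), hW.coeff_lt hi, hu i hi]
    · rw [Function.update_self, hW.coeff_self]
      simp
  intro a b ha hb
  exact X.regular.solvesLevel_iff X.dx_eq X.dt_eq hd j (key u W a ha hu) (key v V b hb hv)

end Front

end NLSCoeffs

/-! ### Determinants of the level systems -/

namespace NLSCoeffs

open TopologicalSpace

namespace EquationData

variable {R : Type*} [CommRing R] [Algebra ℂ R] (E : EquationData R)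

theorem isUnit_I : IsUnit E.I := IsUnit.of_mul_eq_one (-E.I) (by linear_combination -E.I_sq)

theorem isUnit_l : IsUnit E.l := IsUnit.of_mul_eq_one _ E.l_linv

theorem isUnit_ofNat (n : ℕ) [n.AtLeastTwo] : IsUnit (OfNat.ofNat n : R) := by
  have h : (OfNat.ofNat n : R) = algebraMap ℂ R (OfNat.ofNat n) := (map_ofNat _ n).symm
  rw [h]
  exact (IsUnit.mk0 _ (OfNat.ofNat_ne_zero n)).map (algebraMap ℂ R)

theorem isUnit_intCast {z : ℤ} (hz : z ≠ 0) : IsUnit (z : R) := by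
  rw [← map_intCast (algebraMap ℂ R)]
  exact (IsUnit.mk0 _ (by exact_mod_cast hz)).map (algebraMap ℂ R)

theorem levelOff_eq (κ u : R) (j : ℕ) : E.levelOff κ (-1) (-1) j u =
    E.I * κ * u ^ 2 * (E.m * (j - 3) + E.n * (j - 2)) := by
  rw [levelOff]
  push_cast
  ring

/-- The leading balance eliminates l κ², leaving `m`, `n` and κ u v only; the factor 6 avoids a
division. -/
theorem six_mul_levelDiag (κ u v : R) (j : ℕ)
    (h : (3 * E.m + 2 * E.n) * (u * v) = -6 * E.l * κ ^ 2) :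
    6 * E.levelDiag κ (-1) (-1) 0 j u v = E.I * κ * (u * v) *
      (6 * (2 * E.m * (j - 3) + E.n * (j - 4)) -
        (3 * E.m + 2 * E.n) * ((j - 1) * (j - 2) * (j - 3))) := by
  rw [levelDiag, if_pos rfl]
  push_cast
  linear_combination (E.I * κ * ((j - 1) * (j - 2) * (j - 3))) * h

/-- The determinant of the linear system for the coefficients of level `j`. -/
theorem levelDet_eq (κ u v : R) (j : ℕ)
    (h : (3 * E.m + 2 * E.n) * (u * v) = -6 * E.l * κ ^ 2) :
    36 * (E.levelDiag κ (-1) (-1) 0 j u v * E.conj.levelDiag κ (-1) (-1) 0 j v u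
      - E.levelOff κ (-1) (-1) j u * E.conj.levelOff κ (-1) (-1) j v) =
    (κ * (u * v)) ^ 2 * ((3 * E.m + 2 * E.n) * ((j - 3) * (j - 4) * (j + 1))) *
      (j * ((3 * E.m + 2 * E.n) * (j ^ 2 - 6 * j + 11) - 6 * E.m)) := by
  have h1 := E.six_mul_levelDiag κ u v j h
  have h2 := E.conj.six_mul_levelDiag κ v u j (by rw [mul_comm v u]; exact h)
  rw [E.conj_I] at h2
  rw [levelOff_eq, levelOff_eq, E.conj_I]
  change 6 * _ = _ * (6 * (2 * E.m * (j - 3) + E.n * (j - 4)) -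
        (3 * E.m + 2 * E.n) * ((j - 1) * (j - 2) * (j - 3))) at h2
  change 36 * (_ - _ * (_ * (E.m * (j - 3) + E.n * (j - 2)))) = _
  linear_combination (6 * E.conj.levelDiag κ (-1) (-1) 0 j v u) * h1 +
    (E.I * κ * (u * v) * (6 * (2 * E.m * (j - 3) + E.n * (j - 4)) -
        (3 * E.m + 2 * E.n) * ((j - 1) * (j - 2) * (j - 3)))) * h2 +
    (κ ^ 2 * (u * v) ^ 2 * (36 * (E.m * (j - 3) + E.n * (j - 2)) ^ 2 -
      (6 * (2 * E.m * (j - 3) + E.n * (j - 4)) -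
        (3 * E.m + 2 * E.n) * ((j - 1) * (j - 2) * (j - 3))) ^ 2)) * E.I_sq

/-- Up to units the level 0 equation is (3m + 2n) u₀ v₀ = -6 l κ², and `hσ` defines `σ` so as to
solve it. -/
theorem coeff_zero_series_eq_zero_iff {κ τ σ : R} (hκ : IsUnit κ)
    (hσ : σ * (3 * E.m + 2 * E.n) = -6 * E.l) (hσ' : IsUnit σ) {W V : R⟦X⟧}
    (hW : IsUnit (PowerSeries.coeff 0 W)) :
    PowerSeries.coeff 0 (E.series κ τ (-1) (-1) 0 W V) = 0 ↔
      PowerSeries.coeff 0 W * PowerSeries.coeff 0 V = σ * κ ^ 2 := by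
  rw [coeff_zero_series, if_pos rfl, ← hσ'.mul_right_eq_zero,
    ← sub_eq_zero (a := _ * PowerSeries.coeff 0 V),
    ← (((E.isUnit_I.mul hW).mul (hκ.mul E.isUnit_l)).mul (isUnit_ofNat 6)).mul_right_eq_zero
      (b := _ - σ * κ ^ 2)]
  refine Eq.congr ?_ rfl
  push_cast
  linear_combination (-(E.I * PowerSeries.coeff 0 W * κ * PowerSeries.coeff 0 W *
    PowerSeries.coeff 0 V)) * hσ

end EquationData

namespace Front

variable {c : NLSCoeffs} {U : Opens (ℝ × ℝ)} {Φ : ℝ × ℝ → ℂ} (X : Front c U Φ)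
variable {α β : ℤ} {d j : ℕ} {u v : ℕ → ℝ × ℝ → ℂ} {W V : (analyticRing U)⟦X⟧}

/-- Cramer's rule, with `w` the inverse of the determinant. -/
theorem levelEqns_existsUnique (hj : j ≠ 0)
    (h : IsUnit (X.E.levelDiag X.κ α β d j (PowerSeries.coeff 0 W) (PowerSeries.coeff 0 V) *
        X.E.conj.levelDiag X.κ β α d j (PowerSeries.coeff 0 V) (PowerSeries.coeff 0 W)
      - X.E.levelOff X.κ α β j (PowerSeries.coeff 0 W) *
        X.E.conj.levelOff X.κ β α j (PowerSeries.coeff 0 V))) :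
    ∃ A B, X.LevelEqns α β d j W V A B ∧
      ∀ A' B', X.LevelEqns α β d j W V A' B' → A' = A ∧ B' = B := by
  simp only [X.levelEqns_iff hj]
  generalize X.E.levelDiag X.κ α β d j (PowerSeries.coeff 0 W) (PowerSeries.coeff 0 V) = p at *
  generalize X.E.levelOff X.κ α β j (PowerSeries.coeff 0 W) = q at *
  generalize X.E.conj.levelDiag X.κ β α d j (PowerSeries.coeff 0 V) (PowerSeries.coeff 0 W) = p'
    at *
  generalize X.E.conj.levelOff X.κ β α j (PowerSeries.coeff 0 V) = q' at *
  generalize PowerSeries.coeff j (X.E.series X.κ X.τ α β d W V) = r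
  generalize PowerSeries.coeff j (X.E.conj.series X.κ X.τ β α d V W) = r'
  obtain ⟨w, hw⟩ := h.exists_right_inv
  refine ⟨PowerSeries.coeff j W + w * (q * r' - p' * r),
    PowerSeries.coeff j V + w * (q' * r - p * r'), ⟨?_, ?_⟩, fun A' B' h => ⟨?_, ?_⟩⟩
  · linear_combination (-r) * hw
  · linear_combination (-r') * hw
  · linear_combination (-(A' - PowerSeries.coeff j W)) * hw + w * p' * h.1 - w * q * h.2
  · linear_combination (-(B' - PowerSeries.coeff j V)) * hw + w * p * h.2 - w * q' * h.1

/-- The first equation determines `B` from `A` because the coefficient of `B` is a unit; `h2` makes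
the second equation redundant. -/
theorem levelEqns_solvable (hj : j ≠ 0)
    (h : IsUnit (X.E.levelOff X.κ α β j (PowerSeries.coeff 0 W)))
    (h2 : ∀ A B, PowerSeries.coeff j (X.E.series X.κ X.τ α β d (setCoeff W j A) (setCoeff V j B)) =
        0 →
      PowerSeries.coeff j (X.E.conj.series X.κ X.τ β α d (setCoeff V j B) (setCoeff W j A)) = 0)
    (A : analyticRing U) :
    ∃ B, X.LevelEqns α β d j W V A B ∧ ∀ B', X.LevelEqns α β d j W V A B' → B' = B := by
  obtain ⟨w, hw⟩ := h.exists_right_inv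
  have e : ∀ B, PowerSeries.coeff j
      (X.E.series X.κ X.τ α β d (setCoeff W j A) (setCoeff V j B)) = _ := fun B =>
    (X.E.perturbs_series X.κ X.τ α β d j hj (perturbs_setCoeff W j A)
      (perturbs_setCoeff V j B)).coeff_self
  simp only [PowerSeries.coeff_zero_eq_constantCoeff] at hw
  refine ⟨PowerSeries.coeff j V - w * (PowerSeries.coeff j (X.E.series X.κ X.τ α β d W V) +
    X.E.levelDiag X.κ α β d j (PowerSeries.constantCoeff W) (PowerSeries.constantCoeff V) *
      (A - PowerSeries.coeff j W)), ⟨?_, h2 _ _ ?_⟩, fun B' hB' => ?_⟩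
  · rw [e]
    linear_combination (-(PowerSeries.coeff j (X.E.series X.κ X.τ α β d W V) +
      X.E.levelDiag X.κ α β d j (PowerSeries.constantCoeff W) (PowerSeries.constantCoeff V) *
        (A - PowerSeries.coeff j W))) * hw
  · rw [e]
    linear_combination (-(PowerSeries.coeff j (X.E.series X.κ X.τ α β d W V) +
      X.E.levelDiag X.κ α β d j (PowerSeries.constantCoeff W) (PowerSeries.constantCoeff V) *
        (A - PowerSeries.coeff j W))) * hw
  · have h3 := hB'.1
    rw [e] at h3
    linear_combination w * h3 - (B' - PowerSeries.coeff j V) * hw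

end Front

end NLSCoeffs

/-! ### Solving a level at and away from resonances -/

namespace NLSCoeffs

open TopologicalSpace

namespace analyticRing

variable {U : Opens (ℝ × ℝ)}

/-- Evaluation at a point. -/
def evalHom (p : U) : analyticRing U →+* ℂ :=
  (Pi.evalRingHom (fun _ : U => ℂ) p).comp (analyticRing U).val.toRingHom

theorem eq_zero_of_forall_hom (w : analyticRing U) (h : ∀ φ : analyticRing U →+* ℂ, φ w = 0) :
    w = 0 := ext' fun p => h (evalHom p)

end analyticRing

namespace EquationData.Normalization.SolvedBelow

variable {R : Type*} [CommRing R] [Algebra ℂ R] {E : EquationData R}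
  {κ τ θ a σ σi u₀ ui v₀ vi : R} {N : E.Normalization κ τ θ a σ σi u₀ ui v₀ vi}

theorem of_perturbs {j : ℕ} (hj : j ≠ 0) {W V W' V' : R⟦X⟧} (h : N.SolvedBelow j W V) {A B : R}
    (hW : Perturbs j W W' A) (hV : Perturbs j V V' B) : N.SolvedBelow j W' V' where
  coeff_zero_U := by rw [hW.coeff_lt (Nat.pos_of_ne_zero hj), h.coeff_zero_U]
  coeff_zero_V := by rw [hV.coeff_lt (Nat.pos_of_ne_zero hj), h.coeff_zero_V]
  eqn i hi := by rw [(E.perturbs_series κ τ _ _ 0 j hj hW hV).coeff_lt hi, h.eqn i hi]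
  eqn_conj i hi :=
      by rw [(E.conj.perturbs_series κ τ _ _ 0 j hj hV hW).coeff_lt hi, h.eqn_conj i hi]

end EquationData.Normalization.SolvedBelow

namespace Front

variable {c : NLSCoeffs} {U : Opens (ℝ × ℝ)} {Φ : ℝ × ℝ → ℂ} (X : Front c U Φ)
variable {j : ℕ} {u v : ℕ → ℝ × ℝ → ℂ} {a σ σi : analyticRing U}

/-- Level 0 supplies u₀ v₀ = σ κ², the condition under which a normalization with these leading
coefficients exists. -/
theorem exists_solvedBelow (a : analyticRing U) (hσ : X.E.dx σ = 0) (hσi : σ * σi = 1)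
    (hs : σ * (3 * X.E.m + 2 * X.E.n) = -6 * X.E.l) (hj : j ≠ 0)
    (hlow : ∀ i < j, Admissible U i (u i) ∧ Admissible U i (v i) ∧
      c.SolvesLevel U Φ (-1) (-1) u v i) :
    ∃ (θ u₀ ui v₀ vi : analyticRing U)
      (N : X.E.Normalization X.κ X.τ θ a σ σi u₀ ui v₀ vi),
      N.SolvedBelow j (powerSeriesOf U u) (powerSeriesOf U v) := by
  have hlev : ∀ i < j, _ := fun i hi => (X.regular.solvesLevel_iff X.dx_eq X.dt_eq
    (d := 0) (by norm_num) (W := powerSeriesOf U u) (V := powerSeriesOf U v) i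
    (fun k hk p => by rw [coeff_powerSeriesOf u k (hlow k (by omega)).1.1]; rfl)
    (fun k hk p => by rw [coeff_powerSeriesOf v k (hlow k (by omega)).2.1.1]; rfl)).1
      (hlow i hi).2.2
  have h0 := hlow 0 (Nat.pos_of_ne_zero hj)
  have hu0 := coeff_powerSeriesOf (U := U) u 0 h0.1.1
  have hv0 := coeff_powerSeriesOf (U := U) v 0 h0.2.1.1
  have hu : IsUnit (PowerSeries.coeff 0 (powerSeriesOf U u)) := by
    rw [hu0, isUnit_restr_iff]; exact h0.1.2 rfl
  have hv : IsUnit (PowerSeries.coeff 0 (powerSeriesOf U v)) := by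
    rw [hv0, isUnit_restr_iff]; exact h0.2.1.2 rfl
  obtain ⟨ui, hui⟩ := hu.exists_right_inv
  obtain ⟨vi, hvi⟩ := hv.exists_right_inv
  obtain ⟨κi, hκi⟩ := X.isUnit_κ.exists_right_inv
  have huv := (X.E.coeff_zero_series_eq_zero_iff X.isUnit_κ hs (IsUnit.of_mul_eq_one _ hσi) hu).1
    (hlev 0 (Nat.pos_of_ne_zero hj)).1
  obtain ⟨N⟩ := X.E.exists_normalization X.κ κi X.τ a σ σi _ ui _ vi hκi X.dx_τ hσ hσi hui hvi huv
  exact ⟨_, _, _, _, _, N, rfl, rfl, fun i hi => (hlev i hi).1, fun i hi => (hlev i hi).2⟩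

/-- At level `0` one of the leading coefficients is arbitrary. -/
theorem hasArbitrary_level_zero (hσi : σ * σi = 1)
    (hs : σ * (3 * X.E.m + 2 * X.E.n) = -6 * X.E.l) :
    HasArbitrary U (Admissible U 0) (fun a b =>
      c.SolvesLevel U Φ (-1) (-1) (Function.update u 0 a) (Function.update v 0 b) 0) 1 := by
  have hσ := IsUnit.of_mul_eq_one _ hσi
  refine hasArbitrary_one (X.describes (d := 0) (by norm_num) (W := 0) (V := 0)
    (fun i hi => absurd hi (Nat.not_lt_zero i)) (fun i hi => absurd hi (Nat.not_lt_zero i)))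
    fun A hA => ?_
  obtain ⟨Ai, hAi⟩ := (hA rfl).exists_right_inv
  have e1 : ∀ B, PowerSeries.coeff 0 (X.E.series X.κ X.τ (-1) (-1) 0 (setCoeff 0 0 A)
      (setCoeff 0 0 B)) = 0 ↔ A * B = σ * X.κ ^ 2 := fun B => by
    have := X.E.coeff_zero_series_eq_zero_iff (τ := X.τ) X.isUnit_κ hs hσ (W := setCoeff 0 0 A)
      (V := setCoeff 0 0 B) (by rw [coeff_setCoeff_self]; exact hA rfl)
    rwa [coeff_setCoeff_self, coeff_setCoeff_self] at this
  have e2 : ∀ B, IsUnit B → (PowerSeries.coeff 0 (X.E.conj.series X.κ X.τ (-1) (-1) 0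
      (setCoeff 0 0 B) (setCoeff 0 0 A)) = 0 ↔ B * A = σ * X.κ ^ 2) := fun B hB => by
    have := X.E.conj.coeff_zero_series_eq_zero_iff (τ := X.τ) X.isUnit_κ hs hσ
      (W := setCoeff 0 0 B) (V := setCoeff 0 0 A) (by rw [coeff_setCoeff_self]; exact hB)
    rwa [coeff_setCoeff_self, coeff_setCoeff_self] at this
  have hB : IsUnit (Ai * (σ * X.κ ^ 2)) :=
    (IsUnit.of_mul_eq_one A (by rw [mul_comm]; exact hAi)).mul (hσ.mul (X.isUnit_κ.pow 2))
  refine ⟨Ai * (σ * X.κ ^ 2), fun _ => hB, ⟨(e1 _).2 ?_, (e2 _ hB).2 ?_⟩, fun B' hB' => ?_⟩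
  · linear_combination (σ * X.κ ^ 2) * hAi
  · linear_combination (σ * X.κ ^ 2) * hAi
  · have := (e1 _).1 hB'.1
    linear_combination Ai * this - B' * hAi

section Levels

variable {θ u₀ ui v₀ vi : analyticRing U} {N : X.E.Normalization X.κ X.τ θ a σ σi u₀ ui v₀ vi}
  {W V : (analyticRing U)⟦X⟧}

/-- At a simple resonance `hrel` is the dependence between the two equations; `ε` is 1 or -1
according to whether `compat_add` or `compat_sub` provides it. -/
theorem levelEqns_solvable_of_relation (hj : j ≠ 0) (h : N.SolvedBelow j W V)
    (hoff : IsUnit (X.E.m * (j - 3) + X.E.n * (j - 2))) (ε : analyticRing U) (hε : IsUnit ε)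
    (hrel : ∀ W' V', N.SolvedBelow j W' V' →
      v₀ * PowerSeries.coeff j (X.E.series X.κ X.τ (-1) (-1) 0 W' V') +
        ε * u₀ * PowerSeries.coeff j (X.E.conj.series X.κ X.τ (-1) (-1) 0 V' W') = 0)
    (A : analyticRing U) :
    ∃ B, X.LevelEqns (-1) (-1) 0 j W V A B ∧
      ∀ B', X.LevelEqns (-1) (-1) 0 j W V A B' → B' = B := by
  have hu₀ := IsUnit.of_mul_eq_one _ N.u₀_mul_ui
  refine X.levelEqns_solvable hj ?_ (fun A B h1 => ?_) A
  · rw [EquationData.levelOff_eq, h.coeff_zero_U]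
    exact ((X.E.isUnit_I.mul X.isUnit_κ).mul (hu₀.pow 2)).mul hoff
  · have := hrel _ _ (h.of_perturbs hj (perturbs_setCoeff W j A) (perturbs_setCoeff V j B))
    rw [h1, mul_zero, zero_add] at this
    exact (hε.mul hu₀).mul_right_eq_zero.1 this

theorem leading_eq (h : N.SolvedBelow j W V) (hj : j ≠ 0) (hσi : σ * σi = 1)
    (hs : σ * (3 * X.E.m + 2 * X.E.n) = -6 * X.E.l) : u₀ * v₀ = σ * X.κ ^ 2 := by
  have hu₀ := IsUnit.of_mul_eq_one _ N.u₀_mul_ui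
  have := (X.E.coeff_zero_series_eq_zero_iff (τ := X.τ) X.isUnit_κ hs
    (IsUnit.of_mul_eq_one _ hσi) (by rw [h.coeff_zero_U]; exact hu₀)).1
    (h.eqn 0 (Nat.pos_of_ne_zero hj))
  rwa [h.coeff_zero_U, h.coeff_zero_V] at this

theorem isUnit_levelDet (h : N.SolvedBelow j W V)
    (hs : σ * (3 * X.E.m + 2 * X.E.n) = -6 * X.E.l)
    (hκ : u₀ * v₀ = σ * X.κ ^ 2)
    (hu : IsUnit (((3 * X.E.m + 2 * X.E.n) * ((j - 3) * (j - 4) * (j + 1))) *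
      (j * ((3 * X.E.m + 2 * X.E.n) * (j ^ 2 - 6 * j + 11) - 6 * X.E.m)))) :
    IsUnit (X.E.levelDiag X.κ (-1) (-1) 0 j (PowerSeries.coeff 0 W) (PowerSeries.coeff 0 V) *
        X.E.conj.levelDiag X.κ (-1) (-1) 0 j (PowerSeries.coeff 0 V) (PowerSeries.coeff 0 W)
      - X.E.levelOff X.κ (-1) (-1) j (PowerSeries.coeff 0 W) *
        X.E.conj.levelOff X.κ (-1) (-1) j (PowerSeries.coeff 0 V)) := by
  have hu₀ := IsUnit.of_mul_eq_one _ N.u₀_mul_ui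
  have hv₀ := IsUnit.of_mul_eq_one _ N.v₀_mul_vi
  rw [h.coeff_zero_U, h.coeff_zero_V]
  refine isUnit_of_mul_isUnit_right (x := 36) ?_
  rw [X.E.levelDet_eq X.κ u₀ v₀ j (by linear_combination (3 * X.E.m + 2 * X.E.n) * hκ
    + X.κ ^ 2 * hs), mul_assoc]
  exact ((X.isUnit_κ.mul (hu₀.mul hv₀)).pow 2).mul hu

end Levels

end Front

end NLSCoeffs

/-! ### Sufficiency on a single front -/

namespace NLSCoeffs

open TopologicalSpace

namespace Front

variable {c : NLSCoeffs} {U : Opens (ℝ × ℝ)} {Φ : ℝ × ℝ → ℂ} (X : Front c U Φ)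
variable {j : ℕ} {u v : ℕ → ℝ × ℝ → ℂ} {a σ σi : analyticRing U}

theorem describes_powerSeriesOf (hlow : ∀ i < j, Admissible U i (u i) ∧ Admissible U i (v i) ∧
      c.SolvesLevel U Φ (-1) (-1) u v i) :
    Describes U (X.LevelEqns (-1) (-1) 0 j (powerSeriesOf U u) (powerSeriesOf U v))
      (fun a b => c.SolvesLevel U Φ (-1) (-1) (Function.update u j a) (Function.update v j b) j) :=
  X.describes (by norm_num)
    (fun i hi p => by rw [coeff_powerSeriesOf u i (hlow i hi).1.1]; rfl)
    (fun i hi p => by rw [coeff_powerSeriesOf v i (hlow i hi).2.1.1]; rfl)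

/-- The compatibility conditions suffice in the case `n = -m`. -/
theorem hasArbitrary_hirota (hσ : X.E.dx σ = 0) (hσi : σ * σi = 1) (hn : X.E.n = -X.E.m)
    (hs : σ * X.E.m = -6 * X.E.l) (hC : X.E.Compatible a σ σi) (hd : X.E.dx (X.E.diffH a) = 0)
    (hlow : ∀ i < j, Admissible U i (u i) ∧ Admissible U i (v i) ∧
      c.SolvesLevel U Φ (-1) (-1) u v i) :
    HasArbitrary U (Admissible U j) (fun a b =>
      c.SolvesLevel U Φ (-1) (-1) (Function.update u j a) (Function.update v j b) j)
      (({0, 1, 3, 4, 5} : Multiset ℕ).count j) := by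
  have hs' : σ * (3 * X.E.m + 2 * X.E.n) = -6 * X.E.l := by rw [hn]; linear_combination hs
  rcases eq_or_ne j 0 with rfl | hj
  · exact X.hasArbitrary_level_zero hσi hs'
  obtain ⟨θ, u₀, ui, v₀, vi, N, hN⟩ := X.exists_solvedBelow a hσ hσi hs' hj hlow
  have hm : IsUnit X.E.m := by
    refine isUnit_of_mul_isUnit_right (x := σ) ?_
    rw [hs]
    exact (EquationData.isUnit_ofNat 6).neg.mul X.E.isUnit_l
  have hoff : IsUnit (X.E.m * ((j : analyticRing U) - 3) + X.E.n * (j - 2)) := by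
    rw [hn, show X.E.m * ((j : analyticRing U) - 3) + -X.E.m * (j - 2) = -X.E.m by ring]
    exact hm.neg
  have hcompat := N.hirota_compat analyticRing.eq_zero_of_forall_hom hC hd
    (by linear_combination X.E.linv * hs - 6 * X.E.l_linv)
    (by rw [hn]; linear_combination -X.E.linv * hs + 6 * X.E.l_linv)
  have one : ∀ ε : analyticRing U, IsUnit ε → (∀ W' V', N.SolvedBelow j W' V' →
      v₀ * PowerSeries.coeff j (X.E.series X.κ X.τ (-1) (-1) 0 W' V') +
        ε * u₀ * PowerSeries.coeff j (X.E.conj.series X.κ X.τ (-1) (-1) 0 V' W') = 0) →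
      HasArbitrary U (Admissible U j) (fun a b =>
        c.SolvesLevel U Φ (-1) (-1) (Function.update u j a) (Function.update v j b) j) 1 := by
    intro ε hε hrel
    refine hasArbitrary_one (X.describes_powerSeriesOf hlow) fun A _ => ?_
    obtain ⟨B, hB⟩ := X.levelEqns_solvable_of_relation hj hN hoff ε hε hrel A
    exact ⟨B, fun h => absurd h hj, hB⟩
  by_cases hres : j = 1 ∨ j = 3 ∨ j = 4 ∨ j = 5
  · rcases hres with rfl | rfl | rfl | rfl
    · exact one 1 isUnit_one fun W' V' h => by
        have := h.compat_add ((hcompat W' V').1 h)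
        linear_combination this
    · exact one (-1) (IsUnit.of_mul_eq_one (-1) (by ring)) fun W' V' h => by
        have := h.compat_sub ((hcompat W' V').2.1 h)
        linear_combination this
    · exact one (-1) (IsUnit.of_mul_eq_one (-1) (by ring)) fun W' V' h => by
        have := h.compat_sub ((hcompat W' V').2.2.1 h)
        linear_combination this
    · exact one 1 isUnit_one fun W' V' h => by
        have := h.compat_add ((hcompat W' V').2.2.2 h)
        linear_combination this
  · push Not at hres
    rw [Multiset.count_eq_zero.2 (by simp; omega)]
    refine hasArbitrary_zero hj (X.describes_powerSeriesOf hlow) (X.levelEqns_existsUnique hj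
      (X.isUnit_levelDet hN hs' (X.leading_eq hN hj hσi hs') ?_))
    -- For n = -m the quadratic factor is m (j² - 6j + 5) = m (j - 1)(j - 5).
    have h1 : ((j : ℤ) - 3) * (j - 4) * (j + 1) * j * (j - 1) * (j - 5) ≠ 0 := by
      simp only [mul_ne_zero_iff]
      omega
    have h2 := (hm.pow 2).mul (EquationData.isUnit_intCast (R := analyticRing U) h1)
    push_cast at h2
    rw [hn]
    convert h2 using 1
    ring

/-- The compatibility conditions suffice in the case `n = -m / 2`. -/
theorem hasArbitrary_sasaSatsuma (hσ : X.E.dx σ = 0) (hσi : σ * σi = 1)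
    (hn : 2 * X.E.n = -X.E.m) (hs : σ * X.E.m = -3 * X.E.l) (hC : X.E.Compatible a σ σi)
    (hd : X.E.diffH a = 0)
    (hlow : ∀ i < j, Admissible U i (u i) ∧ Admissible U i (v i) ∧
      c.SolvesLevel U Φ (-1) (-1) u v i) :
    HasArbitrary U (Admissible U j) (fun a b =>
      c.SolvesLevel U Φ (-1) (-1) (Function.update u j a) (Function.update v j b) j)
      (({0, 2, 3, 4, 4} : Multiset ℕ).count j) := by
  have hs' : σ * (3 * X.E.m + 2 * X.E.n) = -6 * X.E.l := by rw [hn]; linear_combination 2 * hs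
  rcases eq_or_ne j 0 with rfl | hj
  · exact X.hasArbitrary_level_zero hσi hs'
  obtain ⟨θ, u₀, ui, v₀, vi, N, hN⟩ := X.exists_solvedBelow a hσ hσi hs' hj hlow
  have hm : IsUnit X.E.m := by
    refine isUnit_of_mul_isUnit_right (x := σ) ?_
    rw [hs]
    exact (EquationData.isUnit_ofNat 3).neg.mul X.E.isUnit_l
  have hcompat := N.sasaSatsuma_compat analyticRing.eq_zero_of_forall_hom hC hd
    (by linear_combination X.E.linv * hs - 3 * X.E.l_linv)
    (by linear_combination -X.E.linv * hs + 3 * X.E.l_linv + σ * X.E.linv * hn)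
  -- The off-diagonal factor is m (j - 4)/2, a unit except at the double resonance, which needs
  -- separate treatment.
  have one : j < 4 → ∀ ε : analyticRing U, IsUnit ε → (∀ W' V', N.SolvedBelow j W' V' →
      v₀ * PowerSeries.coeff j (X.E.series X.κ X.τ (-1) (-1) 0 W' V') +
        ε * u₀ * PowerSeries.coeff j (X.E.conj.series X.κ X.τ (-1) (-1) 0 V' W') = 0) →
      HasArbitrary U (Admissible U j) (fun a b =>
        c.SolvesLevel U Φ (-1) (-1) (Function.update u j a) (Function.update v j b) j) 1 := by
    intro hj4 ε hε hrel
    have hoff : IsUnit (X.E.m * ((j : analyticRing U) - 3) + X.E.n * (j - 2)) := by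
      refine isUnit_of_mul_isUnit_right (x := 2) ?_
      have h1 : ((j : ℤ) - 4) ≠ 0 := by omega
      have h2 := hm.mul (EquationData.isUnit_intCast (R := analyticRing U) h1)
      push_cast at h2
      convert h2 using 1
      linear_combination ((j : analyticRing U) - 2) * hn
    refine hasArbitrary_one (X.describes_powerSeriesOf hlow) fun A _ => ?_
    obtain ⟨B, hB⟩ := X.levelEqns_solvable_of_relation hj hN hoff ε hε hrel A
    exact ⟨B, fun h => absurd h hj, hB⟩
  by_cases hres : j = 2 ∨ j = 3 ∨ j = 4
  · rcases hres with rfl | rfl | rfl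
    · exact one (by norm_num) 1 isUnit_one fun W' V' h => by
        have := h.compat_add ((hcompat W' V').1 h)
        linear_combination this
    · exact one (by norm_num) (-1) (IsUnit.of_mul_eq_one (-1) (by ring)) fun W' V' h => by
        have := h.compat_sub ((hcompat W' V').2.1 h)
        linear_combination this
    · refine hasArbitrary_two (X.describes_powerSeriesOf hlow) fun A B => ?_
      have h := hN.of_perturbs hj (perturbs_setCoeff _ 4 A) (perturbs_setCoeff _ 4 B)
      exact ⟨h.compat_eq_zero ((hcompat _ _).2.2 h).1,
        h.compat_conj_eq_zero ((hcompat _ _).2.2 h).2⟩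
  · push Not at hres
    rw [Multiset.count_eq_zero.2 (by simp; omega)]
    refine hasArbitrary_zero hj (X.describes_powerSeriesOf hlow) (X.levelEqns_existsUnique hj
      (X.isUnit_levelDet hN hs' (X.leading_eq hN hj hσi hs') ?_))
    -- Here 3m + 2n = 2m and the quadratic factor is 2m (j - 2)(j - 4); so 4 is a root of both
    -- factors of the determinant.
    have h1 : 4 * (((j : ℤ) - 3) * (j - 4) * (j + 1) * j * (j - 2) * (j - 4)) ≠ 0 := by
      simp only [mul_ne_zero_iff]
      omega
    have h2 := (hm.pow 2).mul (EquationData.isUnit_intCast (R := analyticRing U) h1)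
    push_cast at h2
    rw [hn]
    convert h2 using 1
    ring

end Front

end NLSCoeffs

/-! ### Real and imaginary parts of the conditions -/

namespace NLSCoeffs

namespace EquationData

variable {R : Type*} [CommRing R] [Algebra ℂ R]

/-- The coefficients of the equation split into real and imaginary parts. -/
structure Parts (E : EquationData R) where
  f₁ : R
  f₂ : R
  g₁ : R
  g₂ : R
  h₁ : R
  h₂ : R
  k₁ : R
  k₂ : R
  minv : R
  f_eq : E.f = f₁ + E.I * f₂
  fb_eq : E.fb = f₁ - E.I * f₂
  g_eq : E.g = g₁ + E.I * g₂
  gb_eq : E.gb = g₁ - E.I * g₂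
  h_eq : E.h = h₁ + E.I * h₂
  hb_eq : E.hb = h₁ - E.I * h₂
  k_eq : E.k = k₁ + E.I * k₂
  kb_eq : E.kb = k₁ - E.I * k₂
  m_minv : E.m * minv = 1

namespace Parts

variable {E : EquationData R} (P : E.Parts)

/-- The gauge that removes `f` and `g` from the equation. -/
def gauge : R := P.g₁ * P.minv

/-- The part of `k₂` that is affine in `x` for integrable equations. -/
def drift : R := P.k₂ + 3 * E.l * P.gauge ^ 2

/-- The part of `h₁` whose derivative in `x` is that of an integral for integrable equations. -/
def potential : R :=
  P.h₁ - P.gauge * P.drift + E.l * P.gauge ^ 3 - E.l * E.dx (E.dx P.gauge)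

/-- The conditions on the equation that are common to both integrable cases. -/
structure Integrable : Prop where
  f₁ : P.f₁ = 3 * E.l * P.gauge
  f₂ : P.f₂ = 0
  g₂ : P.g₂ = 0
  k₁ : P.k₁ = 3 * E.l * E.dx P.gauge
  drift : E.dx (E.dx P.drift) = 0
  h₂ : 2 * P.h₂ = E.dt E.m * P.minv - E.dt E.l * E.linv - 6 * E.l * P.gauge * E.dx P.gauge
    + 2 * E.dx P.drift

theorem dx_minv : E.dx P.minv = 0 := by
  have h := congrArg E.dx P.m_minv
  rw [Derivation.leibniz, E.dx_m, smul_zero, add_zero, Derivation.map_one_eq_zero, smul_eq_mul] at h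
  linear_combination P.minv * h - E.dx P.minv * P.m_minv

theorem normF_eq : E.normF P.gauge =
    E.linv * P.f₂ - E.I * E.linv * (P.f₁ - 3 * E.l * P.gauge) := by
  rw [normF, P.f_eq]
  linear_combination -(E.linv * P.f₂) * E.I_sq - 3 * E.I * P.gauge * E.l_linv

theorem conj_normF_eq : E.conj.normF P.gauge =
    E.linv * P.f₂ + E.I * E.linv * (P.f₁ - 3 * E.l * P.gauge) := by
  rw [normF, conj_I]
  change -(-E.I) * E.linv * E.fb + 3 * -E.I * P.gauge = _
  rw [P.fb_eq]
  linear_combination -(E.linv * P.f₂) * E.I_sq + 3 * E.I * P.gauge * E.l_linv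

theorem normG_eq (σ : R) : E.normG P.gauge σ = σ * E.linv * P.g₂ := by
  rw [normG, P.g_eq, gauge]
  linear_combination -(σ * E.linv * P.g₂) * E.I_sq + σ * E.linv * E.I * P.g₁ * P.m_minv

theorem conj_normG_eq (σ : R) : E.conj.normG P.gauge σ = σ * E.linv * P.g₂ := by
  rw [normG, conj_I]
  change σ * E.linv * -E.I * (P.gauge * E.m - E.gb) = _
  rw [P.gb_eq, gauge]
  linear_combination -(σ * E.linv * P.g₂) * E.I_sq - σ * E.linv * E.I * P.g₁ * P.m_minv

section

variable (hf₁ : P.f₁ = 3 * E.l * P.gauge) (hf₂ : P.f₂ = 0)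
include hf₁ hf₂

theorem normK_eq : E.normK P.gauge =
    E.linv * P.drift - E.I * E.linv * (P.k₁ - 3 * E.l * E.dx P.gauge) := by
  rw [normK, P.f_eq, P.k_eq, hf₁, hf₂, drift]
  linear_combination -(E.linv * P.k₂) * E.I_sq
    + (3 * P.gauge ^ 2 - 3 * E.I * E.dx P.gauge) * E.l_linv

theorem conj_normK_eq : E.conj.normK P.gauge =
    E.linv * P.drift + E.I * E.linv * (P.k₁ - 3 * E.l * E.dx P.gauge) := by
  rw [normK, conj_I]
  change -(-E.I) * E.linv * E.kb + 2 * P.gauge * E.linv * E.fb + 3 * -E.I * E.dx P.gauge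
    - 3 * P.gauge ^ 2 = _
  rw [P.fb_eq, P.kb_eq, hf₁, hf₂, drift]
  linear_combination -(E.linv * P.k₂) * E.I_sq
    + (3 * P.gauge ^ 2 + 3 * E.I * E.dx P.gauge) * E.l_linv

/-- In the sum the part `h₁` cancels. The logarithmic derivatives come from σ = s l / m, with `s`
constant in time: σ_t/σ = l_t/l - m_t/m. -/
theorem sumH_eq (hk₁ : P.k₁ = 3 * E.l * E.dx P.gauge) {s σ σi : R} (hs : E.dt s = 0)
    (hσ : σ * E.m = s * E.l) (hσi : σ * σi = 1) : E.sumH P.gauge σ σi =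
      E.linv * (2 * P.h₂ + E.dt E.l * E.linv - E.dt E.m * P.minv
        + 6 * E.l * P.gauge * E.dx P.gauge) := by
  have hd : E.dt σ * σi = E.dt E.l * E.linv - E.dt E.m * P.minv := by
    have h := congrArg E.dt hσ
    simp only [Derivation.leibniz, smul_eq_mul, hs, mul_zero, add_zero] at h
    linear_combination (P.minv * σi) * h - E.dt σ * σi * P.m_minv - P.minv * E.dt E.m * hσi
      + E.dt E.l * (-(s * P.minv * σi) * E.l_linv - E.linv * P.minv * σi * hσ
        + E.m * P.minv * E.linv * hσi + E.linv * P.m_minv)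
  rw [sumH, hd]
  simp only [normH, conj_I]
  change _ + (-(-E.I) * E.linv * E.hb + P.gauge * E.linv * E.kb
    - -E.I * E.linv * (-E.I * E.dx P.gauge - P.gauge ^ 2) * E.fb
    + -E.I * E.dx (E.dx P.gauge) - 3 * P.gauge * E.dx P.gauge - -E.I * P.gauge ^ 3) + _ = _
  rw [P.f_eq, P.fb_eq, P.h_eq, P.hb_eq, P.k_eq, P.kb_eq, hf₁, hf₂, hk₁]
  linear_combination (-2 * E.linv * P.h₂ - 6 * E.l * E.linv * P.gauge * E.dx P.gauge) * E.I_sq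
    + 6 * P.gauge * E.dx P.gauge * E.l_linv

/-- Only terms odd in i survive in the difference of the two coefficients; `potential` is their
collection, divided by -2 i / l. -/
theorem diffH_eq : E.diffH P.gauge =
    -2 * E.I * E.linv * (E.dx P.potential - E.dt P.gauge) := by
  have h : E.normH P.gauge - E.conj.normH P.gauge = -2 * E.I * E.linv * P.potential := by
    simp only [normH, conj_I]
    change _ - (-(-E.I) * E.linv * E.hb + P.gauge * E.linv * E.kb
      - -E.I * E.linv * (-E.I * E.dx P.gauge - P.gauge ^ 2) * E.fb
      + -E.I * E.dx (E.dx P.gauge) - 3 * P.gauge * E.dx P.gauge - -E.I * P.gauge ^ 3) = _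
    rw [P.f_eq, P.fb_eq, P.h_eq, P.hb_eq, P.k_eq, P.kb_eq, hf₁, hf₂, potential, drift]
    linear_combination E.I * (2 * P.gauge ^ 3 - 2 * E.dx (E.dx P.gauge)) * E.l_linv
  rw [diffH, h]
  simp only [Derivation.leibniz, dx_linv, dx_I, smul_eq_mul, Derivation.map_neg, mul_zero]
  have h2 : E.dx (2 : R) = 0 := E.dx.map_natCast 2
  rw [h2]
  ring

end

section

variable {s σ σi : R} (hs : E.dt s = 0) (hσ : σ * E.m = s * E.l) (hσi : σ * σi = 1)
include hs hσ hσi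

/-- Sums and differences of conjugate conditions isolate real and imaginary parts, since 2, i, 1/l
and σ are units. The conditions on `f` come first because they simplify `normK`, and then those on
`f₁`, `f₂`, `k₁` simplify `sumH`. -/
theorem compatible_iff : E.Compatible P.gauge σ σi ↔ P.Integrable := by
  have hl : IsUnit E.linv := IsUnit.of_mul_eq_one E.l (by rw [mul_comm, E.l_linv])
  have h2 : IsUnit (2 : R) := isUnit_ofNat 2
  have hI : IsUnit E.I := E.isUnit_I
  have hu : IsUnit σ := IsUnit.of_mul_eq_one _ hσi
  constructor
  · rintro ⟨e1, e2, e3, e4, e5, e6, e7⟩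
    rw [P.normF_eq] at e1
    rw [P.conj_normF_eq] at e2
    rw [P.normG_eq] at e3
    have hf₂ : P.f₂ = 0 := (h2.mul hl).mul_right_eq_zero.1 (by linear_combination e1 + e2)
    have hf₁ : P.f₁ = 3 * E.l * P.gauge := sub_eq_zero.1
      (((h2.mul hI).mul hl).mul_right_eq_zero.1 (by linear_combination e2 - e1))
    rw [P.conj_normK_eq hf₁ hf₂, P.normK_eq hf₁ hf₂] at e5
    have hk₁ : P.k₁ = 3 * E.l * E.dx P.gauge := sub_eq_zero.1
      (((h2.mul hI).mul hl).mul_right_eq_zero.1 (by linear_combination e5))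
    have hK : E.normK P.gauge = E.linv * P.drift := by
      rw [P.normK_eq hf₁ hf₂]; linear_combination -E.I * E.linv * hk₁
    rw [hK] at e6 e7
    rw [P.sumH_eq hf₁ hf₂ hk₁ hs hσ hσi] at e7
    simp only [Derivation.leibniz, dx_linv, smul_eq_mul, mul_zero, add_zero] at e6 e7
    refine ⟨hf₁, hf₂, (hu.mul hl).mul_right_eq_zero.1 e3, hk₁, hl.mul_right_eq_zero.1 e6, ?_⟩
    exact sub_eq_zero.1 (hl.mul_right_eq_zero.1 (by linear_combination e7))
  · rintro ⟨hf₁, hf₂, hg₂, hk₁, hK2, hh₂⟩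
    have hK : E.normK P.gauge = E.linv * P.drift := by
      rw [P.normK_eq hf₁ hf₂]; linear_combination -E.I * E.linv * hk₁
    refine ⟨?_, ?_, ?_, ?_, ?_, ?_, ?_⟩
    · rw [P.normF_eq, hf₂, hf₁]; ring
    · rw [P.conj_normF_eq, hf₂, hf₁]; ring
    · rw [P.normG_eq, hg₂, mul_zero]
    · rw [P.conj_normG_eq, hg₂, mul_zero]
    · rw [P.conj_normK_eq hf₁ hf₂, hK]; linear_combination E.I * E.linv * hk₁
    · rw [hK]
      simp only [Derivation.leibniz, dx_linv, smul_eq_mul, mul_zero, add_zero, hK2]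
    · rw [P.sumH_eq hf₁ hf₂ hk₁ hs hσ hσi, hK]
      simp only [Derivation.leibniz, dx_linv, smul_eq_mul, mul_zero, add_zero]
      linear_combination E.linv * hh₂

end

theorem Integrable.diffH_eq_zero_iff {P : E.Parts} (h : P.Integrable) :
    E.diffH P.gauge = 0 ↔ E.dx P.potential = E.dt P.gauge := by
  have hl : IsUnit E.linv := IsUnit.of_mul_eq_one E.l (by rw [mul_comm, E.l_linv])
  rw [P.diffH_eq h.f₁ h.f₂, (((isUnit_ofNat 2).neg.mul E.isUnit_I).mul hl).mul_right_eq_zero,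
    sub_eq_zero]

theorem Integrable.dx_diffH_eq_zero_iff {P : E.Parts} (h : P.Integrable) :
    E.dx (E.diffH P.gauge) = 0 ↔ E.dx (E.dx P.potential - E.dt P.gauge) = 0 := by
  have hl : IsUnit E.linv := IsUnit.of_mul_eq_one E.l (by rw [mul_comm, E.l_linv])
  have h2 : E.dx (-2 : R) = 0 := by rw [Derivation.map_neg]; simpa using E.dx.map_natCast 2
  rw [P.diffH_eq h.f₁ h.f₂, Derivation.leibniz, Derivation.leibniz, Derivation.leibniz, h2, dx_I,
    dx_linv]
  simp only [smul_eq_mul, mul_zero, add_zero]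
  rw [(((isUnit_ofNat 2).neg.mul E.isUnit_I).mul hl).mul_right_eq_zero]

end Parts

end EquationData

end NLSCoeffs

/-! ### Pointwise form of the conditions -/

namespace NLSCoeffs

open TopologicalSpace

namespace analyticRing

variable {U : Opens (ℝ × ℝ)} {φ ψ : analyticRing U} {F G : ℝ × ℝ → ℝ}

/-- The element `φ` is the restriction of the real function `F`. -/
def IsReal (φ : analyticRing U) (F : ℝ × ℝ → ℝ) : Prop := ∀ p : U, φ.1 p = (F p : ℂ)

namespace IsReal

theorem add (hF : IsReal φ F) (hG : IsReal ψ G) : IsReal (φ + ψ) (fun p => F p + G p) := fun p => by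
  simp [hF p, hG p]

theorem sub (hF : IsReal φ F) (hG : IsReal ψ G) : IsReal (φ - ψ) (fun p => F p - G p) := fun p => by
  simp [hF p, hG p]

theorem mul (hF : IsReal φ F) (hG : IsReal ψ G) : IsReal (φ * ψ) (fun p => F p * G p) := fun p => by
  simp [hF p, hG p]

theorem pow (hF : IsReal φ F) (n : ℕ) : IsReal (φ ^ n) (fun p => F p ^ n) := fun p => by
  simp [hF p]

theorem ofNat (n : ℕ) [n.AtLeastTwo] :
    IsReal (OfNat.ofNat n : analyticRing U) (fun _ => OfNat.ofNat n) := fun _ =>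
  Complex.ofReal_ofNat n

theorem zero : IsReal (0 : analyticRing U) (fun _ => 0) := fun p => by simp

theorem congr (hF : IsReal φ F) (h : ∀ p : U, F p = G p) : IsReal φ G := fun p => by
  rw [hF p, h p]

theorem eq_iff (hF : IsReal φ F) (hG : IsReal ψ G) : φ = ψ ↔ ∀ p ∈ U, F p = G p := by
  refine ⟨fun h p hp => ?_, fun h => ext' fun p => by rw [hF p, hG p, h p p.2]⟩
  have h1 := hF ⟨p, hp⟩
  rw [h, hG ⟨p, hp⟩] at h1
  exact_mod_cast h1.symm

/-- Near a point of `U` the function agrees with the real part of an analytic function, so no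
regularity of `F` has to be assumed. -/
theorem analyticAt (hF : IsReal φ F) {p : ℝ × ℝ} (hp : p ∈ U) : AnalyticAt ℝ F p := by
  have h : AnalyticAt ℝ (fun q => (extend φ q).re) p :=
    (Complex.reCLM.analyticAt _).comp (extend_analytic φ p hp)
  refine h.congr (Filter.eventuallyEq_of_mem (U.isOpen.mem_nhds hp) fun q hq => ?_)
  have := extend_apply φ ⟨q, hq⟩
  simp only at this
  rw [this, hF ⟨q, hq⟩, Complex.ofReal_re]

theorem dirDeriv (hF : IsReal φ F) (v : ℝ × ℝ) :
    IsReal (dirDeriv v φ) (fun p => fderiv ℝ F p v) := fun p => by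
  rw [dirDeriv_apply v (fun p => (F p : ℂ)) φ hF p]
  have h := Complex.ofRealCLM.hasFDerivAt.comp (p : ℝ × ℝ)
    (hF.analyticAt p.2).differentiableAt.hasFDerivAt
  have h2 : HasFDerivAt (fun q => (F q : ℂ)) (Complex.ofRealCLM.comp (fderiv ℝ F p)) p := h
  rw [h2.fderiv]
  rfl

theorem dirDeriv_fst (hF : IsReal φ F) : IsReal (analyticRing.dirDeriv (1, 0) φ) (dx F) :=
  hF.dirDeriv (1, 0)

theorem hasDerivAt (hF : IsReal φ F) {x t : ℝ} (hp : (x, t) ∈ U) :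
    HasDerivAt (fun s => F (s, t)) (dx F (x, t)) x := by
  have h := (hF.analyticAt hp).differentiableAt.hasFDerivAt
  have h2 : HasDerivAt (fun s : ℝ => (s, t)) (1, 0) x := (hasDerivAt_id x).prodMk (hasDerivAt_const
      x t)
  exact h.comp_hasDerivAt x h2

end IsReal

end analyticRing

/-- The part of the imaginary part of `k` that is affine in `x` for integrable equations. -/
noncomputable def drift (c : NLSCoeffs) (p : ℝ × ℝ) : ℝ :=
  (c.k p).im + 3 * c.l p.2 / c.m p.2 ^ 2 * (c.g p).re ^ 2

/-- The time derivative of `g₁ / m`. -/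
noncomputable def source (c : NLSCoeffs) (p : ℝ × ℝ) : ℝ :=
  dt (fun p => (c.g p).re) p / c.m p.2 - deriv c.m p.2 * (c.g p).re / c.m p.2 ^ 2

/-- The part of the real part of `h` that is the integral of the source, up to a function affine in
`x`, for integrable equations. -/
noncomputable def potential (c : NLSCoeffs) (p : ℝ × ℝ) : ℝ :=
  (c.h p).re - c.drift p * ((c.g p).re / c.m p.2) + c.l p.2 / c.m p.2 ^ 3 * (c.g p).re ^ 3
    - c.l p.2 / c.m p.2 * dx (dx (fun p => (c.g p).re)) p

/-- The pointwise form of the compatibility conditions, except for the one on the real part of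
`h`. -/
structure PointwiseConditions (c : NLSCoeffs) (S : Set (ℝ × ℝ)) : Prop where
  f_re : ∀ p ∈ S, (c.f p).re = 3 * c.l p.2 / c.m p.2 * (c.g p).re
  f_im : ∀ p ∈ S, (c.f p).im = 0
  g_im : ∀ p ∈ S, (c.g p).im = 0
  k_re : ∀ p ∈ S, (c.k p).re = 3 * c.l p.2 / c.m p.2 * dx (fun p => (c.g p).re) p
  drift : ∀ p ∈ S, dx (dx c.drift) p = 0
  h_im : ∀ p ∈ S, (c.h p).im = deriv c.m p.2 / (2 * c.m p.2) - deriv c.l p.2 / (2 * c.l p.2)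
    - 3 * c.l p.2 / c.m p.2 ^ 2 * (c.g p).re * dx (fun p => (c.g p).re) p + dx c.drift p

theorem PointwiseConditions.mono {c : NLSCoeffs} {S S' : Set (ℝ × ℝ)} (h : c.PointwiseConditions S)
    (hS : S' ⊆ S) : c.PointwiseConditions S' :=
  ⟨fun p hp => h.f_re p (hS hp), fun p hp => h.f_im p (hS hp), fun p hp => h.g_im p (hS hp),
    fun p hp => h.k_re p (hS hp), fun p hp => h.drift p (hS hp), fun p hp => h.h_im p (hS hp)⟩

namespace RegularOn

open analyticRing

variable {c : NLSCoeffs} {U : Opens (ℝ × ℝ)} (hc : c.RegularOn U)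

/-- The real parts and imaginary parts of the coefficients of the equation. -/
noncomputable def parts (hm : ∀ p ∈ U, (c.m p.2 : ℂ) ≠ 0) : hc.data.Parts :=
  have re : ∀ {F : ℝ × ℝ → ℂ}, AnalyticOnNhd ℝ F U → AnalyticOnNhd ℝ (fun p => ((F p).re : ℂ)) U :=
    fun {F} hF p hp => (Complex.ofRealCLM.analyticAt _).comp_of_eq (f := fun q => (F q).re)
      ((Complex.reCLM.analyticAt _).comp (hF p hp)) rfl
  have im : ∀ {F : ℝ × ℝ → ℂ}, AnalyticOnNhd ℝ F U → AnalyticOnNhd ℝ (fun p => ((F p).im : ℂ)) U :=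
    fun {F} hF p hp => (Complex.ofRealCLM.analyticAt _).comp_of_eq (f := fun q => (F q).im)
      ((Complex.imCLM.analyticAt _).comp (hF p hp)) rfl
  have eq : ∀ z : ℂ, z = z.re + Complex.I * z.im := fun z => by
    rw [mul_comm, Complex.re_add_im]
  have eq_conj : ∀ z : ℂ, (starRingEnd ℂ) z = z.re - Complex.I * z.im := fun z => by
    apply Complex.ext <;> simp
  { f₁ := restr _ (re hc.f)
    f₂ := restr _ (im hc.f)
    g₁ := restr _ (re hc.g)
    g₂ := restr _ (im hc.g)
    h₁ := restr _ (re hc.h)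
    h₂ := restr _ (im hc.h)
    k₁ := restr _ (re hc.k)
    k₂ := restr _ (im hc.k)
    minv := restr (fun p : ℝ × ℝ => (c.m p.2 : ℂ))⁻¹ (fun p hp => (hc.m p hp).inv (hm p hp))
    f_eq := ext' fun p => eq (c.f p)
    fb_eq := ext' fun p => eq_conj (c.f p)
    g_eq := ext' fun p => eq (c.g p)
    gb_eq := ext' fun p => eq_conj (c.g p)
    h_eq := ext' fun p => eq (c.h p)
    hb_eq := ext' fun p => eq_conj (c.h p)
    k_eq := ext' fun p => eq (c.k p)
    kb_eq := ext' fun p => eq_conj (c.k p)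
    m_minv := ext' fun p => mul_inv_cancel₀ (hm p p.2) }

variable (hm : ∀ p ∈ U, (c.m p.2 : ℂ) ≠ 0)

theorem isReal_l : IsReal hc.data.l (fun p => c.l p.2) := fun _ => rfl

theorem isReal_linv : IsReal hc.data.linv (fun p => (c.l p.2)⁻¹) := fun _ =>
  (Complex.ofReal_inv _).symm

theorem isReal_m : IsReal hc.data.m (fun p => c.m p.2) := fun _ => rfl

theorem isReal_minv : IsReal (hc.parts hm).minv (fun p => (c.m p.2)⁻¹) := fun _ =>
  (Complex.ofReal_inv _).symm

theorem isReal_dt_l : IsReal (hc.data.dt hc.data.l) (fun p => deriv c.l p.2) :=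
  (hc.isReal_l.dirDeriv (0, 1)).congr fun p => by
    have h := differentiableAt_of_comp_snd (hc.isReal_l.analyticAt p.2).differentiableAt
    rw [fderiv_comp_snd c.l _ h, one_smul]

theorem isReal_dt_m : IsReal (hc.data.dt hc.data.m) (fun p => deriv c.m p.2) :=
  (hc.isReal_m.dirDeriv (0, 1)).congr fun p => by
    have h := differentiableAt_of_comp_snd (hc.isReal_m.analyticAt p.2).differentiableAt
    rw [fderiv_comp_snd c.m _ h, one_smul]

theorem isReal_g₁ : IsReal (hc.parts hm).g₁ (fun p => (c.g p).re) := fun _ => rfl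

theorem isReal_gauge : IsReal (hc.parts hm).gauge (fun p => (c.g p).re * (c.m p.2)⁻¹) :=
  (hc.isReal_g₁ hm).mul (hc.isReal_minv hm)

theorem isReal_dx_gauge : IsReal (hc.data.dx (hc.parts hm).gauge)
    (fun p => dx (fun p => (c.g p).re) p * (c.m p.2)⁻¹) := by
  rw [EquationData.Parts.gauge, Derivation.leibniz, (hc.parts hm).dx_minv, smul_zero, zero_add,
    smul_eq_mul, mul_comm]
  exact ((hc.isReal_g₁ hm).dirDeriv (1, 0)).mul (hc.isReal_minv hm)

theorem isReal_dx_dx_gauge : IsReal (hc.data.dx (hc.data.dx (hc.parts hm).gauge))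
    (fun p => dx (dx (fun p => (c.g p).re)) p * (c.m p.2)⁻¹) := by
  have h2 : hc.data.dx (hc.data.dx (hc.parts hm).gauge) =
      hc.data.dx (hc.data.dx (hc.parts hm).g₁) * (hc.parts hm).minv := by
    simp only [EquationData.Parts.gauge, Derivation.leibniz, (hc.parts hm).dx_minv, smul_eq_mul,
      mul_zero, zero_mul, zero_add, add_zero, mul_comm]
  rw [h2]
  exact (((hc.isReal_g₁ hm).dirDeriv (1, 0)).dirDeriv (1, 0)).mul (hc.isReal_minv hm)

/-- The quotient rule; the derivative of 1/m is found by differentiating m · (1/m) = 1. -/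
theorem isReal_dt_gauge : IsReal (hc.data.dt (hc.parts hm).gauge) c.source := by
  have h := congrArg hc.data.dt (hc.parts hm).m_minv
  rw [Derivation.leibniz, Derivation.map_one_eq_zero, smul_eq_mul, smul_eq_mul] at h
  have h2 : hc.data.dt (hc.parts hm).gauge = hc.data.dt (hc.parts hm).g₁ * (hc.parts hm).minv
      - hc.data.dt hc.data.m * (hc.parts hm).g₁ * (hc.parts hm).minv ^ 2 := by
    rw [EquationData.Parts.gauge, Derivation.leibniz, smul_eq_mul, smul_eq_mul]
    linear_combination (hc.parts hm).g₁ * (hc.parts hm).minv * h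
      - (hc.parts hm).g₁ * hc.data.dt (hc.parts hm).minv * (hc.parts hm).m_minv
  rw [h2]
  refine ((((hc.isReal_g₁ hm).dirDeriv (0, 1)).mul (hc.isReal_minv hm)).sub
    ((hc.isReal_dt_m.mul (hc.isReal_g₁ hm)).mul ((hc.isReal_minv hm).pow 2))).congr fun p => ?_
  simp only [source, dt, div_eq_mul_inv, inv_pow]

theorem isReal_drift : IsReal (hc.parts hm).drift c.drift := by
  have h2 : IsReal (hc.parts hm).k₂ (fun p => (c.k p).im) := fun _ => rfl
  refine (h2.add (((IsReal.ofNat 3).mul hc.isReal_l).mul ((hc.isReal_gauge hm).pow 2))).congr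
    fun p => ?_
  simp only [drift, div_eq_mul_inv]
  ring

theorem isReal_potential : IsReal (hc.parts hm).potential c.potential := by
  have h2 : IsReal (hc.parts hm).h₁ (fun p => (c.h p).re) := fun _ => rfl
  refine (((h2.sub ((hc.isReal_gauge hm).mul (hc.isReal_drift hm))).add
    (hc.isReal_l.mul ((hc.isReal_gauge hm).pow 3))).sub
    (hc.isReal_l.mul (hc.isReal_dx_dx_gauge hm))).congr fun p => ?_
  simp only [potential, div_eq_mul_inv]
  ring

theorem integrable_iff : (hc.parts hm).Integrable ↔ c.PointwiseConditions U := by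
  have e₁ : (hc.parts hm).f₁ = 3 * hc.data.l * (hc.parts hm).gauge ↔ ∀ p ∈ U, (c.f p).re = _ :=
    IsReal.eq_iff (F := fun p => (c.f p).re) (fun _ => rfl)
      (((IsReal.ofNat 3).mul hc.isReal_l).mul (hc.isReal_gauge hm))
  have e₂ : (hc.parts hm).f₂ = 0 ↔ ∀ p ∈ U, (c.f p).im = _ :=
    IsReal.eq_iff (F := fun p => (c.f p).im) (fun _ => rfl) IsReal.zero
  have e₃ : (hc.parts hm).g₂ = 0 ↔ ∀ p ∈ U, (c.g p).im = _ :=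
    IsReal.eq_iff (F := fun p => (c.g p).im) (fun _ => rfl) IsReal.zero
  have e₄ : (hc.parts hm).k₁ = 3 * hc.data.l * hc.data.dx (hc.parts hm).gauge ↔
      ∀ p ∈ U, (c.k p).re = _ :=
    IsReal.eq_iff (F := fun p => (c.k p).re) (fun _ => rfl)
      (((IsReal.ofNat 3).mul hc.isReal_l).mul (hc.isReal_dx_gauge hm))
  have hd := (hc.isReal_drift hm).dirDeriv_fst
  have e₅ := hd.dirDeriv_fst.eq_iff IsReal.zero
  have e₆ := ((IsReal.ofNat 2).mul (F := fun _ => 2) (G := fun p => (c.h p).im)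
      (ψ := (hc.parts hm).h₂) (fun _ => rfl)).eq_iff
    ((((hc.isReal_dt_m.mul (hc.isReal_minv hm)).sub (hc.isReal_dt_l.mul hc.isReal_linv)).sub
      ((((IsReal.ofNat 6).mul hc.isReal_l).mul (hc.isReal_gauge hm)).mul
        (hc.isReal_dx_gauge hm))).add ((IsReal.ofNat 2).mul hd))
  constructor
  · rintro ⟨h₁, h₂, h₃, h₄, h₅, h₆⟩
    refine ⟨fun p hp => (e₁.1 h₁ p hp).trans ?_, e₂.1 h₂, e₃.1 h₃,
      fun p hp => (e₄.1 h₄ p hp).trans ?_, e₅.1 h₅, fun p hp => ?_⟩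
    · ring
    · ring
    · have := e₆.1 h₆ p hp
      linear_combination this / 2
  · rintro ⟨h₁, h₂, h₃, h₄, h₅, h₆⟩
    refine ⟨e₁.2 fun p hp => (h₁ p hp).trans ?_, e₂.2 h₂, e₃.2 h₃,
      e₄.2 fun p hp => (h₄ p hp).trans ?_, e₅.2 h₅, e₆.2 fun p hp => ?_⟩
    · ring
    · ring
    · have := h₆ p hp
      linear_combination 2 * this

theorem dx_potential_eq_iff : hc.data.dx (hc.parts hm).potential = hc.data.dt (hc.parts hm).gauge ↔
    ∀ p ∈ U, dx c.potential p = c.source p :=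
  ((hc.isReal_potential hm).dirDeriv (1, 0)).eq_iff (hc.isReal_dt_gauge hm)

theorem dx_sub_eq_zero_iff :
    hc.data.dx (hc.data.dx (hc.parts hm).potential - hc.data.dt (hc.parts hm).gauge) = 0 ↔
    ∀ p ∈ U, dx (fun p => dx c.potential p - c.source p) p = 0 :=
  ((((hc.isReal_potential hm).dirDeriv (1, 0)).sub (hc.isReal_dt_gauge hm)).dirDeriv (1, 0)).eq_iff
    IsReal.zero

end RegularOn

end NLSCoeffs

/-! ### From derivatives in x to functions of time -/

namespace NLSCoeffs

open TopologicalSpace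

open analyticRing

theorem hasDerivAt_integral_of_continuousOn {I : Set ℝ} (hI : IsOpen I) (hI' : I.OrdConnected)
    {x₀ x : ℝ} (hx₀ : x₀ ∈ I) (hx : x ∈ I) {q : ℝ → ℝ} (hq : ContinuousOn q I) :
    HasDerivAt (fun y => ∫ s in x₀..y, q s) (q x) x :=
  intervalIntegral.integral_hasDerivAt_right
    ((hq.mono (hI'.uIcc_subset hx₀ hx)).intervalIntegrable)
    (hq.stronglyMeasurableAtFilter hI x hx) (hq.continuousAt (hI.mem_nhds hx))

theorem eq_of_hasDerivAt_zero {I : Set ℝ} (hI' : I.OrdConnected) {x₀ x : ℝ}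
    (hx₀ : x₀ ∈ I) (hx : x ∈ I) {F : ℝ → ℝ} (hF : ∀ y ∈ I, HasDerivAt F 0 y) : F x = F x₀ := by
  have h := hI'.convex.norm_image_sub_le_of_norm_hasDerivWithin_le (f := F) (f' := fun _ => 0) (C :=
      0)
    (fun y hy => (hF y hy).hasDerivWithinAt) (fun y _ => by simp) hx₀ hx
  rw [zero_mul, norm_le_zero_iff, sub_eq_zero] at h
  exact h

section

variable {c : NLSCoeffs} {I T : Set ℝ} {x₀ : ℝ} {U : Opens (ℝ × ℝ)}

theorem continuousOn_of_isReal {φ : analyticRing U} {F : ℝ × ℝ → ℝ} (hF : IsReal φ F)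
    (hU : (U : Set (ℝ × ℝ)) = I ×ˢ T) {t : ℝ} (ht : t ∈ T) : ContinuousOn (fun s => F (s, t)) I :=
  fun s hs => by
    have hp : (s, t) ∈ U := by
      change (s, t) ∈ (U : Set (ℝ × ℝ)); rw [hU]; exact ⟨hs, ht⟩
    exact (hF.hasDerivAt hp).continuousAt.continuousWithinAt

/-- The compatibility conditions in terms of derivatives. -/
theorem CompatibilityConditions.pointwise (hI : IsOpen I) (hI' : I.OrdConnected) (hx₀ : x₀ ∈ I)
    (hc : c.RegularOn U) (hm : ∀ p ∈ U, (c.m p.2 : ℂ) ≠ 0) (hU : (U : Set (ℝ × ℝ)) = I ×ˢ T)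
    {γ₁ γ₂ β₁ β₂ : ℝ → ℝ} (h : c.CompatibilityConditions I T x₀ γ₁ γ₂ β₁ β₂) :
    c.PointwiseConditions U ∧ ∀ p ∈ U, dx c.potential p - c.source p = β₁ p.2 := by
  have mem : ∀ x t, (x, t) ∈ U ↔ x ∈ I ∧ t ∈ T := fun x t => by
    change (x, t) ∈ (U : Set (ℝ × ℝ)) ↔ _; rw [hU]; rfl
  have hdrift : ∀ x ∈ I, ∀ t ∈ T, c.drift (x, t) = x * γ₁ t + γ₂ t := fun x hx t ht => by
    rw [drift, h.k_im x hx t ht]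
    ring
  have hdx : ∀ p ∈ U, dx c.drift p = γ₁ p.2 := by
    rintro ⟨x, t⟩ hp
    have hp' := (mem x t).1 hp
    have h1 := (hc.isReal_drift hm).hasDerivAt hp
    have h2 : HasDerivAt (fun s => s * γ₁ t + γ₂ t) (γ₁ t) x := by
      simpa using ((hasDerivAt_id x).mul_const (γ₁ t)).add_const (γ₂ t)
    exact h1.unique (h2.congr_of_eventuallyEq
      (Filter.eventuallyEq_of_mem (hI.mem_nhds hp'.1) fun s hs => hdrift s hs t hp'.2))
  refine ⟨⟨?_, ?_, ?_, ?_, ?_, ?_⟩, ?_⟩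
  · rintro ⟨x, t⟩ hp
    exact h.f_re x ((mem x t).1 hp).1 t ((mem x t).1 hp).2
  · rintro ⟨x, t⟩ hp
    exact h.f_im x ((mem x t).1 hp).1 t ((mem x t).1 hp).2
  · rintro ⟨x, t⟩ hp
    exact h.g_im x ((mem x t).1 hp).1 t ((mem x t).1 hp).2
  · rintro ⟨x, t⟩ hp
    exact h.k_re x ((mem x t).1 hp).1 t ((mem x t).1 hp).2
  · intro p hp
    -- The function `γ₁` need not be differentiable: only its independence of x matters.
    have h1 : dx c.drift =ᶠ[nhds p] fun q => γ₁ q.2 :=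
      Filter.eventuallyEq_of_mem (U.isOpen.mem_nhds hp) hdx
    rw [dx, h1.fderiv_eq, fderiv_comp_snd_fst]
  · rintro ⟨x, t⟩ hp
    rw [hdx _ hp]
    exact h.h_im x ((mem x t).1 hp).1 t ((mem x t).1 hp).2
  · rintro ⟨x, t⟩ hp
    have hp' := (mem x t).1 hp
    have h1 := (hc.isReal_potential hm).hasDerivAt hp
    have h2 := ((hasDerivAt_integral_of_continuousOn hI hI' hx₀ hp'.1
      (continuousOn_of_isReal (hc.isReal_dt_gauge hm) hU hp'.2)).add
      ((hasDerivAt_id x).mul_const (β₁ t))).add_const (β₂ t)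
    have h3 := h1.unique (h2.congr_of_eventuallyEq
      (Filter.eventuallyEq_of_mem (hI.mem_nhds hp'.1) fun s hs => ?_))
    · rw [h3]; ring
    · dsimp only [id, Pi.add_apply]
      rw [potential, h.h_re s hs t hp'.2, hdrift s hs t hp'.2]
      simp only [source]
      ring

/-- The compatibility conditions from their form in terms of derivatives. -/
theorem PointwiseConditions.compatibilityConditions (hI' : I.OrdConnected)
    (hx₀ : x₀ ∈ I) (hc : c.RegularOn U) (hm : ∀ p ∈ U, (c.m p.2 : ℂ) ≠ 0)
    (hU : (U : Set (ℝ × ℝ)) = I ×ˢ T) (h : c.PointwiseConditions U) {β₁ : ℝ → ℝ}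
    (hβ : ∀ p ∈ U, dx c.potential p - c.source p = β₁ p.2) :
    ∃ γ₁ γ₂ β₂ : ℝ → ℝ, c.CompatibilityConditions I T x₀ γ₁ γ₂ β₁ β₂ := by
  have mem : ∀ x ∈ I, ∀ t ∈ T, (x, t) ∈ U := fun x hx t ht => by
    change (x, t) ∈ (U : Set (ℝ × ℝ)); rw [hU]; exact ⟨hx, ht⟩
  have hdx : ∀ x ∈ I, ∀ t ∈ T, dx c.drift (x, t) = dx c.drift (x₀, t) := fun x hx t ht =>
    eq_of_hasDerivAt_zero hI' hx₀ hx (F := fun x => dx c.drift (x, t)) fun y hy => by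
      have := (hc.isReal_drift hm).dirDeriv_fst.hasDerivAt (mem y hy t ht)
      rwa [h.drift _ (mem y hy t ht)] at this
  have hdrift : ∀ x ∈ I, ∀ t ∈ T, c.drift (x, t) =
      x * dx c.drift (x₀, t) + (c.drift (x₀, t) - x₀ * dx c.drift (x₀, t)) := fun x hx t ht => by
    have := eq_of_hasDerivAt_zero hI' hx₀ hx
      (F := fun x => c.drift (x, t) - x * dx c.drift (x₀, t)) fun y hy => by
      have h1 := ((hc.isReal_drift hm).hasDerivAt (mem y hy t ht)).sub
        ((hasDerivAt_id y).mul_const (dx c.drift (x₀, t)))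
      rwa [hdx y hy t ht, one_mul, sub_self] at h1
    linear_combination this
  have hpot : ∀ x ∈ I, ∀ t ∈ T, c.potential (x, t) =
      (∫ s in x₀..x, c.source (s, t)) + x * β₁ t + (c.potential (x₀, t) - x₀ * β₁ t) :=
    fun x hx t ht => by
    have hcont := continuousOn_of_isReal (hc.isReal_dt_gauge hm) hU ht
    have := intervalIntegral.integral_eq_sub_of_hasDerivAt
      (f := fun s => c.potential (s, t) - s * β₁ t) (f' := fun s => c.source (s, t))
      (a := x₀) (b := x) (fun y hy => by
        have hy' := hI'.uIcc_subset hx₀ hx hy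
        have h1 := ((hc.isReal_potential hm).hasDerivAt (mem y hy' t ht)).sub
          ((hasDerivAt_id y).mul_const (β₁ t))
        have h2 : c.source (y, t) = dx c.potential (y, t) - 1 * β₁ t := by
          linear_combination -hβ _ (mem y hy' t ht)
        rw [h2]
        exact h1)
      ((hcont.mono (hI'.uIcc_subset hx₀ hx)).intervalIntegrable)
    linear_combination -this
  -- Slope and intercept of the affine function `drift`, read off at `x₀`; the last witness is the
  -- value of the remainder of `potential` at `x₀`, where the integral vanishes.
  refine ⟨fun t => dx c.drift (x₀, t), fun t => c.drift (x₀, t) - x₀ * dx c.drift (x₀, t),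
    fun t => c.potential (x₀, t) - x₀ * β₁ t, ?_, ?_, ?_, ?_, ?_, ?_, ?_⟩
  · exact fun x hx t ht => h.f_re _ (mem x hx t ht)
  · exact fun x hx t ht => h.f_im _ (mem x hx t ht)
  · exact fun x hx t ht => h.g_im _ (mem x hx t ht)
  · exact fun x hx t ht => h.k_re _ (mem x hx t ht)
  · intro x hx t ht
    have := hdrift x hx t ht
    rw [NLSCoeffs.drift] at this
    linear_combination this
  · intro x hx t ht
    have h1 := hpot x hx t ht
    have h2 := hdrift x hx t ht
    rw [potential, h2] at h1
    simp only [source] at h1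
    linear_combination h1
  · intro x hx t ht
    rw [h.h_im _ (mem x hx t ht), hdx x hx t ht]

/-- A function with vanishing `x`-derivative on a rectangle depends on time only. -/
theorem exists_eq_comp_snd (hI' : I.OrdConnected) (hx₀ : x₀ ∈ I)
    (hU : (U : Set (ℝ × ℝ)) = I ×ˢ T) {φ : analyticRing U} {F : ℝ × ℝ → ℝ} (hF : IsReal φ F)
    (h : ∀ p ∈ U, dx F p = 0) : ∃ β : ℝ → ℝ, ∀ p ∈ U, F p = β p.2 := by
  refine ⟨fun t => F (x₀, t), ?_⟩
  rintro ⟨x, t⟩ hp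
  have mem : ∀ y ∈ I, (y, t) ∈ U := fun y hy => by
    change (x, t) ∈ (U : Set (ℝ × ℝ)) at hp
    change (y, t) ∈ (U : Set (ℝ × ℝ)); rw [hU] at hp ⊢; exact ⟨hy, hp.2⟩
  have hx : x ∈ I := by
    change (x, t) ∈ (U : Set (ℝ × ℝ)) at hp
    rw [hU] at hp; exact hp.1
  exact eq_of_hasDerivAt_zero hI' hx₀ hx (F := fun x => F (x, t)) fun y hy => by
    have := hF.hasDerivAt (mem y hy)
    rwa [h _ (mem y hy)] at this

end

end NLSCoeffs

/-! ### Sufficiency on the rectangle -/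

namespace NLSCoeffs

open TopologicalSpace

open analyticRing

/-- The coefficients of the equation are analytic on `I × J`, where `I`, `J` are open intervals. -/
structure AnalyticOnRectangle (c : NLSCoeffs) (I J : Set ℝ) : Prop where
  isOpen_fst : IsOpen I
  ordConnected_fst : I.OrdConnected
  isOpen_snd : IsOpen J
  ordConnected_snd : J.OrdConnected
  f : AnalyticOnNhd ℝ c.f (I ×ˢ J)
  g : AnalyticOnNhd ℝ c.g (I ×ˢ J)
  h : AnalyticOnNhd ℝ c.h (I ×ˢ J)
  k : AnalyticOnNhd ℝ c.k (I ×ˢ J)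
  l : AnalyticOnNhd ℝ c.l J
  m : AnalyticOnNhd ℝ c.m J
  n : AnalyticOnNhd ℝ c.n J

namespace AnalyticOnRectangle

variable {c : NLSCoeffs} {I J : Set ℝ} {x₀ : ℝ} (H : c.AnalyticOnRectangle I J)

include H

theorem isOpen_regularTimes : IsOpen (c.regularTimes J) := by
  have key : ∀ F : ℝ → ℝ, AnalyticOnNhd ℝ F J → IsOpen (J ∩ F ⁻¹' {0}ᶜ) := fun F hF =>
    hF.continuousOn.isOpen_inter_preimage H.isOpen_snd isOpen_compl_singleton
  have : c.regularTimes J = (J ∩ c.l ⁻¹' {0}ᶜ) ∩ ((J ∩ c.m ⁻¹' {0}ᶜ) ∩ (J ∩ c.n ⁻¹' {0}ᶜ)) := by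
    ext t
    simp only [regularTimes, Set.mem_ofPred_eq, Set.mem_inter_iff, Set.mem_preimage,
      Set.mem_compl_iff, Set.mem_singleton_iff]
    tauto
  rw [this]
  exact (key _ H.l).inter ((key _ H.m).inter (key _ H.n))

theorem regularOn {U : Opens (ℝ × ℝ)} (hU : (U : Set (ℝ × ℝ)) ⊆ I ×ˢ c.regularTimes J) :
    c.RegularOn U := by
  have hJ : (U : Set (ℝ × ℝ)) ⊆ I ×ˢ J := fun p hp => ⟨(hU hp).1, (hU hp).2.1⟩
  exact ⟨H.f.mono hJ, H.g.mono hJ, H.h.mono hJ, H.k.mono hJ,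
    analyticOnNhd_comp_snd H.l fun p hp => (hJ hp).2,
    analyticOnNhd_comp_snd H.m fun p hp => (hJ hp).2,
    analyticOnNhd_comp_snd H.n fun p hp => (hJ hp).2,
    fun p hp => by exact_mod_cast (hU hp).2.2.1⟩

omit H in
theorem _root_.NLSCoeffs.m_ne_zero_of_subset {U : Opens (ℝ × ℝ)}
    (hU : (U : Set (ℝ × ℝ)) ⊆ I ×ˢ c.regularTimes J) : ∀ p ∈ U, (c.m p.2 : ℂ) ≠ 0 := fun p hp => by
  exact_mod_cast (hU hp).2.2.2.1

/-- The part of the plane on which the Painlevé test is made. -/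
def domain : Opens (ℝ × ℝ) := ⟨I ×ˢ c.regularTimes J, H.isOpen_fst.prod H.isOpen_regularTimes⟩

omit H in
theorem exists_front {U : Set (ℝ × ℝ)} {Φ : ℝ × ℝ → ℂ} (H : c.AnalyticOnRectangle I J)
    (hU : U ⊆ I ×ˢ c.regularTimes J) (hΦ : c.SingularManifold U Φ) :
    Nonempty (Front c ⟨U, hΦ.isOpen⟩ Φ) :=
  SingularManifold.exists_front (U := ⟨U, hΦ.isOpen⟩) (H.regularOn hU) hΦ

end AnalyticOnRectangle

namespace RegularOn

variable {c : NLSCoeffs} {U : Opens (ℝ × ℝ)} (hc : c.RegularOn U)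
  (hm : ∀ p ∈ U, (c.m p.2 : ℂ) ≠ 0) (s : ℤ)

/-- The ratio `s l / m`. -/
noncomputable def ratio : analyticRing U := s * (hc.data.l * (hc.parts hm).minv)

theorem ratio_mul_m : hc.ratio hm s * hc.data.m = s * hc.data.l := by
  rw [ratio]
  linear_combination s * hc.data.l * (hc.parts hm).m_minv

theorem dx_ratio : hc.data.dx (hc.ratio hm s) = 0 := by
  rw [ratio, Derivation.leibniz, Derivation.leibniz, hc.data.dx_l, (hc.parts hm).dx_minv]
  simp

theorem exists_ratio_mul_eq_one (hs : s ≠ 0) : ∃ σi, hc.ratio hm s * σi = 1 := by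
  have h : IsUnit (hc.ratio hm s) :=
    (EquationData.isUnit_intCast hs).mul (hc.data.isUnit_l.mul
      (IsUnit.of_mul_eq_one hc.data.m (by rw [mul_comm, (hc.parts hm).m_minv])))
  exact h.exists_right_inv

theorem compatible_iff {s : ℤ} {σi : analyticRing U} (hσi : hc.ratio hm s * σi = 1) :
    hc.data.Compatible (hc.parts hm).gauge (hc.ratio hm s) σi ↔ c.PointwiseConditions U := by
  rw [(hc.parts hm).compatible_iff (s := (s : analyticRing U)) (by simp) (hc.ratio_mul_m hm s) hσi,
    hc.integrable_iff hm]

end RegularOn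

section Sufficiency

variable {c : NLSCoeffs} {I J : Set ℝ} (H : c.AnalyticOnRectangle I J)
include H

theorem passesPainleveTest_hirota (hn : ∀ t ∈ J, c.n t = -c.m t)
    (h : c.PointwiseConditions (I ×ˢ c.regularTimes J))
    (hd : ∀ p ∈ I ×ˢ c.regularTimes J, dx (fun p => dx c.potential p - c.source p) p = 0) :
    c.PassesPainleveTest (I ×ˢ c.regularTimes J) := by
  refine ⟨-1, -1, by norm_num, by norm_num, {0, 1, 3, 4, 5}, rfl, fun U hU Φ hΦ j u v hlow => ?_⟩
  obtain ⟨X⟩ := H.exists_front hU hΦ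
  have hm := m_ne_zero_of_subset (U := ⟨U, hΦ.isOpen⟩) hU
  obtain ⟨σi, hσi⟩ := X.regular.exists_ratio_mul_eq_one hm (-6) (by norm_num)
  have hp := h.mono hU
  refine X.hasArbitrary_hirota (X.regular.dx_ratio hm _) hσi ?_ ?_
    ((X.regular.compatible_iff hm hσi).2 hp) ?_ hlow
  · refine ext' fun p => ?_
    change (c.n p.1.2 : ℂ) = -(c.m p.1.2 : ℂ)
    exact_mod_cast hn _ (hU p.2).2.1
  · rw [X.regular.ratio_mul_m]
    norm_num
  · rw [((X.regular.integrable_iff hm).2 hp).dx_diffH_eq_zero_iff]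
    exact (X.regular.dx_sub_eq_zero_iff hm).2 fun p hp => hd p (hU hp)

theorem passesPainleveTest_sasaSatsuma (hn : ∀ t ∈ J, c.n t = -(c.m t / 2))
    (h : c.PointwiseConditions (I ×ˢ c.regularTimes J))
    (hd : ∀ p ∈ I ×ˢ c.regularTimes J, dx c.potential p = c.source p) :
    c.PassesPainleveTest (I ×ˢ c.regularTimes J) := by
  refine ⟨-1, -1, by norm_num, by norm_num, {0, 2, 3, 4, 4}, rfl, fun U hU Φ hΦ j u v hlow => ?_⟩
  obtain ⟨X⟩ := H.exists_front hU hΦ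
  have hm := m_ne_zero_of_subset (U := ⟨U, hΦ.isOpen⟩) hU
  obtain ⟨σi, hσi⟩ := X.regular.exists_ratio_mul_eq_one hm (-3) (by norm_num)
  have hp := h.mono hU
  refine X.hasArbitrary_sasaSatsuma (X.regular.dx_ratio hm _) hσi ?_ ?_
    ((X.regular.compatible_iff hm hσi).2 hp) ?_ hlow
  · refine ext' fun p => ?_
    change 2 * (c.n p.1.2 : ℂ) = -(c.m p.1.2 : ℂ)
    have := hn _ (hU p.2).2.1
    rw [this]
    push_cast
    ring
  · rw [X.regular.ratio_mul_m]
    norm_num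
  · rw [((X.regular.integrable_iff hm).2 hp).diffH_eq_zero_iff]
    exact (X.regular.dx_potential_eq_iff hm).2 fun p hp => hd p (hU hp)

end Sufficiency

end NLSCoeffs

/-! ### The resonances -/

namespace NLSCoeffs

section Resonances

open Polynomial

variable {l m n : ℝ} {κ a b : ℂ}

/-- The determinant is d² - (κ a b e)². By the leading balance the two factors are l κ³ (X + 1)(X -
3)(X - 4) and l κ³ X (X - r)(X - (6 - r)): the quadratic left over has root sum 6, and `hr`
prescribes its root product. -/
theorem resonances_eq (hl : l ≠ 0) (hκ : κ ≠ 0) (hab : (3 * m + 2 * n) * (a * b) = -6 * l * κ ^ 2)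
    (r : ℂ) (hr : (3 * m + 2 * n) * (r * (6 - r)) = 11 * (3 * m + 2 * n) - 6 * m) :
    resonances l m n κ a b = {-1, 0, 3, 4, r, 6 - r} := by
  have hl' : (l : ℂ) ≠ 0 := by exact_mod_cast hl
  have key : (resonanceMatrix l m n κ a b).det = C ((l * κ ^ 3) ^ 2) *
      (({-1, 0, 3, 4, r, 6 - r} : Multiset ℂ).map fun z => X - C z).prod := by
    have h : (3 * C (m : ℂ) + 2 * C (n : ℂ)) * C (κ * a * b) = -6 * C (l * κ ^ 3) := by
      have := congrArg (fun z => C (κ * z)) hab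
      simp only [map_mul, map_add, map_neg, map_pow, map_ofNat] at this ⊢
      linear_combination this
    have h2 : (3 * C (m : ℂ) + 2 * C (n : ℂ)) * (C r * (6 - C r)) =
        11 * (3 * C (m : ℂ) + 2 * C (n : ℂ)) - 6 * C (m : ℂ) := by
      have := congrArg C hr
      simpa only [map_mul, map_add, map_sub, map_ofNat] using this
    have hI : C Complex.I * C Complex.I = -1 := by
      rw [← C_mul, Complex.I_mul_I, C_neg, C_1]
    have e₁ : 6 * (C (l * κ ^ 3) * ((X - 1) * (X - 2) * (X - 3))
        + C (κ * a * b) * (C (2 * m + n : ℂ) * (X - 2) - 2 * C (m + n : ℂ)))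
        + 6 * (C (κ * a * b) * (C (m + n : ℂ) * (X - 1) - C (2 * m + n : ℂ)))
        = 6 * (C (l * κ ^ 3) * ((X + 1) * (X - 3) * (X - 4))) := by
      simp only [C_add, C_mul (a := (2 : ℂ)), map_ofNat]
      linear_combination (6 * X - 18) * h
    have e₂ : 6 * (C (l * κ ^ 3) * ((X - 1) * (X - 2) * (X - 3))
        + C (κ * a * b) * (C (2 * m + n : ℂ) * (X - 2) - 2 * C (m + n : ℂ)))
        - 6 * (C (κ * a * b) * (C (m + n : ℂ) * (X - 1) - C (2 * m + n : ℂ)))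
        = 6 * (C (l * κ ^ 3) * (X * (X - C r) * (X - (6 - C r)))) := by
      simp only [C_add, C_mul (a := (2 : ℂ)), map_ofNat]
      linear_combination ((11 - C r * (6 - C r)) * X - 6) * h + C (κ * a * b) * X * h2
    have h36 : (36 : ℂ[X]) ≠ 0 := by
      rw [← map_ofNat C, Ne, C_eq_zero]; norm_num
    refine mul_left_cancel₀ h36 ?_
    simp only [resonanceMatrix, Matrix.det_fin_two_of, Multiset.insert_eq_cons, Multiset.map_cons,
      Multiset.map_singleton, Multiset.prod_cons, Multiset.prod_singleton]
    have e₃ := congrArg₂ (· * ·) e₁ e₂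
    simp only [neg_mul, C_neg, C_mul, C_pow, map_sub, map_ofNat, C_1, C_0] at e₃ ⊢
    linear_combination (-(C Complex.I * C Complex.I)) * e₃ - 36 * (C (l : ℂ) ^ 2 * C κ ^ 6 *
      ((X + 1) * (X - 3) * (X - 4) * (X * (X - C r) * (X - (6 - C r))))) * hI
  rw [resonances, key, roots_C_mul _ (pow_ne_zero 2 (mul_ne_zero hl' (pow_ne_zero 3 hκ))),
    roots_multiset_prod_X_sub_C]

theorem resonances_of_eq_neg (hl : l ≠ 0) (hκ : κ ≠ 0)
    (hab : (3 * m + 2 * n) * (a * b) = -6 * l * κ ^ 2) (h : n = -m) :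
    resonances l m n κ a b = {-1, 0, 1, 3, 4, 5} := by
  rw [resonances_eq hl hκ hab 1 (by rw [h]; push_cast; ring), show (6 - 1 : ℂ) = 5 by norm_num]
  simp only [Multiset.insert_eq_cons]
  rw [Multiset.cons_swap 4 1, Multiset.cons_swap 3 1]

theorem resonances_of_eq_neg_half (hl : l ≠ 0) (hκ : κ ≠ 0)
    (hab : (3 * m + 2 * n) * (a * b) = -6 * l * κ ^ 2) (h : n = -(m / 2)) :
    resonances l m n κ a b = {-1, 0, 2, 3, 4, 4} := by
  rw [resonances_eq hl hκ hab 2 (by rw [h]; push_cast; ring), show (6 - 2 : ℂ) = 4 by norm_num]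
  simp only [Multiset.insert_eq_cons]
  rw [Multiset.cons_swap 4 2, Multiset.cons_swap 3 2]

/-- The values pair up as j and 6 - j, and the middle value 3 would give n = 0. -/
theorem eq_neg_or_eq_neg_half {j : ℕ} (hn : n ≠ 0) (hj : 0 < j) (hj' : j < 6)
    (h : (3 * m + 2 * n) * (j * (6 - j)) = 11 * (3 * m + 2 * n) - 6 * m) :
    n = -m ∨ n = -(m / 2) := by
  interval_cases j
  · left; norm_num at h; linarith
  · right; norm_num at h; linarith
  · exact absurd (by norm_num at h; linarith) hn
  · right; norm_num at h; linarith
  · left; norm_num at h; linarith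

theorem exists_resonances_iff (hl : l ≠ 0) (hn : n ≠ 0) (hκ : κ ≠ 0)
    (hab : (3 * m + 2 * n) * (a * b) = -6 * l * κ ^ 2) :
    (∃ s : Multiset ℕ, (∀ j ∈ s, 0 < j) ∧
      resonances l m n κ a b = {-1, 0} + s.map (fun j : ℕ => (j : ℂ))) ↔
        n = -m ∨ n = -(m / 2) := by
  constructor
  · rintro ⟨s, hs, h⟩
    have hM : (3 * m + 2 * n : ℂ) ≠ 0 := fun h0 => by
      rw [h0, zero_mul] at hab
      have hl' : (l : ℂ) ≠ 0 := by exact_mod_cast hl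
      exact mul_ne_zero (mul_ne_zero (by norm_num) hl') (pow_ne_zero 2 hκ) hab.symm
    -- A square root of the discriminant about the centre 3; the last two roots are 3 + w and 3 - w.
    obtain ⟨w, hw⟩ := IsAlgClosed.exists_pow_nat_eq
      (9 - (11 * (3 * m + 2 * n) - 6 * m) / (3 * m + 2 * n) : ℂ) (n := 2) (by norm_num)
    have hr : (3 * m + 2 * n : ℂ) * ((3 + w) * (6 - (3 + w))) = 11 * (3 * m + 2 * n) - 6 * m := by
      field_simp at hw
      linear_combination -hw
    rw [resonances_eq hl hκ hab _ hr] at h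
    have h2 : ({3, 4, 3 + w, 6 - (3 + w)} : Multiset ℂ) = s.map (fun j : ℕ => (j : ℂ)) := by
      have : ({-1, 0, 3, 4, 3 + w, 6 - (3 + w)} : Multiset ℂ) =
          {-1, 0} + {3, 4, 3 + w, 6 - (3 + w)} := rfl
      rw [this] at h
      exact add_left_cancel h
    obtain ⟨i, hi, hi'⟩ := Multiset.mem_map.1 (h2 ▸
        (by simp : 3 + w ∈ ({3, 4, 3 + w, 6 - (3 + w)} : Multiset ℂ)))
    obtain ⟨j, hj, hj'⟩ := Multiset.mem_map.1 (h2 ▸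
        (by simp : 6 - (3 + w) ∈ ({3, 4, 3 + w, 6 - (3 + w)} : Multiset ℂ)))
    -- With sum 6, positivity of both roots confines each to 1, …, 5.
    have hij : i + j = 6 := by
      have : (i : ℂ) + j = 6 := by rw [hi', hj']; ring
      exact_mod_cast this
    have h0 := hs j hj
    refine eq_neg_or_eq_neg_half hn (hs i hi) (by omega) ?_
    rw [← hi'] at hr
    exact_mod_cast hr
  · rintro (h | h)
    · refine ⟨{1, 3, 4, 5}, by simp, ?_⟩
      rw [resonances_of_eq_neg hl hκ hab h]
      simp only [Multiset.insert_eq_cons, Multiset.map_cons, Multiset.map_singleton,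
        Nat.cast_ofNat, Nat.cast_one, Multiset.cons_add, Multiset.singleton_add]
    · refine ⟨{2, 3, 4, 4}, by simp, ?_⟩
      rw [resonances_of_eq_neg_half hl hκ hab h]
      simp only [Multiset.insert_eq_cons, Multiset.map_cons, Multiset.map_singleton,
        Nat.cast_ofNat, Multiset.cons_add, Multiset.singleton_add]

end Resonances

end NLSCoeffs

/-! ### The test over the analytic ring, and straight fronts -/

namespace NLSCoeffs

open TopologicalSpace

open analyticRing

namespace Front

variable {c : NLSCoeffs} {U : Opens (ℝ × ℝ)} {Φ : ℝ × ℝ → ℂ} (X : Front c U Φ)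
variable {α β : ℤ} {d j : ℕ} {W V : (analyticRing U)⟦X⟧} {res : Multiset ℕ}

/-- The equations of the levels below `j` hold. -/
structure Solved (α β : ℤ) (d j : ℕ) (W V : (analyticRing U)⟦X⟧) : Prop where
  isUnit_left : j ≠ 0 → IsUnit (PowerSeries.coeff 0 W)
  isUnit_right : j ≠ 0 → IsUnit (PowerSeries.coeff 0 V)
  eqn : ∀ i < j, PowerSeries.coeff i (X.E.series X.κ X.τ α β d W V) = 0
  eqn_conj : ∀ i < j, PowerSeries.coeff i (X.E.conj.series X.κ X.τ β α d V W) = 0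

/-- The equations of every level leave as many coefficients arbitrary as `res` requires. -/
def Tests (α β : ℤ) (d : ℕ) (res : Multiset ℕ) : Prop :=
  ∀ j W V, X.Solved α β d j W V → ∃ S, HasArbitrary U (Admissible U j) S (res.count j) ∧
    Describes U (X.LevelEqns α β d j W V) S

theorem tests_of_hasArbitrary (hd : (d : ℤ) = -α - β - 2)
    (h : ∀ (j : ℕ) (u v : ℕ → ℝ × ℝ → ℂ),
      (∀ i < j, Admissible U i (u i) ∧ Admissible U i (v i) ∧ c.SolvesLevel U Φ α β u v i) →
        HasArbitrary U (Admissible U j)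
          (fun a b => c.SolvesLevel U Φ α β (Function.update u j a) (Function.update v j b) j)
          (res.count j)) : X.Tests α β d res := by
  intro j W V hS
  have ad : ∀ (W : (analyticRing U)⟦X⟧), (j ≠ 0 → IsUnit (PowerSeries.coeff 0 W)) → ∀ i < j,
      Admissible U i (extend (PowerSeries.coeff i W)) := fun W hW i hi => by
    refine ⟨extend_analytic _, ?_⟩
    rintro rfl p hp
    have := (isUnit_iff _).1 (hW (by omega)) ⟨p, hp⟩
    rwa [← extend_apply] at this
  refine ⟨_, h j (fun i => extend (PowerSeries.coeff i W)) (fun i => extend (PowerSeries.coeff i V))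
    fun i hi => ⟨ad W hS.1 i hi, ad V hS.2 i hi, ?_⟩, X.describes hd
      (fun i _ p => extend_apply _ p) (fun i _ p => extend_apply _ p)⟩
  exact (X.regular.solvesLevel_iff X.dx_eq X.dt_eq hd i (fun k _ p => extend_apply _ p)
    (fun k _ p => extend_apply _ p)).2 ⟨hS.3 i hi, hS.4 i hi⟩

variable {X}

theorem Solved.mono {i : ℕ} (h : X.Solved α β d j W V) (hij : i ≤ j) : X.Solved α β d i W V :=
  ⟨fun hi => h.1 (by omega), fun hi => h.2 (by omega), fun k hk => h.3 k (by omega),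
    fun k hk => h.4 k (by omega)⟩

theorem Solved.setCoeff_of_levelEqns {A B : analyticRing U} (h : X.Solved α β d j W V) (hj : j ≠ 0)
    (hAB : X.LevelEqns α β d j W V A B) :
    X.Solved α β d (j + 1) (setCoeff W j A) (setCoeff V j B) := by
  have hW := perturbs_setCoeff W j A
  have hV := perturbs_setCoeff V j B
  refine ⟨fun _ => ?_, fun _ => ?_, fun i hi => ?_, fun i hi => ?_⟩
  · rw [hW.coeff_lt (by omega)]; exact h.1 hj
  · rw [hV.coeff_lt (by omega)]; exact h.2 hj
  · rcases Nat.lt_succ_iff_lt_or_eq.1 hi with hi | rfl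
    · rw [(X.E.perturbs_series X.κ X.τ α β d j hj hW hV).coeff_lt hi, h.3 i hi]
    · exact hAB.1
  · rcases Nat.lt_succ_iff_lt_or_eq.1 hi with hi | rfl
    · rw [(X.E.conj.perturbs_series X.κ X.τ β α d j hj hV hW).coeff_lt hi, h.4 i hi]
    · exact hAB.2

namespace Tests

variable (hT : X.Tests α β d res)
include hT

theorem exists_solved_one : ∃ W V, X.Solved α β d 1 W V := by
  obtain ⟨S, hS, hd⟩ := hT 0 0 0 ⟨fun h => absurd rfl h, fun h => absurd rfl h,
    fun i hi => absurd hi (Nat.not_lt_zero i), fun i hi => absurd hi (Nat.not_lt_zero i)⟩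
  obtain ⟨a, b, ha, hb, hab⟩ := hS.exists_solution
    ⟨fun _ => 1, analyticOnNhd_const, fun _ _ _ => one_ne_zero⟩
  have h := (hd a b ha.1 hb.1).1 hab
  refine ⟨setCoeff 0 0 (restr a ha.1), setCoeff 0 0 (restr b hb.1), fun _ => ?_, fun _ => ?_,
    fun i hi => ?_, fun i hi => ?_⟩
  · rw [coeff_setCoeff_self]; exact (isUnit_restr_iff ha.1).2 (ha.2 rfl)
  · rw [coeff_setCoeff_self]; exact (isUnit_restr_iff hb.1).2 (hb.2 rfl)
  · obtain rfl : i = 0 := by omega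
    exact h.1
  · obtain rfl : i = 0 := by omega
    exact h.2

theorem exists_extension (hj : j ≠ 0) (h : X.Solved α β d j W V) :
    ∃ A B, X.Solved α β d (j + 1) (setCoeff W j A) (setCoeff V j B) := by
  obtain ⟨S, hS, hd⟩ := hT j W V h
  obtain ⟨A, B, hAB⟩ := hd.exists_solution hj hS
  exact ⟨A, B, h.setCoeff_of_levelEqns hj hAB⟩

theorem exists_solved (j : ℕ) : ∃ W V, X.Solved α β d (j + 1) W V := by
  induction j with
  | zero => exact hT.exists_solved_one
  | succ j ih =>
    obtain ⟨W, V, h⟩ := ih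
    obtain ⟨A, B, h'⟩ := hT.exists_extension j.succ_ne_zero h
    exact ⟨_, _, h'⟩

/-- At a resonance the linear system for the coefficients of the level has a nonzero kernel. -/
theorem exists_kernel (hj : j ≠ 0) (hN : res.count j ≠ 0) (h : X.Solved α β d j W V) :
    ∃ A B a b, X.LevelEqns α β d j W V A B ∧ X.LevelEqns α β d j W V (A + a) (B + b) ∧
      (a = 1 ∨ b = 1) := by
  obtain ⟨S, hS, hd⟩ := hT j W V h
  obtain ⟨A, B, A', B', h1, h2, h3⟩ := hd.exists_variation hj hN hS
  refine ⟨A, B, A' - A, B' - B, h1, by rwa [add_sub_cancel, add_sub_cancel], ?_⟩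
  rcases h3 with rfl | rfl
  · left; ring
  · right; ring

end Tests

theorem LevelEqns.kernel (hj : j ≠ 0) {A B a b : analyticRing U} (h : X.LevelEqns α β d j W V A B)
    (h' : X.LevelEqns α β d j W V (A + a) (B + b)) :
    X.E.levelDiag X.κ α β d j (PowerSeries.coeff 0 W) (PowerSeries.coeff 0 V) * a
      + X.E.levelOff X.κ α β j (PowerSeries.coeff 0 W) * b = 0 ∧
    X.E.conj.levelDiag X.κ β α d j (PowerSeries.coeff 0 V) (PowerSeries.coeff 0 W) * b
      + X.E.conj.levelOff X.κ β α j (PowerSeries.coeff 0 V) * a = 0 := by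
  rw [X.levelEqns_iff hj] at h h'
  exact ⟨by linear_combination h'.1 - h.1, by linear_combination h'.2 - h.2⟩

theorem LevelEqns.add_kernel (hj : j ≠ 0) {A B a b : analyticRing U}
    (h : X.LevelEqns α β d j W V A B)
    (h₁ : X.E.levelDiag X.κ α β d j (PowerSeries.coeff 0 W) (PowerSeries.coeff 0 V) * a
      + X.E.levelOff X.κ α β j (PowerSeries.coeff 0 W) * b = 0)
    (h₂ : X.E.conj.levelDiag X.κ β α d j (PowerSeries.coeff 0 V) (PowerSeries.coeff 0 W) * b
      + X.E.conj.levelOff X.κ β α j (PowerSeries.coeff 0 V) * a = 0) :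
    X.LevelEqns α β d j W V (A + a) (B + b) := by
  rw [X.levelEqns_iff hj] at h ⊢
  exact ⟨by linear_combination h.1 + h₁, by linear_combination h.2 + h₂⟩

/-- A level with a nonzero kernel is a resonance. -/
theorem Tests.count_ne_zero (hT : X.Tests α β d res) (hj : j ≠ 0) (h : X.Solved α β d j W V)
    {a b : analyticRing U} (ha : a ≠ 0)
    (h₁ : X.E.levelDiag X.κ α β d j (PowerSeries.coeff 0 W) (PowerSeries.coeff 0 V) * a
      + X.E.levelOff X.κ α β j (PowerSeries.coeff 0 W) * b = 0)
    (h₂ : X.E.conj.levelDiag X.κ β α d j (PowerSeries.coeff 0 V) (PowerSeries.coeff 0 W) * b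
      + X.E.conj.levelOff X.κ β α j (PowerSeries.coeff 0 V) * a = 0) : res.count j ≠ 0 := by
  intro h0
  obtain ⟨S, hS, hd⟩ := hT j W V h
  obtain ⟨A, B, hAB⟩ := hd.exists_solution hj hS
  rw [h0] at hS
  have := hd.unique hj hS hAB (hAB.add_kernel hj h₁ h₂)
  exact ha (by linear_combination this)

end Front

/-- The function `x - x₀ - s (t - t₁)`. -/
def linearPhase (x₀ t₁ s : ℝ) (p : ℝ × ℝ) : ℂ := ((p.1 - x₀ - s * (p.2 - t₁) : ℝ) : ℂ)

theorem fderiv_linearPhase (x₀ t₁ s : ℝ) (p v : ℝ × ℝ) :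
    fderiv ℝ (linearPhase x₀ t₁ s) p v = ((v.1 - s * v.2 : ℝ) : ℂ) := by
  have h : HasFDerivAt (fun p : ℝ × ℝ => p.1 - x₀ - s * (p.2 - t₁))
      (ContinuousLinearMap.fst ℝ ℝ ℝ - s • ContinuousLinearMap.snd ℝ ℝ ℝ) p :=
    ((hasFDerivAt_fst (𝕜 := ℝ) (E := ℝ) (F := ℝ)).sub_const x₀).sub
      (((hasFDerivAt_snd (𝕜 := ℝ) (E := ℝ) (F := ℝ)).sub_const t₁).const_mul s)
  have h2 : HasFDerivAt (linearPhase x₀ t₁ s) (Complex.ofRealCLM.comp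
      (ContinuousLinearMap.fst ℝ ℝ ℝ - s • ContinuousLinearMap.snd ℝ ℝ ℝ)) p :=
    Complex.ofRealCLM.hasFDerivAt.comp p h
  rw [h2.fderiv]
  simp

theorem analyticOnNhd_linearPhase (x₀ t₁ s : ℝ) (U : Set (ℝ × ℝ)) :
    AnalyticOnNhd ℝ (linearPhase x₀ t₁ s) U := fun p _ => by
  have h : AnalyticAt ℝ (fun p : ℝ × ℝ => p.1 - x₀ - s * (p.2 - t₁)) p :=
    (analyticAt_fst.sub analyticAt_const).sub
      (analyticAt_const.mul (analyticAt_snd.sub analyticAt_const))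
  exact AnalyticAt.comp (f := fun p : ℝ × ℝ => p.1 - x₀ - s * (p.2 - t₁))
    (Complex.ofRealCLM.analyticAt _) h

/-- A straight front. -/
noncomputable def RegularOn.linearFront {c : NLSCoeffs} {U : Opens (ℝ × ℝ)} (hc : c.RegularOn U)
    (x₀ t₁ s : ℝ) : Front c U (linearPhase x₀ t₁ s) where
  regular := hc
  κ := 1
  τ := algebraMap ℂ (analyticRing U) (-s : ℂ)
  dx_eq := fun p => by simp [dx, fderiv_linearPhase]
  dt_eq := fun p => by simp [dt, fderiv_linearPhase]
  isUnit_κ := isUnit_one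
  dx_τ := by rw [Derivation.map_algebraMap, Derivation.map_one_eq_zero]

theorem RegularOn.singularManifold_linearPhase {c : NLSCoeffs} {U : Opens (ℝ × ℝ)} (hc : c.RegularOn
    U)
    {x₀ t₁ : ℝ} (h : (x₀, t₁) ∈ U) (s : ℝ) : c.SingularManifold U (linearPhase x₀ t₁ s) where
  isOpen := U.isOpen
  analytic := analyticOnNhd_linearPhase x₀ t₁ s U
  noncharacteristic := fun p hp => by
    simpa [dx, fderiv_linearPhase] using hc.l_ne_zero p hp
  zero := ⟨(x₀, t₁), h, by simp [linearPhase]⟩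

end NLSCoeffs

/-! ### Leading orders and the number of resonances -/

namespace NLSCoeffs

open TopologicalSpace

open analyticRing

theorem analyticRing.nontrivial_of_mem {U : Opens (ℝ × ℝ)} {p : ℝ × ℝ} (hp : p ∈ U) :
    Nontrivial (analyticRing U) := (evalHom (⟨p, hp⟩ : U)).domain_nontrivial

namespace Front

variable {c : NLSCoeffs} {U : Opens (ℝ × ℝ)} {Φ : ℝ × ℝ → ℂ} {X : Front c U Φ}
variable {α β : ℤ} {d j : ℕ} {W V : (analyticRing U)⟦X⟧} {res : Multiset ℕ}

/-- Leading orders other than `-1`, `-1` do not give finitely many resonances. -/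
theorem Tests.eq_zero [Nontrivial (analyticRing U)] (hT : X.Tests α β d res) (hα : α ≠ 0)
    (hm : IsUnit X.E.m) : d = 0 := by
  by_contra hd
  -- A level that is neither 0 nor a listed resonance; a kernel vector will be exhibited there.
  obtain ⟨j, hj⟩ := Infinite.exists_notMem_finset (insert 0 res.toFinset)
  simp only [Finset.mem_insert, Multiset.mem_toFinset, not_or] at hj
  obtain ⟨i, rfl⟩ := Nat.exists_eq_succ_of_ne_zero hj.1
  obtain ⟨W, V, h⟩ := hT.exists_solved i
  have hu := h.isUnit_left i.succ_ne_zero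
  have hv := h.isUnit_right i.succ_ne_zero
  have e₁ := h.eqn 0 i.succ_pos
  have e₂ := h.eqn_conj 0 i.succ_pos
  rw [EquationData.coeff_zero_series, if_neg hd, mul_zero, zero_add, ← mul_assoc] at e₁ e₂
  replace e₁ := ((X.E.isUnit_I.mul hu).mul ((X.isUnit_κ.mul hu).mul hv)).mul_right_eq_zero.1
    (by rw [mul_assoc] at e₁ ⊢; exact e₁)
  replace e₂ := ((X.E.conj.isUnit_I.mul hv).mul ((X.isUnit_κ.mul hv).mul hu)).mul_right_eq_zero.1
    (by rw [mul_assoc] at e₂ ⊢; exact e₂)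
  change X.E.m * _ + X.E.n * _ = 0 at e₂
  -- Without dispersion the two leading equations differ by m (α - β).
  have hαβ : α = β := by
    by_contra hne
    have h1 : IsUnit (X.E.m * ((α - β : ℤ) : analyticRing U)) :=
      hm.mul (EquationData.isUnit_intCast (sub_ne_zero.2 hne))
    refine h1.ne_zero ?_
    push_cast
    linear_combination e₁ - e₂
  subst hαβ
  have hmn : 3 * X.E.m + 2 * X.E.n = 0 :=
    (EquationData.isUnit_intCast (R := analyticRing U) hα).mul_right_eq_zero.1
      (by linear_combination e₁)
  -- With 3m + 2n = 0, the vector (u₀, v₀) lies in the kernel at every level.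
  refine hT.count_ne_zero i.succ_ne_zero h hu.ne_zero (b := PowerSeries.coeff 0 V) ?_ ?_
    (Multiset.count_eq_zero.2 hj.2)
  · rw [EquationData.levelDiag, EquationData.levelOff, if_neg hd]
    linear_combination (X.E.I * X.κ * PowerSeries.coeff 0 W ^ 2 * PowerSeries.coeff 0 V *
      (3 * α + (i.succ : ℕ))) * hmn
  · rw [EquationData.levelDiag, EquationData.levelOff, if_neg hd]
    change X.E.conj.I * (_ + _ * (2 * X.E.m * _ + X.E.n * _)) * _ +
      _ * (_ * (X.E.m * _ + X.E.n * _)) * _ = 0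
    linear_combination (X.E.conj.I * X.κ * PowerSeries.coeff 0 V ^ 2 * PowerSeries.coeff 0 W *
      (3 * α + (i.succ : ℕ))) * hmn

theorem Solved.leading (h : X.Solved (-1) (-1) 0 j W V) (hj : j ≠ 0) :
    (3 * X.E.m + 2 * X.E.n) * (PowerSeries.coeff 0 W * PowerSeries.coeff 0 V) =
      -6 * X.E.l * X.κ ^ 2 := by
  have e := h.eqn 0 (Nat.pos_of_ne_zero hj)
  rw [EquationData.coeff_zero_series, if_pos rfl] at e
  refine sub_eq_zero.1 ((((X.E.isUnit_I.mul (h.isUnit_left hj)).mul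
      X.isUnit_κ).neg).mul_right_eq_zero.1 ?_)
  push_cast at e
  linear_combination e

/-- A kernel vector annihilates the determinant up to its entries; one entry being 1 replaces the
absence of zero divisors. -/
theorem Tests.levelDet_eq_zero (hT : X.Tests (-1) (-1) 0 res) (h : X.Solved (-1) (-1) 0 j W V)
    (hj : j ≠ 0) (hc : res.count j ≠ 0) :
    (3 * X.E.m + 2 * X.E.n) * (((j : analyticRing U) - 3) * (j - 4) * (j + 1)) *
      (j * ((3 * X.E.m + 2 * X.E.n) * (j ^ 2 - 6 * j + 11) - 6 * X.E.m)) = 0 := by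
  obtain ⟨A, B, a, b, h1, h2, hab⟩ := hT.exists_kernel hj hc h
  obtain ⟨e₁, e₂⟩ := h1.kernel hj h2
  have hd := X.E.levelDet_eq X.κ (PowerSeries.coeff 0 W) (PowerSeries.coeff 0 V) j (h.leading hj)
  have hu := (X.isUnit_κ.mul ((h.isUnit_left hj).mul (h.isUnit_right hj))).pow 2
  rw [mul_assoc] at hd
  refine hu.mul_right_eq_zero.1 (hd.symm.trans ?_)
  have h36 := EquationData.isUnit_ofNat (R := analyticRing U) 36
  rw [h36.mul_right_eq_zero]
  rcases hab with rfl | rfl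
  · linear_combination X.E.conj.levelDiag X.κ (-1) (-1) 0 j (PowerSeries.coeff 0 V)
      (PowerSeries.coeff 0 W) * e₁ - X.E.levelOff X.κ (-1) (-1) j (PowerSeries.coeff 0 W) * e₂
  · linear_combination X.E.levelDiag X.κ (-1) (-1) 0 j (PowerSeries.coeff 0 W)
      (PowerSeries.coeff 0 V) * e₂ - X.E.conj.levelOff X.κ (-1) (-1) j (PowerSeries.coeff 0 V) * e₁

/-- If both new coefficients are free, the second one can be changed alone, so its factor in the
first equation is zero. -/
theorem Tests.levelOff_eq_zero (hT : X.Tests (-1) (-1) 0 res) (h : X.Solved (-1) (-1) 0 j W V)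
    (hj : j ≠ 0) (hc : res.count j = 2) : X.E.m * ((j : analyticRing U) - 3) + X.E.n * (j - 2) =
        0 := by
  obtain ⟨S, hS, hd⟩ := hT j W V h
  rw [hc] at hS
  have h1 := hd.forall_of_two hj hS 0 0
  have h2 := (h1.kernel hj (a := 0) (b := 1) (hd.forall_of_two hj hS _ _)).1
  rw [mul_zero, zero_add, mul_one, EquationData.levelOff_eq] at h2
  exact ((X.E.isUnit_I.mul X.isUnit_κ).mul ((h.isUnit_left hj).pow 2)).mul_right_eq_zero.1 h2

theorem Tests.count_le_two (hT : X.Tests α β d res) (j : ℕ) : res.count j ≤ 2 := by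
  obtain ⟨W, V, h⟩ := hT.exists_solved j
  obtain ⟨S, hS, -⟩ := hT j W V (h.mono j.le_succ)
  exact hS.le_two

/-- The leading balance fixes the product u₀ v₀; two free leading coefficients would allow both
products 1 and 2. -/
theorem Tests.count_zero_le_one [Nontrivial (analyticRing U)] (hT : X.Tests (-1) (-1) 0 res) :
    res.count 0 ≤ 1 := by
  by_contra hc
  have hc2 : res.count 0 = 2 := by have := hT.count_le_two 0; omega
  obtain ⟨S, hS, hd⟩ := hT 0 0 0 ⟨fun h => absurd rfl h, fun h => absurd rfl h,
    fun i hi => absurd hi (Nat.not_lt_zero i), fun i hi => absurd hi (Nat.not_lt_zero i)⟩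
  rw [hc2] at hS
  have key : ∀ z : ℂ, z ≠ 0 → (3 * X.E.m + 2 * X.E.n) * algebraMap ℂ (analyticRing U) z =
      -6 * X.E.l * X.κ ^ 2 := fun z hz => by
    have h1 := (hd (fun _ => z) (fun _ => 1) analyticOnNhd_const analyticOnNhd_const).1
      (hS _ _ ⟨analyticOnNhd_const, fun _ _ _ => hz⟩ ⟨analyticOnNhd_const, fun _ _ _ =>
          one_ne_zero⟩)
    have e := h1.1
    rw [EquationData.coeff_zero_series, if_pos rfl, coeff_setCoeff_self, coeff_setCoeff_self] at e
    have hz' : IsUnit (algebraMap ℂ (analyticRing U) z) := (IsUnit.mk0 z hz).map _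
    have e1 : restr (U := U) (fun _ => z) analyticOnNhd_const = algebraMap ℂ (analyticRing U) z :=
        rfl
    have e2 : restr (U := U) (fun _ => 1) analyticOnNhd_const = 1 := rfl
    rw [e1, e2] at e
    refine sub_eq_zero.1 ((((X.E.isUnit_I.mul hz').mul X.isUnit_κ).neg).mul_right_eq_zero.1 ?_)
    push_cast at e
    linear_combination e
  have h1 := key 1 one_ne_zero
  have h2 := key 2 two_ne_zero
  rw [map_one] at h1
  rw [map_ofNat] at h2
  refine ((((EquationData.isUnit_ofNat 6).neg.mul X.E.isUnit_l).mul (X.isUnit_κ.pow 2))).ne_zero ?_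
  linear_combination h2 - 2 * h1

/-- Possible levels are 0, 3, 4 and the roots of a quadratic with root sum 6. Outside the two cases
all multiplicities are at most 1: a double level needs a vanishing off-diagonal entry, which means n
= 0 at 3 and n = -m/2 at 4. Two further distinct levels would add up to 6 and avoid 0, 3, 4, so they
would be 1 and 5, which means n = -m. -/
theorem Tests.card_le (hT : X.Tests (-1) (-1) 0 res) {p : ℝ × ℝ} (hp : p ∈ U) (hm : c.m p.2 ≠ 0)
    (hn : c.n p.2 ≠ 0) (hmn : c.n p.2 ≠ -c.m p.2) (hmn' : c.n p.2 ≠ -(c.m p.2 / 2)) :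
    res.card ≤ 4 := by
  have := analyticRing.nontrivial_of_mem hp
  have hN : (3 * c.m p.2 + 2 * c.n p.2 : ℝ) ≠ 0 := fun h0 => by
    obtain ⟨W, V, h⟩ := hT.exists_solved 0
    have h1 := congrArg (fun w : analyticRing U => w.1 ⟨p, hp⟩) (h.leading one_ne_zero)
    have h2 := (isUnit_iff _).1 ((((EquationData.isUnit_ofNat 6).neg.mul X.E.isUnit_l).mul
      (X.isUnit_κ.pow 2))) ⟨p, hp⟩
    refine h2 (h1.symm.trans ?_)
    change ((3 * (c.m p.2 : ℂ) + 2 * (c.n p.2 : ℂ)) * _) = 0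
    have h3 : (3 * (c.m p.2 : ℂ) + 2 * (c.n p.2 : ℂ)) = 0 := by exact_mod_cast h0
    rw [h3, zero_mul]
  have root : ∀ j ≠ 0, res.count j ≠ 0 → j = 3 ∨ j = 4 ∨
      (3 * c.m p.2 + 2 * c.n p.2) * ((j : ℝ) ^ 2 - 6 * j + 11) = 6 * c.m p.2 := fun j hj hc => by
    obtain ⟨i, rfl⟩ := Nat.exists_eq_succ_of_ne_zero hj
    obtain ⟨W, V, h⟩ := hT.exists_solved i
    have h1 := congrArg (fun w : analyticRing U => w.1 ⟨p, hp⟩) (hT.levelDet_eq_zero h hj hc)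
    change (3 * (c.m p.2 : ℂ) + 2 * (c.n p.2 : ℂ)) * (((i.succ : ℕ) - 3) * ((i.succ : ℕ) - 4) *
      ((i.succ : ℕ) + 1)) * ((i.succ : ℕ) * ((3 * (c.m p.2 : ℂ) + 2 * (c.n p.2 : ℂ)) *
      ((i.succ : ℕ) ^ 2 - 6 * (i.succ : ℕ) + 11) - 6 * (c.m p.2 : ℂ))) = 0 at h1
    generalize i.succ = j at *
    have h2 : (3 * c.m p.2 + 2 * c.n p.2) * (((j : ℝ) - 3) * (j - 4) * (j + 1)) *
      (j * ((3 * c.m p.2 + 2 * c.n p.2) * ((j : ℝ) ^ 2 - 6 * j + 11) - 6 * c.m p.2)) = 0 := by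
      exact_mod_cast h1
    have hj0 : (j : ℝ) ≠ 0 := by exact_mod_cast hj
    have hj1 : (j : ℝ) + 1 ≠ 0 := by positivity
    simp only [mul_eq_zero, hN, hj0, hj1, or_false, false_or, sub_eq_zero] at h2
    rcases h2 with (h2 | h2) | h2
    · left; exact_mod_cast h2
    · right; left; exact_mod_cast h2
    · right; right; exact h2
  have simple : ∀ j, res.count j ≤ 1 := fun j => by
    rcases eq_or_ne j 0 with rfl | hj
    · exact hT.count_zero_le_one
    by_contra hc
    have hc2 : res.count j = 2 := by have := hT.count_le_two j; omega
    obtain ⟨W, V, h⟩ := hT.exists_solved j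
    have h1 := congrArg (fun w : analyticRing U => w.1 ⟨p, hp⟩)
      (hT.levelOff_eq_zero (h.mono j.le_succ) hj hc2)
    change (c.m p.2 : ℂ) * (j - 3) + (c.n p.2 : ℂ) * (j - 2) = 0 at h1
    have h2 : c.m p.2 * ((j : ℝ) - 3) + c.n p.2 * (j - 2) = 0 := by exact_mod_cast h1
    have h34 : j = 3 ∨ j = 4 := by
      rcases root j hj (by omega) with h3 | h3 | h3
      · exact Or.inl h3
      · exact Or.inr h3
      -- Eliminating `n` between the quadratic equation and the vanishing off-diagonal entry leads
      -- back to the roots 3 and 4.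
      · have h4 : c.m p.2 * (((j : ℝ) - 3) * (j - 4) * (j + 1)) = 0 := by
          linear_combination ((j : ℝ) - 2) * h3 - 2 * ((j : ℝ) ^ 2 - 6 * j + 11) * h2
        have hj1 : (j : ℝ) + 1 ≠ 0 := by positivity
        simp only [mul_eq_zero, hm, hj1, or_false, false_or, sub_eq_zero] at h4
        exact_mod_cast h4
    rcases h34 with rfl | rfl
    · exact hn (by norm_num at h2; exact h2)
    · exact hmn' (by norm_num at h2; linarith)
  by_contra hcard
  have hnodup : res.Nodup := Multiset.nodup_iff_count_le_one.2 simple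
  have h1 : 5 ≤ res.toFinset.card := by
    rw [Multiset.toFinset_card_of_nodup hnodup]; omega
  have h2 : 1 < (res.toFinset \ {0, 3, 4}).card := by
    have := Finset.le_card_sdiff ({0, 3, 4} : Finset ℕ) res.toFinset
    have h3 : ({0, 3, 4} : Finset ℕ).card = 3 := rfl
    omega
  obtain ⟨i, hi, j, hj, hij⟩ := Finset.one_lt_card.1 h2
  have key : ∀ k ∈ res.toFinset \ {0, 3, 4}, k ≠ 0 ∧ k ≠ 4 ∧
      (3 * c.m p.2 + 2 * c.n p.2) * ((k : ℝ) ^ 2 - 6 * k + 11) = 6 * c.m p.2 := fun k hk => by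
    simp only [Finset.mem_sdiff, Multiset.mem_toFinset, Finset.mem_insert, Finset.mem_singleton,
      not_or] at hk
    refine ⟨hk.2.1, hk.2.2.2, ?_⟩
    rcases root k hk.2.1 (Multiset.count_ne_zero.2 hk.1) with h | h | h
    · exact absurd h hk.2.2.1
    · exact absurd h hk.2.2.2
    · exact h
  obtain ⟨hi0, hi4, ei⟩ := key i hi
  obtain ⟨hj0, hj4, ej⟩ := key j hj
  have h5 : (3 * c.m p.2 + 2 * c.n p.2) * (((i : ℝ) - j) * (i + j - 6)) = 0 := by
    linear_combination ei - ej
  have hij' : (i : ℝ) - j ≠ 0 := sub_ne_zero.2 (by exact_mod_cast hij)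
  simp only [mul_eq_zero, hN, hij', false_or, sub_eq_zero] at h5
  have h6 : i + j = 6 := by exact_mod_cast h5
  have h7 : i = 1 ∨ i = 5 := by omega
  rcases h7 with rfl | rfl
  · exact hmn (by norm_num at ei; linarith)
  · exact hmn (by norm_num at ei; linarith)

end Front

section Exponents

variable {c : NLSCoeffs} {I J : Set ℝ} (H : c.AnalyticOnRectangle I J)
include H

/-- If the equation passes the Painlevé test, then the leading orders are `-1`, `-1`. -/
theorem PassesPainleveTest.exists_tests (h : c.PassesPainleveTest (I ×ˢ c.regularTimes J)) {x₀ t₁ :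
    ℝ}
    (hx₀ : x₀ ∈ I) (ht₁ : t₁ ∈ c.regularTimes J) : ∃ res : Multiset ℕ, res.card = 5 ∧
      ∀ (hc : c.RegularOn H.domain) (s : ℝ), (hc.linearFront x₀ t₁ s).Tests (-1) (-1) 0 res := by
  obtain ⟨α, β, hα, hβ, res, hres, hT⟩ := h
  have hp : (x₀, t₁) ∈ H.domain := ⟨hx₀, ht₁⟩
  have := analyticRing.nontrivial_of_mem hp
  have hc : c.RegularOn H.domain := H.regularOn subset_rfl
  have key : ∀ s, (hc.linearFront x₀ t₁ s).Tests α β (-α - β - 2).toNat res := fun s =>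
    Front.tests_of_hasArbitrary _ (Int.toNat_of_nonneg (by omega))
      (hT _ subset_rfl _ (hc.singularManifold_linearPhase hp s))
  have hm : IsUnit hc.data.m := (isUnit_iff _).2 fun p => m_ne_zero_of_subset subset_rfl p p.2
  have hd := (key 0).eq_zero (by omega) hm
  -- Two negative integers with -α - β - 2 not positive are both -1.
  have hα1 : α = -1 := by omega
  have hβ1 : β = -1 := by omega
  subst hα1 hβ1
  exact ⟨res, by omega, fun _ s => key s⟩

/-- The ratio of `m` and `n` in equations that pass the Painlevé test. -/
theorem PassesPainleveTest.eq_neg_or_eq_neg_half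
    (h : c.PassesPainleveTest (I ×ˢ c.regularTimes J)) (hI : I.Nonempty)
    (hl0 : ∃ t ∈ J, c.l t ≠ 0) (hm0 : ∃ t ∈ J, c.m t ≠ 0) (hn0 : ∃ t ∈ J, c.n t ≠ 0) :
    (∀ t ∈ J, c.n t = -c.m t) ∨ (∀ t ∈ J, c.n t = -(c.m t / 2)) := by
  obtain ⟨x₀, hx₀⟩ := hI
  have hT : ∀ t ∈ c.regularTimes J, c.n t = -c.m t ∨ c.n t = -(c.m t / 2) := fun t ht => by
    by_contra! hne
    obtain ⟨res, hres, hT⟩ := h.exists_tests H hx₀ ht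
    have := (hT (H.regularOn subset_rfl) 0).card_le (p := (x₀, t)) ⟨hx₀, ht⟩ ht.2.2.1 ht.2.2.2
      hne.1 hne.2
    omega
  have hJ := H.ordConnected_snd.isPreconnected
  have a1 : AnalyticOnNhd ℝ (fun t => c.n t + c.m t) J := H.n.add H.m
  have a2 : AnalyticOnNhd ℝ (fun t => c.n t + c.m t / 2) J :=
    H.n.add (H.m.div_const)
  -- At every time of J one factor vanishes, at the excluded times one of `l`, `m`, `n`. On the
  -- interval an analytic factor then vanishes identically.
  have hprod : ∀ t ∈ J, (c.l t * (c.m t * c.n t)) * ((c.n t + c.m t) * (c.n t + c.m t / 2)) = 0 :=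
      by
    intro t ht
    by_cases hr : t ∈ c.regularTimes J
    · rcases hT t hr with h1 | h1
      · rw [h1]; ring
      · rw [h1]; ring
    · have : c.l t = 0 ∨ c.m t = 0 ∨ c.n t = 0 := by
        by_contra! hne
        exact hr ⟨ht, hne.1, hne.2.1, hne.2.2⟩
      rcases this with h1 | h1 | h1 <;> rw [h1] <;> ring
  have zero : ∀ {F G : ℝ → ℝ}, AnalyticOnNhd ℝ F J → AnalyticOnNhd ℝ G J →
      (∀ t ∈ J, F t * G t = 0) → (∀ t ∈ J, F t = 0) ∨ ∀ t ∈ J, G t = 0 := fun hF hG h =>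
    AnalyticOnNhd.eq_zero_or_eq_zero_of_mul_eq_zero hF hG h hJ
  rcases zero (H.l.mul (H.m.mul H.n)) (a1.mul a2) hprod with h1 | h1
  · rcases zero H.l (H.m.mul H.n) h1 with h2 | h2
    · obtain ⟨t, ht, hne⟩ := hl0
      exact absurd (h2 t ht) hne
    · rcases zero H.m H.n h2 with h3 | h3
      · obtain ⟨t, ht, hne⟩ := hm0
        exact absurd (h3 t ht) hne
      · obtain ⟨t, ht, hne⟩ := hn0
        exact absurd (h3 t ht) hne
  · rcases zero a1 a2 h1 with h2 | h2
    · exact Or.inl fun t ht => by linear_combination h2 t ht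
    · exact Or.inr fun t ht => by linear_combination h2 t ht

end Exponents

end NLSCoeffs

/-! ### Solutions varied at a resonance -/

namespace NLSCoeffs

namespace EquationData

variable {R : Type*} [CommRing R] [Algebra ℂ R] {E : EquationData R}

namespace Normalization

variable {κ τ θ a σ σi u₀ ui v₀ vi : R} {N : E.Normalization κ τ θ a σ σi u₀ ui v₀ vi}

/-- The values at a point of the coefficients of the normalized equations. -/
structure Valuation (N : E.Normalization κ τ θ a σ σi u₀ ui v₀ vi) (φ : R →+* ℂ)
    (F J G H B K L : ℕ → ℂ) : Prop where
  evalF : Evaluates φ (E.expandC κ (E.normF a)) F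
  evalJ : Evaluates φ (E.expandC κ (E.conj.normF a)) J
  evalG : Evaluates φ (E.expandC κ (E.normG a σ)) G
  evalG_conj : Evaluates φ (E.expandC κ (E.conj.normG a σ)) G
  evalH : Evaluates φ N.H H
  evalB : Evaluates φ N.B B
  evalK : Evaluates φ (E.expandC κ (E.normK a) + PowerSeries.C (E.linv * θ)) K
  evalL : Evaluates φ (E.expandC κ (E.conj.normK a) + PowerSeries.C (E.linv * θ)) L

namespace Valuation

variable {φ : R →+* ℂ} {F J G H B K L Y Z : ℕ → ℂ} (v : N.Valuation φ F J G H B K L)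
  {j : ℕ} {W V : R⟦X⟧}
include v

theorem level_one (h : N.SolvedBelow j W V) (hj : 1 < j) {μ ν : ℂ}
    (hμ : φ (σ * E.m * E.linv) = μ) (hν : φ (σ * E.n * E.linv) = ν)
    (hY : Evaluates φ (N.Y W) Y) (hZ : Evaluates φ (N.Z V) Z) :
      2*F 0 + G 0 - 4*Y 1*μ - 3*Y 1*ν - 2*Z 1*μ - Z 1*ν = 0 ∧
      2*J 0 + G 0 - 4*Z 1*μ - 3*Z 1*ν - 2*Y 1*μ - Y 1*ν = 0 := by
  constructor
  · rw [← map_coeff_normalSeries_one φ (E.linv • E.slide θ) (μ' := σ * E.m * E.linv)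
      hμ hν v.evalF v.evalG hY hZ h.coeff_zero_Y h.coeff_zero_Z, ← φ.map_zero, ← h.normal_eq hj,
          normal]
  · rw [← map_coeff_normalSeries_one φ (E.linv • E.slide θ) (μ' := σ * E.m * E.linv)
      hμ hν v.evalJ v.evalG_conj hZ hY h.coeff_zero_Z h.coeff_zero_Y, ← φ.map_zero, ←
          h.normalConj_eq hj, normalConj]

theorem level_two (h : N.SolvedBelow j W V) (hj : 2 < j) {μ ν : ℂ}
    (hμ : φ (σ * E.m * E.linv) = μ) (hν : φ (σ * E.n * E.linv) = ν)
    (hY : Evaluates φ (N.Y W) Y) (hZ : Evaluates φ (N.Z V) Z) :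
      2*F 1 + G 1 - K 0 + 2*G 0*Y 1 + G 0*Z 1 - 2*Y 2*μ - 2*Y 2*ν - Z 2*μ - 2*Y 1*Z 1*μ - Y 1*Z
      1*ν - Y 1^2*μ - Y 1^2*ν = 0 ∧
      2*J 1 + G 1 - L 0 + 2*G 0*Z 1 + G 0*Y 1 - 2*Z 2*μ - 2*Z 2*ν - Y 2*μ - 2*Z 1*Y 1*μ - Z 1*Y
      1*ν - Z 1^2*μ - Z 1^2*ν = 0 := by
  constructor
  · rw [← map_coeff_normalSeries_two φ (E.linv • E.slide θ) (μ' := σ * E.m * E.linv)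
      hμ hν v.evalF v.evalG v.evalK hY hZ h.coeff_zero_Y h.coeff_zero_Z, ← φ.map_zero, ← h.normal_eq
          hj, normal]
  · rw [← map_coeff_normalSeries_two φ (E.linv • E.slide θ) (μ' := σ * E.m * E.linv)
      hμ hν v.evalJ v.evalG_conj v.evalL hZ hY h.coeff_zero_Z h.coeff_zero_Y, ← φ.map_zero, ←
          h.normalConj_eq hj, normalConj]

theorem level_three (h : N.SolvedBelow j W V) (hj : 3 < j) {ν : ℂ}
    (hν : φ (σ * E.n * E.linv) = ν)
    (hY : Evaluates φ (N.Y W) Y) (hZ : Evaluates φ (N.Z V) Z) :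
      2*F 2 + G 2 + H 0 - K 1 + 2*G 0*Y 2 + G 0*Z 2 + 2*G 1*Y 1 + G 1*Z 1 - Y 3*ν + Z 3*ν + 2*G
      0*Y 1*Z 1 + G 0*Y 1^2 - Y 1*Y 2*ν + Y 1*Z 2*ν = 0 ∧
      2*J 2 + G 2 + B 0 - L 1 + 2*G 0*Z 2 + G 0*Y 2 + 2*G 1*Z 1 + G 1*Y 1 - Z 3*ν + Y 3*ν + 2*G
      0*Z 1*Y 1 + G 0*Z 1^2 - Z 1*Z 2*ν + Z 1*Y 2*ν = 0 := by
  constructor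
  · rw [← map_coeff_normalSeries_three φ (E.linv • E.slide θ) (μ' := σ * E.m * E.linv)
      hν v.evalF v.evalG v.evalH v.evalK hY hZ h.coeff_zero_Y h.coeff_zero_Z, ← φ.map_zero, ←
          h.normal_eq hj, normal]
  · rw [← map_coeff_normalSeries_three φ (E.linv • E.slide θ) (μ' := σ * E.m * E.linv)
      hν v.evalJ v.evalG_conj v.evalB v.evalL hZ hY h.coeff_zero_Z h.coeff_zero_Y, ← φ.map_zero, ←
          h.normalConj_eq hj, normalConj]

theorem level_four (h : N.SolvedBelow j W V) (hj : 4 < j) {μ ν : ℂ}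
    (hμ : φ (σ * E.m * E.linv) = μ) (hν : φ (σ * E.n * E.linv) = ν)
    (hY : Evaluates φ (N.Y W) Y) (hZ : Evaluates φ (N.Z V) Z) :
      φ ((E.linv • E.slide θ) (PowerSeries.coeff 1 (N.Y W))) + 2*F 3 + G 3 + H 1 - K 2 + 6*Y 4 +
      2*F 0*Y 3 + 2*G 0*Y 3 + G 0*Z 3 + 2*G 1*Y 2 + G 1*Z 2 + 2*G 2*Y 1 + G 2*Z 1 + H 0*Y 1 + K
      0*Y 2 + 2*Y 4*μ + Z 4*μ + 2*Z 4*ν + 2*G 0*Y 1*Y 2 + 2*G 0*Y 1*Z 2 + 2*G 0*Y 2*Z 1 + 2*G 1*Y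
      1*Z 1 + G 1*Y 1^2 + 2*Y 1*Y 3*μ + 2*Y 1*Z 3*μ + 3*Y 1*Z 3*ν + 2*Y 2*Z 2*μ + 2*Y 2*Z 2*ν + Y
      2^2*μ + 2*Y 3*Z 1*μ + Y 3*Z 1*ν + G 0*Y 1^2*Z 1 + 2*Y 1*Y 2*Z 1*μ + Y 1*Y 2*Z 1*ν + Y 1^2*Z
      2*μ + Y 1^2*Z 2*ν = 0 ∧
      φ ((E.linv • E.slide θ) (PowerSeries.coeff 1 (N.Z V))) + 2*J 3 + G 3 + B 1 - L 2 + 6*Z 4 +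
      2*J 0*Z 3 + 2*G 0*Z 3 + G 0*Y 3 + 2*G 1*Z 2 + G 1*Y 2 + 2*G 2*Z 1 + G 2*Y 1 + B 0*Z 1 + L
      0*Z 2 + 2*Z 4*μ + Y 4*μ + 2*Y 4*ν + 2*G 0*Z 1*Z 2 + 2*G 0*Z 1*Y 2 + 2*G 0*Z 2*Y 1 + 2*G 1*Z
      1*Y 1 + G 1*Z 1^2 + 2*Z 1*Z 3*μ + 2*Z 1*Y 3*μ + 3*Z 1*Y 3*ν + 2*Z 2*Y 2*μ + 2*Z 2*Y 2*ν + Z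
      2^2*μ + 2*Z 3*Y 1*μ + Z 3*Y 1*ν + G 0*Z 1^2*Y 1 + 2*Z 1*Z 2*Y 1*μ + Z 1*Z 2*Y 1*ν + Z 1^2*Y
      2*μ + Z 1^2*Y 2*ν = 0 := by
  constructor
  · rw [← map_coeff_normalSeries_four φ (E.linv • E.slide θ) (μ' := σ * E.m * E.linv)
      hμ hν v.evalF v.evalG v.evalH v.evalK hY hZ h.coeff_zero_Y h.coeff_zero_Z, ← φ.map_zero, ←
          h.normal_eq hj, normal]
  · rw [← map_coeff_normalSeries_four φ (E.linv • E.slide θ) (μ' := σ * E.m * E.linv)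
      hμ hν v.evalJ v.evalG_conj v.evalB v.evalL hZ hY h.coeff_zero_Z h.coeff_zero_Y, ← φ.map_zero,
          ← h.normalConj_eq hj, normalConj]

end Valuation

end Normalization

end EquationData

end NLSCoeffs

namespace NLSCoeffs

open TopologicalSpace

namespace Front

variable {c : NLSCoeffs} {U : Opens (ℝ × ℝ)} {Φ : ℝ × ℝ → ℂ} {X : Front c U Φ}
variable {i j : ℕ} {W V : (analyticRing U)⟦X⟧} {res : Multiset ℕ}
variable {θ a σ σi u₀ ui v₀ vi : analyticRing U}
  {N : X.E.Normalization X.κ X.τ θ a σ σi u₀ ui v₀ vi}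

theorem solved_of_solvedBelow (h : N.SolvedBelow j W V) : X.Solved (-1) (-1) 0 j W V :=
  ⟨fun _ => by rw [h.1]; exact IsUnit.of_mul_eq_one _ N.u₀_mul_ui,
    fun _ => by rw [h.2]; exact IsUnit.of_mul_eq_one _ N.v₀_mul_vi, h.3, h.4⟩

theorem solvedBelow_of_solved (h : X.Solved (-1) (-1) 0 j W V) (hW : PowerSeries.coeff 0 W = u₀)
    (hV : PowerSeries.coeff 0 V = v₀) : N.SolvedBelow j W V := ⟨hW, hV, h.3, h.4⟩

theorem solvedBelow_setCoeff (h : N.SolvedBelow j W V) (hj : j ≠ 0) {A B : analyticRing U}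
    (hAB : X.LevelEqns (-1) (-1) 0 j W V A B) :
    N.SolvedBelow (j + 1) (setCoeff W j A) (setCoeff V j B) :=
  solvedBelow_of_solved ((solved_of_solvedBelow h).setCoeff_of_levelEqns hj hAB)
    (by rw [(perturbs_setCoeff W j A).coeff_lt (Nat.pos_of_ne_zero hj), h.1])
    (by rw [(perturbs_setCoeff V j B).coeff_lt (Nat.pos_of_ne_zero hj), h.2])

namespace Tests

variable (hT : X.Tests (-1) (-1) 0 res)
include hT

/-- Every level is solvable whatever was chosen before, and a new coefficient at order `j` leaves
the normalized coefficients below `j` unchanged. -/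
theorem exists_solvedBelow_ge (hi : i ≠ 0) (hij : i ≤ j) (h : N.SolvedBelow i W V) :
    ∃ W' V', N.SolvedBelow j W' V' ∧
      (∀ k < i, PowerSeries.coeff k (N.Y W') = PowerSeries.coeff k (N.Y W)) ∧
      ∀ k < i, PowerSeries.coeff k (N.Z V') = PowerSeries.coeff k (N.Z V) := by
  induction j, hij using Nat.le_induction with
  | base => exact ⟨W, V, h, fun _ _ => rfl, fun _ _ => rfl⟩
  | succ j hij ih =>
    obtain ⟨W', V', h', hY, hZ⟩ := ih
    have hj : j ≠ 0 := by omega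
    obtain ⟨S, hS, hd⟩ := hT j W' V' (solved_of_solvedBelow h')
    obtain ⟨A, B, hAB⟩ := hd.exists_solution hj hS
    refine ⟨_, _, solvedBelow_setCoeff h' hj hAB, fun k hk => ?_, fun k hk => ?_⟩
    · rw [← hY k hk, (N.perturbs_Y j _ _ _ (perturbs_setCoeff W' j A)).coeff_lt (by omega)]
    · rw [← hZ k hk, (N.perturbs_Z j _ _ _ (perturbs_setCoeff V' j B)).coeff_lt (by omega)]

omit hT in
theorem _root_.NLSCoeffs.Front.exists_solvedBelow_one
    (N : X.E.Normalization X.κ X.τ θ a σ σi u₀ ui v₀ vi)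
    (hs : (3 * X.E.m + 2 * X.E.n) * (u₀ * v₀) = -6 * X.E.l * X.κ ^ 2) :
    ∃ W V, N.SolvedBelow 1 W V := by
  refine ⟨PowerSeries.C u₀, PowerSeries.C v₀, by simp, by simp, fun i hi => ?_, fun i hi => ?_⟩
  · obtain rfl : i = 0 := by omega
    rw [EquationData.coeff_zero_series, if_pos rfl]
    simp only [PowerSeries.coeff_zero_C]
    push_cast
    linear_combination (-(X.E.I * u₀ * X.κ)) * hs
  · obtain rfl : i = 0 := by omega
    rw [EquationData.coeff_zero_series, if_pos rfl]
    simp only [PowerSeries.coeff_zero_C]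
    push_cast
    change X.E.conj.I * v₀ * (X.E.l * _ + _ * (X.E.m * _ + X.E.n * _)) = 0
    linear_combination (-(X.E.conj.I * v₀ * X.κ)) * hs

theorem exists_solvedBelow_of_leading (hs : (3 * X.E.m + 2 * X.E.n) * (u₀ * v₀) = -6 * X.E.l * X.κ ^
    2)
    (N : X.E.Normalization X.κ X.τ θ a σ σi u₀ ui v₀ vi) (hj : j ≠ 0) :
    ∃ W V, N.SolvedBelow j W V := by
  obtain ⟨W, V, h⟩ := exists_solvedBelow_one N hs
  obtain ⟨W', V', h', -⟩ := hT.exists_solvedBelow_ge one_ne_zero (Nat.pos_of_ne_zero hj) h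
  exact ⟨W', V', h'⟩

/-- Two solutions that differ first at a resonance. -/
theorem exists_two (hκ : X.κ = 1)
    (hs : (3 * X.E.m + 2 * X.E.n) * (u₀ * v₀) = -6 * X.E.l * X.κ ^ 2)
    (N : X.E.Normalization X.κ X.τ θ a σ σi u₀ ui v₀ vi) (hi : i ≠ 0) (hij : i < j) (ε : ℤ)
    (hε : X.E.l * X.κ ^ 2 * (((i : analyticRing U) - 1) * (i - 2) * (i - 3)) +
      u₀ * v₀ * (X.E.m * ((2 + ε) * (i - 3)) + X.E.n * ((i - 4) + ε * (i - 2))) = 0)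
    (hε1 : ε * ε = 1) :
    ∃ W V W' V', N.SolvedBelow j W V ∧ N.SolvedBelow j W' V' ∧
      (∀ k < i, PowerSeries.coeff k (N.Y W') = PowerSeries.coeff k (N.Y W)) ∧
      (∀ k < i, PowerSeries.coeff k (N.Z V') = PowerSeries.coeff k (N.Z V)) ∧
      PowerSeries.coeff i (N.Y W') = PowerSeries.coeff i (N.Y W) + 1 := by
  obtain ⟨W, V, h⟩ := hT.exists_solvedBelow_of_leading hs N hi
  obtain ⟨S, hS, hd⟩ := hT i W V (solved_of_solvedBelow h)
  obtain ⟨A, B, hAB⟩ := hd.exists_solution hi hS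
  have hε1' : (ε : analyticRing U) * ε = 1 := by rw [← Int.cast_mul, hε1, Int.cast_one]
  -- The kernel vector is (u₀, ε v₀), which is (1, ε) in normalized unknowns; the sign `ε` selects
  -- the factor of the determinant that vanishes at level `i`.
  have hAB' : X.LevelEqns (-1) (-1) 0 i W V (A + u₀) (B + ε * v₀) := by
    refine hAB.add_kernel hi ?_ ?_
    · rw [h.1, h.2, EquationData.levelDiag, EquationData.levelOff, if_pos rfl]
      push_cast
      linear_combination (X.E.I * X.κ * u₀) * hε
    · rw [h.1, h.2, EquationData.levelDiag, EquationData.levelOff, if_pos rfl]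
      push_cast
      change X.E.conj.I * (X.E.l * _ + _ * (2 * X.E.m * _ + X.E.n * _)) * _ +
        X.E.conj.I * (_ * (X.E.m * _ + X.E.n * _)) * _ = 0
      linear_combination (X.E.conj.I * X.κ * v₀ * ε) * hε - (X.E.conj.I * X.κ * v₀ ^ 2 * u₀ *
        (X.E.m * (i - 3) + X.E.n * (i - 2))) * hε1'
  obtain ⟨W₁, V₁, h₁, hY₁, hZ₁⟩ := hT.exists_solvedBelow_ge i.succ_ne_zero hij
    (solvedBelow_setCoeff h hi hAB)
  obtain ⟨W₂, V₂, h₂, hY₂, hZ₂⟩ := hT.exists_solvedBelow_ge i.succ_ne_zero hij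
    (solvedBelow_setCoeff h hi hAB')
  have pY := fun A => N.perturbs_Y i _ _ _ (perturbs_setCoeff W i A)
  have pZ := fun B => N.perturbs_Z i _ _ _ (perturbs_setCoeff V i B)
  refine ⟨W₁, V₁, W₂, V₂, h₁, h₂, fun k hk => ?_, fun k hk => ?_, ?_⟩
  · rw [hY₁ k (by omega), hY₂ k (by omega), (pY _).coeff_lt hk, (pY _).coeff_lt hk]
  · rw [hZ₁ k (by omega), hZ₂ k (by omega), (pZ _).coeff_lt hk, (pZ _).coeff_lt hk]
  · rw [hY₁ i i.lt_succ_self, hY₂ i i.lt_succ_self, (pY _).coeff_self, (pY _).coeff_self]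
    have h1 : X.κ ^ i = 1 := by rw [hκ, one_pow]
    linear_combination X.κ ^ i * N.u₀_mul_ui + h1

end Tests

end Front

end NLSCoeffs

/-! ### Necessity in the case n = -m -/

namespace NLSCoeffs

open TopologicalSpace

namespace EquationData

variable {R : Type*} [CommRing R] [Algebra ℂ R] {E : EquationData R}

theorem coeff_zero_expandC_add_C (κ w z : R) :
    PowerSeries.coeff 0 (E.expandC κ w + PowerSeries.C z) = w + z := by
  rw [map_add, E.coeff_zero_expandC, PowerSeries.coeff_zero_C]

theorem coeff_succ_expandC_add_C (κ w z : R) (n : ℕ) :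
    PowerSeries.coeff (n + 1) (E.expandC κ w + PowerSeries.C z) =
      PowerSeries.coeff (n + 1) (E.expandC κ w) := by
  rw [map_add, PowerSeries.coeff_C, if_neg n.succ_ne_zero, add_zero]

/-- The constraint imposed on the coefficients by level `3`, up to a multiple of the speed of the
front. -/
def levelThree (E : EquationData R) (a σ σi : R) : R :=
  4 * E.sumH a σ σi + 8 * E.dx (E.dx (E.normF a)) + 4 * E.dx (E.dx (E.normG a σ))
    - 8 * E.dx (E.normK a) - 4 * E.normF a * E.dx (E.normG a σ)
    - 8 * E.dx (E.normF a) * E.normG a σ - 6 * E.normG a σ * E.dx (E.normG a σ)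
    + 4 * E.normG a σ * E.normK a + 2 * E.normF a * E.normG a σ ^ 2 + E.normG a σ ^ 3

theorem Normalization.valuation {κ τ θ a σ σi u₀ ui v₀ vi : R}
    (N : E.Normalization κ τ θ a σ σi u₀ ui v₀ vi) (hG : E.conj.normG a σ = E.normG a σ)
    (φ : R →+* ℂ) : N.Valuation φ (fun n => φ (PowerSeries.coeff n (E.expandC κ (E.normF a))))
      (fun n => φ (PowerSeries.coeff n (E.expandC κ (E.conj.normF a))))
      (fun n => φ (PowerSeries.coeff n (E.expandC κ (E.normG a σ))))
      (fun n => φ (PowerSeries.coeff n N.H)) (fun n => φ (PowerSeries.coeff n N.B))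
      (fun n => φ (PowerSeries.coeff n (E.expandC κ (E.normK a) + PowerSeries.C (E.linv * θ))))
      (fun n => φ (PowerSeries.coeff n
        (E.expandC κ (E.conj.normK a) + PowerSeries.C (E.linv * θ)))) :=
  ⟨fun _ => rfl, fun _ => rfl, fun _ => rfl, fun _ => by rw [hG], fun _ => rfl, fun _ => rfl,
    fun _ => rfl, fun _ => rfl⟩

theorem Normalization.exists_valuation {κ τ θ a σ σi u₀ ui v₀ vi : R}
    (N : E.Normalization κ τ θ a σ σi u₀ ui v₀ vi) (hG : E.conj.normG a σ = E.normG a σ)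
    (φ : R →+* ℂ) : ∃ F J G H B K L, N.Valuation φ F J G H B K L :=
  ⟨_, _, _, _, _, _, _, N.valuation hG φ⟩

namespace Normalization.Valuation

variable {κ τ θ a σ σi u₀ ui v₀ vi : R} {N : E.Normalization κ τ θ a σ σi u₀ ui v₀ vi} {φ : R →+* ℂ}
  {F J G H B K L : ℕ → ℂ} (v : N.Valuation φ F J G H B K L)
include v

theorem F_zero : F 0 = φ (E.normF a) := by rw [← v.evalF, E.coeff_zero_expandC]

theorem F_one : F 1 = φ (E.dx (E.normF a)) := by rw [← v.evalF, coeff_one_expandC]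

theorem F_two : 2 * F 2 = φ (E.dx (E.dx (E.normF a))) := by
  rw [← v.evalF, ← two_mul_coeff_two_expandC κ, map_mul, map_ofNat]

theorem J_zero : J 0 = φ (E.conj.normF a) := by rw [← v.evalJ, E.coeff_zero_expandC]

theorem eq_of_normF (hF : E.conj.normF a = E.normF a) : J = F := by
  funext n
  rw [← v.evalF, ← v.evalJ, hF]

theorem eq_of_normK (hK : E.conj.normK a = E.normK a) : L = K := by
  funext n
  rw [← v.evalK, ← v.evalL, hK]

theorem F_eq_zero (hF : E.normF a = 0) : F = 0 := by
  funext n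
  rw [← v.evalF, hF]
  simp

theorem G_eq_zero (hG : E.normG a σ = 0) : G = 0 := by
  funext n
  rw [← v.evalG, hG]
  simp

theorem G_zero : G 0 = φ (E.normG a σ) := by rw [← v.evalG, E.coeff_zero_expandC]

theorem G_one : G 1 = φ (E.dx (E.normG a σ)) := by rw [← v.evalG, coeff_one_expandC]

theorem G_two : 2 * G 2 = φ (E.dx (E.dx (E.normG a σ))) := by
  rw [← v.evalG, ← two_mul_coeff_two_expandC κ, map_mul, map_ofNat]

theorem K_zero : K 0 = φ (E.normK a) + φ (E.linv * θ) := by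
  rw [← v.evalK, coeff_zero_expandC_add_C, map_add]

theorem K_one : K 1 = φ (E.dx (E.normK a)) := by
  rw [← v.evalK, coeff_succ_expandC_add_C, coeff_one_expandC]

theorem K_two : 2 * K 2 = φ (E.dx (E.dx (E.normK a))) := by
  rw [← v.evalK, coeff_succ_expandC_add_C, ← two_mul_coeff_two_expandC κ, map_mul, map_ofNat]

theorem L_zero : L 0 = φ (E.conj.normK a) + φ (E.linv * θ) := by
  rw [← v.evalL, coeff_zero_expandC_add_C, map_add]

theorem sum_zero : H 0 + B 0 = φ (E.sumH a σ σi) := by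
  rw [← v.evalH, ← v.evalB, ← map_add, ← map_add, N.sum_eq, E.coeff_zero_expandC]

theorem sum_one : H 1 + B 1 = φ (E.dx (E.sumH a σ σi)) := by
  rw [← v.evalH, ← v.evalB, ← map_add, ← map_add, N.sum_eq, coeff_one_expandC]

theorem diff_one : H 1 - B 1 = φ (E.diffH a) := by
  rw [← v.evalH, ← v.evalB, ← map_sub, N.diff_one]

end Normalization.Valuation

end EquationData

namespace Front

variable {c : NLSCoeffs} {U : Opens (ℝ × ℝ)} {Φ : ℝ × ℝ → ℂ} {X : Front c U Φ}
variable {res : Multiset ℕ} (hT : X.Tests (-1) (-1) 0 res)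
variable {θ a σ σi u₀ ui v₀ vi : analyticRing U}
  (N : X.E.Normalization X.κ X.τ θ a σ σi u₀ ui v₀ vi) (hκ : X.κ = 1)
  (hs : (3 * X.E.m + 2 * X.E.n) * (u₀ * v₀) = -6 * X.E.l * X.κ ^ 2)
  (hG : X.E.conj.normG a σ = X.E.normG a σ)

section Hirota

variable (hn : X.E.n = -X.E.m) (hμ : σ * X.E.m * X.E.linv = -6)

include hn hμ in
theorem hirota_map (φ : analyticRing U →+* ℂ) :
    φ (σ * X.E.m * X.E.linv) = -6 ∧ φ (σ * X.E.n * X.E.linv) = 6 := by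
  have h : σ * X.E.n * X.E.linv = 6 := by rw [hn]; linear_combination -hμ
  rw [h, hμ]
  exact ⟨by rw [map_neg, map_ofNat], map_ofNat φ 6⟩

section Relation

variable {N} {φ : analyticRing U →+* ℂ} {F G H B K L : ℕ → ℂ} (v : N.Valuation φ F F G H B K L)
include hn hμ v

theorem hirota_relation {W V : (analyticRing U)⟦X⟧} (h : N.SolvedBelow 4 W V) :
    -6 * B 0 + -24 * F 2 + -12 * G 2 + -6 * H 0 + 6 * K 1 + 6 * L 1 + 6 * F 0 * G 1 +
      -2 * F 0 * K 0 + 2 * F 0 * L 0 + 12 * F 1 * G 0 + 9 * G 0 * G 1 + -4 * G 0 * K 0 +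
      -2 * G 0 * L 0 + -12 * K 0 * φ (PowerSeries.coeff 1 (N.Y W)) +
      12 * L 0 * φ (PowerSeries.coeff 1 (N.Y W)) + -3 * F 0 * G 0 ^ 2 + -3/2 * G 0 ^ 3 = 0 := by
  obtain ⟨m₁, m₂⟩ := hirota_map hn hμ φ
  obtain ⟨Y, hY⟩ : ∃ Y, Evaluates φ (N.Y W) Y := ⟨_, fun _ => rfl⟩
  obtain ⟨Z, hZ⟩ : ∃ Z, Evaluates φ (N.Z V) Z := ⟨_, fun _ => rfl⟩
  obtain ⟨e₁, -⟩ := v.level_one h (by norm_num) m₁ m₂ hY hZ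
  obtain ⟨e₂, e₂'⟩ := v.level_two h (by norm_num) m₁ m₂ hY hZ
  obtain ⟨e₃, e₃'⟩ := v.level_three h (by norm_num) m₂ hY hZ
  rw [hY 1]
  exact @hirota_constraint_three (B 0) (F 0) (F 1) (F 2) (G 0) (G 1) (G 2) (H 0) (K 0) (K 1) (L 0)
    (L 1) (Y 1) (Y 2) (Y 3) (Z 1) (Z 2) (Z 3)
    (by linear_combination e₁) (by linear_combination e₂) (by linear_combination e₂')
    (by linear_combination e₃) (by linear_combination e₃')

end Relation

include hT N hs hG hn hμ

/-- At the resonance 1 the new unknowns enter both equations in the same combination, so the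
equations can agree only if F and J do. -/
theorem Tests.hirota_normF : X.E.conj.normF a = X.E.normF a := by
  obtain ⟨W, V, h⟩ := hT.exists_solvedBelow_of_leading hs N two_ne_zero
  refine sub_eq_zero.1 (analyticRing.eq_zero_of_forall_hom _ fun φ => ?_)
  obtain ⟨m₁, m₂⟩ := hirota_map hn hμ φ
  obtain ⟨F, J, G, H, B, K, L, v⟩ := N.exists_valuation hG φ
  obtain ⟨Y, hY⟩ : ∃ Y, Evaluates φ (N.Y W) Y := ⟨_, fun _ => rfl⟩
  obtain ⟨Z, hZ⟩ : ∃ Z, Evaluates φ (N.Z V) Z := ⟨_, fun _ => rfl⟩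
  obtain ⟨e₁, e₂⟩ := v.level_one h (by norm_num) m₁ m₂ hY hZ
  rw [map_sub, sub_eq_zero, ← v.F_zero, ← v.J_zero]
  exact (@hirota_dispersion_one (F 0) (G 0) (J 0) (Y 1) (Z 1) (by linear_combination e₁)
    (by linear_combination e₂)).symm

variable (hF : X.E.conj.normF a = X.E.normF a)
include hF

-- The coefficient `Y1` is free because 1 is a resonance, and `hirota_relation` is affine in it with
-- slope 12 (L0 - K0). The kernel direction there is (1, -1).
include hκ in
theorem Tests.hirota_normK : X.E.conj.normK a = X.E.normK a := by
  obtain ⟨W, V, W', V', h, h', -, -, hY⟩ := hT.exists_two (i := 1) (j := 4) hκ hs N one_ne_zero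
    (by norm_num) (-1) (by rw [hn]; push_cast; ring) rfl
  refine sub_eq_zero.1 (analyticRing.eq_zero_of_forall_hom _ fun φ => ?_)
  obtain ⟨F, J, G, H, B, K, L, v⟩ := N.exists_valuation hG φ
  obtain rfl := v.eq_of_normF hF
  have e := hirota_relation hn hμ v h
  have e' := hirota_relation hn hμ v h'
  rw [hY, map_add, map_one] at e'
  rw [map_sub]
  linear_combination (1 / 12) * (e' - e) - v.L_zero + v.K_zero

variable (hK : X.E.conj.normK a = X.E.normK a)
include hK

/-- Since K0 is `normK` plus θ/l, the level 3 constraint is affine in `θ` with a slope proportional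
to `normG`. The rest, `levelThree`, does not depend on the front. -/
theorem Tests.hirota_linear_relation :
    X.E.levelThree a σ σi + 4 * (X.E.normG a σ * X.E.linv * θ) = 0 := by
  obtain ⟨W, V, h⟩ := hT.exists_solvedBelow_of_leading hs N four_ne_zero
  refine analyticRing.eq_zero_of_forall_hom _ fun φ => ?_
  obtain ⟨F, J, G, H, B, K, L, v⟩ := N.exists_valuation hG φ
  obtain rfl := v.eq_of_normF hF
  obtain rfl := v.eq_of_normK hK
  have e := hirota_relation hn hμ v h
  have hK0 := v.K_zero
  simp only [EquationData.levelThree, map_add, map_sub, map_mul, map_pow, map_ofNat] at hK0 ⊢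
  rw [← v.sum_zero, ← v.F_two, ← v.G_two, ← v.K_one, ← v.F_zero, ← v.F_one, ← v.G_zero, ← v.G_one]
  linear_combination (-2 / 3) * e - 4 * G 0 * hK0

omit hK
variable (hG0 : X.E.normG a σ = 0)
include hG0

-- Two solutions that differ at the resonance 3, in direction (1, 1), are compared at the resonance
-- 4.
include hκ in
theorem Tests.hirota_normF_eq_zero : X.E.normF a = 0 := by
  obtain ⟨W, V, W', V', h, h', hlow, hlow', hY3⟩ := hT.exists_two (i := 3) (j := 5) hκ hs N
    three_ne_zero (by norm_num) 1 (by push_cast; ring) rfl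
  refine analyticRing.eq_zero_of_forall_hom _ fun φ => ?_
  obtain ⟨m₁, m₂⟩ := hirota_map hn hμ φ
  obtain ⟨F, J, G, H, B, K, L, v⟩ := N.exists_valuation hG φ
  obtain rfl := v.eq_of_normF hF
  obtain rfl := v.G_eq_zero hG0
  obtain rfl := v.eq_of_normK (hT.hirota_normK N hκ hs hG hn hμ hF)
  obtain ⟨Y, hY⟩ : ∃ Y, Evaluates φ (N.Y W) Y := ⟨_, fun _ => rfl⟩
  obtain ⟨Z, hZ⟩ : ∃ Z, Evaluates φ (N.Z V) Z := ⟨_, fun _ => rfl⟩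
  obtain ⟨Y', hY'⟩ : ∃ Y, Evaluates φ (N.Y W') Y := ⟨_, fun _ => rfl⟩
  obtain ⟨Z', hZ'⟩ : ∃ Z, Evaluates φ (N.Z V') Z := ⟨_, fun _ => rfl⟩
  obtain ⟨e₁, -⟩ := v.level_one h (by norm_num) m₁ m₂ hY hZ
  obtain ⟨e₃, -⟩ := v.level_three h (by norm_num) m₂ hY hZ
  obtain ⟨f₃, -⟩ := v.level_three h' (by norm_num) m₂ hY' hZ'
  obtain ⟨e₄, e₄'⟩ := v.level_four h (by norm_num) m₁ m₂ hY hZ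
  obtain ⟨f₄, f₄'⟩ := v.level_four h' (by norm_num) m₁ m₂ hY' hZ'
  rw [hlow 1 (by norm_num)] at f₄
  rw [hlow' 1 (by norm_num)] at f₄'
  have y : ∀ k < 3, Y' k = Y k := fun k hk => by rw [← hY, ← hY', hlow k hk]
  have z : ∀ k < 3, Z' k = Z k := fun k hk => by rw [← hZ, ← hZ', hlow' k hk]
  have y₃ : Y' 3 = Y 3 + 1 := by rw [← hY, ← hY', hY3, map_add, map_one]
  simp only [y 1 (by norm_num), y 2 (by norm_num), z 1 (by norm_num), z 2 (by norm_num),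
    Pi.zero_apply] at e₁ e₃ f₃ e₄ e₄' f₄ f₄'
  rw [← v.F_zero]
  exact @hirota_dispersion_four (B 0) (B 1)
    (φ ((X.E.linv • X.E.slide θ) (PowerSeries.coeff 1 (N.Y W))))
    (φ ((X.E.linv • X.E.slide θ) (PowerSeries.coeff 1 (N.Z V))))
    (J 0) (J 2) (J 3) (H 0) (H 1) (L 0) (L 1) (L 2)
    (Y 1) (Y 2) (Y 3) (Y' 3) (Y 4) (Y' 4) (Z 1) (Z 2) (Z 3) (Z' 3) (Z 4) (Z' 4)
    (by linear_combination e₁) (by linear_combination e₃) (by linear_combination f₃)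
    (by linear_combination e₄) (by linear_combination e₄') (by linear_combination f₄)
    (by linear_combination f₄') y₃

variable (hF0 : X.E.normF a = 0) (hK : X.E.conj.normK a = X.E.normK a)
  (hS : X.E.sumH a σ σi = 2 * X.E.dx (X.E.normK a))
include hF0 hK hS

theorem Tests.hirota_dx_dx_normK : X.E.dx (X.E.dx (X.E.normK a)) = 0 := by
  obtain ⟨W, V, h⟩ := hT.exists_solvedBelow_of_leading (j := 5) hs N (by norm_num)
  have hYZ : PowerSeries.coeff 1 (N.Z V) = -PowerSeries.coeff 1 (N.Y W) := by
    refine sub_eq_zero.1 (analyticRing.eq_zero_of_forall_hom _ fun φ => ?_)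
    obtain ⟨m₁, m₂⟩ := hirota_map hn hμ φ
    obtain ⟨F, J, G, H, B, K, L, v⟩ := N.exists_valuation hG φ
    obtain rfl := v.F_eq_zero hF0
    obtain rfl := v.G_eq_zero hG0
    obtain ⟨e₁, -⟩ := v.level_one h (by norm_num) m₁ m₂ (fun _ => rfl) (fun _ => rfl)
    simp only [Pi.zero_apply] at e₁
    rw [map_sub, map_neg]
    linear_combination (1 / 6) * e₁
  refine analyticRing.eq_zero_of_forall_hom _ fun φ => ?_
  obtain ⟨m₁, m₂⟩ := hirota_map hn hμ φ
  obtain ⟨F, J, G, H, B, K, L, v⟩ := N.exists_valuation hG φ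
  obtain rfl := v.eq_of_normF hF
  obtain rfl := v.F_eq_zero hF0
  obtain rfl := v.G_eq_zero hG0
  obtain rfl := v.eq_of_normK hK
  obtain ⟨Y, hY⟩ : ∃ Y, Evaluates φ (N.Y W) Y := ⟨_, fun _ => rfl⟩
  obtain ⟨Z, hZ⟩ : ∃ Z, Evaluates φ (N.Z V) Z := ⟨_, fun _ => rfl⟩
  obtain ⟨e₁, -⟩ := v.level_one h (by norm_num) m₁ m₂ hY hZ
  obtain ⟨e₂, e₂'⟩ := v.level_two h (by norm_num) m₁ m₂ hY hZ
  obtain ⟨e₃, -⟩ := v.level_three h (by norm_num) m₂ hY hZ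
  obtain ⟨e₄, e₄'⟩ := v.level_four h (by norm_num) m₁ m₂ hY hZ
  simp only [Pi.zero_apply] at e₁ e₂ e₂' e₃ e₄ e₄'
  have s₀ := v.sum_zero
  have s₁ := v.sum_one
  have t : X.E.dx (2 : analyticRing U) = 0 := X.E.dx.map_natCast 2
  rw [hS, Derivation.leibniz, t, smul_zero, add_zero, smul_eq_mul, map_mul, map_ofNat, ← v.K_two]
    at s₁
  rw [hS, map_mul, map_ofNat, ← v.K_one] at s₀
  have := @hirota_constraint_four (B 0) (B 1)
    (φ ((X.E.linv • X.E.slide θ) (PowerSeries.coeff 1 (N.Y W))))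
    (φ ((X.E.linv • X.E.slide θ) (PowerSeries.coeff 1 (N.Z V))))
    (H 0) (H 1) (L 0) (L 1) (L 2) (Y 1) (Y 2) (Y 3)
    (Y 4) (Z 1) (Z 2) (Z 3) (Z 4) (by linear_combination e₁) (by linear_combination e₂)
    (by linear_combination e₂') (by linear_combination e₃) (by linear_combination e₄)
    (by linear_combination e₄')
    ((EquationData.Normalization.map_derivation_eq φ (X.E.linv • X.E.slide θ) hYZ).trans
        (by rw [map_neg, map_neg]))
    s₀ (by linear_combination s₁)
  rw [← v.K_two, this, mul_zero]

theorem Tests.hirota_compatible : X.E.Compatible a σ σi :=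
  ⟨hF0, hF.trans hF0, hG0, hG.trans hG0, hK,
    hT.hirota_dx_dx_normK N hs hG hn hμ hF hK hG0 hF0 hS, hS⟩

/-- The constraint of the resonance 5 is H2 = B2, and 2 (H2 - B2) is the x-derivative of `diffH`. -/
theorem Tests.hirota_dx_diffH : X.E.dx (X.E.diffH a) = 0 := by
  obtain ⟨W, V, h⟩ := hT.exists_solvedBelow_of_leading (j := 6) hs N (by norm_num)
  have hC := hT.hirota_compatible N hs hG hn hμ hF hK hG0 hF0 hS
  have h0 := h.mono (Nat.zero_le _)
  have hYZ : PowerSeries.coeff 2 (N.Z V) = PowerSeries.coeff 2 (N.Y W) := by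
    refine sub_eq_zero.1 (analyticRing.eq_zero_of_forall_hom _ fun φ => ?_)
    obtain ⟨m₁, m₂⟩ := hirota_map hn hμ φ
    obtain ⟨F, J, G, H, B, K, L, v⟩ := N.exists_valuation hG φ
    obtain rfl := v.eq_of_normF hF
    obtain rfl := v.F_eq_zero hF0
    obtain rfl := v.G_eq_zero hG0
    obtain rfl := v.eq_of_normK hK
    obtain ⟨e₂, e₂'⟩ := v.level_two h (by norm_num) m₁ m₂ (fun _ => rfl) (fun _ => rfl)
    simp only [Pi.zero_apply] at e₂ e₂'
    rw [map_sub]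
    linear_combination (1 / 6) * (e₂ - e₂')
  refine analyticRing.eq_zero_of_forall_hom _ fun φ => ?_
  obtain ⟨m₁, m₂⟩ := hirota_map hn hμ φ
  obtain ⟨H, B, K, hv⟩ : ∃ H B K, N.Values φ H B K := ⟨_, _, _, N.values hC φ⟩
  obtain ⟨Y, hY⟩ : ∃ Y, Evaluates φ (N.Y W) Y := ⟨_, fun _ => rfl⟩
  obtain ⟨Z, hZ⟩ : ∃ Z, Evaluates φ (N.Z V) Z := ⟨_, fun _ => rfl⟩
  have zero : ∀ {i}, i < 6 → φ (PowerSeries.coeff i (N.normal W V)) = 0 := fun hi => by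
    rw [h.normal_eq hi, map_zero]
  have zero' : ∀ {i}, i < 6 → φ (PowerSeries.coeff i (N.normalConj W V)) = 0 := fun hi => by
    rw [h.normalConj_eq hi, map_zero]
  have e₁ := (EquationData.Normalization.map_coeff_normal_one hC m₁ m₂ hY hZ h0).symm.trans
    (zero (by norm_num))
  have e₂ := (EquationData.Normalization.map_coeff_normal_two hC m₁ m₂ hv hY hZ h0).symm.trans
    (zero (by norm_num))
  have e₂' := (EquationData.Normalization.map_coeff_normalConj_two hC m₁ m₂ hv hY hZ h0).symm.trans
    (zero' (by norm_num))
  have e₃ := (EquationData.Normalization.map_coeff_normal_three hC m₂ hv hY hZ h0).symm.trans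
    (zero (by norm_num))
  have e₄ := (EquationData.Normalization.map_coeff_normal_four hC m₁ m₂ hv hY hZ h0).symm.trans
    (zero (by norm_num))
  have e₅ := (EquationData.Normalization.map_coeff_normal_five hC m₁ m₂ hv hY hZ h0).symm.trans
    (zero (by norm_num))
  have e₅' := (EquationData.Normalization.map_coeff_normalConj_five hC m₁ m₂ hv hY hZ h0).symm.trans
    (zero' (by norm_num))
  have := @hirota_constraint_five (B 0) (B 1) (B 2)
    (φ ((X.E.linv • X.E.slide θ) (PowerSeries.coeff 1 (N.Y W))))
    (φ ((X.E.linv • X.E.slide θ) (PowerSeries.coeff 2 (N.Y W))))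
    (φ ((X.E.linv • X.E.slide θ) (PowerSeries.coeff 2 (N.Z V))))
    (H 0) (H 1) (H 2) (K 0) (K 1) (Y 1) (Y 2)
    (Y 3) (Y 4) (Y 5) (Z 1) (Z 2) (Z 3) (Z 4) (Z 5) (by linear_combination e₁)
    (by linear_combination e₂) (by linear_combination e₂') (by linear_combination e₃)
    (by linear_combination e₄ + hv.K_zero 0) (by linear_combination e₅ + hv.K_zero 1)
    (by linear_combination e₅' + hv.K_zero 1)
    (EquationData.Normalization.map_derivation_eq φ (X.E.linv • X.E.slide θ) hYZ) hv.sum_zero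
        (hv.sum_succ 0)
  rw [← hv.diff_two, this, sub_self, mul_zero]

end Hirota

end Front

end NLSCoeffs

/-! ### Necessity in the case n = -m/2 -/

namespace NLSCoeffs

open TopologicalSpace

namespace Front

variable {c : NLSCoeffs} {U : Opens (ℝ × ℝ)} {Φ : ℝ × ℝ → ℂ} {X : Front c U Φ}
variable {res : Multiset ℕ} (hT : X.Tests (-1) (-1) 0 res)
variable {θ a σ σi u₀ ui v₀ vi : analyticRing U}
  (N : X.E.Normalization X.κ X.τ θ a σ σi u₀ ui v₀ vi) (hκ : X.κ = 1)
  (hs : (3 * X.E.m + 2 * X.E.n) * (u₀ * v₀) = -6 * X.E.l * X.κ ^ 2)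
  (hG : X.E.conj.normG a σ = X.E.normG a σ)
  (hn : 2 * X.E.n = -X.E.m) (hμ : σ * X.E.m * X.E.linv = -3)

include hn hμ in
theorem sasaSatsuma_map (φ : analyticRing U →+* ℂ) :
    φ (σ * X.E.m * X.E.linv) = -3 ∧ φ (σ * X.E.n * X.E.linv) = 3 / 2 := by
  have h : 2 * (σ * X.E.n * X.E.linv) = 3 := by
    linear_combination σ * X.E.linv * hn - hμ
  have h' := congrArg φ h
  rw [map_mul, map_ofNat, map_ofNat] at h'
  refine ⟨by rw [hμ, map_neg, map_ofNat], by linear_combination (1 / 2) * h'⟩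

include hT N hs hG hn hμ

-- Level 1 is nonsingular here and cannot relate F to J. The relation comes from varying the free
-- coefficient of the resonance 2 and looking at level 3.
include hκ in
theorem Tests.sasaSatsuma_normF : X.E.conj.normF a = X.E.normF a := by
  obtain ⟨W, V, W', V', h, h', hlow, hlow', hY2⟩ := hT.exists_two (i := 2) (j := 4) hκ hs N
    two_ne_zero (by norm_num) (-1)
    (by push_cast; linear_combination -(u₀ * v₀) * hn) rfl
  refine sub_eq_zero.1 (analyticRing.eq_zero_of_forall_hom _ fun φ => ?_)
  obtain ⟨m₁, m₂⟩ := sasaSatsuma_map hn hμ φ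
  obtain ⟨F, J, G, H, B, K, L, v⟩ := N.exists_valuation hG φ
  obtain ⟨Y, hY⟩ : ∃ Y, Evaluates φ (N.Y W) Y := ⟨_, fun _ => rfl⟩
  obtain ⟨Z, hZ⟩ : ∃ Z, Evaluates φ (N.Z V) Z := ⟨_, fun _ => rfl⟩
  obtain ⟨Y', hY'⟩ : ∃ Y, Evaluates φ (N.Y W') Y := ⟨_, fun _ => rfl⟩
  obtain ⟨Z', hZ'⟩ : ∃ Z, Evaluates φ (N.Z V') Z := ⟨_, fun _ => rfl⟩
  obtain ⟨e₁, e₁'⟩ := v.level_one h (by norm_num) m₁ m₂ hY hZ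
  obtain ⟨e₂, -⟩ := v.level_two h (by norm_num) m₁ m₂ hY hZ
  obtain ⟨f₂, -⟩ := v.level_two h' (by norm_num) m₁ m₂ hY' hZ'
  obtain ⟨e₃, e₃'⟩ := v.level_three h (by norm_num) m₂ hY hZ
  obtain ⟨f₃, f₃'⟩ := v.level_three h' (by norm_num) m₂ hY' hZ'
  have y : Y' 1 = Y 1 := by rw [← hY, ← hY', hlow 1 (by norm_num)]
  have z : Z' 1 = Z 1 := by rw [← hZ, ← hZ', hlow' 1 (by norm_num)]
  have y₂ : Y' 2 = Y 2 + 1 := by rw [← hY, ← hY', hY2, map_add, map_one]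
  rw [y, z] at f₂ f₃ f₃'
  rw [map_sub, sub_eq_zero, ← v.F_zero, ← v.J_zero]
  exact (@sasaSatsuma_dispersion_three (B 0) (F 0) (F 1) (F 2) (G 0) (G 1) (G 2) (H 0) (J 0) (J 2)
    (K 0) (K 1) (L 1) (Y 1) (Y 2) (Y' 2) (Y 3) (Y' 3) (Z 1) (Z 2) (Z' 2) (Z 3) (Z' 3)
    (by linear_combination e₁) (by linear_combination e₁') (by linear_combination e₂)
    (by linear_combination f₂) (by linear_combination e₃) (by linear_combination e₃')
    (by linear_combination f₃) (by linear_combination f₃') y₂).symm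

variable (hF : X.E.conj.normF a = X.E.normF a)
include hF

theorem Tests.sasaSatsuma_normK : X.E.conj.normK a = X.E.normK a := by
  obtain ⟨W, V, h⟩ := hT.exists_solvedBelow_of_leading hs N three_ne_zero
  refine sub_eq_zero.1 (analyticRing.eq_zero_of_forall_hom _ fun φ => ?_)
  obtain ⟨m₁, m₂⟩ := sasaSatsuma_map hn hμ φ
  obtain ⟨F, J, G, H, B, K, L, v⟩ := N.exists_valuation hG φ
  obtain rfl := v.eq_of_normF hF
  obtain ⟨Y, hY⟩ : ∃ Y, Evaluates φ (N.Y W) Y := ⟨_, fun _ => rfl⟩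
  obtain ⟨Z, hZ⟩ : ∃ Z, Evaluates φ (N.Z V) Z := ⟨_, fun _ => rfl⟩
  obtain ⟨e₁, e₁'⟩ := v.level_one h (by norm_num) m₁ m₂ hY hZ
  obtain ⟨e₂, e₂'⟩ := v.level_two h (by norm_num) m₁ m₂ hY hZ
  have := @sasaSatsuma_constraint_two (J 0) (J 1) (G 0) (G 1) (J 0) (J 1) (K 0) (L 0) (Y 1) (Y 2)
    (Z 1) (Z 2) (by linear_combination e₁) (by linear_combination e₁')
    (by linear_combination e₂) (by linear_combination e₂')
  rw [map_sub]
  linear_combination (1 / 3) * this - v.L_zero + v.K_zero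

variable (hK : X.E.conj.normK a = X.E.normK a)
include hK

theorem Tests.sasaSatsuma_linear_relation :
    X.E.levelThree a σ σi + 4 * (X.E.normG a σ * X.E.linv * θ) = 0 := by
  obtain ⟨W, V, h⟩ := hT.exists_solvedBelow_of_leading hs N four_ne_zero
  refine analyticRing.eq_zero_of_forall_hom _ fun φ => ?_
  obtain ⟨m₁, m₂⟩ := sasaSatsuma_map hn hμ φ
  obtain ⟨F, J, G, H, B, K, L, v⟩ := N.exists_valuation hG φ
  obtain rfl := v.eq_of_normF hF
  obtain rfl := v.eq_of_normK hK
  obtain ⟨Y, hY⟩ : ∃ Y, Evaluates φ (N.Y W) Y := ⟨_, fun _ => rfl⟩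
  obtain ⟨Z, hZ⟩ : ∃ Z, Evaluates φ (N.Z V) Z := ⟨_, fun _ => rfl⟩
  obtain ⟨e₁, e₁'⟩ := v.level_one h (by norm_num) m₁ m₂ hY hZ
  obtain ⟨e₂, -⟩ := v.level_two h (by norm_num) m₁ m₂ hY hZ
  obtain ⟨e₃, e₃'⟩ := v.level_three h (by norm_num) m₂ hY hZ
  have e := @sasaSatsuma_constraint_three (B 0) (J 0) (J 1) (J 2) (G 0) (G 1) (G 2) (H 0) (L 0)
    (L 1) (Y 1) (Y 2) (Y 3) (Z 1) (Z 2) (Z 3) (by linear_combination e₁)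
    (by linear_combination e₁') (by linear_combination e₂) (by linear_combination e₃)
    (by linear_combination e₃')
  have hK0 := v.K_zero
  simp only [EquationData.levelThree, map_add, map_sub, map_mul, map_pow, map_ofNat] at hK0 ⊢
  rw [← v.sum_zero, ← v.F_two, ← v.G_two, ← v.K_one, ← v.F_zero, ← v.F_one, ← v.G_zero, ← v.G_one]
  linear_combination (-8 / 3) * e - 4 * G 0 * hK0

variable (hG0 : X.E.normG a σ = 0)
include hG0

include hκ in
theorem Tests.sasaSatsuma_normF_eq_zero : X.E.normF a = 0 := by
  obtain ⟨W, V, W', V', h, h', hlow, hlow', hY3⟩ := hT.exists_two (i := 3) (j := 5) hκ hs N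
    three_ne_zero (by norm_num) 1 (by push_cast; ring) rfl
  refine analyticRing.eq_zero_of_forall_hom _ fun φ => ?_
  obtain ⟨m₁, m₂⟩ := sasaSatsuma_map hn hμ φ
  obtain ⟨F, J, G, H, B, K, L, v⟩ := N.exists_valuation hG φ
  obtain rfl := v.eq_of_normF hF
  obtain rfl := v.G_eq_zero hG0
  obtain rfl := v.eq_of_normK hK
  obtain ⟨Y, hY⟩ : ∃ Y, Evaluates φ (N.Y W) Y := ⟨_, fun _ => rfl⟩
  obtain ⟨Z, hZ⟩ : ∃ Z, Evaluates φ (N.Z V) Z := ⟨_, fun _ => rfl⟩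
  obtain ⟨Y', hY'⟩ : ∃ Y, Evaluates φ (N.Y W') Y := ⟨_, fun _ => rfl⟩
  obtain ⟨Z', hZ'⟩ : ∃ Z, Evaluates φ (N.Z V') Z := ⟨_, fun _ => rfl⟩
  obtain ⟨e₁, e₁'⟩ := v.level_one h (by norm_num) m₁ m₂ hY hZ
  obtain ⟨e₃, -⟩ := v.level_three h (by norm_num) m₂ hY hZ
  obtain ⟨f₃, -⟩ := v.level_three h' (by norm_num) m₂ hY' hZ'
  obtain ⟨e₄, -⟩ := v.level_four h (by norm_num) m₁ m₂ hY hZ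
  obtain ⟨f₄, -⟩ := v.level_four h' (by norm_num) m₁ m₂ hY' hZ'
  rw [hlow 1 (by norm_num)] at f₄
  have y : ∀ k < 3, Y' k = Y k := fun k hk => by rw [← hY, ← hY', hlow k hk]
  have z : ∀ k < 3, Z' k = Z k := fun k hk => by rw [← hZ, ← hZ', hlow' k hk]
  have y₃ : Y' 3 = Y 3 + 1 := by rw [← hY, ← hY', hY3, map_add, map_one]
  simp only [y 1 (by norm_num), y 2 (by norm_num), z 1 (by norm_num), z 2 (by norm_num),
    Pi.zero_apply] at e₁ e₁' e₃ f₃ e₄ f₄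
  rw [← v.F_zero]
  exact @sasaSatsuma_dispersion_four
    (φ ((X.E.linv • X.E.slide θ) (PowerSeries.coeff 1 (N.Y W)))) (J 0) (J 2) (J 3) (H 0) (H 1)
    (L 0) (L 1) (L 2) (Y 1) (Y 2) (Y 3) (Y' 3) (Z 1) (Z 2) (Z 3) (Z' 3)
    (by linear_combination e₁) (by linear_combination e₁') (by linear_combination e₃)
    (by linear_combination f₃) (by linear_combination e₄) (by linear_combination f₄) y₃

variable (hF0 : X.E.normF a = 0) (hS : X.E.sumH a σ σi = 2 * X.E.dx (X.E.normK a))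
include hF0 hS

/-- At the double resonance both equations are constraints, H1 = K2 and B1 = K2. Since H1 + B1 = 4
K2, both claims follow; this extra constraint is what removes the term with `β₁`. -/
theorem Tests.sasaSatsuma_level_four :
    X.E.dx (X.E.dx (X.E.normK a)) = 0 ∧ X.E.diffH a = 0 := by
  obtain ⟨W, V, h⟩ := hT.exists_solvedBelow_of_leading (j := 5) hs N (by norm_num)
  have hYZ : PowerSeries.coeff 1 (N.Y W) = 0 ∧ PowerSeries.coeff 1 (N.Z V) = 0 := by
    have key : ∀ φ : analyticRing U →+* ℂ, φ (PowerSeries.coeff 1 (N.Y W)) = 0 ∧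
        φ (PowerSeries.coeff 1 (N.Z V)) = 0 := fun φ => by
      obtain ⟨m₁, m₂⟩ := sasaSatsuma_map hn hμ φ
      obtain ⟨F, J, G, H, B, K, L, v⟩ := N.exists_valuation hG φ
      obtain rfl := v.eq_of_normF hF
      obtain rfl := v.F_eq_zero hF0
      obtain rfl := v.G_eq_zero hG0
      obtain ⟨e₁, e₁'⟩ := v.level_one h (by norm_num) m₁ m₂ (fun _ => rfl) (fun _ => rfl)
      simp only [Pi.zero_apply] at e₁ e₁'
      exact ⟨by linear_combination (5 / 24) * e₁ - (1 / 8) * e₁',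
        by linear_combination (5 / 24) * e₁' - (1 / 8) * e₁⟩
    exact ⟨analyticRing.eq_zero_of_forall_hom _ fun φ => (key φ).1,
      analyticRing.eq_zero_of_forall_hom _ fun φ => (key φ).2⟩
  have key : ∀ φ : analyticRing U →+* ℂ, φ (X.E.dx (X.E.dx (X.E.normK a))) = 0 ∧
      φ (X.E.diffH a) = 0 := fun φ => by
    obtain ⟨m₁, m₂⟩ := sasaSatsuma_map hn hμ φ
    obtain ⟨F, J, G, H, B, K, L, v⟩ := N.exists_valuation hG φ
    obtain rfl := v.eq_of_normF hF
    obtain rfl := v.F_eq_zero hF0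
    obtain rfl := v.G_eq_zero hG0
    obtain rfl := v.eq_of_normK hK
    obtain ⟨Y, hY⟩ : ∃ Y, Evaluates φ (N.Y W) Y := ⟨_, fun _ => rfl⟩
    obtain ⟨Z, hZ⟩ : ∃ Z, Evaluates φ (N.Z V) Z := ⟨_, fun _ => rfl⟩
    obtain ⟨e₁, e₁'⟩ := v.level_one h (by norm_num) m₁ m₂ hY hZ
    obtain ⟨e₂, -⟩ := v.level_two h (by norm_num) m₁ m₂ hY hZ
    obtain ⟨e₃, -⟩ := v.level_three h (by norm_num) m₂ hY hZ
    obtain ⟨e₄, e₄'⟩ := v.level_four h (by norm_num) m₁ m₂ hY hZ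
    rw [hYZ.1, map_zero, map_zero] at e₄
    rw [hYZ.2, map_zero, map_zero] at e₄'
    simp only [Pi.zero_apply] at e₁ e₁' e₂ e₃ e₄ e₄'
    have hH := @sasaSatsuma_constraint_four 0 (H 0) (H 1) (L 0) (L 1) (L 2) (Y 1) (Y 2) (Y 3) (Z 1)
      (Z 2) (Z 3) (by linear_combination e₁) (by linear_combination e₁') (by linear_combination e₂)
      (by linear_combination e₃) (by linear_combination e₄) rfl
    have hB := @sasaSatsuma_constraint_four_conj (B 0) (B 1) 0 (H 0) (L 0) (L 1) (L 2) (Y 1) (Y 2)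
      (Y 3) (Z 1) (Z 2) (Z 3) (by linear_combination e₁) (by linear_combination e₁')
      (by linear_combination e₂) (by linear_combination e₃) (by linear_combination e₄') rfl
    have s₁ := v.sum_one
    have t : X.E.dx (2 : analyticRing U) = 0 := X.E.dx.map_natCast 2
    rw [hS, Derivation.leibniz, t, smul_zero, add_zero, smul_eq_mul, map_mul, map_ofNat] at s₁
    have k₂ := v.K_two
    exact ⟨by linear_combination hH + hB - s₁ + k₂, by rw [← v.diff_one, hH, hB, sub_self]⟩
  exact ⟨analyticRing.eq_zero_of_forall_hom _ fun φ => (key φ).1,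
    analyticRing.eq_zero_of_forall_hom _ fun φ => (key φ).2⟩

theorem Tests.sasaSatsuma_compatible : X.E.Compatible a σ σi :=
  ⟨hF0, hF.trans hF0, hG0, hG.trans hG0, hK,
    (hT.sasaSatsuma_level_four N hs hG hn hμ hF hK hG0 hF0 hS).1, hS⟩

end Front

end NLSCoeffs

/-! ### Necessity on the rectangle -/

namespace NLSCoeffs

open TopologicalSpace

open analyticRing

namespace EquationData

variable {R : Type*} [CommRing R] [Algebra ℂ R] {E : EquationData R} {a σ σi : R}

theorem normG_eq_zero_of_levelThree (h₀ : E.levelThree a σ σi = 0) {w : R} (hw : IsUnit w)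
    (h : E.levelThree a σ σi + 4 * (E.normG a σ * E.linv * w) = 0) : E.normG a σ = 0 := by
  have hl : IsUnit E.linv := IsUnit.of_mul_eq_one E.l (by rw [mul_comm, E.l_linv])
  rw [h₀, zero_add, (isUnit_ofNat 4).mul_right_eq_zero, mul_assoc,
    (hl.mul hw).mul_left_eq_zero] at h
  exact h

theorem sumH_eq_of_levelThree (h₀ : E.levelThree a σ σi = 0) (hG : E.normG a σ = 0)
    (hF : E.normF a = 0) : E.sumH a σ σi = 2 * E.dx (E.normK a) := by
  simp only [levelThree, hG, hF, map_zero] at h₀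
  exact (isUnit_ofNat 4).mul_left_cancel (by linear_combination h₀)

end EquationData

namespace RegularOn

variable {c : NLSCoeffs} {U : Opens (ℝ × ℝ)} (hc : c.RegularOn U) {x₀ t₁ : ℝ}
  {a σ σi : analyticRing U}

/-- On a straight front κ = 1, so 1 and `σ` are admissible leading coefficients. -/
theorem exists_normalization (s : ℝ) (hσ : hc.data.dx σ = 0) (hσi : σ * σi = 1) :
    Nonempty ((hc.linearFront x₀ t₁ s).E.Normalization (hc.linearFront x₀ t₁ s).κ
      (hc.linearFront x₀ t₁ s).τ ((hc.linearFront x₀ t₁ s).τ * 1) a σ σi 1 1 σ σi) :=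
  EquationData.exists_normalization _ 1 1 _ a σ σi 1 1 σ σi (one_mul 1)
    (hc.linearFront x₀ t₁ s).dx_τ hσ hσi (one_mul 1) hσi (by rw [one_mul, one_pow, mul_one])

variable {res : Multiset ℕ}
  (hT : ∀ s : ℝ, (hc.linearFront x₀ t₁ s).Tests (-1) (-1) 0 res)
  (hm : ∀ p ∈ U, (c.m p.2 : ℂ) ≠ 0)

include hT

theorem compatible_of_tests_hirota (hn : hc.data.n = -hc.data.m)
    (hσ : hc.data.dx σ = 0) (hσi : σ * σi = 1) (hσm : σ * hc.data.m = -6 * hc.data.l)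
    (hG : hc.data.conj.normG a σ = hc.data.normG a σ) :
    hc.data.Compatible a σ σi ∧ hc.data.dx (hc.data.diffH a) = 0 := by
  have hμ : σ * hc.data.m * hc.data.linv = -6 := by
    linear_combination hc.data.linv * hσm - 6 * hc.data.l_linv
  have hs : (3 * hc.data.m + 2 * hc.data.n) * (1 * σ) = -6 * hc.data.l * 1 ^ 2 := by
    rw [hn]; linear_combination hσm
  -- Two fronts through the same point with different speeds: the first gives `levelThree` = 0, and
  -- then the second gives `normG` = 0.
  obtain ⟨N₀⟩ := hc.exists_normalization (x₀ := x₀) (t₁ := t₁) (a := a) 0 hσ hσi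
  obtain ⟨N₁⟩ := hc.exists_normalization (x₀ := x₀) (t₁ := t₁) (a := a) 1 hσ hσi
  have hF := (hT 0).hirota_normF N₀ hs hG hn hμ
  have hK := (hT 0).hirota_normK N₀ rfl hs hG hn hμ hF
  have r₀ : hc.data.levelThree a σ σi + 4 * (hc.data.normG a σ * hc.data.linv *
      ((hc.linearFront x₀ t₁ 0).τ * 1)) = 0 :=
    (hT 0).hirota_linear_relation N₀ hs hG hn hμ hF hK
  have r₁ : hc.data.levelThree a σ σi + 4 * (hc.data.normG a σ * hc.data.linv *
      ((hc.linearFront x₀ t₁ 1).τ * 1)) = 0 :=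
    (hT 1).hirota_linear_relation N₁ hs hG hn hμ hF hK
  have hτ₀ : (hc.linearFront x₀ t₁ 0).τ = 0 := by simp [linearFront]
  have hτ₁ : (hc.linearFront x₀ t₁ 1).τ = -1 := by simp [linearFront]
  rw [hτ₀, zero_mul, mul_zero, mul_zero, add_zero] at r₀
  rw [hτ₁, mul_one] at r₁
  have hG0 := EquationData.normG_eq_zero_of_levelThree r₀ isUnit_one.neg r₁
  have hF0 := (hT 0).hirota_normF_eq_zero N₀ rfl hs hG hn hμ hF hG0
  have hS := EquationData.sumH_eq_of_levelThree r₀ hG0 hF0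
  exact ⟨(hT 0).hirota_compatible N₀ hs hG hn hμ hF hK hG0 hF0 hS,
    (hT 0).hirota_dx_diffH N₀ hs hG hn hμ hF hK hG0 hF0 hS⟩

theorem integrable_of_tests_hirota (hn : hc.data.n = -hc.data.m) :
    (hc.parts hm).Integrable ∧ hc.data.dx (hc.data.diffH (hc.parts hm).gauge) = 0 := by
  obtain ⟨σi, hσi⟩ := hc.exists_ratio_mul_eq_one hm (-6) (by norm_num)
  obtain ⟨hC, hd⟩ := hc.compatible_of_tests_hirota hT (a := (hc.parts hm).gauge) hn
    (hc.dx_ratio hm (-6)) hσi (by rw [hc.ratio_mul_m]; norm_num)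
    (by rw [(hc.parts hm).normG_eq, (hc.parts hm).conj_normG_eq])
  exact ⟨(hc.integrable_iff hm).2 ((hc.compatible_iff hm hσi).1 hC), hd⟩

theorem compatible_of_tests_sasaSatsuma (hn : 2 * hc.data.n = -hc.data.m)
    (hσ : hc.data.dx σ = 0) (hσi : σ * σi = 1) (hσm : σ * hc.data.m = -3 * hc.data.l)
    (hG : hc.data.conj.normG a σ = hc.data.normG a σ) :
    hc.data.Compatible a σ σi ∧ hc.data.diffH a = 0 := by
  have hμ : σ * hc.data.m * hc.data.linv = -3 := by
    linear_combination hc.data.linv * hσm - 3 * hc.data.l_linv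
  have hs : (3 * hc.data.m + 2 * hc.data.n) * (1 * σ) = -6 * hc.data.l * 1 ^ 2 := by
    rw [hn]; linear_combination 2 * hσm
  obtain ⟨N₀⟩ := hc.exists_normalization (x₀ := x₀) (t₁ := t₁) (a := a) 0 hσ hσi
  obtain ⟨N₁⟩ := hc.exists_normalization (x₀ := x₀) (t₁ := t₁) (a := a) 1 hσ hσi
  have hF := (hT 0).sasaSatsuma_normF N₀ rfl hs hG hn hμ
  have hK := (hT 0).sasaSatsuma_normK N₀ hs hG hn hμ hF
  have r₀ : hc.data.levelThree a σ σi + 4 * (hc.data.normG a σ * hc.data.linv *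
      ((hc.linearFront x₀ t₁ 0).τ * 1)) = 0 :=
    (hT 0).sasaSatsuma_linear_relation N₀ hs hG hn hμ hF hK
  have r₁ : hc.data.levelThree a σ σi + 4 * (hc.data.normG a σ * hc.data.linv *
      ((hc.linearFront x₀ t₁ 1).τ * 1)) = 0 :=
    (hT 1).sasaSatsuma_linear_relation N₁ hs hG hn hμ hF hK
  have hτ₀ : (hc.linearFront x₀ t₁ 0).τ = 0 := by simp [linearFront]
  have hτ₁ : (hc.linearFront x₀ t₁ 1).τ = -1 := by simp [linearFront]
  rw [hτ₀, zero_mul, mul_zero, mul_zero, add_zero] at r₀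
  rw [hτ₁, mul_one] at r₁
  have hG0 := EquationData.normG_eq_zero_of_levelThree r₀ isUnit_one.neg r₁
  have hF0 := (hT 0).sasaSatsuma_normF_eq_zero N₀ rfl hs hG hn hμ hF hK hG0
  have hS := EquationData.sumH_eq_of_levelThree r₀ hG0 hF0
  exact ⟨(hT 0).sasaSatsuma_compatible N₀ hs hG hn hμ hF hK hG0 hF0 hS,
    ((hT 0).sasaSatsuma_level_four N₀ hs hG hn hμ hF hK hG0 hF0 hS).2⟩

theorem integrable_of_tests_sasaSatsuma (hn : 2 * hc.data.n = -hc.data.m) :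
    (hc.parts hm).Integrable ∧ hc.data.diffH (hc.parts hm).gauge = 0 := by
  obtain ⟨σi, hσi⟩ := hc.exists_ratio_mul_eq_one hm (-3) (by norm_num)
  obtain ⟨hC, hd⟩ := hc.compatible_of_tests_sasaSatsuma hT (a := (hc.parts hm).gauge) hn
    (hc.dx_ratio hm (-3)) hσi (by rw [hc.ratio_mul_m]; norm_num)
    (by rw [(hc.parts hm).normG_eq, (hc.parts hm).conj_normG_eq])
  exact ⟨(hc.integrable_iff hm).2 ((hc.compatible_iff hm hσi).1 hC), hd⟩

end RegularOn

section Necessity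

variable {c : NLSCoeffs} {I J : Set ℝ} (H : c.AnalyticOnRectangle I J) {x₀ : ℝ}
include H

theorem PassesPainleveTest.pointwise_hirota (h : c.PassesPainleveTest (I ×ˢ c.regularTimes J))
    (hn : ∀ t ∈ J, c.n t = -c.m t) : c.PointwiseConditions (I ×ˢ c.regularTimes J) ∧
      ∀ p ∈ I ×ˢ c.regularTimes J, dx (fun p => dx c.potential p - c.source p) p = 0 := by
  -- An empty domain carries no front, but then the conditions are vacuous.
  rcases (I ×ˢ c.regularTimes J).eq_empty_or_nonempty with he | ⟨⟨x₀, t₁⟩, hx₀, ht₁⟩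
  · rw [he]
    exact ⟨by constructor <;> simp, by simp⟩
  obtain ⟨res, -, hT⟩ := h.exists_tests H hx₀ ht₁
  have hc : c.RegularOn H.domain := H.regularOn subset_rfl
  have hm := m_ne_zero_of_subset (c := c) (U := H.domain) subset_rfl
  obtain ⟨hi, hd⟩ := hc.integrable_of_tests_hirota (hT hc) hm (ext' fun p => by
    change (c.n p.1.2 : ℂ) = -(c.m p.1.2 : ℂ)
    exact_mod_cast hn _ p.2.2.1)
  rw [hi.dx_diffH_eq_zero_iff] at hd
  exact ⟨(hc.integrable_iff hm).1 hi, (hc.dx_sub_eq_zero_iff hm).1 hd⟩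

theorem PassesPainleveTest.pointwise_sasaSatsuma
    (h : c.PassesPainleveTest (I ×ˢ c.regularTimes J)) (hn : ∀ t ∈ J, c.n t = -(c.m t / 2)) :
    c.PointwiseConditions (I ×ˢ c.regularTimes J) ∧
      ∀ p ∈ I ×ˢ c.regularTimes J, dx c.potential p = c.source p := by
  rcases (I ×ˢ c.regularTimes J).eq_empty_or_nonempty with he | ⟨⟨x₀, t₁⟩, hx₀, ht₁⟩
  · rw [he]
    exact ⟨by constructor <;> simp, by simp⟩
  obtain ⟨res, -, hT⟩ := h.exists_tests H hx₀ ht₁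
  have hc : c.RegularOn H.domain := H.regularOn subset_rfl
  have hm := m_ne_zero_of_subset (c := c) (U := H.domain) subset_rfl
  obtain ⟨hi, hd⟩ := hc.integrable_of_tests_sasaSatsuma (hT hc) hm (ext' fun p => by
    change 2 * (c.n p.1.2 : ℂ) = -(c.m p.1.2 : ℂ)
    rw [hn _ p.2.2.1]
    push_cast
    ring)
  rw [hi.diffH_eq_zero_iff] at hd
  exact ⟨(hc.integrable_iff hm).1 hi, (hc.dx_potential_eq_iff hm).1 hd⟩

end Necessity

end NLSCoeffs

/-! ### Assembly of the equivalences and the main theorem -/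

namespace NLSCoeffs

theorem AnalyticOnRectangle.passesPainleveTest_hirota_iff {c : NLSCoeffs} {I J : Set ℝ} {x₀ : ℝ}
    (H : c.AnalyticOnRectangle I J) (hx₀ : x₀ ∈ I) (hn : ∀ t ∈ J, c.n t = -c.m t) :
    c.PassesPainleveTest (I ×ˢ c.regularTimes J) ↔ ∃ γ₁ γ₂ β₁ β₂ : ℝ → ℝ,
      c.CompatibilityConditions I (c.regularTimes J) x₀ γ₁ γ₂ β₁ β₂ := by
  have hc : c.RegularOn H.domain := H.regularOn subset_rfl
  have hm := m_ne_zero_of_subset (c := c) (U := H.domain) subset_rfl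
  constructor
  · intro h
    obtain ⟨hp, hd⟩ := h.pointwise_hirota H hn
    -- The x-derivative of `potential` and `source` differ by a function of time alone, and this
    -- difference is `β₁`.
    obtain ⟨β₁, hβ⟩ := exists_eq_comp_snd (U := H.domain) H.ordConnected_fst hx₀ rfl
      ((hc.isReal_potential hm).dirDeriv_fst.sub (hc.isReal_dt_gauge hm)) hd
    obtain ⟨γ₁, γ₂, β₂, hγ⟩ := PointwiseConditions.compatibilityConditions (U := H.domain)
      H.ordConnected_fst hx₀ hc hm rfl hp hβ
    exact ⟨γ₁, γ₂, β₁, β₂, hγ⟩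
  · rintro ⟨γ₁, γ₂, β₁, β₂, hγ⟩
    obtain ⟨hp, hd⟩ := hγ.pointwise H.isOpen_fst H.ordConnected_fst hx₀ hc hm rfl
    refine NLSCoeffs.passesPainleveTest_hirota H hn hp fun p hp => ?_
    have h1 : (fun p => dx c.potential p - c.source p) =ᶠ[nhds p] fun p => β₁ p.2 :=
      Filter.eventually_of_mem (H.domain.isOpen.mem_nhds hp) hd
    rw [dx, h1.fderiv_eq, fderiv_comp_snd_fst]

theorem AnalyticOnRectangle.passesPainleveTest_sasaSatsuma_iff {c : NLSCoeffs} {I J : Set ℝ}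
    {x₀ : ℝ} (H : c.AnalyticOnRectangle I J) (hx₀ : x₀ ∈ I)
    (hn : ∀ t ∈ J, c.n t = -(c.m t / 2)) :
    c.PassesPainleveTest (I ×ˢ c.regularTimes J) ↔ ∃ γ₁ γ₂ β₂ : ℝ → ℝ,
      c.CompatibilityConditions I (c.regularTimes J) x₀ γ₁ γ₂ (fun _ => 0) β₂ := by
  have hc : c.RegularOn H.domain := H.regularOn subset_rfl
  have hm := m_ne_zero_of_subset (c := c) (U := H.domain) subset_rfl
  constructor
  · intro h
    obtain ⟨hp, hd⟩ := h.pointwise_sasaSatsuma H hn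
    exact PointwiseConditions.compatibilityConditions (U := H.domain)
      H.ordConnected_fst hx₀ hc hm rfl hp fun p hp => sub_eq_zero.2 (hd p hp)
  · rintro ⟨γ₁, γ₂, β₂, hγ⟩
    obtain ⟨hp, hd⟩ := hγ.pointwise H.isOpen_fst H.ordConnected_fst hx₀ hc hm rfl
    exact NLSCoeffs.passesPainleveTest_sasaSatsuma H hn hp fun p hp => sub_eq_zero.1 (hd p hp)

end NLSCoeffs

theorem mainTheorem5 (c : NLSCoeffs) (I J : Set ℝ) (x₀ : ℝ)
    (hI : IsOpen I) (hI' : I.OrdConnected) (hx₀ : x₀ ∈ I)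
    (hJ : IsOpen J) (hJ' : J.OrdConnected)
    (hf : AnalyticOnNhd ℝ c.f (I ×ˢ J)) (hg : AnalyticOnNhd ℝ c.g (I ×ˢ J))
    (hh : AnalyticOnNhd ℝ c.h (I ×ˢ J)) (hk : AnalyticOnNhd ℝ c.k (I ×ˢ J))
    (hl : AnalyticOnNhd ℝ c.l J) (hm : AnalyticOnNhd ℝ c.m J) (hn : AnalyticOnNhd ℝ c.n J)
    (hl0 : ∃ t ∈ J, c.l t ≠ 0) (hm0 : ∃ t ∈ J, c.m t ≠ 0) (hn0 : ∃ t ∈ J, c.n t ≠ 0) :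
    -- passing the test requires `n = -m` or `n = -m/2`
    (c.PassesPainleveTest (I ×ˢ c.regularTimes J) →
      (∀ t ∈ J, c.n t = -c.m t) ∨ (∀ t ∈ J, c.n t = -(c.m t / 2))) ∧
    -- the resonances are `-1`, `0` and four positive integers exactly in these two cases
    (∀ t ∈ c.regularTimes J, ∀ κ a b : ℂ, κ ≠ 0 → a ≠ 0 → b ≠ 0 →
      (3 * c.m t + 2 * c.n t) * (a * b) = -6 * c.l t * κ ^ 2 →
      ((∃ s : Multiset ℕ, (∀ j ∈ s, 0 < j) ∧
          NLSCoeffs.resonances (c.l t) (c.m t) (c.n t) κ a b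
            = {-1, 0} + s.map (fun j : ℕ => (j : ℂ))) ↔
        c.n t = -c.m t ∨ c.n t = -(c.m t / 2)) ∧
      (c.n t = -c.m t →
        NLSCoeffs.resonances (c.l t) (c.m t) (c.n t) κ a b = {-1, 0, 1, 3, 4, 5}) ∧
      (c.n t = -(c.m t / 2) →
        NLSCoeffs.resonances (c.l t) (c.m t) (c.n t) κ a b = {-1, 0, 2, 3, 4, 4})) ∧
    -- the case `n = -m`
    ((∀ t ∈ J, c.n t = -c.m t) →
      (c.PassesPainleveTest (I ×ˢ c.regularTimes J) ↔
        ∃ γ₁ γ₂ β₁ β₂ : ℝ → ℝ,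
          c.CompatibilityConditions I (c.regularTimes J) x₀ γ₁ γ₂ β₁ β₂)) ∧
    -- the case `n = -m/2`
    ((∀ t ∈ J, c.n t = -(c.m t / 2)) →
      (c.PassesPainleveTest (I ×ˢ c.regularTimes J) ↔
        ∃ γ₁ γ₂ β₂ : ℝ → ℝ,
          c.CompatibilityConditions I (c.regularTimes J) x₀ γ₁ γ₂ (fun _ => 0) β₂)) := by
  have H : c.AnalyticOnRectangle I J := ⟨hI, hI', hJ, hJ', hf, hg, hh, hk, hl, hm, hn⟩
  refine ⟨fun h => h.eq_neg_or_eq_neg_half H ⟨x₀, hx₀⟩ hl0 hm0 hn0,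
    fun t ht κ a b hκ _ _ hab => ⟨NLSCoeffs.exists_resonances_iff ht.2.1 ht.2.2.2 hκ hab,
      NLSCoeffs.resonances_of_eq_neg ht.2.1 hκ hab,
      NLSCoeffs.resonances_of_eq_neg_half ht.2.1 hκ hab⟩,
    H.passesPainleveTest_hirota_iff hx₀, H.passesPainleveTest_sasaSatsuma_iff hx₀⟩
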